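/- Let $d\in\{2,3\}$. Let $\Omega\subset\mathbb{R}^d$ and $\Omega_1,\Omega_2\subset\mathbb{R}^d$ be bounded Lipschitz domains (open and connected) with $\overline{\Omega}=\overline{\Omega}_1\cup\overline{\Omega}_2$, $\Omega_1\cap\Omega_2=\emptyset$, and with nonempty exterior boundaries $\partial\Omega\setminus\partial\Omega_i$ for $i=1,2$. Put $\Gamma=(\partial\Omega_1\cap\partial\Omega_2)\setminus\partial\Omega$. Let $\alpha\in L^\infty(\Omega)$ satisfy $\alpha\ge c_0>0$ a.e. in $\Omega$. Let $V=H_0^1(\Omega)$ and $V_i=\{v\in H^1(\Omega_i): v|_{\partial\Omega_i\setminus\Gamma}=0\}$ (in the sense of traces), both with the full $H^1$-norm. For a bounded Lipschitz domain $U$, let $E_{\mathbb R}$ and $E_{\rm even}$ denote the extension by zero and the even extension $L^2(\mathbb{R}^+,L^2(U))\to L^2(\mathbb{R},L^2(U))$, and let $H^{1/2}(\mathbb{R},L^2(U))$ have the norm $\|w\|^2=\int_{\mathbb R}(1+\xi^2)^{1/2}\|\hat w(\xi)\|_{L^2(U)}^2\,d\xi$. Let $H^{1/2}_{00}(\mathbb{R}^+,L^2(U))$,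 respectively $H^{1/2}(\mathbb{R}^+,L^2(U))$, be the space of all $u\in L^2(\mathbb{R}^+,L^2(U))$ with $E_{\mathbb R}u\in H^{1/2}(\mathbb{R},L^2(U))$, respectively $E_{\rm even}u\in H^{1/2}(\mathbb{R},L^2(U))$, normed by the norm of the extension. For a subspace $Y$ of $H^1(U)$ put $$W(U,Y)=H^{1/2}_{00}(\mathbb{R}^+,L^2(U))\cap L^2(\mathbb{R}^+,Y),\qquad \tilde W(U,Y)=H^{1/2}(\mathbb{R}^+,L^2(U))\cap L^2(\mathbb{R}^+,Y)$$ with the intersection norms (the square root of the sum of the squared norms), and $W=W(\Omega,V)$, $\tilde W=\tilde W(\Omega,V)$, $W_i=W(\Omega_i,V_i)$, $\tilde W_i=\tilde W(\Omega_i,V_i)$. Let $\mathcal D=C_0^\infty(\mathbb{R}^+,C_0^\infty(\Omega))$ and $\mathcal D_i=C_0^\infty(\mathbb{R}^+,C^\infty(\overline{\Omega_i}))$. 1. There is exactly one bounded linear operator $A:W\to\tilde W^*$ such that $$\langle Au,v\rangle=\int_{\mathbb{R}^+}\int_{\Omega}\partial_tu\,v+\alpha\nabla u\cdot\nabla v\,dx\,dt\qquad\text{for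 all }u,v\in\mathcal D.$$ 2. For $i=1,2$ there is exactly one bounded linear operator $W(\Omega_i,H^1(\Omega_i))\to\tilde W(\Omega_i,H^1(\Omega_i))^*$ that is given by the same formula, with $\Omega_i$ in place of $\Omega$, for all $u,v\in\mathcal D_i$. Let $A_i:W_i\to\tilde W_i^*$ be the bounded linear operator that it induces by restriction to $W_i$ and $\tilde W_i$. 3. For $i=1,2$ the space $W_i$ is continuously included in $\tilde W_i$, and there is $c>0$ such that $$\langle A_iu,u\rangle\ge c\,\|u\|_{L^2(\mathbb{R}^+,V_i)}^2\qquad\text{for all }u\in W_i.$$ 4. For $i=1,2$ there are $\varphi\in(0,\pi/2)$, $c>0$ and a bounded linear operator $B_i:W_i\to\tilde W_i$ of the form $$B_iu=\bigl[(\cos(\varphi)I-\sin(\varphi)\mathcal H)E_{\mathbb R}u\bigr]\big|_{\mathbb{R}^+},$$ where $\mathcal H$ is the Hilbert transform in time on $L^2(\mathbb{R},L^2(\Omega_i))$ (the Fourier multiplier with symbol $-\mathrm{i}\,\mathrm{sgn}(\xi)$), such that $$\langle A_iu,B_iu\rangle\ge c\,\|u\|_{W_i}^2\qquad\text{for all }u\in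 W_i.$$ -/

import Mathlib

open MeasureTheory Set Filter Topology
open scoped ContDiff FourierTransform RealInnerProductSpace

noncomputable section

namespace RobinRobin

/-- The physical space `ℝᵈ` with its Euclidean norm. -/
abbrev Sp (d : ℕ) : Type := EuclideanSpace ℝ (Fin d)

variable {d : ℕ}

/-! ### Lipschitz domains and decompositions -/

/-- Near each boundary point, and after a rotation, the set `Ω` is the region strictly below the
graph of a Lipschitz function of the `d - 1` coordinates orthogonal to the unit vector `e`. -/
def HasLipschitzBoundary (Ω : Set (Sp d)) : Prop :=
  ∀ x ∈ frontier Ω, ∃ (e : Sp d) (r : ℝ) (K : NNReal) (γ : Sp d → ℝ),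
    ‖e‖ = 1 ∧ 0 < r ∧ LipschitzWith K γ ∧
      ∀ y ∈ Metric.ball x r, y ∈ Ω ↔ ⟪e, y⟫ < γ (y - ⟪e, y⟫ • e)

/-- A bounded Lipschitz domain. -/
structure IsLipschitzDomain (Ω : Set (Sp d)) : Prop where
  isOpen : IsOpen Ω
  isConnected : IsConnected Ω
  isBounded : Bornology.IsBounded Ω
  lipschitz : HasLipschitzBoundary Ω

/-- A nonoverlapping decomposition of the domain `Ω` into the two subdomains `S 0`, `S 1`;
`frontier Ω \ frontier (S i)` are the exterior boundaries. -/
structure IsDecomposition (Ω : Set (Sp d)) (S : Fin 2 → Set (Sp d)) : Prop where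
  domain : IsLipschitzDomain Ω
  subdomain : ∀ i, IsLipschitzDomain (S i)
  closure_eq : closure Ω = closure (S 0) ∪ closure (S 1)
  disjoint : Disjoint (S 0) (S 1)
  exterior_nonempty : ∀ i, (frontier Ω \ frontier (S i)).Nonempty

/-- The interface `Γ`. -/
def interface (Ω : Set (Sp d)) (S : Fin 2 → Set (Sp d)) : Set (Sp d) :=
  (frontier (S 0) ∩ frontier (S 1)) \ frontier Ω

/-! ### Spatial function spaces -/

/-- `L²(Ω)`. -/
abbrev L2 (Ω : Set (Sp d)) : Type := Lp ℝ 2 (volume.restrict Ω)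

/-- `L²(Ω; ℂ)`, the complexification of `L²(Ω)`. -/
abbrev L2C (Ω : Set (Sp d)) : Type := Lp ℂ 2 (volume.restrict Ω)

/-- Test functions `C₀^∞(Ω)`. -/
def IsTest (Ω : Set (Sp d)) (φ : Sp d → ℝ) : Prop :=
  ContDiff ℝ ∞ φ ∧ HasCompactSupport φ ∧ tsupport φ ⊆ Ω

/-- `g` is the weak gradient of `v` on `Ω`. -/
def IsWeakGradient (Ω : Set (Sp d)) (v : Sp d → ℝ) (g : Sp d → Sp d) : Prop :=
  ∀ φ, IsTest Ω φ → ∫ x in Ω, v x • gradient φ x = - ∫ x in Ω, φ x • g x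

lemma IsTest.memLp {Ω : Set (Sp d)} {φ : Sp d → ℝ} (h : IsTest Ω φ) :
    MemLp φ 2 (volume.restrict Ω) :=
  h.1.continuous.memLp_of_hasCompactSupport h.2.1

lemma IsTest.memLp_gradient {Ω : Set (Sp d)} {φ : Sp d → ℝ} (h : IsTest Ω φ) :
    MemLp (gradient φ) 2 (volume.restrict Ω) := by
  have hc : Continuous (gradient φ) :=
    (InnerProductSpace.toDual ℝ (Sp d)).symm.continuous.comp (h.1.continuous_fderiv (by simp))
  refine hc.memLp_of_hasCompactSupport ?_
  exact (h.2.1.fderiv (𝕜 := ℝ)).comp_left (g := (InnerProductSpace.toDual ℝ (Sp d)).symm)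
    (map_zero _)

/-- The pairs (function, weak gradient) in `L²(Ω) × L²(Ω)ᵈ`. -/
def H1Sub (Ω : Set (Sp d)) :
    Submodule ℝ (WithLp 2 (L2 Ω × Lp (Sp d) 2 (volume.restrict Ω))) where
  carrier := {p | IsWeakGradient Ω p.fst p.snd}
  zero_mem' := by
    intro φ _
    have h1 : ∫ x in Ω, ((0 : L2 Ω) : Sp d → ℝ) x • gradient φ x = 0 := by
      rw [← integral_zero (Sp d) (Sp d) (μ := volume.restrict Ω)]
      refine integral_congr_ae ?_
      filter_upwards [Lp.coeFn_zero ℝ 2 (volume.restrict Ω)] with x hx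
      rw [hx, Pi.zero_apply, zero_smul]
    have h2 : ∫ x in Ω, φ x • ((0 : Lp (Sp d) 2 (volume.restrict Ω)) : Sp d → Sp d) x = 0 := by
      rw [← integral_zero (Sp d) (Sp d) (μ := volume.restrict Ω)]
      refine integral_congr_ae ?_
      filter_upwards [Lp.coeFn_zero (Sp d) 2 (volume.restrict Ω)] with x hx
      rw [hx, Pi.zero_apply, smul_zero]
    rw [WithLp.zero_fst, WithLp.zero_snd, h1, h2, neg_zero]
  add_mem' := by
    intro p q hp hq φ hφ
    have i1 (w : L2 Ω) : Integrable (fun x => w x • gradient φ x) (volume.restrict Ω) :=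
      memLp_one_iff_integrable.1 ((hφ.memLp_gradient).smul (Lp.memLp w))
    have i2 (w : Lp (Sp d) 2 (volume.restrict Ω)) :
        Integrable (fun x => φ x • w x) (volume.restrict Ω) :=
      memLp_one_iff_integrable.1 ((Lp.memLp w).smul hφ.memLp)
    have h1 : ∫ x in Ω, (p.fst + q.fst : L2 Ω) x • gradient φ x =
        ∫ x in Ω, p.fst x • gradient φ x + q.fst x • gradient φ x := by
      refine integral_congr_ae ?_
      filter_upwards [Lp.coeFn_add p.fst q.fst] with x hx
      rw [hx, Pi.add_apply, add_smul]
    have h2 : ∫ x in Ω, φ x • (p.snd + q.snd : Lp (Sp d) 2 (volume.restrict Ω)) x =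
        ∫ x in Ω, φ x • p.snd x + φ x • q.snd x := by
      refine integral_congr_ae ?_
      filter_upwards [Lp.coeFn_add p.snd q.snd] with x hx
      rw [hx, Pi.add_apply, smul_add]
    rw [WithLp.add_fst, WithLp.add_snd, h1, h2, integral_add (i1 _) (i1 _),
      integral_add (i2 _) (i2 _), hp φ hφ, hq φ hφ, neg_add]
  smul_mem' := by
    intro c p hp φ hφ
    have h1 : ∫ x in Ω, (c • p.fst : L2 Ω) x • gradient φ x =
        ∫ x in Ω, c • (p.fst x • gradient φ x) := by
      refine integral_congr_ae ?_
      filter_upwards [Lp.coeFn_smul c p.fst] with x hx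
      simp [hx, mul_smul]
    have h2 : ∫ x in Ω, φ x • (c • p.snd : Lp (Sp d) 2 (volume.restrict Ω)) x =
        ∫ x in Ω, c • (φ x • p.snd x) := by
      refine integral_congr_ae ?_
      filter_upwards [Lp.coeFn_smul c p.snd] with x hx
      simp only [hx, Pi.smul_apply]
      rw [smul_comm]
    rw [WithLp.smul_fst, WithLp.smul_snd, h1, h2, integral_smul, integral_smul, hp φ hφ, smul_neg]

/-- `H¹(Ω)`, with the norm `(‖v‖² + ‖∇v‖²)^{1/2}`. -/
def H1 (Ω : Set (Sp d)) : Type := H1Sub Ω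

instance (Ω : Set (Sp d)) : NormedAddCommGroup (H1 Ω) :=
  inferInstanceAs (NormedAddCommGroup (H1Sub Ω))

instance (Ω : Set (Sp d)) : InnerProductSpace ℝ (H1 Ω) :=
  inferInstanceAs (InnerProductSpace ℝ (H1Sub Ω))

/-- The embedding `H¹(Ω) → L²(Ω)`. -/
def H1.toL2 (Ω : Set (Sp d)) : H1 Ω →L[ℝ] L2 Ω :=
  (WithLp.fstL 2 ℝ (L2 Ω) (Lp (Sp d) 2 (volume.restrict Ω))).comp (H1Sub Ω).subtypeL

/-- `H₀¹(Ω)`: the closure of `C₀^∞(Ω)` in `H¹(Ω)`. -/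
def H10 (Ω : Set (Sp d)) : Submodule ℝ (H1 Ω) :=
  (Submodule.span ℝ
    {v : H1 Ω | ∃ φ, IsTest Ω φ ∧ H1.toL2 Ω v =ᵐ[volume.restrict Ω] φ}).topologicalClosure

/-- The surface measure on `∂Ω`: the `(d-1)`-dimensional Hausdorff measure. -/
def surfaceMeasure (Ω : Set (Sp d)) : Measure (Sp d) :=
  (Measure.hausdorffMeasure ((d : ℝ) - 1)).restrict (frontier Ω)

/-- The graph of the trace operator `H¹(Ω) → L²(∂Ω)`: the closure of the graph of the restriction
`φ ↦ φ|_{∂Ω}` on functions that are smooth up to the boundary. -/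
def traceGraph (Ω : Set (Sp d)) : Submodule ℝ (H1 Ω × Lp ℝ 2 (surfaceMeasure Ω)) :=
  (Submodule.span ℝ {p : H1 Ω × Lp ℝ 2 (surfaceMeasure Ω) | ∃ φ : Sp d → ℝ, ContDiff ℝ ∞ φ ∧
    H1.toL2 Ω p.1 =ᵐ[volume.restrict Ω] φ ∧ p.2 =ᵐ[surfaceMeasure Ω] φ}).topologicalClosure

/-- The space of those `v ∈ H¹(U)` whose trace vanishes on `∂U \ Γ`. -/
def H1van (U Γ : Set (Sp d)) : Submodule ℝ (H1 U) where
  carrier := {v | ∃ g : Lp ℝ 2 (surfaceMeasure U), (v, g) ∈ traceGraph U ∧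
    ∀ᵐ x ∂(surfaceMeasure U), x ∈ frontier U \ Γ → g x = 0}
  zero_mem' := by
    refine ⟨0, (traceGraph U).zero_mem, ?_⟩
    filter_upwards [Lp.coeFn_zero ℝ 2 (surfaceMeasure U)] with x hx _
    rw [hx, Pi.zero_apply]
  add_mem' := by
    rintro v w ⟨g, hg, hg0⟩ ⟨k, hk, hk0⟩
    refine ⟨g + k, (traceGraph U).add_mem hg hk, ?_⟩
    filter_upwards [Lp.coeFn_add g k, hg0, hk0] with x hx h1 h2 hm
    rw [hx, Pi.add_apply, h1 hm, h2 hm, add_zero]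
  smul_mem' := by
    rintro c v ⟨g, hg, hg0⟩
    refine ⟨c • g, (traceGraph U).smul_mem c hg, ?_⟩
    filter_upwards [Lp.coeFn_smul c g, hg0] with x hx h1 hm
    rw [hx, Pi.smul_apply, h1 hm, smul_zero]

/-! ### Extension from `ℝ⁺` to `ℝ` -/

/-- Lebesgue measure on `ℝ⁺ = (0, ∞)`. -/
abbrev volPos : Measure ℝ := volume.restrict (Ioi 0)

section Extension

lemma memLp_zeroExt {Y : Type*} [NormedAddCommGroup Y] (u : Lp Y 2 volPos) :
    MemLp ((Ioi (0 : ℝ)).indicator u) 2 (volume : Measure ℝ) :=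
  (memLp_indicator_iff_restrict measurableSet_Ioi).2 (Lp.memLp u)

variable {Y : Type*} [NormedAddCommGroup Y] [NormedSpace ℝ Y]

/-- Extension by zero, `E_ℝ : L²(ℝ⁺, Y) → L²(ℝ, Y)`. -/
def zeroExt : Lp Y 2 volPos →ₗ[ℝ] Lp Y 2 (volume : Measure ℝ) where
  toFun u := (memLp_zeroExt u).toLp _
  map_add' u v := by
    rw [← MemLp.toLp_add, MemLp.toLp_eq_toLp_iff]
    filter_upwards [(ae_restrict_iff' measurableSet_Ioi).1 (Lp.coeFn_add u v)] with t ht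
    by_cases h : t ∈ Ioi (0 : ℝ)
    · simp only [Pi.add_apply, indicator_of_mem h, ht h]
    · simp only [Pi.add_apply, indicator_of_notMem h, add_zero]
  map_smul' c u := by
    rw [RingHom.id_apply, ← MemLp.toLp_const_smul, MemLp.toLp_eq_toLp_iff]
    filter_upwards [(ae_restrict_iff' measurableSet_Ioi).1 (Lp.coeFn_smul c u)] with t ht
    by_cases h : t ∈ Ioi (0 : ℝ)
    · simp only [Pi.smul_apply, indicator_of_mem h, ht h]
    · simp only [Pi.smul_apply, indicator_of_notMem h, smul_zero]

/-- Even extension, `E_even : L²(ℝ⁺, Y) → L²(ℝ, Y)`, written as the sum of the extension by zero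
and its reflection in `t = 0`. -/
def evenExt : Lp Y 2 volPos →ₗ[ℝ] Lp Y 2 (volume : Measure ℝ) :=
  zeroExt + (Lp.compMeasurePreservingₗ ℝ (fun t : ℝ => -t)
    (Measure.measurePreserving_neg volume)) ∘ₗ zeroExt

end Extension

/-! ### Temporal regularity through the Fourier transform -/

/-- `L²(ℝ, L²(Ω)) → L²(ℝ, L²(Ω; ℂ))`. -/
def complexify (Ω : Set (Sp d)) :
    Lp (L2 Ω) 2 (volume : Measure ℝ) →L[ℝ] Lp (L2C Ω) 2 (volume : Measure ℝ) :=
  (Complex.ofRealCLM.compLpL 2 (volume.restrict Ω)).compLpL 2 volume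

/-- The Fourier transform in time, `L²(ℝ, L²(Ω)) → L²(ℝ, L²(Ω; ℂ))`. -/
def timeFourier (Ω : Set (Sp d)) :
    Lp (L2 Ω) 2 (volume : Measure ℝ) →ₗ[ℝ] Lp (L2C Ω) 2 (volume : Measure ℝ) :=
  ((Lp.fourierTransformₗᵢ ℝ (L2C Ω)).toLinearEquiv.toLinearMap.restrictScalars ℝ) ∘ₗ
    (complexify Ω).toLinearMap

/-- `w = ℋ v` for the Hilbert transform in time `ℋ` on `L²(ℝ, L²(Ω))`: the Fourier multiplier with
symbol `-i sgn(ξ)`. -/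
def IsHilbertTransform (Ω : Set (Sp d)) (v w : Lp (L2 Ω) 2 (volume : Measure ℝ)) : Prop :=
  ∀ᵐ ξ : ℝ, timeFourier Ω w ξ = (-Complex.I * (SignType.sign ξ : ℂ)) • timeFourier Ω v ξ

/-- The embedding `L²(ℝ⁺, H¹(Ω)) → L²(ℝ⁺, L²(Ω))`. -/
def embL2 (Ω : Set (Sp d)) : Lp (H1 Ω) 2 volPos →L[ℝ] Lp (L2 Ω) 2 volPos :=
  (H1.toL2 Ω).compLpL 2 volPos

/-- `h` is the function `(1 + ξ²)^{1/4} ŵ(ξ)`; the `L²`-norm of `h` is then the norm of `w` in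
`H^{1/2}(ℝ, L²(Ω))`. -/
def IsHalfDensity (Ω : Set (Sp d)) (w : Lp (L2 Ω) 2 (volume : Measure ℝ))
    (h : Lp (L2C Ω) 2 (volume : Measure ℝ)) : Prop :=
  ∀ᵐ ξ : ℝ, h ξ = ((1 + ξ ^ 2) ^ (1 / 4 : ℝ) : ℝ) • timeFourier Ω w ξ

lemma IsHalfDensity.zero (Ω : Set (Sp d)) : IsHalfDensity Ω 0 0 := by
  unfold IsHalfDensity
  rw [map_zero]
  filter_upwards [Lp.coeFn_zero (L2C Ω) 2 (volume : Measure ℝ)] with ξ hξ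
  rw [hξ, Pi.zero_apply, smul_zero]

lemma IsHalfDensity.add {Ω : Set (Sp d)} {w w' : Lp (L2 Ω) 2 (volume : Measure ℝ)}
    {h h' : Lp (L2C Ω) 2 (volume : Measure ℝ)} (hw : IsHalfDensity Ω w h)
    (hw' : IsHalfDensity Ω w' h') : IsHalfDensity Ω (w + w') (h + h') := by
  unfold IsHalfDensity
  rw [map_add]
  filter_upwards [hw, hw', Lp.coeFn_add h h', Lp.coeFn_add (timeFourier Ω w) (timeFourier Ω w')]
    with ξ h1 h2 h3 h4
  rw [h3, h4, Pi.add_apply, Pi.add_apply, h1, h2, smul_add]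

lemma IsHalfDensity.smul {Ω : Set (Sp d)} {w : Lp (L2 Ω) 2 (volume : Measure ℝ)}
    {h : Lp (L2C Ω) 2 (volume : Measure ℝ)} (c : ℝ) (hw : IsHalfDensity Ω w h) :
    IsHalfDensity Ω (c • w) (c • h) := by
  unfold IsHalfDensity
  rw [map_smul]
  filter_upwards [hw, Lp.coeFn_smul c h, Lp.coeFn_smul c (timeFourier Ω w)] with ξ h1 h3 h4
  rw [h3, h4, Pi.smul_apply, Pi.smul_apply, h1, smul_comm]

/-- Ambient Hilbert space for the space-time spaces. -/
abbrev Ambient (Ω : Set (Sp d)) : Type :=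
  WithLp 2 (Lp (H1 Ω) 2 volPos × Lp (L2C Ω) 2 (volume : Measure ℝ))

/-- For an extension operator `E` and a subspace `V` of `H¹(Ω)`, the space
`{u ∈ L²(ℝ⁺, V) : E u ∈ H^{1/2}(ℝ, L²(Ω))}` with the norm
`(‖u‖²_{L²(ℝ⁺, V)} + ‖E u‖²_{H^{1/2}(ℝ, L²(Ω))})^{1/2}`.  An element is a pair `(u, h)` in which `h`
is the function `(1 + ξ²)^{1/4} ŵ(ξ)`, `w = E u`; it is determined by `u`. -/
def STSpace (Ω : Set (Sp d)) (E : Lp (L2 Ω) 2 volPos →ₗ[ℝ] Lp (L2 Ω) 2 (volume : Measure ℝ))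
    (V : Submodule ℝ (H1 Ω)) : Submodule ℝ (Ambient Ω) where
  carrier := {p | (∀ᵐ t ∂volPos, p.fst t ∈ V) ∧ IsHalfDensity Ω (E (embL2 Ω p.fst)) p.snd}
  zero_mem' := by
    constructor
    · filter_upwards [Lp.coeFn_zero (H1 Ω) 2 volPos] with t ht
      exact ht ▸ V.zero_mem
    · have := IsHalfDensity.zero Ω
      rwa [← map_zero E, ← map_zero (embL2 Ω)] at this
  add_mem' := by
    rintro p q ⟨hp, hp'⟩ ⟨hq, hq'⟩
    constructor
    · filter_upwards [hp, hq, Lp.coeFn_add p.fst q.fst] with t h1 h2 h3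
      exact h3 ▸ V.add_mem h1 h2
    · have := hp'.add hq'
      rwa [← map_add E, ← map_add (embL2 Ω)] at this
  smul_mem' := by
    rintro c p ⟨hp, hp'⟩
    constructor
    · filter_upwards [hp, Lp.coeFn_smul c p.fst] with t h1 h3
      exact h3 ▸ V.smul_mem c h1
    · have := hp'.smul c
      rwa [← map_smul E, ← map_smul (embL2 Ω)] at this

/-- The function `u ∈ L²(ℝ⁺, H¹(Ω))` underlying an element of a space-time space. -/
def fn {Ω : Set (Sp d)}
    {E : Lp (L2 Ω) 2 volPos →ₗ[ℝ] Lp (L2 Ω) 2 (volume : Measure ℝ)} {V : Submodule ℝ (H1 Ω)}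
    (u : STSpace Ω E V) : Lp (H1 Ω) 2 volPos :=
  (u : Ambient Ω).fst

/-- `H₀₀^{1/2}(ℝ⁺, L²(Ω)) ∩ L²(ℝ⁺, V)`. -/
abbrev Trial (Ω : Set (Sp d)) (V : Submodule ℝ (H1 Ω)) : Submodule ℝ (Ambient Ω) :=
  STSpace Ω zeroExt V

/-- `H^{1/2}(ℝ⁺, L²(Ω)) ∩ L²(ℝ⁺, V)`. -/
abbrev Test (Ω : Set (Sp d)) (V : Submodule ℝ (H1 Ω)) : Submodule ℝ (Ambient Ω) :=
  STSpace Ω evenExt V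

lemma STSpace.mono (Ω : Set (Sp d))
    (E : Lp (L2 Ω) 2 volPos →ₗ[ℝ] Lp (L2 Ω) 2 (volume : Measure ℝ)) {V V' : Submodule ℝ (H1 Ω)}
    (h : V ≤ V') : STSpace Ω E V ≤ STSpace Ω E V' :=
  fun _ hp => ⟨hp.1.mono fun _ ht => h ht, hp.2⟩

/-- A space-time space with spatial constraint `V`, as a subspace of the unconstrained one. -/
def toFull {Ω : Set (Sp d)}
    {E : Lp (L2 Ω) 2 volPos →ₗ[ℝ] Lp (L2 Ω) 2 (volume : Measure ℝ)} {V : Submodule ℝ (H1 Ω)}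
    (u : STSpace Ω E V) : STSpace Ω E (⊤ : Submodule ℝ (H1 Ω)) :=
  Submodule.inclusion (STSpace.mono Ω E le_top) u

/-! ### The parabolic form -/

/-- `C₀^∞(ℝ⁺, C₀^∞(Ω))`. -/
def smoothCompact (Ω : Set (Sp d)) : Set (ℝ → Sp d → ℝ) :=
  {φ | ContDiff ℝ ∞ (fun p : ℝ × Sp d => φ p.1 p.2) ∧
    HasCompactSupport (fun p : ℝ × Sp d => φ p.1 p.2) ∧
    tsupport (fun p : ℝ × Sp d => φ p.1 p.2) ⊆ Ioi 0 ×ˢ Ω}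

/-- `C₀^∞(ℝ⁺, C^∞(closure U))`, where functions smooth up to the boundary are restrictions of
functions smooth on the whole space. -/
def smoothUpTo (d : ℕ) : Set (ℝ → Sp d → ℝ) :=
  {φ | ContDiff ℝ ∞ (fun p : ℝ × Sp d => φ p.1 p.2) ∧
    ∃ a b : ℝ, 0 < a ∧ ∀ t, t ∉ Icc a b → ∀ x, φ t x = 0}

/-- `∫_{ℝ⁺} ∫_Ω ∂ₜφ ψ + α ∇φ · ∇ψ dx dt` for smooth `φ`, `ψ`. -/
def smoothForm (Ω : Set (Sp d)) (α : Sp d → ℝ) (φ ψ : ℝ → Sp d → ℝ) : ℝ :=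
  ∫ t in Ioi (0 : ℝ), ∫ x in Ω,
    (deriv (fun s => φ s x) t * ψ t x + α x * ⟪gradient (φ t) x, gradient (ψ t) x⟫)

/-- The element `u` of a space-time space is (the class of) the function `φ` on `ℝ⁺ × Ω`. -/
def Represents {Ω : Set (Sp d)}
    {E : Lp (L2 Ω) 2 volPos →ₗ[ℝ] Lp (L2 Ω) 2 (volume : Measure ℝ)} {V : Submodule ℝ (H1 Ω)}
    (u : STSpace Ω E V) (φ : ℝ → Sp d → ℝ) : Prop :=
  ∀ᵐ t ∂volPos, H1.toL2 Ω (fn u t) =ᵐ[volume.restrict Ω] φ t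

/-- All smooth functions in `D` belong to the trial and to the test space, and the bounded operator
`A` from the trial space to the dual of the test space is given on them by the integral formula. -/
def ExtendsForm (Ω : Set (Sp d)) (V : Submodule ℝ (H1 Ω)) (D : Set (ℝ → Sp d → ℝ))
    (α : Sp d → ℝ) (A : Trial Ω V →L[ℝ] Test Ω V →L[ℝ] ℝ) : Prop :=
  ∀ φ ∈ D, ∀ ψ ∈ D, ∃ (u : Trial Ω V) (v : Test Ω V),
    Represents u φ ∧ Represents v ψ ∧ A u v = smoothForm Ω α φ ψ

/-- `v = R (cos θ I - sin θ ℋ) E_ℝ u`, where `E_ℝ` is the extension by zero, `ℋ` the Hilbert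
transform in time and `R` the restriction to `ℝ⁺`. -/
def IsRotatedHilbert {Ω : Set (Sp d)} {V : Submodule ℝ (H1 Ω)} (θ : ℝ)
    (u : Trial Ω V) (v : Test Ω V) : Prop :=
  ∃ w, IsHilbertTransform Ω (zeroExt (embL2 Ω (fn u))) w ∧
    ∀ᵐ t ∂volPos, embL2 Ω (fn v) t =
      Real.cos θ • zeroExt (embL2 Ω (fn u)) t - Real.sin θ • w t

end RobinRobin

end

open RobinRobin

/-! In terms of the half densities (1 + ξ²)^{1/4} ŵ(ξ), Parseval turns ∫ ∂ₜu v into an L² pairing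
with the bounded multiplier 2πiξ / (1 + ξ²)^{1/2}. Written in this way (`ambientForm`) the parabolic
form is bounded at once. A smooth trial function, extended by zero, has no time derivative for t ≤
0, so the negative half of the even extension of the test function does not enter, and the integral
formula follows (`extendsForm_parabolicForm`).

Uniqueness is density of the smooth functions in both spaces. In time, trial functions are mollified
with kernels supported in (0, ∞), test functions with even kernels. The latter need not vanish at t
= 0, but 1/2 is the critical exponent: a cutoff of width 1/n is small in L² and bounded in H^{1/2}.
Strong convergence in H^{1/2} is never needed, since a bounded sequence in a closed subspace that
converges in L²(ℝ⁺, H¹) has its limit in the subspace (`mem_of_bounded_of_tendsto`). In space, H₀¹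
is a closure of test functions by definition, and for H¹ of a Lipschitz domain functions are
localized, moved off the boundary and mollified (`H1smooth_eq_top`).

For coercivity, cos θ - sin θ ℋ has the symbol cos θ + i sin θ sgn ξ. Paired with the symbol of ∂ₜ
its real part is 2π sin θ |ξ|, which controls the H^{1/2} seminorm (`timeForm_rotSymbol`). In space
the rotation costs at most sin θ times the multiplier norm of α, hence little for small θ
(`exists_angle`). Restriction to ℝ⁺ is harmless: the time form does not see the test function at
negative times (`timeForm_eq_zero`), and the even extension of a restriction stays in H^{1/2}, by
the Gagliardo seminorm (`IsHalfDensity.evenExt_restr`). The angle θ = 0 yields the inclusion of the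
trial in the test space and the coercivity in L²(ℝ⁺, V).

The gradient controls the full H¹ norm by a Friedrichs inequality. The trace vanishes near some
exterior boundary point; the bound near this point spreads through the connected domain by
translations and then reaches the rest of the boundary (`FriedrichsOn.self`). Boundedness of the
trace makes the spatial spaces complete (`isComplete_H1van`), as the projections and the Hilbert
transform require. -/

noncomputable section

namespace RobinRobin

set_option linter.unusedSectionVars false

variable {d : ℕ}

section

open scoped ENNReal

/-! ### Bochner integrals with values in `L²` -/

section BochnerLp

variable {S X Y : Type*} [MeasurableSpace S] [MeasurableSpace X] {ν : Measure S} {μ : Measure X}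
  [NormedAddCommGroup Y] [NormedSpace ℝ Y]

/-- Hölder's inequality on a set of finite measure; the exponent is 1/1 - 1/2 = 1/2. -/
lemma integral_norm_restrict_le (f : Lp Y 2 μ) {A : Set X} (hμA : μ A < ⊤) :
    ∫ x in A, ‖f x‖ ∂μ ≤ (μ A ^ (1 / 2 : ℝ)).toReal * ‖f‖ := by
  have hf : AEStronglyMeasurable f (μ.restrict A) := (Lp.aestronglyMeasurable f).restrict
  have h1 : eLpNorm f 1 (μ.restrict A) ≤ eLpNorm f 2 μ * μ A ^ (1 / 2 : ℝ) := by
    have := eLpNorm_le_eLpNorm_mul_rpow_measure_univ (p := 1) (q := 2) (by norm_num) hf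
    refine this.trans ?_
    have h2 : (1 / (1 : ℝ≥0∞).toReal - 1 / (2 : ℝ≥0∞).toReal) = (1 / 2 : ℝ) := by norm_num
    rw [h2, Measure.restrict_apply_univ]
    gcongr
    exact Measure.restrict_le_self
  rw [integral_norm_eq_lintegral_enorm hf, ← eLpNorm_one_eq_lintegral_enorm, Lp.norm_def, mul_comm,
    ← ENNReal.toReal_mul]
  refine ENNReal.toReal_mono (ENNReal.mul_ne_top (Lp.eLpNorm_ne_top f) ?_) h1
  exact ENNReal.rpow_ne_top_of_nonneg (by norm_num) hμA.ne

lemma integrableOn_Lp_two (f : Lp Y 2 μ) {A : Set X} (hμA : μ A < ⊤) :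
    IntegrableOn f A μ := by
  have : IsFiniteMeasure (μ.restrict A) := ⟨by simpa using hμA⟩
  exact ((Lp.memLp f).restrict A).integrable (by norm_num)

/-- Integration over a set of finite measure, as a functional on `L²`. -/
def setIntegralL {A : Set X} (hμA : μ A < ⊤) : Lp Y 2 μ →L[ℝ] Y :=
  LinearMap.mkContinuous
    { toFun := fun f => ∫ x in A, f x ∂μ
      map_add' := fun f g => by
        rw [← integral_add (integrableOn_Lp_two f hμA) (integrableOn_Lp_two g hμA)]
        exact integral_congr_ae (ae_restrict_of_ae (Lp.coeFn_add f g))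
      map_smul' := fun c f => by
        rw [RingHom.id_apply, ← integral_smul]
        exact integral_congr_ae (ae_restrict_of_ae (Lp.coeFn_smul c f)) }
    (μ A ^ (1 / 2 : ℝ)).toReal
    (fun f => (norm_integral_le_integral_norm _).trans (integral_norm_restrict_le f hμA))

/-- A Bochner integral with values in `L²` can be evaluated pointwise. -/
lemma integral_Lp_ae_eq [CompleteSpace Y] [SigmaFinite ν] [SigmaFinite μ] {F : S → Lp Y 2 μ}
    {f : S → X → Y} (hF : Integrable F ν)
    (hf : AEStronglyMeasurable (fun p : S × X => f p.1 p.2) (ν.prod μ))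
    (hFf : ∀ s, F s =ᵐ[μ] f s) :
    (∫ s, F s ∂ν : Lp Y 2 μ) =ᵐ[μ] fun x => ∫ s, f s x ∂ν := by
  -- On a set of finite measure the L¹ norm is controlled by the L² norm, uniformly in s, so Fubini
  -- applies on S × A.
  have key : ∀ A, MeasurableSet A → μ A < ⊤ →
      Integrable (fun p : S × X => f p.1 p.2) (ν.prod (μ.restrict A)) := by
    intro A hA hμA
    have hm : AEStronglyMeasurable (fun p : S × X => f p.1 p.2) (ν.prod (μ.restrict A)) := by
      refine hf.mono_ac ?_
      exact Measure.AbsolutelyContinuous.rfl.prod Measure.restrict_le_self.absolutelyContinuous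
    rw [integrable_prod_iff hm]
    constructor
    · refine Eventually.of_forall fun s => ?_
      exact (integrableOn_Lp_two (F s) hμA).congr (ae_restrict_of_ae (hFf s))
    · refine Integrable.mono' (hF.norm.const_mul (μ A ^ (1 / 2 : ℝ)).toReal)
        hm.norm.integral_prod_right' (Eventually.of_forall fun s => ?_)
      rw [Real.norm_of_nonneg (integral_nonneg fun _ => norm_nonneg _)]
      have : ∫ x in A, ‖f s x‖ ∂μ = ∫ x in A, ‖F s x‖ ∂μ :=
        integral_congr_ae (ae_restrict_of_ae ((hFf s).symm.fun_comp _))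
      rw [this]
      exact integral_norm_restrict_le (F s) hμA
  -- It suffices to compare integrals over sets of finite measure; such an integral is a bounded
  -- functional on L² and commutes with the Bochner integral.
  refine ae_eq_of_forall_setIntegral_eq_of_sigmaFinite
    (fun A _ hμA => integrableOn_Lp_two _ hμA)
    (fun A hA hμA => (key A hA hμA).integral_prod_right) fun A hA hμA => ?_
  have h1 : ∫ x in A, (∫ s, F s ∂ν : Lp Y 2 μ) x ∂μ = ∫ s, ∫ x in A, F s x ∂μ ∂ν :=
    ((setIntegralL hμA).integral_comp_comm hF).symm
  have h2 : ∀ s, ∫ x in A, F s x ∂μ = ∫ x in A, f s x ∂μ := fun s =>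
    integral_congr_ae (ae_restrict_of_ae (hFf s))
  rw [h1, integral_congr_ae (Eventually.of_forall h2)]
  exact integral_integral_swap (key A hA hμA)

end BochnerLp

/-! ### Translations and averages of translations -/

section Average

variable {G : Type*} [NormedAddCommGroup G] [InnerProductSpace ℝ G] [FiniteDimensional ℝ G]
  [MeasurableSpace G] [BorelSpace G]
  {Y : Type*} [NormedAddCommGroup Y] [NormedSpace ℝ Y]
  {Y' : Type*} [NormedAddCommGroup Y'] [NormedSpace ℝ Y']

/-- Translation by `s` on `L²(G, Y)`. -/
def translate (s : G) : Lp Y 2 (volume : Measure G) →ₗᵢ[ℝ] Lp Y 2 (volume : Measure G) :=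
  Lp.compMeasurePreservingₗᵢ ℝ (fun x => x - s) (measurePreserving_sub_right volume s)

lemma translate_ae (s : G) (f : Lp Y 2 (volume : Measure G)) :
    translate s f =ᵐ[volume] fun x => f (x - s) :=
  Lp.coeFn_compMeasurePreserving f (measurePreserving_sub_right volume s)

lemma continuous_translate (f : Lp Y 2 (volume : Measure G)) :
    Continuous fun s => translate s f := by
  have hc : Continuous fun s : G => (⟨fun x => x - s, by fun_prop⟩ : C(G, G)) :=
    ContinuousMap.continuous_of_continuous_uncurry _ (by
      simp only [Function.uncurry_def, ContinuousMap.coe_mk]; fun_prop)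
  exact (continuous_const (y := f)).compMeasurePreservingLp hc
    (fun s => measurePreserving_sub_right volume s) (by norm_num)

lemma translate_zero (f : Lp Y 2 (volume : Measure G)) : translate (0 : G) f = f := by
  refine Lp.ext ((translate_ae 0 f).trans ?_)
  simp

/-- The convolution of `f` with the kernel `κ`, as an average of translates. -/
def average (κ : G → ℝ) (f : Lp Y 2 (volume : Measure G)) : Lp Y 2 (volume : Measure G) :=
  ∫ s, κ s • translate s f

variable {κ : G → ℝ}

lemma integrable_average (hκ : Integrable κ) (f : Lp Y 2 (volume : Measure G)) :
    Integrable fun s => κ s • translate s f := by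
  have h1 : AEStronglyMeasurable (fun s => translate s f) (volume : Measure G) :=
    (continuous_translate f).aestronglyMeasurable
  refine (hκ.norm.mul_const ‖f‖).mono' (hκ.aestronglyMeasurable.smul h1) ?_
  refine Eventually.of_forall fun s => ?_
  rw [norm_smul, LinearIsometry.norm_map]

lemma norm_average_le (κ : G → ℝ) (f : Lp Y 2 (volume : Measure G)) :
    ‖average κ f‖ ≤ (∫ s, ‖κ s‖) * ‖f‖ := by
  refine (norm_integral_le_integral_norm _).trans_eq ?_
  rw [← integral_mul_const]
  refine integral_congr_ae (Eventually.of_forall fun s => ?_)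
  simp only [norm_smul, LinearIsometry.norm_map]

lemma average_add (hκ : Integrable κ) (f g : Lp Y 2 (volume : Measure G)) :
    average κ (f + g) = average κ f + average κ g := by
  unfold average
  rw [← integral_add (integrable_average hκ f) (integrable_average hκ g)]
  simp only [map_add, smul_add]

lemma average_smul (c : ℝ) (f : Lp Y 2 (volume : Measure G)) :
    average κ (c • f) = c • average κ f := by
  unfold average
  rw [← integral_smul]
  simp only [map_smul, smul_comm c]

/-- A bounded operator that intertwines translations with the family `T` maps averages to averages
with respect to `T`. -/
lemma map_average [CompleteSpace Y] {W : Type*} [NormedAddCommGroup W] [NormedSpace ℝ W]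
    [CompleteSpace W] (hκ : Integrable κ) (L : Lp Y 2 (volume : Measure G) →L[ℝ] W)
    (f : Lp Y 2 (volume : Measure G)) :
    L (average κ f) = ∫ s, κ s • L (translate s f) := by
  unfold average
  rw [← L.integral_comp_comm (integrable_average hκ f)]
  simp only [map_smul]

lemma translate_compLp (L : Y →L[ℝ] Y') (s : G) (f : Lp Y 2 (volume : Measure G)) :
    L.compLp (translate s f) = translate s (L.compLp f) := by
  refine Lp.ext ?_
  filter_upwards [L.coeFn_compLp (translate s f), translate_ae s f, translate_ae s (L.compLp f),
    (measurePreserving_sub_right volume s).quasiMeasurePreserving.ae (L.coeFn_compLp f)]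
    with x h1 h2 h3 h4
  rw [h1, h2, h3, h4]

lemma compLp_average [CompleteSpace Y] [CompleteSpace Y'] (hκ : Integrable κ) (L : Y →L[ℝ] Y')
    (f : Lp Y 2 (volume : Measure G)) :
    L.compLp (average κ f) = average κ (L.compLp f) := by
  have := map_average hκ (L.compLpL 2 (volume : Measure G)) f
  refine this.trans ?_
  unfold average
  refine integral_congr_ae (Eventually.of_forall fun s => ?_)
  exact congrArg (κ s • ·) (translate_compLp L s f)

lemma average_ae [CompleteSpace Y] (hκ : Integrable κ) (f : Lp Y 2 (volume : Measure G)) :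
    average κ f =ᵐ[volume] fun x => ∫ s, κ s • f (x - s) := by
  refine integral_Lp_ae_eq (f := fun s x => κ s • f (x - s)) (integrable_average hκ f) ?_ ?_
  · have h1 : AEStronglyMeasurable (fun p : G × G => κ p.1) (volume.prod volume) :=
      hκ.aestronglyMeasurable.comp_quasiMeasurePreserving Measure.quasiMeasurePreserving_fst
    have h2 : AEStronglyMeasurable (fun p : G × G => f (p.2 - p.1))
        ((volume : Measure G).prod volume) :=
      (Lp.aestronglyMeasurable f).comp_quasiMeasurePreserving (by
        have := quasiMeasurePreserving_sub (volume : Measure G) (volume : Measure G)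
        exact this.comp Measure.measurePreserving_swap.quasiMeasurePreserving)
    exact h1.smul h2
  · intro s
    filter_upwards [Lp.coeFn_smul (κ s) (translate s f), translate_ae s f] with x h1 h2
    rw [h1, Pi.smul_apply, h2]

/-- Averages over small translations approximate the identity. -/
lemma norm_average_sub_le [CompleteSpace Y] (f : Lp Y 2 (volume : Measure G)) {ε : ℝ} (hε : 0 < ε) :
    ∃ r > 0, ∀ κ : G → ℝ, Integrable κ → (∀ s, 0 ≤ κ s) → ∫ s, κ s = 1 →
      (∀ s, κ s ≠ 0 → ‖s‖ ≤ r) → ‖average κ f - f‖ ≤ ε := by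
  have hc := (continuous_translate f).tendsto 0
  rw [translate_zero, Metric.tendsto_nhds_nhds] at hc
  obtain ⟨r, hr, H⟩ := hc ε hε
  -- Halving turns the non-strict bound on the support into the strict one that continuity of
  -- translation asks for.
  refine ⟨r / 2, by positivity, fun κ hκ h0 h1 hs => ?_⟩
  have h2 : average κ f - f = ∫ s, κ s • (translate s f - f) := by
    simp only [smul_sub]
    rw [integral_sub (integrable_average hκ f) (hκ.smul_const f), integral_smul_const, h1, one_smul]
    rfl
  rw [h2]
  have h3 : ∫ s, κ s * ε = ε := by rw [integral_mul_const, h1, one_mul]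
  refine (norm_integral_le_of_norm_le (hκ.mul_const ε) (Eventually.of_forall fun s => ?_)).trans
    h3.le
  rw [norm_smul, Real.norm_of_nonneg (h0 s)]
  by_cases h : κ s = 0
  · simp [h]
  · refine mul_le_mul_of_nonneg_left ?_ (h0 s)
    have := H (x := s) (by rw [dist_zero_right]; linarith [hs s h])
    rw [dist_eq_norm] at this
    exact this.le

end Average

/-! ### Multiplication operators -/

section Multiplier

variable {X : Type*} [MeasurableSpace X] {μ : Measure X} {𝕜 : Type*} [RCLike 𝕜]
  {Z : Type*} [NormedAddCommGroup Z] [NormedSpace 𝕜 Z]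

/-- Multiplication by a bounded function on `L²`. -/
def mulL (m : X → 𝕜) (hm : MemLp m ⊤ μ) : Lp Z 2 μ →L[𝕜] Lp Z 2 μ :=
  (ContinuousLinearMap.lsmul 𝕜 𝕜).holderL μ ⊤ 2 2 (hm.toLp m)

lemma mulL_ae (m : X → 𝕜) (hm : MemLp m ⊤ μ) (g : Lp Z 2 μ) :
    mulL m hm g =ᵐ[μ] fun x => m x • g x := by
  filter_upwards [(ContinuousLinearMap.lsmul 𝕜 𝕜 (E := Z)).coeFn_holder (r := 2) (hm.toLp m) g,
    hm.coeFn_toLp] with x h1 h2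
  have : mulL m hm g x = ((ContinuousLinearMap.lsmul 𝕜 𝕜 (E := Z)).holder 2 (hm.toLp m) g) x := rfl
  rw [this, h1, h2]
  rfl

end Multiplier

end

/-! ### The Fourier transform on `L²(ℝ, Z)` -/

section Fourier

variable {Z : Type*} [NormedAddCommGroup Z] [InnerProductSpace ℂ Z] [CompleteSpace Z]
  {Z' : Type*} [NormedAddCommGroup Z'] [InnerProductSpace ℂ Z'] [CompleteSpace Z']

variable (Z) in
/-- The Fourier transform on `L²(ℝ, Z)`. -/
abbrev FT : Lp Z 2 (volume : Measure ℝ) ≃ₗᵢ[ℂ] Lp Z 2 (volume : Measure ℝ) :=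
  Lp.fourierTransformₗᵢ ℝ Z

/-- The character `ξ ↦ exp (-2πi s ξ)`. -/
def mode (s ξ : ℝ) : ℂ := ((Real.fourierChar (-(s * ξ)) : Circle) : ℂ)

lemma continuous_mode : Continuous fun p : ℝ × ℝ => mode p.1 p.2 :=
  continuous_induced_dom.comp (Real.continuous_fourierChar.comp (by fun_prop))

lemma norm_mode (s ξ : ℝ) : ‖mode s ξ‖ = 1 := Circle.norm_coe _

lemma memLp_mode (s : ℝ) : MemLp (mode s) ⊤ (volume : Measure ℝ) :=
  memLp_top_of_bound
    (continuous_mode.comp (Continuous.prodMk_right s)).aestronglyMeasurable 1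
    (Eventually.of_forall fun ξ => (norm_mode s ξ).le)

/-- The Fourier transform of `L²`-functions is self-adjoint with respect to the pairing with
Schwartz functions. -/
lemma integral_smul_fourier (F : Lp Z 2 (volume : Measure ℝ)) (φ : SchwartzMap ℝ ℂ) :
    ∫ ξ, φ ξ • (FT Z F) ξ = ∫ t, (𝓕 (φ : ℝ → ℂ)) t • F t := by
  have h := Lp.fourier_toTemperedDistribution_eq F
  have h1 := DFunLike.congr_fun h φ
  rw [TemperedDistribution.fourier_apply, Lp.toTemperedDistribution_apply,
    Lp.toTemperedDistribution_apply] at h1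
  exact h1.symm

/-- Both sides are tested against smooth compactly supported g. For the L² transform and for the
Fourier integral alike, the transform can be moved onto g. -/
lemma fourier_toLp_ae {f : ℝ → Z} (hf1 : Integrable f) (hf2 : MemLp f 2) :
    FT Z (hf2.toLp f) =ᵐ[volume] 𝓕 f := by
  refine ae_eq_of_integral_contDiff_smul_eq
    ((Lp.memLp (FT Z (hf2.toLp f))).locallyIntegrable (by norm_num)) ?_ fun g hg hgc => ?_
  · exact (VectorFourier.fourierIntegral_continuous Real.continuous_fourierChar
      continuous_inner hf1).locallyIntegrable
  · have hg' : ContDiff ℝ ∞ (fun x => (g x : ℂ)) := Complex.ofRealCLM.contDiff.comp hg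
    have hgc' : HasCompactSupport (fun x => (g x : ℂ)) :=
      hgc.comp_left (g := ((↑) : ℝ → ℂ)) Complex.ofReal_zero
    have h1 := integral_smul_fourier (hf2.toLp f) (hgc'.toSchwartzMap hg')
    have h2 : ∫ t, (𝓕 (fun x => (g x : ℂ))) t • f t = ∫ ξ, (g ξ : ℂ) • 𝓕 f ξ := by
      have := VectorFourier.integral_fourierIntegral_smul_eq_flip (μ := volume) (ν := volume)
        (L := innerₗ ℝ) (f := fun x => (g x : ℂ)) (g := f) Real.continuous_fourierChar
        continuous_inner (hg'.continuous.integrable_of_hasCompactSupport hgc') hf1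
      rw [flip_innerₗ] at this
      exact this
    have h3 : ∫ t, (𝓕 (fun x => (g x : ℂ))) t • (hf2.toLp f) t =
        ∫ t, (𝓕 (fun x => (g x : ℂ))) t • f t := by
      refine integral_congr_ae ?_
      filter_upwards [hf2.coeFn_toLp] with t ht
      rw [ht]
    have h4 : ∀ (x : ℝ) (z : Z), g x • z = (g x : ℂ) • z := fun x z => rfl
    simp only [h4]
    rw [← h2, ← h3]
    exact h1

/-- The reflection `t ↦ -t` on `L²`. -/
def reflect (f : Lp Z 2 (volume : Measure ℝ)) : Lp Z 2 (volume : Measure ℝ) :=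
  Lp.compMeasurePreserving (fun t : ℝ => -t) (Measure.measurePreserving_neg volume) f

lemma reflect_ae (f : Lp Z 2 (volume : Measure ℝ)) :
    reflect f =ᵐ[volume] fun t => f (-t) :=
  Lp.coeFn_compMeasurePreserving f (Measure.measurePreserving_neg volume)

lemma continuous_reflect :
    Continuous (reflect : Lp Z 2 (volume : Measure ℝ) → Lp Z 2 (volume : Measure ℝ)) :=
  (Lp.isometry_compMeasurePreserving (Measure.measurePreserving_neg volume)).continuous

/-- Schwartz functions are dense in L², so closed properties need only be checked on L¹ ∩ L², where
the transform is an honest integral. -/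
lemma Lp_two_induction {p : Lp Z 2 (volume : Measure ℝ) → Prop}
    (hp : IsClosed {f | p f})
    (h : ∀ (f : ℝ → Z) (_ : Integrable f) (hf2 : MemLp f 2), p (hf2.toLp f)) (f) : p f :=
  DenseRange.induction_on (p := p)
    (SchwartzMap.denseRange_toLpCLM (E := ℝ) (F := Z) (p := 2) (μ := volume) ENNReal.ofNat_ne_top)
    f hp fun g => h g g.integrable (g.memLp 2 volume)

lemma continuous_fourier_Lp :
    Continuous (fun F : Lp Z 2 (volume : Measure ℝ) => FT Z F) :=
  (Lp.fourierTransformₗᵢ ℝ Z).continuous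

/-- The Fourier transform commutes with complex linear operators. -/
lemma fourier_compLp (L : Z →L[ℂ] Z') (F : Lp Z 2 (volume : Measure ℝ)) :
    FT Z' (L.compLp F) = L.compLp (FT Z F) := by
  revert F
  refine Lp_two_induction ?_ fun f hf1 hf2 => ?_
  · exact isClosed_eq (continuous_fourier_Lp.comp (L.compLpL 2 volume).continuous)
      ((L.compLpL 2 volume).continuous.comp continuous_fourier_Lp)
  · have h1 : MemLp (L ∘ f) 2 := L.comp_memLp' hf2
    have h2 : L.compLp (hf2.toLp f) = h1.toLp (L ∘ f) := by
      refine Lp.ext ?_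
      filter_upwards [L.coeFn_compLp (hf2.toLp f), h1.coeFn_toLp, hf2.coeFn_toLp] with t a b c
      rw [a, b, c, Function.comp_apply]
    rw [h2]
    refine Lp.ext ?_
    filter_upwards [fourier_toLp_ae (L.integrable_comp hf1) h1, fourier_toLp_ae hf1 hf2,
      L.coeFn_compLp (FT Z (hf2.toLp f))] with ξ a b c
    refine Eq.trans (a.trans ?_) c.symm
    rw [b, Real.fourier_eq, Real.fourier_eq, ← L.integral_comp_comm]
    · simp only [Circle.smul_def, map_smul]
    · exact (Real.fourierIntegral_convergent_iff ξ).2 hf1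

/-- The Fourier transform turns a conjugate linear operator into its composition with the
reflection. -/
lemma fourier_compLp_conj (L : Z →SL[starRingEnd ℂ] Z') (F : Lp Z 2 (volume : Measure ℝ)) :
    FT Z' (L.compLp F) = L.compLp (reflect (FT Z F)) := by
  have hc : Continuous fun F : Lp Z 2 (volume : Measure ℝ) => L.compLp F :=
    (LipschitzWith.lipschitzWith_compLp _ _).continuous
  revert F
  refine Lp_two_induction ?_ fun f hf1 hf2 => ?_
  · exact isClosed_eq (continuous_fourier_Lp.comp hc)
      (hc.comp (continuous_reflect.comp continuous_fourier_Lp))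
  · have h1 : MemLp (L ∘ f) 2 := L.comp_memLp' hf2
    have h2 : L.compLp (hf2.toLp f) = h1.toLp (L ∘ f) := by
      refine Lp.ext ?_
      filter_upwards [L.coeFn_compLp (hf2.toLp f), h1.coeFn_toLp, hf2.coeFn_toLp] with t a b c
      rw [a, b, c, Function.comp_apply]
    -- Conjugation fixes the reals, so the operator is real linear and commutes with Bochner
    -- integrals. It conjugates the character, which flips the sign of the frequency.
    let Lr : Z →L[ℝ] Z' :=
      { toFun := L, map_add' := map_add L, cont := L.continuous
        map_smul' := fun c z => by
          change L ((c : ℂ) • z) = (c : ℂ) • L z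
          rw [L.map_smulₛₗ]; simp }
    have h3 : Integrable (L ∘ f) := Lr.integrable_comp hf1
    rw [h2]
    refine Lp.ext ?_
    filter_upwards [fourier_toLp_ae h3 h1,
      (Measure.measurePreserving_neg (volume : Measure ℝ)).quasiMeasurePreserving.ae
        (fourier_toLp_ae hf1 hf2), reflect_ae (FT Z (hf2.toLp f)),
      L.coeFn_compLp (reflect (FT Z (hf2.toLp f)))] with ξ a b c e
    rw [a, e, c, b]
    change _ = Lr _
    rw [Real.fourier_eq, Real.fourier_eq, ← Lr.integral_comp_comm]
    · refine integral_congr_ae (Eventually.of_forall fun t => ?_)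
      change _ = L _
      simp only [Function.comp_apply, Circle.smul_def, L.map_smulₛₗ]
      congr 1
      rw [inner_neg_right, neg_neg, ← Circle.coe_inv_eq_conj, AddChar.map_neg_eq_inv]
    · exact (Real.fourierIntegral_convergent_iff _).2 hf1

lemma fourier_translate (s : ℝ) (F : Lp Z 2 (volume : Measure ℝ)) :
    FT Z (Lp.compMeasurePreserving (fun x => x - s) (measurePreserving_sub_right volume s) F)
      =ᵐ[volume] fun ξ => mode s ξ • (FT Z F) ξ := by
  suffices h : FT Z (Lp.compMeasurePreserving (fun x => x - s)
      (measurePreserving_sub_right volume s) F) = mulL _ (memLp_mode s) (FT Z F) by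
    rw [h]; exact mulL_ae _ _ _
  have hi := (Lp.isometry_compMeasurePreserving (E := Z) (p := 2)
    (measurePreserving_sub_right (volume : Measure ℝ) s)).continuous
  revert F
  refine Lp_two_induction ?_ fun f hf1 hf2 => ?_
  · exact isClosed_eq (continuous_fourier_Lp.comp hi)
      ((mulL _ (memLp_mode s)).continuous.comp continuous_fourier_Lp)
  · rw [Lp.toLp_compMeasurePreserving]
    refine Lp.ext ?_
    filter_upwards [fourier_toLp_ae (hf1.comp_sub_right s)
      (hf2.comp_measurePreserving (measurePreserving_sub_right volume s)), fourier_toLp_ae hf1 hf2,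
      mulL_ae _ (memLp_mode s) (FT Z (hf2.toLp f))] with ξ a b c
    have := congrFun (VectorFourier.fourierIntegral_comp_add_right Real.fourierChar volume
      (innerₗ ℝ) f (-s)) ξ
    rw [c, b]
    refine a.trans (Eq.trans ?_ (this.trans ?_))
    · rfl
    · simp only [innerₗ_apply_apply, inner_neg_left]
      rw [Circle.smul_def, mode]
      congr 3
      simp [mul_comm]

lemma fourier_deriv_ae {f f' : ℝ → Z} (hf : ∀ t, HasDerivAt f (f' t) t) (h1 : Integrable f)
    (h2 : MemLp f 2) (h1' : Integrable f') (h2' : MemLp f' 2) :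
    FT Z (h2'.toLp f') =ᵐ[volume] fun ξ => (2 * Real.pi * Complex.I * ξ : ℂ) • FT Z (h2.toLp f) ξ := by
  have hd : deriv f = f' := funext fun t => (hf t).deriv
  filter_upwards [fourier_toLp_ae h1 h2, fourier_toLp_ae h1' h2'] with ξ a b
  rw [a, b, ← hd, Real.fourier_deriv h1 (fun t => (hf t).differentiableAt) (hd ▸ h1')]

end Fourier

/-! ### The Fourier transform of averages of translates. -/

section FourierAverage

variable {Z : Type*} [NormedAddCommGroup Z] [InnerProductSpace ℂ Z] [CompleteSpace Z]
  [NormedSpace ℝ Z] [IsScalarTower ℝ ℂ Z]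

/-- The transform of a convolution is a product: the bounded operator `FT` passes under the Bochner
integral of translates, and each translate contributes a character. -/
lemma fourier_average {κ : ℝ → ℝ} (hκ : Integrable κ) (F : Lp Z 2 (volume : Measure ℝ)) :
    FT Z (average κ F) =ᵐ[volume] fun ξ => (𝓕 (fun t => (κ t : ℂ)) ξ : ℂ) • (FT Z F) ξ := by
  let L : Lp Z 2 (volume : Measure ℝ) →L[ℝ] Lp Z 2 (volume : Measure ℝ) :=
    ((Lp.fourierTransformₗᵢ ℝ Z).toContinuousLinearEquiv :
      Lp Z 2 (volume : Measure ℝ) →L[ℂ] Lp Z 2 (volume : Measure ℝ)).restrictScalars ℝ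
  have h1 : FT Z (average κ F) = ∫ s, κ s • FT Z (translate s F) := map_average hκ L F
  have hi : Integrable fun s => κ s • FT Z (translate s F) := by
    have := L.integrable_comp (integrable_average hκ F)
    refine this.congr (Eventually.of_forall fun s => ?_)
    simp only [map_smul]
    rfl
  rw [h1]
  refine (integral_Lp_ae_eq (f := fun s ξ => κ s • mode s ξ • (FT Z F) ξ)
    hi ?_ ?_).trans ?_
  · have a : AEStronglyMeasurable (fun p : ℝ × ℝ => κ p.1) (volume.prod volume) :=
      hκ.aestronglyMeasurable.comp_quasiMeasurePreserving Measure.quasiMeasurePreserving_fst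
    have b : AEStronglyMeasurable (fun p : ℝ × ℝ => (FT Z F) p.2)
        ((volume : Measure ℝ).prod volume) :=
      (Lp.aestronglyMeasurable (FT Z F)).comp_quasiMeasurePreserving
        Measure.quasiMeasurePreserving_snd
    have c : AEStronglyMeasurable (fun p : ℝ × ℝ => mode p.1 p.2)
        ((volume : Measure ℝ).prod volume) := continuous_mode.aestronglyMeasurable
    exact a.smul (c.smul b)
  · intro s
    filter_upwards [Lp.coeFn_smul (κ s) (FT Z (translate s F)), fourier_translate s F] with ξ a b
    rw [a, Pi.smul_apply]
    exact congrArg (κ s • ·) b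
  · refine Eventually.of_forall fun ξ => ?_
    have a : ∀ s, κ s • mode s ξ • (FT Z F) ξ =
        (mode s ξ * (κ s : ℂ)) • (FT Z F) ξ := fun s => by
      rw [mul_comm, mul_smul, ← algebraMap_smul ℂ (κ s)]
      rfl
    simp only [a]
    rw [integral_smul_const, Real.fourier_eq]
    congr 1
    refine integral_congr_ae (Eventually.of_forall fun s => ?_)
    change mode s ξ * _ = _ • _
    rw [Circle.smul_def, smul_eq_mul]
    simp only [mode]
    simp [mul_comm]

end FourierAverage

/-! ### The Hilbert space `H¹(Ω)` -/

section H1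

variable {Ω : Set (Sp d)}

/-- The weak gradient as a bounded operator. -/
def H1.grad (Ω : Set (Sp d)) : H1 Ω →L[ℝ] Lp (Sp d) 2 (volume.restrict Ω) :=
  (WithLp.sndL 2 ℝ (L2 Ω) (Lp (Sp d) 2 (volume.restrict Ω))).comp (H1Sub Ω).subtypeL

lemma H1.norm_sq (v : H1 Ω) : ‖v‖ ^ 2 = ‖H1.toL2 Ω v‖ ^ 2 + ‖H1.grad Ω v‖ ^ 2 :=
  WithLp.prod_norm_sq_eq_of_L2 (v : H1Sub Ω).1

lemma H1.isWeakGradient (v : H1 Ω) : IsWeakGradient Ω (H1.toL2 Ω v) (H1.grad Ω v) :=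
  (v : H1Sub Ω).2

/-- For a fixed test function both sides of the weak gradient identity are continuous in the pair,
so the space is an intersection of closed sets. -/
lemma isClosed_H1Sub (Ω : Set (Sp d)) :
    IsClosed (H1Sub Ω : Set (WithLp 2 (L2 Ω × Lp (Sp d) 2 (volume.restrict Ω)))) := by
  have h : (H1Sub Ω : Set (WithLp 2 (L2 Ω × Lp (Sp d) 2 (volume.restrict Ω)))) =
      ⋂ (φ : Sp d → ℝ) (_ : IsTest Ω φ), {p | ∫ x in Ω, p.fst x • gradient φ x =
        - ∫ x in Ω, φ x • p.snd x} := by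
    ext p
    simp only [mem_iInter]
    rfl
  rw [h]
  refine isClosed_iInter fun φ => isClosed_iInter fun hφ => ?_
  let B : ℝ →L[ℝ] Sp d →L[ℝ] Sp d := ContinuousLinearMap.lsmul ℝ ℝ
  have h1 : ∀ v : L2 Ω, ∫ x in Ω, v x • gradient φ x =
      B.lpPairing (volume.restrict Ω) 2 2 v hφ.memLp_gradient.toLp := fun v => by
    rw [ContinuousLinearMap.lpPairing_eq_integral]
    refine integral_congr_ae ?_
    filter_upwards [hφ.memLp_gradient.coeFn_toLp] with x hx
    rw [hx]; rfl
  have h2 : ∀ g : Lp (Sp d) 2 (volume.restrict Ω), ∫ x in Ω, φ x • g x =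
      B.lpPairing (volume.restrict Ω) 2 2 hφ.memLp.toLp g := fun v => by
    rw [ContinuousLinearMap.lpPairing_eq_integral]
    refine integral_congr_ae ?_
    filter_upwards [hφ.memLp.coeFn_toLp] with x hx
    rw [hx]; rfl
  simp only [h1, h2]
  refine isClosed_eq ?_ ?_
  · exact ((B.lpPairing (volume.restrict Ω) 2 2).flip _).continuous.comp
      (WithLp.fstL 2 ℝ (L2 Ω) (Lp (Sp d) 2 (volume.restrict Ω))).continuous
  · exact ((B.lpPairing (volume.restrict Ω) 2 2 _).continuous.comp
      (WithLp.sndL 2 ℝ (L2 Ω) (Lp (Sp d) 2 (volume.restrict Ω))).continuous).neg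

instance (Ω : Set (Sp d)) : CompleteSpace (H1 Ω) :=
  (isClosed_H1Sub Ω).completeSpace_coe

lemma H1.ext_pair {v w : H1 Ω} (h1 : H1.toL2 Ω v = H1.toL2 Ω w) (h2 : H1.grad Ω v = H1.grad Ω w) :
    v = w := by
  have : ‖v - w‖ ^ 2 = 0 := by
    rw [H1.norm_sq, map_sub, map_sub, h1, h2]; simp
  exact sub_eq_zero.1 (norm_eq_zero.1 (pow_eq_zero_iff two_ne_zero |>.1 this))

/-- Weak gradients are unique. -/
lemma H1.toL2_injective (hΩ : IsOpen Ω) : Function.Injective (H1.toL2 Ω) := by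
  rw [injective_iff_map_eq_zero]
  intro v hv
  refine H1.ext_pair (by simpa using hv) ?_
  rw [map_zero]
  refine Lp.ext (EventuallyEq.trans ?_ (Lp.coeFn_zero _ _ _).symm)
  have hloc : LocallyIntegrableOn (H1.grad Ω v) Ω volume := by
    have := (Lp.memLp (H1.grad Ω v)).locallyIntegrable (by norm_num)
    exact fun x hx => by
      obtain ⟨s, hs, hi⟩ := this x
      refine ⟨s ∩ Ω, inter_mem (nhdsWithin_le_nhds hs) self_mem_nhdsWithin, ?_⟩
      rw [IntegrableOn, Measure.restrict_restrict_of_subset inter_subset_right |>.symm]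
      exact hi.mono_set inter_subset_left
  refine (ae_restrict_iff' hΩ.measurableSet).2 ?_
  refine hΩ.ae_eq_zero_of_integral_contDiff_smul_eq_zero hloc fun φ h1 h2 h3 => ?_
  have h4 := v.isWeakGradient φ ⟨h1, h2, h3⟩
  rw [hv] at h4
  have h5 : ∫ x in Ω, ((0 : L2 Ω) : Sp d → ℝ) x • gradient φ x = 0 := by
    rw [← integral_zero (Sp d) (Sp d) (μ := volume.restrict Ω)]
    refine integral_congr_ae ?_
    filter_upwards [Lp.coeFn_zero ℝ 2 (volume.restrict Ω)] with x hx
    rw [hx, Pi.zero_apply, zero_smul]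
  rw [h5, eq_comm, neg_eq_zero] at h4
  rw [← h4, setIntegral_eq_integral_of_forall_compl_eq_zero]
  intro x hx
  rw [image_eq_zero_of_notMem_tsupport (fun h => hx (h3 h)), zero_smul]

end H1

/-! ### Extension and restriction operators -/

section Extension

variable {Y : Type*} [NormedAddCommGroup Y] [NormedSpace ℝ Y]
  {Y' : Type*} [NormedAddCommGroup Y'] [NormedSpace ℝ Y']

/-- Restriction from `ℝ` to `ℝ⁺`. -/
def restr : Lp Y 2 (volume : Measure ℝ) →L[ℝ] Lp Y 2 volPos :=
  LpToLpRestrictCLM ℝ Y ℝ volume 2 (Ioi 0)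

lemma restr_ae (f : Lp Y 2 (volume : Measure ℝ)) : restr f =ᵐ[volPos] f :=
  LpToLpRestrictCLM_coeFn ℝ _ f

lemma zeroExt_ae (u : Lp Y 2 volPos) : zeroExt u =ᵐ[volume] (Ioi (0 : ℝ)).indicator u :=
  (memLp_zeroExt u).coeFn_toLp

lemma restr_zeroExt (u : Lp Y 2 volPos) : restr (zeroExt u) = u := by
  refine Lp.ext ?_
  filter_upwards [restr_ae (zeroExt u), ae_restrict_of_ae (zeroExt_ae u),
    ae_restrict_mem measurableSet_Ioi] with t h1 h2 h3
  rw [h1, h2, indicator_of_mem h3]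

lemma norm_zeroExt (u : Lp Y 2 volPos) : ‖zeroExt u‖ = ‖u‖ := by
  have h1 : ‖zeroExt u‖ = (eLpNorm ((Ioi (0 : ℝ)).indicator u) 2 volume).toReal :=
    Lp.norm_toLp _ (memLp_zeroExt u)
  rw [h1, eLpNorm_indicator_eq_eLpNorm_restrict measurableSet_Ioi, Lp.norm_def]

lemma evenExt_ae (u : Lp Y 2 volPos) :
    evenExt u =ᵐ[volume] fun t => zeroExt u t + zeroExt u (-t) := by
  have h : evenExt u = zeroExt u + Lp.compMeasurePreserving (fun t : ℝ => -t)
    (Measure.measurePreserving_neg volume) (zeroExt u) := rfl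
  rw [h]
  filter_upwards [Lp.coeFn_add (zeroExt u) (Lp.compMeasurePreserving (fun t : ℝ => -t)
    (Measure.measurePreserving_neg volume) (zeroExt u)),
    Lp.coeFn_compMeasurePreserving (zeroExt u) (Measure.measurePreserving_neg volume)] with t a b
  rw [a, Pi.add_apply, b, Function.comp_apply]

lemma ae_neg {p : ℝ → Prop} (h : ∀ᵐ t : ℝ, p t) : ∀ᵐ t : ℝ, p (-t) :=
  (Measure.measurePreserving_neg (volume : Measure ℝ)).quasiMeasurePreserving.ae h

lemma evenExt_ae' (u : Lp Y 2 volPos) :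
    evenExt u =ᵐ[volume] fun t => (Ioi (0 : ℝ)).indicator u t + (Ioi (0 : ℝ)).indicator u (-t) := by
  filter_upwards [evenExt_ae u, zeroExt_ae u, ae_neg (zeroExt_ae u)] with t h1 h2 h3
  rw [h1, h2, h3]

lemma restr_evenExt (u : Lp Y 2 volPos) : restr (evenExt u) = u := by
  refine Lp.ext ?_
  filter_upwards [restr_ae (evenExt u), ae_restrict_of_ae (evenExt_ae' u),
    ae_restrict_mem measurableSet_Ioi] with t h1 h2 h3
  have h3' : (0 : ℝ) < t := h3
  rw [h1, h2, indicator_of_mem h3, indicator_of_notMem (by simp [h3'.le]), add_zero]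

lemma norm_evenExt_le (u : Lp Y 2 volPos) : ‖evenExt u‖ ≤ 2 * ‖u‖ := by
  have h : evenExt u = zeroExt u + Lp.compMeasurePreserving (fun t : ℝ => -t)
    (Measure.measurePreserving_neg volume) (zeroExt u) := rfl
  rw [h]
  refine (norm_add_le _ _).trans ?_
  rw [Lp.norm_compMeasurePreserving, norm_zeroExt, two_mul]

lemma continuous_zeroExt :
    Continuous (zeroExt : Lp Y 2 volPos →ₗ[ℝ] Lp Y 2 (volume : Measure ℝ)) :=
  AddMonoidHomClass.continuous_of_bound _ 1 fun u => by rw [norm_zeroExt, one_mul]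

lemma continuous_evenExt :
    Continuous (evenExt : Lp Y 2 volPos →ₗ[ℝ] Lp Y 2 (volume : Measure ℝ)) :=
  AddMonoidHomClass.continuous_of_bound _ 2 norm_evenExt_le

lemma zeroExt_compLp (L : Y →L[ℝ] Y') (u : Lp Y 2 volPos) :
    zeroExt (L.compLp u) = L.compLp (zeroExt u) := by
  refine Lp.ext ?_
  filter_upwards [zeroExt_ae (L.compLp u), zeroExt_ae u, L.coeFn_compLp (zeroExt u),
    (ae_restrict_iff' measurableSet_Ioi).1 (L.coeFn_compLp u)] with t h1 h2 h3 h4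
  rw [h1, h3, h2]
  by_cases h : t ∈ Ioi (0 : ℝ)
  · rw [indicator_of_mem h, indicator_of_mem h, h4 h]
  · rw [indicator_of_notMem h, indicator_of_notMem h, map_zero]

lemma evenExt_compLp (L : Y →L[ℝ] Y') (u : Lp Y 2 volPos) :
    evenExt (L.compLp u) = L.compLp (evenExt u) := by
  refine Lp.ext ?_
  filter_upwards [evenExt_ae (L.compLp u), evenExt_ae u, L.coeFn_compLp (evenExt u),
    L.coeFn_compLp (zeroExt u), ae_neg (L.coeFn_compLp (zeroExt u))] with t h1 h2 h3 h4 h5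
  rw [h1, h3, h2, zeroExt_compLp, h4, h5, map_add]

lemma restr_compLp (L : Y →L[ℝ] Y') (f : Lp Y 2 (volume : Measure ℝ)) :
    restr (L.compLp f) = L.compLp (restr f) := by
  refine Lp.ext ?_
  filter_upwards [restr_ae (L.compLp f), restr_ae f, ae_restrict_of_ae (L.coeFn_compLp f),
    L.coeFn_compLp (restr f)] with t h1 h2 h3 h4
  rw [h1, h3, h4, h2]

lemma zeroExt_restr {f : Lp Y 2 (volume : Measure ℝ)} (h : ∀ᵐ t : ℝ, t ≤ 0 → f t = 0) :
    zeroExt (restr f) = f := by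
  refine Lp.ext ?_
  filter_upwards [zeroExt_ae (restr f), h,
    (ae_restrict_iff' measurableSet_Ioi).1 (restr_ae f)] with t h1 h2 h3
  rw [h1]
  by_cases h : t ∈ Ioi (0 : ℝ)
  · rw [indicator_of_mem h, h3 h]
  · rw [indicator_of_notMem h, h2 (not_lt.1 h)]

lemma evenExt_restr {f : Lp Y 2 (volume : Measure ℝ)} (h : ∀ᵐ t : ℝ, f (-t) = f t) :
    evenExt (restr f) = f := by
  refine Lp.ext ?_
  have h0 : ∀ᵐ t : ℝ, t ≠ 0 := by simp [ae_iff]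
  filter_upwards [evenExt_ae' (restr f), h, (ae_restrict_iff' measurableSet_Ioi).1 (restr_ae f),
    ae_neg ((ae_restrict_iff' measurableSet_Ioi).1 (restr_ae f)), h0] with t h1 h2 h3 h4 h5
  rw [h1]
  rcases lt_or_gt_of_ne h5 with h | h
  · have h' : -t ∈ Ioi (0 : ℝ) := by simpa using h
    rw [indicator_of_notMem (by simp [h.le]), indicator_of_mem h', h4 h', h2, zero_add]
  · rw [indicator_of_mem (by simpa using h), indicator_of_notMem (by simp [h.le]), h3 h, add_zero]

end Extension

/-! ### Half densities -/

section HalfDensity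

variable {Ω : Set (Sp d)}

/-- The weight `(1 + ξ²)^{1/4}`. -/
def wt (ξ : ℝ) : ℝ := (1 + ξ ^ 2) ^ (1 / 4 : ℝ)

lemma one_le_wt (ξ : ℝ) : 1 ≤ wt ξ :=
  Real.one_le_rpow (by nlinarith [sq_nonneg ξ]) (by norm_num)

lemma wt_pos (ξ : ℝ) : 0 < wt ξ := one_pos.trans_le (one_le_wt ξ)

lemma continuous_wt : Continuous wt :=
  Continuous.rpow_const (by fun_prop) fun ξ => Or.inl (by positivity)

lemma wt_sq (ξ : ℝ) : wt ξ ^ 2 = √(1 + ξ ^ 2) := by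
  have h : (0 : ℝ) ≤ 1 + ξ ^ 2 := by positivity
  rw [wt, ← Real.rpow_natCast, ← Real.rpow_mul h, Real.sqrt_eq_rpow]
  norm_num

lemma wt_sq_le (ξ : ℝ) : wt ξ ^ 2 ≤ 1 + |ξ| := by
  rw [wt_sq]
  refine Real.sqrt_le_iff.2 ⟨by positivity, ?_⟩
  nlinarith [sq_abs ξ, abs_nonneg ξ]

lemma abs_le_wt_sq (ξ : ℝ) : |ξ| ≤ wt ξ ^ 2 := by
  rw [wt_sq]
  exact Real.le_sqrt_of_sq_le (by rw [sq_abs]; linarith)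

lemma memLp_wt_inv : MemLp (fun ξ => (wt ξ)⁻¹) ⊤ (volume : Measure ℝ) := by
  refine memLp_top_of_bound (continuous_wt.inv₀ fun ξ => (wt_pos ξ).ne').aestronglyMeasurable 1
    (Eventually.of_forall fun ξ => ?_)
  rw [Real.norm_of_nonneg (inv_nonneg.2 (wt_pos ξ).le)]
  exact inv_le_one_of_one_le₀ (one_le_wt ξ)

/-- Dividing by the weight turns the relation into an equation between bounded operators, from which
closedness can be read off. -/
lemma isHalfDensity_iff {w : Lp (L2 Ω) 2 (volume : Measure ℝ)}
    {h : Lp (L2C Ω) 2 (volume : Measure ℝ)} :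
    IsHalfDensity Ω w h ↔ mulL (fun ξ => (wt ξ)⁻¹) memLp_wt_inv h = timeFourier Ω w := by
  constructor
  · intro H
    refine Lp.ext ?_
    filter_upwards [mulL_ae _ memLp_wt_inv h, H] with ξ h1 h2
    rw [h1, h2]
    exact inv_smul_smul₀ (wt_pos ξ).ne' _
  · intro H
    have := mulL_ae _ memLp_wt_inv h
    rw [H] at this
    filter_upwards [this] with ξ h1
    rw [h1]
    exact (smul_inv_smul₀ (wt_pos ξ).ne' _).symm

lemma IsHalfDensity.unique {w : Lp (L2 Ω) 2 (volume : Measure ℝ)}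
    {h h' : Lp (L2C Ω) 2 (volume : Measure ℝ)} (H : IsHalfDensity Ω w h)
    (H' : IsHalfDensity Ω w h') : h = h' := by
  refine Lp.ext ?_
  filter_upwards [H, H'] with ξ h1 h2
  rw [h1, h2]

lemma norm_complexify (w : Lp (L2 Ω) 2 (volume : Measure ℝ)) : ‖complexify Ω w‖ = ‖w‖ := by
  have h1 : ∀ v : L2 Ω, ‖Complex.ofRealCLM.compLpL 2 (volume.restrict Ω) v‖ = ‖v‖ := fun v => by
    rw [Lp.norm_def, Lp.norm_def]
    congr 1
    refine eLpNorm_congr_norm_ae ?_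
    filter_upwards [Complex.ofRealCLM.coeFn_compLpL v] with x hx
    rw [hx]; simp
  rw [Lp.norm_def, Lp.norm_def]
  congr 1
  refine eLpNorm_congr_norm_ae ?_
  filter_upwards [(Complex.ofRealCLM.compLpL 2 (volume.restrict Ω)).coeFn_compLpL w] with x hx
  rw [← h1]
  exact congrArg _ hx

lemma timeFourier_eq (w : Lp (L2 Ω) 2 (volume : Measure ℝ)) :
    timeFourier Ω w = FT (L2C Ω) (complexify Ω w) := rfl

lemma norm_timeFourier (w : Lp (L2 Ω) 2 (volume : Measure ℝ)) : ‖timeFourier Ω w‖ = ‖w‖ := by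
  rw [timeFourier_eq, LinearIsometryEquiv.norm_map, norm_complexify]

lemma continuous_timeFourier : Continuous (timeFourier Ω) :=
  AddMonoidHomClass.continuous_of_bound _ 1 fun u => by rw [norm_timeFourier, one_mul]

lemma IsHalfDensity.isClosed (E : Lp (L2 Ω) 2 volPos →ₗ[ℝ] Lp (L2 Ω) 2 (volume : Measure ℝ))
    (hE : Continuous E) :
    IsClosed {p : Ambient Ω | IsHalfDensity Ω (E (embL2 Ω p.fst)) p.snd} := by
  simp only [isHalfDensity_iff]
  refine isClosed_eq ?_ ?_
  · exact (mulL _ memLp_wt_inv).continuous.comp (WithLp.sndL 2 ℝ _ _).continuous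
  · exact continuous_timeFourier.comp (hE.comp ((embL2 Ω).continuous.comp
      (WithLp.fstL 2 ℝ (Lp (H1 Ω) 2 volPos) (Lp (L2C Ω) 2 (volume : Measure ℝ))).continuous))

end HalfDensity

/-! ### The space-time spaces -/

section STSpace

variable {Ω : Set (Sp d)} {E : Lp (L2 Ω) 2 volPos →ₗ[ℝ] Lp (L2 Ω) 2 (volume : Measure ℝ)}
  {V : Submodule ℝ (H1 Ω)}

/-- The map `u ↦ fn u` as a bounded operator. -/
def fnL (Ω : Set (Sp d)) (E : Lp (L2 Ω) 2 volPos →ₗ[ℝ] Lp (L2 Ω) 2 (volume : Measure ℝ))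
    (V : Submodule ℝ (H1 Ω)) : STSpace Ω E V →L[ℝ] Lp (H1 Ω) 2 volPos :=
  (WithLp.fstL 2 ℝ (Lp (H1 Ω) 2 volPos) (Lp (L2C Ω) 2 (volume : Measure ℝ))).comp
    (STSpace Ω E V).subtypeL

/-- The half density of an element of a space-time space. -/
def dens (u : STSpace Ω E V) : Lp (L2C Ω) 2 (volume : Measure ℝ) := (u : Ambient Ω).snd

lemma isHalfDensity_dens (u : STSpace Ω E V) : IsHalfDensity Ω (E (embL2 Ω (fn u))) (dens u) :=
  u.2.2

lemma fn_mem (u : STSpace Ω E V) : ∀ᵐ t ∂volPos, fn u t ∈ V := u.2.1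

lemma STSpace.norm_sq (u : STSpace Ω E V) : ‖u‖ ^ 2 = ‖fn u‖ ^ 2 + ‖dens u‖ ^ 2 :=
  WithLp.prod_norm_sq_eq_of_L2 (u : Ambient Ω)

lemma fn_injective : Function.Injective (fn : STSpace Ω E V → Lp (H1 Ω) 2 volPos) := by
  intro u v h
  have h2 : dens u = dens v := (isHalfDensity_dens u).unique (h ▸ isHalfDensity_dens v)
  have h3 : ‖u - v‖ ^ 2 = 0 := by
    rw [STSpace.norm_sq]
    have a : fn (u - v) = fn u - fn v := rfl
    have b : dens (u - v) = dens u - dens v := rfl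
    rw [a, b, h, h2]; simp
  exact sub_eq_zero.1 (norm_eq_zero.1 (pow_eq_zero_iff two_ne_zero |>.1 h3))

/-- The element of a space-time space with given components. -/
def STSpace.mk (f : Lp (H1 Ω) 2 volPos) (h : Lp (L2C Ω) 2 (volume : Measure ℝ))
    (hf : ∀ᵐ t ∂volPos, f t ∈ V) (hh : IsHalfDensity Ω (E (embL2 Ω f)) h) : STSpace Ω E V :=
  ⟨WithLp.toLp 2 (f, h), hf, hh⟩

/-- A bounded operator into `L²(ℝ⁺, V)` whose values have half densities, with norm bounds, is a
bounded operator into the space-time space. -/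
lemma exists_lift {X : Type*} [NormedAddCommGroup X] [NormedSpace ℝ X]
    (L : X →L[ℝ] Lp (H1 Ω) 2 volPos) (C : ℝ) (hV : ∀ x, ∀ᵐ t ∂volPos, L x t ∈ V)
    (hh : ∀ x, ∃ h, IsHalfDensity Ω (E (embL2 Ω (L x))) h ∧ ‖h‖ ≤ C * ‖x‖) :
    ∃ B : X →L[ℝ] STSpace Ω E V, ∀ x, fn (B x) = L x := by
  choose h hh hC using hh
  -- The half densities are chosen separately for each x; linearity is automatic because `fn` is
  -- injective.
  let B₀ : X →ₗ[ℝ] STSpace Ω E V :=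
    { toFun := fun x => STSpace.mk (L x) (h x) (hV x) (hh x)
      map_add' := fun x y => fn_injective (by
        change L (x + y) = L x + L y
        exact map_add L x y)
      map_smul' := fun c x => fn_injective (by
        change L (c • x) = c • L x
        exact map_smul L c x) }
  refine ⟨B₀.mkContinuous (‖L‖ + C) fun x => ?_, fun x => rfl⟩
  have h1 : ‖B₀ x‖ ^ 2 = ‖L x‖ ^ 2 + ‖h x‖ ^ 2 := STSpace.norm_sq _
  have h2 := L.le_opNorm x
  have h3 := hC x
  have h4 := norm_nonneg (L x)
  have h5 := norm_nonneg (h x)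
  refine abs_le_of_sq_le_sq' ?_ (by nlinarith) |>.2
  rw [h1]
  calc ‖L x‖ ^ 2 + ‖h x‖ ^ 2 ≤ (‖L x‖ + ‖h x‖) ^ 2 := by nlinarith
    _ ≤ _ := by
      refine pow_le_pow_left₀ (by positivity) ?_ 2
      nlinarith

/-- Expresses pointwise membership as a fixed point equation of a bounded operator, which is a
closed condition and commutes with extension and averaging. -/
lemma ae_mem_iff [V.HasOrthogonalProjection] {f : Lp (H1 Ω) 2 volPos} :
    (∀ᵐ t ∂volPos, f t ∈ V) ↔ V.starProjection.compLpL 2 volPos f = f := by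
  constructor
  · intro h
    refine Lp.ext ?_
    filter_upwards [V.starProjection.coeFn_compLpL f, h] with t h1 h2
    rw [h1, Submodule.starProjection_eq_self_iff.2 h2]
  · intro h
    have h1 := V.starProjection.coeFn_compLpL (p := 2) (μ := volPos) f
    rw [h] at h1
    filter_upwards [h1] with t h2
    rw [h2]
    exact Submodule.starProjection_apply_mem _ _

lemma STSpace.isClosed [V.HasOrthogonalProjection] (hE : Continuous E) :
    IsClosed (STSpace Ω E V : Set (Ambient Ω)) := by
  have h1 : IsClosed {p : Ambient Ω | ∀ᵐ t ∂volPos, p.fst t ∈ V} := by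
    simp only [ae_mem_iff]
    have hc := (WithLp.fstL 2 ℝ (Lp (H1 Ω) 2 volPos)
      (Lp (L2C Ω) 2 (volume : Measure ℝ))).continuous
    exact isClosed_eq ((V.starProjection.compLpL 2 volPos).continuous.comp hc) hc
  exact h1.inter (IsHalfDensity.isClosed E hE)

/-- In a Hilbert space, a bounded sequence in a closed subspace that converges to `x` after the
application of an injective operator has its limit `x` in the subspace. -/
lemma mem_of_bounded_of_tendsto {H K : Type*} [NormedAddCommGroup H] [InnerProductSpace ℝ H]
    [CompleteSpace H] [NormedAddCommGroup K] [InnerProductSpace ℝ K] [CompleteSpace K]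
    (T : H →L[ℝ] K) (hT : Function.Injective T) (M : Submodule ℝ H) (hM : IsClosed (M : Set H))
    {x : H} {y : ℕ → H} {C : ℝ} (hy : ∀ n, y n ∈ M) (hC : ∀ n, ‖y n‖ ≤ C)
    (hlim : Tendsto (fun n => T (y n)) atTop (𝓝 (T x))) : x ∈ M := by
  have : CompleteSpace M := hM.completeSpace_coe
  rw [← Submodule.orthogonal_orthogonal M, Submodule.mem_orthogonal]
  intro q hq
  have hker : (T : H →ₗ[ℝ] K).ker = ⊥ := LinearMap.ker_eq_bot.2 hT
  -- An injective T has an adjoint with dense range. Approximating q ⊥ M by T*k replaces ⟪q, x - y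
  -- n⟫ by ⟪k, T (x - y n)⟫, which tends to zero; the error is controlled by the bound on y n.
  have hq' : q ∈ closure (range (ContinuousLinearMap.adjoint T)) := by
    have h1 := ContinuousLinearMap.orthogonal_ker T
    have h2 : (T.ker)ᗮ = ⊤ := by
      have : T.ker = ⊥ := hker
      rw [this]; exact Submodule.bot_orthogonal_eq_top
    rw [h2] at h1
    have h3 : q ∈ (ContinuousLinearMap.adjoint T).range.topologicalClosure := h1 ▸ trivial
    exact h3
  have hC0 : 0 ≤ C := (norm_nonneg _).trans (hC 0)
  refine norm_le_zero_iff.1 (le_of_forall_pos_le_add fun ε hε => ?_)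
  obtain ⟨_, ⟨k, rfl⟩, hk⟩ := Metric.mem_closure_iff.1 hq' (ε / (2 * (C + ‖x‖ + 1))) (by positivity)
  have hlim2 : Tendsto (fun n => ⟪k, T (x - y n)⟫) atTop (𝓝 0) := by
    have : Tendsto (fun n => T (x - y n)) atTop (𝓝 0) := by
      have := (tendsto_const_nhds (x := T x)).sub hlim
      simpa [map_sub] using this
    have h2 := (tendsto_const_nhds (x := k)).inner this (𝕜 := ℝ)
    rwa [inner_zero_right] at h2
  obtain ⟨n, hn⟩ := ((Metric.tendsto_nhds.1 hlim2) (ε / 2) (by positivity)).exists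
  rw [dist_zero_right] at hn
  have hqn : ⟪q, y n⟫ = 0 := (Submodule.mem_orthogonal' M q).1 hq _ (hy n)
  have e1 : ⟪q, x⟫ = ⟪q - ContinuousLinearMap.adjoint T k, x - y n⟫ + ⟪k, T (x - y n)⟫ := by
    rw [inner_sub_left, ContinuousLinearMap.adjoint_inner_left, inner_sub_right q, hqn]
    ring
  rw [e1, zero_add]
  have e2 : ‖⟪q - ContinuousLinearMap.adjoint T k, x - y n⟫‖ ≤ ε / 2 := by
    refine (norm_inner_le_norm _ _).trans ?_
    rw [dist_eq_norm] at hk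
    have h1 : ‖x - y n‖ ≤ C + ‖x‖ + 1 := (norm_sub_le _ _).trans (by linarith [hC n])
    calc _ ≤ ε / (2 * (C + ‖x‖ + 1)) * (C + ‖x‖ + 1) :=
          mul_le_mul hk.le h1 (norm_nonneg _) (by positivity)
      _ = ε / 2 := by field_simp
  exact (norm_add_le _ _).trans (by linarith)

/-- This is the form in which density is proved below: convergence is needed in L²(ℝ⁺, H¹) only, and
half densities merely have to stay bounded. -/
lemma STSpace.mem_of_bounded [V.HasOrthogonalProjection] (hE : Continuous E)
    (M : Submodule ℝ (STSpace Ω E V)) {u : STSpace Ω E V} {y : ℕ → STSpace Ω E V} {C : ℝ}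
    (hM : IsClosed (M : Set (STSpace Ω E V)))
    (hy : ∀ n, y n ∈ M) (hC : ∀ n, ‖y n‖ ≤ C)
    (hlim : Tendsto (fun n => fn (y n)) atTop (𝓝 (fn u))) : u ∈ M := by
  have : CompleteSpace (STSpace Ω E V) := (STSpace.isClosed hE).completeSpace_coe
  exact mem_of_bounded_of_tendsto (fnL Ω E V) fn_injective M hM hy hC hlim

lemma Represents.unique (hΩ : IsOpen Ω) {u v : STSpace Ω E V} {φ : ℝ → Sp d → ℝ}
    (hu : Represents u φ) (hv : Represents v φ) : u = v := by
  refine fn_injective (Lp.ext ?_)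
  filter_upwards [hu, hv] with t h1 h2
  exact H1.toL2_injective hΩ (Lp.ext (h1.trans h2.symm))

end STSpace

/-! ### Norms and inner products in `L²` -/

section L2

variable {X : Type*} [MeasurableSpace X] {μ : Measure X}

lemma Lp_integrable_sq {E : Type*} [NormedAddCommGroup E] (f : Lp E 2 μ) :
    Integrable (fun x => ‖f x‖ ^ 2) μ :=
  (Lp.memLp f).norm.integrable_sq

lemma Lp_norm_sq {E : Type*} [NormedAddCommGroup E] (f : Lp E 2 μ) :
    ‖f‖ ^ 2 = ∫ x, ‖f x‖ ^ 2 ∂μ := by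
  have h := (Lp.memLp f).eLpNorm_eq_integral_rpow_norm (by norm_num) (by norm_num)
  have h0 : 0 ≤ ∫ x, ‖f x‖ ^ 2 ∂μ := integral_nonneg fun _ => by positivity
  rw [Lp.norm_def, h, ENNReal.toReal_ofReal (by positivity)]
  simp only [ENNReal.toReal_ofNat, Real.rpow_two]
  rw [← Real.rpow_natCast, ← Real.rpow_mul h0]
  norm_num

lemma real_inner_eq_re {E : Type*} [NormedAddCommGroup E] [InnerProductSpace ℂ E]
    [InnerProductSpace ℝ E] (x y : E) : ⟪x, y⟫ = (inner ℂ x y).re := by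
  have h1 := norm_add_sq_real x y
  have h2 := norm_add_sq (𝕜 := ℂ) x y
  simp only [RCLike.re_to_complex] at h2
  linarith

end L2

/-! ### Differentiable functions of time -/

section C1

variable {Y : Type*} [NormedAddCommGroup Y] [NormedSpace ℝ Y]

/-- `f` is continuously differentiable with compact support and derivative `f'`. -/
structure IsC1c (f f' : ℝ → Y) : Prop where
  hasDerivAt : ∀ t, HasDerivAt f (f' t) t
  continuous' : Continuous f'
  hasCompactSupport : HasCompactSupport f

variable {f f' : ℝ → Y}

lemma IsC1c.continuous (h : IsC1c f f') : Continuous f :=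
  continuous_iff_continuousAt.2 fun t => (h.hasDerivAt t).continuousAt

lemma IsC1c.hasCompactSupport' (h : IsC1c f f') : HasCompactSupport f' := by
  have : deriv f = f' := funext fun t => (h.hasDerivAt t).deriv
  exact this ▸ h.hasCompactSupport.deriv

lemma IsC1c.memLp (h : IsC1c f f') : MemLp f 2 (volume : Measure ℝ) :=
  h.continuous.memLp_of_hasCompactSupport h.hasCompactSupport

lemma IsC1c.memLp' (h : IsC1c f f') : MemLp f' 2 (volume : Measure ℝ) :=
  h.continuous'.memLp_of_hasCompactSupport h.hasCompactSupport'

/-- The class of `f` in `L²(ℝ, Y)`. -/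
def IsC1c.toLp (h : IsC1c f f') : Lp Y 2 (volume : Measure ℝ) := h.memLp.toLp f

/-- The class of the derivative of `f` in `L²(ℝ, Y)`. -/
def IsC1c.derivLp (h : IsC1c f f') : Lp Y 2 (volume : Measure ℝ) := h.memLp'.toLp f'

lemma IsC1c.comp {Y' : Type*} [NormedAddCommGroup Y'] [NormedSpace ℝ Y'] (h : IsC1c f f')
    (L : Y →L[ℝ] Y') : IsC1c (fun t => L (f t)) (fun t => L (f' t)) where
  hasDerivAt t := L.hasFDerivAt.comp_hasDerivAt t (h.hasDerivAt t)
  continuous' := L.continuous.comp h.continuous'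
  hasCompactSupport := h.hasCompactSupport.comp_left (map_zero L)

lemma compLp_toLp {X : Type*} [MeasurableSpace X] {μ : Measure X} {Y' : Type*}
    [NormedAddCommGroup Y'] [NormedSpace ℝ Y'] (L : Y →L[ℝ] Y') {f : X → Y} (h1 : MemLp f 2 μ)
    (h2 : MemLp (fun t => L (f t)) 2 μ) : L.compLp (h1.toLp f) = h2.toLp _ := by
  refine Lp.ext ?_
  filter_upwards [L.coeFn_compLp (h1.toLp f), h1.coeFn_toLp, h2.coeFn_toLp] with t a b c
  rw [a, b, c]

variable {Ω : Set (Sp d)} {f f' : ℝ → L2 Ω}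

/-- The embedding `L²(Ω) → L²(Ω; ℂ)`. -/
abbrev ofRealL2 (Ω : Set (Sp d)) : L2 Ω →L[ℝ] L2C Ω :=
  Complex.ofRealCLM.compLpL 2 (volume.restrict Ω)

lemma IsC1c.complexify_eq (h : IsC1c f f') :
    complexify Ω h.toLp = (h.comp (ofRealL2 Ω)).memLp.toLp _ :=
  compLp_toLp (ofRealL2 Ω) h.memLp _

lemma IsC1c.complexify_deriv_eq (h : IsC1c f f') :
    complexify Ω h.derivLp = (h.comp (ofRealL2 Ω)).memLp'.toLp _ :=
  compLp_toLp (ofRealL2 Ω) h.memLp' _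

lemma IsC1c.timeFourier_deriv (h : IsC1c f f') :
    timeFourier Ω h.derivLp =ᵐ[volume]
      fun ξ => (2 * Real.pi * Complex.I * ξ : ℂ) • timeFourier Ω h.toLp ξ := by
  have hc := h.comp (ofRealL2 Ω)
  have := fourier_deriv_ae (Z := L2C Ω) hc.hasDerivAt
    (hc.continuous.integrable_of_hasCompactSupport hc.hasCompactSupport) hc.memLp
    (hc.continuous'.integrable_of_hasCompactSupport hc.hasCompactSupport') hc.memLp'
  rw [timeFourier_eq, timeFourier_eq, h.complexify_eq, h.complexify_deriv_eq]
  exact this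

/-- Differentiable functions of time have half densities. -/
lemma IsC1c.exists_isHalfDensity (h : IsC1c f f') :
    ∃ k, IsHalfDensity Ω h.toLp k ∧ ∀ r : ℝ, 0 < r →
      ‖k‖ ^ 2 ≤ (1 + r / 2) * ‖h.toLp‖ ^ 2 + ‖h.derivLp‖ ^ 2 / (2 * r) := by
  have hd := h.timeFourier_deriv
  -- The derivative has the symbol 2πiξ; the factor 2π ≥ 1 is discarded.
  have hb : ∀ᵐ ξ : ℝ, |ξ| * ‖timeFourier Ω h.toLp ξ‖ ≤ ‖timeFourier Ω h.derivLp ξ‖ := by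
    filter_upwards [hd] with ξ hξ
    rw [hξ, norm_smul]
    refine mul_le_mul_of_nonneg_right ?_ (norm_nonneg _)
    simp only [norm_mul, Complex.norm_ofNat, Complex.norm_real, Real.norm_eq_abs, Complex.norm_I,
      mul_one, abs_of_pos Real.pi_pos]
    nlinarith [Real.pi_gt_three, abs_nonneg ξ]
  have hm : MemLp (fun ξ => wt ξ • timeFourier Ω h.toLp ξ) 2 volume := by
    refine ((Lp.memLp (timeFourier Ω h.toLp)).norm.add
      (Lp.memLp (timeFourier Ω h.derivLp)).norm).of_le
      (continuous_wt.aestronglyMeasurable.smul (Lp.aestronglyMeasurable _)) ?_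
    filter_upwards [hb] with ξ hξ
    rw [norm_smul, Real.norm_of_nonneg (wt_pos ξ).le, Pi.add_apply, Real.norm_of_nonneg
      (by positivity)]
    have h1 : wt ξ ≤ 1 + |ξ| := by nlinarith [wt_sq_le ξ, one_le_wt ξ]
    nlinarith [norm_nonneg (timeFourier Ω h.toLp ξ)]
  refine ⟨hm.toLp _, hm.coeFn_toLp, fun r hr => ?_⟩
  rw [← norm_timeFourier h.toLp, ← norm_timeFourier h.derivLp, Lp_norm_sq, Lp_norm_sq, Lp_norm_sq,
    ← integral_const_mul, ← integral_div, ← integral_add ((Lp_integrable_sq _).const_mul _)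
      ((Lp_integrable_sq _).div_const _)]
  refine integral_mono_ae (Lp_integrable_sq _) (((Lp_integrable_sq _).const_mul _).add
    ((Lp_integrable_sq _).div_const _)) ?_
  filter_upwards [hm.coeFn_toLp, hb] with ξ h1 h2
  rw [h1, norm_smul, mul_pow, Real.norm_eq_abs, sq_abs]
  set a := ‖timeFourier Ω h.toLp ξ‖
  have ha : 0 ≤ a := norm_nonneg _
  have h3 : (|ξ| * a) ^ 2 ≤ ‖timeFourier Ω h.derivLp ξ‖ ^ 2 :=
    pow_le_pow_left₀ (by positivity) h2 2
  -- Young's inequality for |ξ|. The parameter r stays free so that it can later balance a function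
  -- against its large derivative.
  have h4 : wt ξ ^ 2 ≤ 1 + r / 2 + |ξ| ^ 2 / (2 * r) := by
    refine (wt_sq_le ξ).trans ?_
    have : |ξ| ≤ r / 2 + |ξ| ^ 2 / (2 * r) := by
      rw [← sub_nonneg]
      have : r / 2 + |ξ| ^ 2 / (2 * r) - |ξ| = (r - |ξ|) ^ 2 / (2 * r) := by field_simp; ring
      rw [this]; positivity
    linarith
  calc wt ξ ^ 2 * a ^ 2 ≤ (1 + r / 2 + |ξ| ^ 2 / (2 * r)) * a ^ 2 :=
        mul_le_mul_of_nonneg_right h4 (by positivity)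
    _ = (1 + r / 2) * a ^ 2 + (|ξ| * a) ^ 2 / (2 * r) := by ring
    _ ≤ _ := by gcongr

/-- The symbol of the time derivative on half densities. -/
def timeSymbol (ξ : ℝ) : ℂ := (2 * Real.pi * ξ / wt ξ ^ 2 : ℝ) * Complex.I

lemma memLp_timeSymbol : MemLp timeSymbol ⊤ (volume : Measure ℝ) := by
  refine memLp_top_of_bound (C := 2 * Real.pi) ?_ (Eventually.of_forall fun ξ => ?_)
  · refine Continuous.aestronglyMeasurable ?_
    unfold timeSymbol
    refine (Complex.continuous_ofReal.comp ?_).mul continuous_const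
    exact Continuous.div (by fun_prop) (continuous_wt.pow 2) fun ξ => (pow_pos (wt_pos ξ) 2).ne'
  · unfold timeSymbol
    rw [norm_mul, Complex.norm_I, mul_one, Complex.norm_real, Real.norm_eq_abs, abs_div, abs_mul,
      abs_mul, abs_of_pos Real.pi_pos, abs_two, abs_of_pos (pow_pos (wt_pos ξ) 2),
      div_le_iff₀ (pow_pos (wt_pos ξ) 2)]
    have := abs_le_wt_sq ξ
    have := Real.pi_pos
    gcongr

/-- The bilinear form `∫ ∂ₜu v` on half densities. -/
def timeForm (Ω : Set (Sp d)) (h k : Lp (L2C Ω) 2 (volume : Measure ℝ)) : ℝ :=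
  ⟪mulL timeSymbol memLp_timeSymbol h, k⟫

lemma inner_complexify (w w' : Lp (L2 Ω) 2 (volume : Measure ℝ)) :
    ⟪complexify Ω w, complexify Ω w'⟫ = ⟪w, w'⟫ :=
  LinearIsometry.inner_map_map
    (⟨(complexify Ω).toLinearMap, norm_complexify⟩ :
      Lp (L2 Ω) 2 (volume : Measure ℝ) →ₗᵢ[ℝ] Lp (L2C Ω) 2 (volume : Measure ℝ)) w w'

lemma inner_timeFourier (w w' : Lp (L2 Ω) 2 (volume : Measure ℝ)) :
    ⟪timeFourier Ω w, timeFourier Ω w'⟫ = ⟪w, w'⟫ := by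
  rw [← inner_complexify, real_inner_eq_re, real_inner_eq_re, timeFourier_eq, timeFourier_eq,
    LinearIsometryEquiv.inner_map_map]

/-- Parseval: each half density carries one weight `wt` and the symbol carries `wt` to the power -2,
so the weights cancel and 2πiξ remains. Only the first function has to be differentiable. -/
lemma IsC1c.timeForm_eq (h : IsC1c f f') {w : Lp (L2 Ω) 2 (volume : Measure ℝ)}
    {k l : Lp (L2C Ω) 2 (volume : Measure ℝ)} (hk : IsHalfDensity Ω h.toLp k)
    (hl : IsHalfDensity Ω w l) : timeForm Ω k l = ⟪h.derivLp, w⟫ := by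
  rw [← inner_timeFourier, timeForm, L2.inner_def, L2.inner_def]
  refine integral_congr_ae ?_
  filter_upwards [mulL_ae timeSymbol memLp_timeSymbol k, hk, hl, h.timeFourier_deriv]
    with ξ h1 h2 h3 h4
  rw [h1, h2, h3, h4]
  set a := timeFourier Ω h.toLp ξ
  have e : timeSymbol ξ • ((1 + ξ ^ 2) ^ (1 / 4 : ℝ) : ℝ) • a =
      (wt ξ)⁻¹ • (2 * Real.pi * Complex.I * ξ : ℂ) • a := by
    change timeSymbol ξ • wt ξ • a = _
    rw [← algebraMap_smul ℂ (wt ξ), ← algebraMap_smul ℂ (wt ξ)⁻¹, smul_smul, smul_smul]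
    congr 1
    have : (wt ξ : ℂ) ≠ 0 := by exact_mod_cast (wt_pos ξ).ne'
    simp only [timeSymbol, Complex.coe_algebraMap]
    push_cast
    field_simp
  rw [e, real_inner_smul_left, real_inner_smul_right, ← mul_assoc]
  change (wt ξ)⁻¹ * wt ξ * _ = _
  rw [inv_mul_cancel₀ (wt_pos ξ).ne', one_mul]

end C1

/-! ### Smooth functions on bounded sets -/

section Smooth

variable {U : Set (Sp d)}

lemma gradient_eq (f : Sp d → ℝ) (x : Sp d) :
    gradient f x = (InnerProductSpace.toDual ℝ (Sp d)).symm (fderiv ℝ f x) := rfl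

lemma inner_gradient (f : Sp d → ℝ) (x e : Sp d) : ⟪gradient f x, e⟫ = fderiv ℝ f x e :=
  InnerProductSpace.toDual_symm_apply

lemma continuous_gradient {f : Sp d → ℝ} (hf : ContDiff ℝ 1 f) : Continuous (gradient f) :=
  (InnerProductSpace.toDual ℝ (Sp d)).symm.continuous.comp (hf.continuous_fderiv (by simp))

lemma gradient_mul {f g : Sp d → ℝ} {x : Sp d} (hf : DifferentiableAt ℝ f x)
    (hg : DifferentiableAt ℝ g x) :
    gradient (fun y => f y * g y) x = f x • gradient g x + g x • gradient f x := by
  simp only [gradient_eq]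
  rw [fderiv_fun_mul hf hg, map_add]
  simp

section Bounded

variable {F : Type*} [NormedAddCommGroup F] [NormedSpace ℝ F]

lemma isFiniteMeasure_restrict (hU : Bornology.IsBounded U) :
    IsFiniteMeasure (volume.restrict U) :=
  ⟨by simpa using hU.measure_lt_top⟩

lemma memLp_of_continuous (hU : Bornology.IsBounded U) (hUm : MeasurableSet U) {f : Sp d → F}
    (hf : Continuous f) (p : ENNReal) : MemLp f p (volume.restrict U) := by
  have := isFiniteMeasure_restrict hU
  obtain ⟨C, hC⟩ := hU.isCompact_closure.exists_bound_of_continuousOn hf.continuousOn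
  exact MemLp.of_bound hf.aestronglyMeasurable C
    ((ae_restrict_mem hUm).mono fun x hx => hC x (subset_closure hx))

variable (hU : Bornology.IsBounded U) (hUm : MeasurableSet U) {g g' : ℝ → Sp d → F}

/-- The time slices of a continuous function as elements of `L²(U)`. -/
def slice (hg : Continuous fun p : ℝ × Sp d => g p.1 p.2) (t : ℝ) :
    Lp F 2 (volume.restrict U) :=
  (memLp_of_continuous hU hUm (hg.comp (Continuous.prodMk_right t)) 2).toLp (g t)

lemma slice_ae (hg : Continuous fun p : ℝ × Sp d => g p.1 p.2) (t : ℝ) :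
    slice hU hUm hg t =ᵐ[volume.restrict U] g t :=
  MemLp.coeFn_toLp _

lemma continuous_slice (hg : Continuous fun p : ℝ × Sp d => g p.1 p.2) :
    Continuous (slice hU hUm hg) := by
  have := isFiniteMeasure_restrict hU
  refine continuous_iff_continuousAt.2 fun t => Metric.tendsto_nhds.2 fun ε hε => ?_
  -- m is the square root of the measure of U, the factor from the supremum norm to the L² norm;
  -- dividing by m + 1 also covers m = 0.
  set m : ℝ := measureUnivNNReal (volume.restrict U) ^ (ENNReal.toReal 2)⁻¹ with hm
  have hm0 : 0 ≤ m := by positivity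
  have h1 : ∀ᶠ s in 𝓝 t, ∀ x ∈ closure U, ‖g s x - g t x‖ < ε / (m + 1) := by
    refine hU.isCompact_closure.eventually_forall_of_forall_eventually fun x _ => ?_
    have hc : Continuous fun p : ℝ × Sp d => ‖g p.1 p.2 - g t p.2‖ :=
      (hg.sub (hg.comp (by fun_prop : Continuous fun p : ℝ × Sp d => (t, p.2)))).norm
    exact hc.continuousAt.eventually_lt continuousAt_const (by simp; positivity)
  filter_upwards [h1] with s hs
  rw [dist_eq_norm]
  have h2 : ‖slice hU hUm hg s - slice hU hUm hg t‖ ≤ m * (ε / (m + 1)) := by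
    refine Lp.norm_le_of_ae_bound (by positivity) ?_
    filter_upwards [Lp.coeFn_sub (slice hU hUm hg s) (slice hU hUm hg t), slice_ae hU hUm hg s,
      slice_ae hU hUm hg t, ae_restrict_mem hUm] with x a b c e
    rw [a, Pi.sub_apply, b, c]
    exact (hs x (subset_closure e)).le
  refine h2.trans_lt ?_
  rw [mul_div_assoc', div_lt_iff₀ (by positivity)]
  nlinarith

lemma hasDerivAt_slice (hg : Continuous fun p : ℝ × Sp d => g p.1 p.2)
    (hg' : Continuous fun p : ℝ × Sp d => g' p.1 p.2)
    (hd : ∀ t x, HasDerivAt (fun s => g s x) (g' t x) t) (t : ℝ) :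
    HasDerivAt (slice hU hUm hg) (slice hU hUm hg' t) t := by
  have := isFiniteMeasure_restrict hU
  rw [hasDerivAt_iff_isLittleO, Asymptotics.isLittleO_iff]
  intro ε hε
  set m : ℝ := measureUnivNNReal (volume.restrict U) ^ (ENNReal.toReal 2)⁻¹ with hm
  have hm0 : 0 ≤ m := by positivity
  have h1 : ∀ᶠ s in 𝓝 t, ∀ x ∈ closure U, ‖g' s x - g' t x‖ < ε / (m + 1) := by
    refine hU.isCompact_closure.eventually_forall_of_forall_eventually fun x _ => ?_
    have hc : Continuous fun p : ℝ × Sp d => ‖g' p.1 p.2 - g' t p.2‖ :=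
      (hg'.sub (hg'.comp (by fun_prop : Continuous fun p : ℝ × Sp d => (t, p.2)))).norm
    exact hc.continuousAt.eventually_lt continuousAt_const (by simp; positivity)
  obtain ⟨r, hr, h2⟩ := Metric.eventually_nhds_iff_ball.1 h1
  filter_upwards [Metric.ball_mem_nhds t hr] with s hs
  have h3 : ‖slice hU hUm hg s - slice hU hUm hg t - (s - t) • slice hU hUm hg' t‖ ≤
      m * (ε / (m + 1) * ‖s - t‖) := by
    refine Lp.norm_le_of_ae_bound (by positivity) ?_
    filter_upwards [Lp.coeFn_sub (slice hU hUm hg s - slice hU hUm hg t)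
      ((s - t) • slice hU hUm hg' t),
      Lp.coeFn_sub (slice hU hUm hg s) (slice hU hUm hg t), slice_ae hU hUm hg s,
      Lp.coeFn_smul (s - t) (slice hU hUm hg' t),
      slice_ae hU hUm hg t, slice_ae hU hUm hg' t, ae_restrict_mem hUm] with x a b c e f k hx
    rw [a, Pi.sub_apply, b, Pi.sub_apply, e, Pi.smul_apply, c, f, k]
    -- The mean value inequality for g τ x - (τ - t) g' t x, whose τ-derivative is small uniformly
    -- for x in the compact closure of U.
    have h4 := (convex_ball t r).norm_image_sub_le_of_norm_hasDerivWithin_le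
      (f := fun τ => g τ x - (τ - t) • g' t x) (f' := fun τ => g' τ x - (1 : ℝ) • g' t x)
      (C := ε / (m + 1)) (x := t) (y := s)
      (fun τ _ => ((hd τ x).sub (((hasDerivAt_id τ).sub_const t).smul_const _)).hasDerivWithinAt)
      (fun τ hτ => by rw [one_smul]; exact (h2 τ hτ x (subset_closure hx)).le)
      (Metric.mem_ball_self hr) hs
    simpa [sub_right_comm] using h4
  refine h3.trans ?_
  rw [← mul_assoc]
  refine mul_le_mul_of_nonneg_right ?_ (norm_nonneg _)
  rw [mul_div_assoc', div_le_iff₀ (by positivity)]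
  nlinarith

end Bounded

/-- Integration by parts against a test function. -/
lemma isWeakGradient_of_contDiff {f : Sp d → ℝ} (hf : ContDiff ℝ 1 f) :
    IsWeakGradient U f (gradient f) := by
  intro φ ⟨h1, h2, h3⟩
  have hφ1 : ContDiff ℝ 1 φ := h1.of_le (by simp)
  have hgφ : HasCompactSupport (gradient φ) :=
    (h2.fderiv (𝕜 := ℝ)).comp_left (g := (InnerProductSpace.toDual ℝ (Sp d)).symm) (map_zero _)
  have e1 : ∫ x in U, f x • gradient φ x = ∫ x, f x • gradient φ x := by
    refine setIntegral_eq_integral_of_forall_compl_eq_zero fun x hx => ?_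
    have : fderiv ℝ φ x = 0 := by
      by_contra h
      exact hx (h3 (support_fderiv_subset ℝ h))
    rw [gradient_eq, this, map_zero, smul_zero]
  have e2 : ∫ x in U, φ x • gradient f x = ∫ x, φ x • gradient f x :=
    setIntegral_eq_integral_of_forall_compl_eq_zero fun x hx => by
      rw [image_eq_zero_of_notMem_tsupport (fun h => hx (h3 h)), zero_smul]
  have i1 : Integrable (fun x => f x • gradient φ x) :=
    (hf.continuous.smul (continuous_gradient hφ1)).integrable_of_hasCompactSupport hgφ.smul_left
  have i2 : Integrable (fun x => φ x • gradient f x) :=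
    (h1.continuous.smul (continuous_gradient hf)).integrable_of_hasCompactSupport h2.smul_right
  have i3 : Integrable (fun x => f x * φ x) :=
    (hf.continuous.mul h1.continuous).integrable_of_hasCompactSupport h2.mul_left
  rw [e1, e2]
  refine ext_inner_right ℝ fun e => ?_
  have hm := integral_mul_fderiv_eq_neg_fderiv_mul_of_integrable (μ := (volume : Measure (Sp d)))
    (f := f) (g := φ) (v := e) ?_ ?_ i3 (fun x _ => hf.differentiable one_ne_zero x)
    (fun x _ => hφ1.differentiable one_ne_zero x)
  · rw [inner_neg_left, ← real_inner_comm (∫ x, f x • gradient φ x), ← real_inner_comm (∫ x, φ x • gradient f x), ← integral_inner i1, ← integral_inner i2]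
    have hi : ∀ (f : Sp d → ℝ) x, ⟪e, gradient f x⟫ = fderiv ℝ f x e := fun f x => by
      rw [real_inner_comm, inner_gradient]
    simp only [inner_smul_right, hi]
    rw [hm]
    congr 1
    refine integral_congr_ae (Eventually.of_forall fun x => ?_)
    simp [mul_comm]
  · have := i2.inner_const (𝕜 := ℝ) e
    refine this.congr (Eventually.of_forall fun x => ?_)
    simp [real_inner_smul_left, mul_comm]
  · have := i1.inner_const (𝕜 := ℝ) e
    refine this.congr (Eventually.of_forall fun x => ?_)
    simp [real_inner_smul_left]

/-- An element of `H¹(U)` from a function and its weak gradient. -/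
def H1.mk (f : Sp d → ℝ) (g : Sp d → Sp d) (hf : MemLp f 2 (volume.restrict U))
    (hg : MemLp g 2 (volume.restrict U)) (h : IsWeakGradient U f g) : H1 U :=
  (⟨WithLp.toLp 2 (hf.toLp f, hg.toLp g), fun φ hφ => by
    have e1 : ∫ x in U, hf.toLp f x • gradient φ x = ∫ x in U, f x • gradient φ x := by
      refine integral_congr_ae ?_
      filter_upwards [hf.coeFn_toLp] with x hx
      rw [hx]
    have e2 : ∫ x in U, φ x • hg.toLp g x = ∫ x in U, φ x • g x := by
      refine integral_congr_ae ?_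
      filter_upwards [hg.coeFn_toLp] with x hx
      rw [hx]
    change ∫ x in U, hf.toLp f x • gradient φ x = - ∫ x in U, φ x • hg.toLp g x
    rw [e1, e2]
    exact h φ hφ⟩ : H1Sub U)

/-- The element of `H¹(U)` given by a smooth function. -/
def H1.ofSmooth (hU : Bornology.IsBounded U) (hUm : MeasurableSet U) (f : Sp d → ℝ)
    (hf : ContDiff ℝ 1 f) : H1 U :=
  H1.mk f (gradient f) (memLp_of_continuous hU hUm hf.continuous 2)
    (memLp_of_continuous hU hUm (continuous_gradient hf) 2) (isWeakGradient_of_contDiff hf)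

section ofSmooth

variable (hU : Bornology.IsBounded U) (hUm : MeasurableSet U) {f : Sp d → ℝ}
    (hf : ContDiff ℝ 1 f)

lemma H1.toL2_ofSmooth_ae : H1.toL2 U (H1.ofSmooth hU hUm f hf) =ᵐ[volume.restrict U] f :=
  (memLp_of_continuous hU hUm hf.continuous 2).coeFn_toLp

lemma H1.grad_ofSmooth_ae :
    H1.grad U (H1.ofSmooth hU hUm f hf) =ᵐ[volume.restrict U] gradient f :=
  (memLp_of_continuous hU hUm (continuous_gradient hf) 2).coeFn_toLp

end ofSmooth

end Smooth

/-! ### Smooth functions of time and space -/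

section SmoothUpTo

variable {φ : ℝ → Sp d → ℝ}

/-- The support projects to a compact subset of (0, ∞), which has a least and a greatest element. If
it is empty the function vanishes and any interval serves. -/
lemma smoothCompact_subset (Ω : Set (Sp d)) : smoothCompact Ω ⊆ smoothUpTo d := by
  rintro φ ⟨h1, h2, h3⟩
  refine ⟨h1, ?_⟩
  set K := Prod.fst '' tsupport (fun p : ℝ × Sp d => φ p.1 p.2) with hK
  have hKc : IsCompact K := h2.isCompact.image continuous_fst
  have hK0 : K ⊆ Ioi 0 := by
    rintro _ ⟨p, hp, rfl⟩; exact (h3 hp).1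
  have hz : ∀ t ∉ K, ∀ x, φ t x = 0 := fun t ht x => by
    by_contra h
    exact ht ⟨(t, x), subset_tsupport _ h, rfl⟩
  rcases K.eq_empty_or_nonempty with h | h
  · exact ⟨1, 1, one_pos, fun t _ => hz t (by simp [h])⟩
  · obtain ⟨a, ha, ha'⟩ := hKc.exists_isLeast h
    obtain ⟨b, hb, hb'⟩ := hKc.exists_isGreatest h
    exact ⟨a, b, hK0 ha, fun t ht => hz t fun hK => ht ⟨ha' hK, hb' hK⟩⟩

/-- The time derivative. -/
def dt (φ : ℝ → Sp d → ℝ) (t : ℝ) (x : Sp d) : ℝ := deriv (fun s => φ s x) t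

section

variable (h : ContDiff ℝ ∞ fun p : ℝ × Sp d => φ p.1 p.2)
include h

lemma contDiff_slice (t : ℝ) : ContDiff ℝ ∞ (φ t) :=
  h.comp (contDiff_const.prodMk contDiff_id)

lemma hasDerivAt_dt (t : ℝ) (x : Sp d) : HasDerivAt (fun s => φ s x) (dt φ t x) t := by
  have : ContDiff ℝ ∞ (fun s => φ s x) := h.comp (contDiff_id.prodMk contDiff_const)
  exact (this.differentiable (by simp) t).hasDerivAt

lemma dt_eq (t : ℝ) (x : Sp d) :
    dt φ t x = fderiv ℝ (fun p : ℝ × Sp d => φ p.1 p.2) (t, x) (1, 0) := by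
  have h1 := (h.differentiable (by simp) (t, x)).hasFDerivAt
  have h2 : HasDerivAt (fun s : ℝ => (s, x)) (1, 0) t :=
    (hasDerivAt_id t).prodMk (hasDerivAt_const t x)
  exact (h1.comp_hasDerivAt t h2).deriv

lemma continuous_dt : Continuous fun p : ℝ × Sp d => dt φ p.1 p.2 := by
  simp only [dt_eq h]
  exact (h.continuous_fderiv (by simp)).clm_apply continuous_const

lemma continuous_grad_slice : Continuous fun p : ℝ × Sp d => gradient (φ p.1) p.2 := by
  have h1 : ∀ p : ℝ × Sp d, fderiv ℝ (φ p.1) p.2 =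
      (fderiv ℝ (fun p : ℝ × Sp d => φ p.1 p.2) p).comp (ContinuousLinearMap.inr ℝ ℝ (Sp d)) := by
    intro p
    have h1 := (h.differentiable (by simp) (p.1, p.2)).hasFDerivAt
    exact (h1.comp p.2 (hasFDerivAt_prodMk_right p.1 p.2)).fderiv
  simp only [gradient_eq, h1]
  refine (InnerProductSpace.toDual ℝ (Sp d)).symm.continuous.comp ?_
  exact (h.continuous_fderiv (by simp)).clm_comp continuous_const

end

variable {U : Set (Sp d)} (hU : Bornology.IsBounded U) (hUm : MeasurableSet U)

/-- The time slices of a smooth function as elements of `H¹(U)`. -/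
def H1slice (h : ContDiff ℝ ∞ fun p : ℝ × Sp d => φ p.1 p.2) (t : ℝ) : H1 U :=
  H1.ofSmooth hU hUm (φ t) ((contDiff_slice h t).of_le (by simp))

lemma continuous_H1slice (h : ContDiff ℝ ∞ fun p : ℝ × Sp d => φ p.1 p.2) :
    Continuous (H1slice hU hUm h) := by
  refine continuous_induced_rng.2 ?_
  exact (WithLp.prod_continuous_toLp 2 _ _).comp
    ((continuous_slice hU hUm h.continuous).prodMk (continuous_slice hU hUm (continuous_grad_slice h)))

lemma toL2_H1slice (h : ContDiff ℝ ∞ fun p : ℝ × Sp d => φ p.1 p.2) (t : ℝ) :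
    H1.toL2 U (H1slice hU hUm h t) = slice hU hUm h.continuous t := rfl

lemma grad_H1slice (h : ContDiff ℝ ∞ fun p : ℝ × Sp d => φ p.1 p.2) (t : ℝ) :
    H1.grad U (H1slice hU hUm h t) =
      slice hU hUm (g := fun s => gradient (φ s)) (continuous_grad_slice h) t := rfl

lemma slice_eq_zero {F : Type*} [NormedAddCommGroup F] [NormedSpace ℝ F] {g : ℝ → Sp d → F}
    (hg : Continuous fun p : ℝ × Sp d => g p.1 p.2) {t : ℝ} (ht : ∀ x, g t x = 0) :
    slice hU hUm hg t = 0 := by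
  refine Lp.ext ?_
  filter_upwards [slice_ae hU hUm hg t, Lp.coeFn_zero F 2 (volume.restrict U)] with x a b
  rw [a, b, ht, Pi.zero_apply]

lemma H1slice_eq_zero (h : ContDiff ℝ ∞ fun p : ℝ × Sp d => φ p.1 p.2) {t : ℝ}
    (ht : ∀ x, φ t x = 0) : H1slice hU hUm h t = 0 := by
  refine H1.ext_pair ?_ ?_
  · rw [toL2_H1slice, slice_eq_zero hU hUm _ ht, map_zero]
  · rw [grad_H1slice, map_zero]
    refine slice_eq_zero hU hUm _ fun x => ?_
    have : φ t = fun _ => 0 := funext ht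
    rw [this, gradient_eq]
    simp

/-- The slices of a smooth function, with compact support in time, form a differentiable function
of time. -/
lemma isC1c_slice (h : ContDiff ℝ ∞ fun p : ℝ × Sp d => φ p.1 p.2)
    (hc : ∃ a b : ℝ, ∀ t, t ∉ Icc a b → ∀ x, φ t x = 0) :
    IsC1c (slice hU hUm h.continuous) (slice hU hUm (continuous_dt h)) where
  hasDerivAt := hasDerivAt_slice hU hUm _ _ (hasDerivAt_dt h)
  continuous' := continuous_slice hU hUm _
  hasCompactSupport := by
    obtain ⟨a, b, hab⟩ := hc
    exact HasCompactSupport.intro isCompact_Icc fun t ht => slice_eq_zero hU hUm _ (hab t ht)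

lemma memLp_H1slice (h : ContDiff ℝ ∞ fun p : ℝ × Sp d => φ p.1 p.2)
    (hc : ∃ a b : ℝ, ∀ t, t ∉ Icc a b → ∀ x, φ t x = 0) :
    MemLp (H1slice hU hUm h) 2 (volume : Measure ℝ) := by
  obtain ⟨a, b, hab⟩ := hc
  exact (continuous_H1slice hU hUm h).memLp_of_hasCompactSupport
    (HasCompactSupport.intro isCompact_Icc fun t ht => H1slice_eq_zero hU hUm h (hab t ht))

end SmoothUpTo

/-! ### Smooth elements of the space-time spaces -/

section Elements

variable {U : Set (Sp d)} (hU : Bornology.IsBounded U) (hUm : MeasurableSet U)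
  {φ : ℝ → Sp d → ℝ} (h : ContDiff ℝ ∞ fun p : ℝ × Sp d => φ p.1 p.2)
  (hc : ∃ a b : ℝ, ∀ t, t ∉ Icc a b → ∀ x, φ t x = 0)

lemma embL2_restr_H1slice :
    embL2 U (restr ((memLp_H1slice hU hUm h hc).toLp _)) = restr (isC1c_slice hU hUm h hc).toLp := by
  have h1 := restr_compLp (H1.toL2 U) ((memLp_H1slice hU hUm h hc).toLp _)
  refine Eq.trans h1.symm (congrArg _ ?_)
  exact compLp_toLp (H1.toL2 U) (memLp_H1slice hU hUm h hc) (isC1c_slice hU hUm h hc).memLp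

/-- A smooth function, with compact support in time, defines an element of the space-time space
if its time extension is given by `E`. -/
lemma exists_element {E : Lp (L2 U) 2 volPos →ₗ[ℝ] Lp (L2 U) 2 (volume : Measure ℝ)}
    {V : Submodule ℝ (H1 U)} (hV : ∀ t, H1slice hU hUm h t ∈ V)
    (hE : E (restr (isC1c_slice hU hUm h hc).toLp) = (isC1c_slice hU hUm h hc).toLp) :
    ∃ u : STSpace U E V, fn u = restr ((memLp_H1slice hU hUm h hc).toLp _) ∧
      E (embL2 U (fn u)) = (isC1c_slice hU hUm h hc).toLp ∧
      ∀ r : ℝ, 0 < r → ‖dens u‖ ^ 2 ≤ (1 + r / 2) * ‖(isC1c_slice hU hUm h hc).toLp‖ ^ 2 +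
        ‖(isC1c_slice hU hUm h hc).derivLp‖ ^ 2 / (2 * r) := by
  obtain ⟨k, hk, hk'⟩ := (isC1c_slice hU hUm h hc).exists_isHalfDensity
  have e1 : E (embL2 U (restr ((memLp_H1slice hU hUm h hc).toLp _))) =
      (isC1c_slice hU hUm h hc).toLp := by
    rw [embL2_restr_H1slice hU hUm h hc, hE]
  refine ⟨STSpace.mk (restr ((memLp_H1slice hU hUm h hc).toLp _)) k ?_ (e1.symm ▸ hk), rfl, e1,
    hk'⟩
  filter_upwards [restr_ae ((memLp_H1slice hU hUm h hc).toLp _),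
    ae_restrict_of_ae (memLp_H1slice hU hUm h hc).coeFn_toLp] with t a b
  rw [a, b]
  exact hV t

lemma fn_restr_ae {f : Lp (H1 U) 2 volPos}
    (hf : f = restr ((memLp_H1slice hU hUm h hc).toLp _)) :
    ∀ᵐ t ∂volPos, f t = H1slice hU hUm h t := by
  filter_upwards [restr_ae ((memLp_H1slice hU hUm h hc).toLp _),
    ae_restrict_of_ae (memLp_H1slice hU hUm h hc).coeFn_toLp] with t a b
  rw [hf, a, b]

lemma represents_of_fn_eq {E : Lp (L2 U) 2 volPos →ₗ[ℝ] Lp (L2 U) 2 (volume : Measure ℝ)}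
    {V : Submodule ℝ (H1 U)} {u : STSpace U E V}
    (hu : fn u = restr ((memLp_H1slice hU hUm h hc).toLp _)) : Represents u φ := by
  filter_upwards [fn_restr_ae hU hUm h hc hu] with t a
  rw [a]
  exact H1.toL2_ofSmooth_ae hU hUm _

lemma zeroExt_restr_slice (h0 : ∀ t ≤ 0, ∀ x, φ t x = 0) :
    zeroExt (restr (isC1c_slice hU hUm h hc).toLp) = (isC1c_slice hU hUm h hc).toLp := by
  refine zeroExt_restr ?_
  filter_upwards [(isC1c_slice hU hUm h hc).memLp.coeFn_toLp] with t a ht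
  exact a.trans (slice_eq_zero hU hUm _ (h0 t ht))

lemma evenExt_restr_slice (h0 : ∀ t x, φ (-t) x = φ t x) :
    evenExt (restr (isC1c_slice hU hUm h hc).toLp) = (isC1c_slice hU hUm h hc).toLp := by
  refine evenExt_restr ?_
  filter_upwards [(isC1c_slice hU hUm h hc).memLp.coeFn_toLp,
    ae_neg (isC1c_slice hU hUm h hc).memLp.coeFn_toLp] with t a b
  refine b.trans (Eq.trans ?_ a.symm)
  refine Lp.ext ?_
  filter_upwards [slice_ae hU hUm h.continuous t, slice_ae hU hUm h.continuous (-t)] with x a b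
  rw [a, b, h0]

end Elements

/-! ### The parabolic bilinear form -/

section Form

variable {U : Set (Sp d)} {α : Sp d → ℝ} (hα : MemLp α ⊤ (volume.restrict U))

/-- The flux `α ∇v` as a bounded operator. -/
def flux : H1 U →L[ℝ] Lp (Sp d) 2 (volume.restrict U) := (mulL α hα).comp (H1.grad U)

/-- The real inner product as a bounded bilinear form. -/
def realInnerL (E : Type*) [NormedAddCommGroup E] [InnerProductSpace ℝ E] : E →L[ℝ] E →L[ℝ] ℝ :=
  (innerₗ E).mkContinuous₂ 1 fun x y => by
    rw [one_mul]; exact norm_inner_le_norm x y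

/-- The bilinear form `∫ ∂ₜu v + α ∇u · ∇v` on the ambient space. -/
def ambientForm : Ambient U →L[ℝ] Ambient U →L[ℝ] ℝ :=
  let P := WithLp.fstL 2 ℝ (Lp (H1 U) 2 volPos) (Lp (L2C U) 2 (volume : Measure ℝ))
  let Q := WithLp.sndL 2 ℝ (Lp (H1 U) 2 volPos) (Lp (L2C U) 2 (volume : Measure ℝ))
  (realInnerL (Lp (L2C U) 2 (volume : Measure ℝ))).bilinearComp
      (((mulL timeSymbol memLp_timeSymbol).restrictScalars ℝ).comp Q) Q +
    (realInnerL (Lp (Lp (Sp d) 2 (volume.restrict U)) 2 volPos)).bilinearComp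
      (((flux hα).compLpL 2 volPos).comp P) (((H1.grad U).compLpL 2 volPos).comp P)

/-- The parabolic operator on the space-time spaces. -/
def parabolicForm (V : Submodule ℝ (H1 U)) : Trial U V →L[ℝ] Test U V →L[ℝ] ℝ :=
  (ambientForm hα).bilinearComp (Trial U V).subtypeL (Test U V).subtypeL

lemma parabolicForm_apply {V : Submodule ℝ (H1 U)} (u : Trial U V) (v : Test U V) :
    parabolicForm hα V u v = timeForm U (dens u) (dens v) +
      ⟪(flux hα).compLpL 2 volPos (fn u), (H1.grad U).compLpL 2 volPos (fn v)⟫ := rfl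

lemma inner_slice {F : Type*} [NormedAddCommGroup F] [InnerProductSpace ℝ F]
    (hU : Bornology.IsBounded U) (hUm : MeasurableSet U) {g k : ℝ → Sp d → F}
    (hg : Continuous fun p : ℝ × Sp d => g p.1 p.2)
    (hk : Continuous fun p : ℝ × Sp d => k p.1 p.2) (t : ℝ) :
    ⟪slice hU hUm hg t, slice hU hUm hk t⟫ = ∫ x in U, ⟪g t x, k t x⟫ := by
  rw [L2.inner_def]
  refine integral_congr_ae ?_
  filter_upwards [slice_ae hU hUm hg t, slice_ae hU hUm hk t] with x a b
  rw [a, b]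

section SmoothForm

variable (hU : Bornology.IsBounded U) (hUm : MeasurableSet U)
    {φ ψ ψ' : ℝ → Sp d → ℝ}
    (h : ContDiff ℝ ∞ fun p : ℝ × Sp d => φ p.1 p.2)
    (hc : ∃ a b : ℝ, ∀ t, t ∉ Icc a b → ∀ x, φ t x = 0)
    (h0 : ∀ t ≤ 0, ∀ x, φ t x = 0)
    (h' : ContDiff ℝ ∞ fun p : ℝ × Sp d => ψ' p.1 p.2)
    (hc' : ∃ a b : ℝ, ∀ t, t ∉ Icc a b → ∀ x, ψ' t x = 0)

include h h0 in
-- At t = 0 only the left neighbourhood is known, but the derivative exists and is therefore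
-- determined by the one-sided one.
lemma dt_eq_zero {t : ℝ} (ht : t ≤ 0) (x : Sp d) : dt φ t x = 0 := by
  have h1 := hasDerivAt_dt h t x
  have h2 : HasDerivWithinAt (fun s => φ s x) 0 (Iic t) t :=
    (hasDerivWithinAt_const t (Iic t) (0 : ℝ)).congr (fun s hs => h0 s (le_trans hs ht) x)
      (h0 t ht x)
  exact (uniqueDiffOn_Iic t t (mem_Iic.2 le_rfl)).eq_deriv _ h1.hasDerivWithinAt h2

include hc hc' in
lemma integrable_inner_slice :
    Integrable (fun t => ⟪slice hU hUm (continuous_dt h) t, slice hU hUm h'.continuous t⟫)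
      volPos := by
  have := L2.integrable_inner (𝕜 := ℝ) (isC1c_slice hU hUm h hc).derivLp
    (isC1c_slice hU hUm h' hc').toLp
  refine (this.congr ?_).restrict
  filter_upwards [(isC1c_slice hU hUm h hc).memLp'.coeFn_toLp,
    (isC1c_slice hU hUm h' hc').memLp.coeFn_toLp] with t a b
  exact congrArg₂ _ a b

include h0 in
-- The time derivative of the trial function vanishes for t ≤ 0. Hence the pairing over ℝ reduces to
-- ℝ⁺, whatever the extended test function does at negative times.
lemma timeForm_smooth {k l : Lp (L2C U) 2 (volume : Measure ℝ)}
    (hk : IsHalfDensity U (isC1c_slice hU hUm h hc).toLp k)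
    (hl : IsHalfDensity U (isC1c_slice hU hUm h' hc').toLp l) :
    timeForm U k l =
      ∫ t in Ioi (0 : ℝ), ⟪slice hU hUm (continuous_dt h) t, slice hU hUm h'.continuous t⟫ := by
  rw [(isC1c_slice hU hUm h hc).timeForm_eq hk hl, L2.inner_def,
    setIntegral_eq_integral_of_forall_compl_eq_zero]
  · refine integral_congr_ae ?_
    filter_upwards [(isC1c_slice hU hUm h hc).memLp'.coeFn_toLp,
      (isC1c_slice hU hUm h' hc').memLp.coeFn_toLp] with t a b
    exact congrArg₂ _ a b
  · intro t ht
    rw [slice_eq_zero hU hUm _ (dt_eq_zero h h0 (not_lt.1 ht)), inner_zero_left]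

include hα in
lemma inner_flux_H1slice (t : ℝ) :
    ⟪flux hα (H1slice hU hUm h t), H1.grad U (H1slice hU hUm h' t)⟫ =
      ∫ x in U, α x * ⟪gradient (φ t) x, gradient (ψ' t) x⟫ := by
  rw [L2.inner_def]
  refine integral_congr_ae ?_
  filter_upwards [mulL_ae α hα (H1.grad U (H1slice hU hUm h t)),
    H1.grad_ofSmooth_ae hU hUm ((contDiff_slice h t).of_le (by simp)),
    H1.grad_ofSmooth_ae hU hUm ((contDiff_slice h' t).of_le (by simp))] with x a b c
  have c' : H1.grad U (H1slice hU hUm h' t) x = gradient (ψ' t) x := c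
  have b' : H1.grad U (H1slice hU hUm h t) x = gradient (φ t) x := b
  have a' : flux hα (H1slice hU hUm h t) x = α x • H1.grad U (H1slice hU hUm h t) x := a
  rw [c', a', b', real_inner_smul_left]

lemma inner_flux_smooth {f g : Lp (H1 U) 2 volPos}
    (hf : f = restr ((memLp_H1slice hU hUm h hc).toLp _))
    (hg : g = restr ((memLp_H1slice hU hUm h' hc').toLp _)) :
    ∀ᵐ t ∂volPos, ⟪(flux hα).compLpL 2 volPos f t, (H1.grad U).compLpL 2 volPos g t⟫ =
      ∫ x in U, α x * ⟪gradient (φ t) x, gradient (ψ' t) x⟫ := by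
  filter_upwards [(flux hα).coeFn_compLpL f, (H1.grad U).coeFn_compLpL g,
    fn_restr_ae hU hUm h hc hf, fn_restr_ae hU hUm h' hc' hg] with t a b c e
  rw [a, b, c, e]
  exact inner_flux_H1slice hα hU hUm h h' t

include hα h h' in
lemma inner_slice_add (t : ℝ) :
    ⟪slice hU hUm (continuous_dt h) t, slice hU hUm h'.continuous t⟫ +
      ∫ x in U, α x * ⟪gradient (φ t) x, gradient (ψ' t) x⟫ =
    ∫ x in U, (deriv (fun s => φ s x) t * ψ' t x +
      α x * ⟪gradient (φ t) x, gradient (ψ' t) x⟫) := by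
  have := isFiniteMeasure_restrict hU
  rw [inner_slice hU hUm, ← integral_add]
  · refine integral_congr_ae (Eventually.of_forall fun x => ?_)
    simp only [dt]
    rw [real_inner_comm]
    simp
  · refine (memLp_of_continuous hU hUm ?_ 1).integrable le_rfl
    exact ((continuous_dt h).comp (Continuous.prodMk_right t)).inner
      (h'.continuous.comp (Continuous.prodMk_right t))
  · have hc : Continuous fun x => ⟪gradient (φ t) x, gradient (ψ' t) x⟫ :=
      ((continuous_grad_slice h).comp (Continuous.prodMk_right t)).inner
        ((continuous_grad_slice h').comp (Continuous.prodMk_right t))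
    have := (memLp_of_continuous hU hUm hc 1)
    exact memLp_one_iff_integrable.1 (this.mul' hα)

include h0 in
/-- The parabolic form of smooth functions. -/
lemma parabolicForm_smooth {V : Submodule ℝ (H1 U)}
    (hψ : ∀ t, 0 < t → ψ' t = ψ t) {u : Trial U V} {v : Test U V}
    (hu : fn u = restr ((memLp_H1slice hU hUm h hc).toLp _))
    (hu' : zeroExt (embL2 U (fn u)) = (isC1c_slice hU hUm h hc).toLp)
    (hv : fn v = restr ((memLp_H1slice hU hUm h' hc').toLp _))
    (hv' : evenExt (embL2 U (fn v)) = (isC1c_slice hU hUm h' hc').toLp) :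
    parabolicForm hα V u v = smoothForm U α φ ψ := by
  have hk := isHalfDensity_dens u
  have hl := isHalfDensity_dens v
  rw [hu'] at hk
  rw [hv'] at hl
  have i1 := integrable_inner_slice hU hUm h hc h' hc'
  have i2 := L2.integrable_inner (𝕜 := ℝ) ((flux hα).compLpL 2 volPos (fn u))
    ((H1.grad U).compLpL 2 volPos (fn v))
  have e1 := timeForm_smooth hU hUm h hc h0 h' hc' hk hl
  have e2 := L2.inner_def (𝕜 := ℝ) ((flux hα).compLpL 2 volPos (fn u))
    ((H1.grad U).compLpL 2 volPos (fn v))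
  refine (parabolicForm_apply hα u v).trans ((congrArg₂ (· + ·) e1 e2).trans ?_)
  refine (integral_add i1 i2).symm.trans (integral_congr_ae ?_)
  filter_upwards [inner_flux_smooth hα hU hUm h hc h' hc' hu hv, ae_restrict_mem measurableSet_Ioi]
    with t a ht
  refine (congrArg _ a).trans ((inner_slice_add hα hU hUm h h' t).trans ?_)
  rw [hψ t ht]

end SmoothForm

/-- The parabolic form is given by the integral formula on smooth functions. -/
lemma extendsForm_parabolicForm (hU : Bornology.IsBounded U) (hUm : MeasurableSet U)
    {V : Submodule ℝ (H1 U)} {D : Set (ℝ → Sp d → ℝ)} (hD : D ⊆ smoothUpTo d)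
    (hV : ∀ φ ∈ D, ∀ (h : ContDiff ℝ ∞ fun p : ℝ × Sp d => φ p.1 p.2) t,
      H1slice hU hUm h t ∈ V) :
    ExtendsForm U V D α (parabolicForm hα V) := by
  intro φ hφ ψ hψ
  obtain ⟨h, a, b, ha, hab⟩ := hD hφ
  obtain ⟨h', a', b', ha', hab'⟩ := hD hψ
  have hc : ∃ a b : ℝ, ∀ t, t ∉ Icc a b → ∀ x, φ t x = 0 := ⟨a, b, hab⟩
  have h0 : ∀ t ≤ 0, ∀ x, φ t x = 0 := fun t ht => hab t fun h => by linarith [h.1]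
  have h0' : ∀ t ≤ 0, ∀ x, ψ t x = 0 := fun t ht => hab' t fun h => by linarith [h.1]
  obtain ⟨u, hu, hu', -⟩ := exists_element hU hUm h hc (E := zeroExt) (hV φ hφ h)
    (zeroExt_restr_slice hU hUm h hc h0)
  -- Since ψ vanishes for t ≤ 0, this smooth function agrees with ψ on ℝ⁺ and is the even extension
  -- of its restriction.
  let ψ' : ℝ → Sp d → ℝ := fun t x => ψ t x + ψ (-t) x
  have hs : ContDiff ℝ ∞ fun p : ℝ × Sp d => ψ (-p.1) p.2 :=
    h'.comp (contDiff_fst.neg.prodMk contDiff_snd)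
  have h'' : ContDiff ℝ ∞ fun p : ℝ × Sp d => ψ' p.1 p.2 := h'.add hs
  have hψ' : ∀ t, 0 < t → ψ' t = ψ t := fun t ht => by
    ext x; simp only [ψ']; rw [h0' (-t) (by linarith), add_zero]
  have hψn : ∀ t, t ≤ 0 → ψ' t = ψ (-t) := fun t ht => by
    ext x; simp only [ψ']; rw [h0' t ht, zero_add]
  have hc'' : ∃ a b : ℝ, ∀ t, t ∉ Icc a b → ∀ x, ψ' t x = 0 := by
    refine ⟨-b', b', fun t ht x => ?_⟩
    simp only [ψ']
    rw [hab' t, hab' (-t), add_zero]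
    · exact fun h => ht ⟨by linarith [h.1, h.2], by linarith [h.1, h.2]⟩
    · exact fun h => ht ⟨by linarith [h.1, h.2], by linarith [h.1, h.2]⟩
  have hV' : ∀ t, H1slice hU hUm h'' t ∈ V := fun t => by
    rcases le_or_gt t 0 with ht | ht
    · have : H1slice hU hUm h'' t = H1slice hU hUm h' (-t) := by
        unfold H1slice
        congr 1
        exact hψn t ht
      rw [this]
      exact hV ψ hψ h' (-t)
    · have : H1slice hU hUm h'' t = H1slice hU hUm h' t := by
        unfold H1slice
        congr 1
        exact hψ' t ht
      rw [this]
      exact hV ψ hψ h' t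
  obtain ⟨v, hv, hv', -⟩ := exists_element hU hUm h'' hc'' (E := evenExt) hV'
    (evenExt_restr_slice hU hUm h'' hc'' fun t x => by simp only [ψ', neg_neg]; ring)
  refine ⟨u, v, represents_of_fn_eq hU hUm h hc hu, ?_, ?_⟩
  · have := represents_of_fn_eq hU hUm h'' hc'' hv
    filter_upwards [this, ae_restrict_mem measurableSet_Ioi] with t a ht
    rwa [← hψ' t ht]
  · exact parabolicForm_smooth hα hU hUm h hc h0 h'' hc'' hψ' hu hu' hv hv'

lemma H1slice_mem_H10 (hU : Bornology.IsBounded U) (hUm : MeasurableSet U) {φ : ℝ → Sp d → ℝ}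
    (hφ : φ ∈ smoothCompact U) (h : ContDiff ℝ ∞ fun p : ℝ × Sp d => φ p.1 p.2) (t : ℝ) :
    H1slice hU hUm h t ∈ H10 U := by
  refine Submodule.le_topologicalClosure _ (Submodule.subset_span ⟨φ t, ?_, ?_⟩)
  · obtain ⟨h1, h2, h3⟩ := hφ
    have hsub : tsupport (φ t) ⊆ (fun x => (t, x)) ⁻¹' tsupport (fun p : ℝ × Sp d => φ p.1 p.2) :=
      closure_minimal (fun x hx => subset_tsupport _ hx)
        ((isClosed_tsupport _).preimage (Continuous.prodMk_right t))
    refine ⟨contDiff_slice h t, ?_, fun x hx => (h3 (hsub hx)).2⟩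
    refine HasCompactSupport.intro (h2.isCompact.image continuous_snd) fun x hx => ?_
    by_contra hne
    exact hx ⟨(t, x), subset_tsupport _ hne, rfl⟩
  · exact H1.toL2_ofSmooth_ae hU hUm _

end Form

/-! ### Mollification in time -/

section Mollify

variable {Ω : Set (Sp d)} {κ : ℝ → ℝ}

lemma timeFourier_average (hκ : Integrable κ) (w : Lp (L2 Ω) 2 (volume : Measure ℝ)) :
    timeFourier Ω (average κ w) =ᵐ[volume]
      fun ξ => (𝓕 (fun t => (κ t : ℂ)) ξ : ℂ) • timeFourier Ω w ξ := by
  have h1 : complexify Ω (average κ w) = average κ (complexify Ω w) :=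
    compLp_average hκ (ofRealL2 Ω) w
  rw [timeFourier_eq, timeFourier_eq, h1]
  exact fourier_average hκ _

lemma norm_fourier_le (f : ℝ → ℂ) (ξ : ℝ) : ‖𝓕 f ξ‖ ≤ ∫ t, ‖f t‖ :=
  VectorFourier.norm_fourierIntegral_le_integral_norm _ _ _ _ _

/-- The transform of κ is bounded by ∫ |κ|, and 2π|ξ| times it by ∫ |κ'|, while `wt ξ` is at most 1
+ |ξ|. -/
lemma exists_wt_mul_fourier_le (h1 : ContDiff ℝ 1 κ) (h2 : HasCompactSupport κ) :
    ∃ C, ∀ ξ, wt ξ * ‖𝓕 (fun t => (κ t : ℂ)) ξ‖ ≤ C := by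
  have hd : ∀ t, HasDerivAt (fun t => (κ t : ℂ)) ((deriv κ t : ℝ) : ℂ) t := fun t =>
    (h1.differentiable one_ne_zero t).hasDerivAt.ofReal_comp
  have hde : deriv (fun t => (κ t : ℂ)) = fun t => ((deriv κ t : ℝ) : ℂ) :=
    funext fun t => (hd t).deriv
  have i1 : Integrable fun t => (κ t : ℂ) :=
    (h1.continuous.integrable_of_hasCompactSupport h2).ofReal
  have i2 : Integrable fun t => ((deriv κ t : ℝ) : ℂ) :=
    ((h1.continuous_deriv le_rfl).integrable_of_hasCompactSupport h2.deriv).ofReal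
  refine ⟨(∫ t, ‖(κ t : ℂ)‖) + ∫ t, ‖((deriv κ t : ℝ) : ℂ)‖, fun ξ => ?_⟩
  have e1 := congrFun (Real.fourier_deriv i1 (fun t => (hd t).differentiableAt) (hde ▸ i2)) ξ
  rw [hde] at e1
  have b1 := norm_fourier_le (fun t => (κ t : ℂ)) ξ
  have b2 := norm_fourier_le (fun t => ((deriv κ t : ℝ) : ℂ)) ξ
  rw [e1, norm_smul] at b2
  simp only [norm_mul, Complex.norm_ofNat, Complex.norm_real, Real.norm_eq_abs, Complex.norm_I,
      mul_one, abs_of_pos Real.pi_pos] at b1 b2 ⊢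
  have h3 : wt ξ ≤ 1 + |ξ| := by nlinarith [wt_sq_le ξ, one_le_wt ξ]
  have h4 := norm_nonneg (𝓕 (fun t => (κ t : ℂ)) ξ)
  nlinarith [Real.pi_gt_three, mul_nonneg (abs_nonneg ξ) h4, mul_le_mul_of_nonneg_right h3 h4]

/-- Averaging multiplies by the transform of κ, whose decay absorbs the weight. Mollification thus
maps all of L² boundedly into H^{1/2}. -/
lemma exists_isHalfDensity_average (h1 : ContDiff ℝ 1 κ) (h2 : HasCompactSupport κ) :
    ∃ C, 0 ≤ C ∧ ∀ w : Lp (L2 Ω) 2 (volume : Measure ℝ), ∃ k, IsHalfDensity Ω (average κ w) k ∧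
      ‖k‖ ≤ C * ‖w‖ := by
  obtain ⟨C, hC⟩ := exists_wt_mul_fourier_le h1 h2
  have hC0 : 0 ≤ C := (mul_nonneg (wt_pos 0).le (norm_nonneg _)).trans (hC 0)
  refine ⟨C, hC0, fun w => ?_⟩
  have hκ := h1.continuous.integrable_of_hasCompactSupport h2 (μ := volume)
  have hb : ∀ᵐ ξ : ℝ, ‖wt ξ • timeFourier Ω (average κ w) ξ‖ ≤ C * ‖timeFourier Ω w ξ‖ := by
    filter_upwards [timeFourier_average hκ w] with ξ hξ
    rw [hξ, norm_smul, norm_smul, ← mul_assoc, Real.norm_of_nonneg (wt_pos ξ).le]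
    exact mul_le_mul_of_nonneg_right (hC ξ) (norm_nonneg _)
  have hm : MemLp (fun ξ => wt ξ • timeFourier Ω (average κ w) ξ) 2 volume :=
    (Lp.memLp (timeFourier Ω w)).of_le_mul
      (continuous_wt.aestronglyMeasurable.smul (Lp.aestronglyMeasurable _)) hb
  refine ⟨hm.toLp _, hm.coeFn_toLp, ?_⟩
  rw [← norm_timeFourier w]
  refine Lp.norm_le_mul_norm_of_ae_le_mul ?_
  filter_upwards [hm.coeFn_toLp, hb] with ξ a b
  rwa [a]

/-- A probability kernel has a Fourier transform of modulus at most 1. In contrast to the previous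
bound, this one is uniform in the kernel. -/
lemma norm_isHalfDensity_average_le (hκ : Integrable κ) (h0 : ∀ s, 0 ≤ κ s) (h1 : ∫ s, κ s = 1)
    {w : Lp (L2 Ω) 2 (volume : Measure ℝ)} {k k' : Lp (L2C Ω) 2 (volume : Measure ℝ)}
    (hk : IsHalfDensity Ω w k) (hk' : IsHalfDensity Ω (average κ w) k') : ‖k'‖ ≤ ‖k‖ := by
  refine Lp.norm_le_norm_of_ae_le ?_
  filter_upwards [hk, hk', timeFourier_average hκ w] with ξ a b c
  rw [a, b, c, norm_smul, norm_smul, norm_smul]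
  have := norm_fourier_le (fun t => (κ t : ℂ)) ξ
  simp only [Complex.norm_real, Real.norm_of_nonneg (h0 _), h1] at this
  refine mul_le_mul_of_nonneg_left ?_ (norm_nonneg _)
  exact mul_le_of_le_one_left (norm_nonneg _) this

end Mollify

/-! ### A density criterion for the space-time spaces. -/

section Density

variable {U : Set (Sp d)} {E : Lp (L2 U) 2 volPos →ₗ[ℝ] Lp (L2 U) 2 (volume : Measure ℝ)}
  {E₁ : Lp (H1 U) 2 volPos →ₗ[ℝ] Lp (H1 U) 2 (volume : Measure ℝ)}
  {V : Submodule ℝ (H1 U)} [V.HasOrthogonalProjection]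

/-- Mollification as an operator. -/
def averageL {Y : Type*} [NormedAddCommGroup Y] [NormedSpace ℝ Y] {κ : ℝ → ℝ}
    (hκ : Integrable κ) : Lp Y 2 (volume : Measure ℝ) →L[ℝ] Lp Y 2 (volume : Measure ℝ) :=
  LinearMap.mkContinuous
    { toFun := average κ
      map_add' := average_add hκ
      map_smul' := fun c f => average_smul c f } (∫ s, ‖κ s‖) (norm_average_le κ)

/-- A smooth mollifier with values in the space-time space. -/
lemma exists_mollifier (hE : Continuous E) (hE₁ : Continuous E₁)
    (hEE₁ : ∀ f, E (embL2 U f) = (H1.toL2 U).compLp (E₁ f))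
    (hE₁P : ∀ (P : H1 U →L[ℝ] H1 U) f, E₁ (P.compLp f) = P.compLp (E₁ f))
    {κ : ℝ → ℝ} (h1 : ContDiff ℝ 1 κ) (h2 : HasCompactSupport κ)
    (hκE : ∀ f : Lp (L2 U) 2 volPos, E (restr (average κ (E f))) = average κ (E f)) :
    ∃ B : Lp (H1 U) 2 volPos →L[ℝ] STSpace U E V,
      ∀ f, fn (B f) = restr (average κ (E₁ (V.starProjection.compLpL 2 volPos f))) ∧
        E (embL2 U (fn (B f))) = average κ (E (embL2 U (V.starProjection.compLpL 2 volPos f))) := by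
  have hκ := h1.continuous.integrable_of_hasCompactSupport h2 (μ := volume)
  let E₁' : Lp (H1 U) 2 volPos →L[ℝ] Lp (H1 U) 2 (volume : Measure ℝ) := ⟨E₁, hE₁⟩
  let E' : Lp (L2 U) 2 volPos →L[ℝ] Lp (L2 U) 2 (volume : Measure ℝ) := ⟨E, hE⟩
  -- The projection makes the operator defined on all of L²(ℝ⁺, H¹) with values in V: it commutes
  -- with extension, averaging and restriction.
  let L : Lp (H1 U) 2 volPos →L[ℝ] Lp (H1 U) 2 volPos :=
    restr.comp ((averageL hκ).comp (E₁'.comp (V.starProjection.compLpL 2 volPos)))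
  have hL : ∀ f, L f = restr (average κ (E₁ (V.starProjection.compLpL 2 volPos f))) := fun f => rfl
  have hemb : ∀ f, E (embL2 U (L f)) =
      average κ (E (embL2 U (V.starProjection.compLpL 2 volPos f))) := fun f => by
    have e1 : embL2 U (L f) =
        restr (average κ (E (embL2 U (V.starProjection.compLpL 2 volPos f)))) := by
      rw [hEE₁, ← compLp_average hκ, restr_compLp]
      rfl
    rw [e1, hκE]
  obtain ⟨C, hC0, hC⟩ := exists_isHalfDensity_average (Ω := U) h1 h2
  have hB := exists_lift (E := E) (V := V) L (C * (‖E'‖ * (‖embL2 U‖ *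
      ‖(V.starProjection.compLpL 2 volPos : Lp (H1 U) 2 volPos →L[ℝ] Lp (H1 U) 2 volPos)‖))) ?_ ?_
  · obtain ⟨B, hB⟩ := hB
    exact ⟨B, fun f => ⟨(hB f).trans (hL f), by rw [hB, hemb]⟩⟩
  · intro f
    rw [ae_mem_iff]
    have hPP : V.starProjection.compLp (V.starProjection.compLp f) = V.starProjection.compLp f := by
      refine Lp.ext ?_
      filter_upwards [V.starProjection.coeFn_compLp (V.starProjection.compLp f),
        V.starProjection.coeFn_compLp f] with t a b
      rw [a, b]
      exact Submodule.starProjection_eq_self_iff.2 (Submodule.starProjection_apply_mem _ _)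
    change V.starProjection.compLp (restr (average κ (E₁ (V.starProjection.compLp f)))) =
      restr (average κ (E₁ (V.starProjection.compLp f)))
    rw [← restr_compLp, compLp_average hκ, ← hE₁P, hPP]
  · intro f
    obtain ⟨k, hk, hk'⟩ := hC (E (embL2 U (V.starProjection.compLpL 2 volPos f)))
    refine ⟨k, by rw [hemb]; exact hk, hk'.trans ?_⟩
    rw [mul_assoc]
    refine mul_le_mul_of_nonneg_left ?_ hC0
    rw [mul_assoc, mul_assoc]
    refine (E'.le_opNorm _).trans (mul_le_mul_of_nonneg_left ?_ (norm_nonneg _))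
    refine ((embL2 U).le_opNorm _).trans (mul_le_mul_of_nonneg_left ?_ (norm_nonneg _))
    exact (V.starProjection.compLpL 2 volPos).le_opNorm _

/-- Membership in a closed subspace of the range of a bounded operator on `L²` follows from
the case of simple tensors. -/
lemma apply_mem_of_indicator {Y W : Type*} [NormedAddCommGroup Y] [InnerProductSpace ℝ Y]
    [NormedAddCommGroup W] [NormedSpace ℝ W]
    (B : Lp Y 2 volPos →L[ℝ] W) (P : Y →L[ℝ] Y) (M : Submodule ℝ W) (hM : IsClosed (M : Set W))
    (G : Set Y) (hG : ∀ v, P v ∈ closure (Submodule.span ℝ G : Set Y))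
    (h : ∀ s (hs : MeasurableSet s) (_ : Bornology.IsBounded s) (hμ : volPos s ≠ ⊤), ∀ v ∈ G,
      B (indicatorConstLp 2 hs hμ v) ∈ M) (f : Lp Y 2 volPos) : B (P.compLp f) ∈ M := by
  -- For a fixed set s the map v ↦ 1_s v is bounded, so the hypothesis on G passes to its closed
  -- span.
  have h1 : ∀ s (hs : MeasurableSet s) (hb : Bornology.IsBounded s) (hμ : volPos s ≠ ⊤),
      ∀ v ∈ closure (Submodule.span ℝ G : Set Y), B (indicatorConstLp 2 hs hμ v) ∈ M := by
    intro s hs hb hμ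
    let T : Y →L[ℝ] Lp Y 2 volPos := LinearMap.mkContinuous
      { toFun := fun v => indicatorConstLp 2 hs hμ v
        map_add' := fun v w => by
          refine Lp.ext ?_
          filter_upwards [Lp.coeFn_add (indicatorConstLp 2 hs hμ v) (indicatorConstLp 2 hs hμ w),
            indicatorConstLp_coeFn (p := 2) (hs := hs) (hμs := hμ) (c := v),
            indicatorConstLp_coeFn (p := 2) (hs := hs) (hμs := hμ) (c := w),
            indicatorConstLp_coeFn (p := 2) (hs := hs) (hμs := hμ) (c := v + w)] with t a b c e
          rw [a, Pi.add_apply, b, c, e]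
          by_cases ht : t ∈ s <;> simp [ht]
        map_smul' := fun r v => by
          refine Lp.ext ?_
          filter_upwards [Lp.coeFn_smul r (indicatorConstLp 2 hs hμ v),
            indicatorConstLp_coeFn (p := 2) (hs := hs) (hμs := hμ) (c := v),
            indicatorConstLp_coeFn (p := 2) (hs := hs) (hμs := hμ) (c := r • v)] with t a b e
          rw [RingHom.id_apply, a, Pi.smul_apply, b, e]
          by_cases ht : t ∈ s <;> simp [ht] }
      (volPos.real s ^ (1 / ENNReal.toReal 2)) fun v => by
        refine (norm_indicatorConstLp (p := 2) (hs := hs) (hμs := hμ) (c := v)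
          (by norm_num) (by norm_num)).trans_le ?_
        rw [mul_comm]
    have hc : IsClosed ((M.comap (B.comp T).toLinearMap : Submodule ℝ Y) : Set Y) :=
      hM.preimage (B.comp T).continuous
    have hs : Submodule.span ℝ G ≤ M.comap (B.comp T).toLinearMap :=
      Submodule.span_le.2 fun v hv => h s hs hb hμ v hv
    exact fun v hv => closure_minimal hs hc hv
  -- A set of finite measure is approximated in measure by its bounded parts s ∩ [-n, n].
  have h2 : ∀ s (hs : MeasurableSet s) (hμ : volPos s ≠ ⊤),
      ∀ v ∈ closure (Submodule.span ℝ G : Set Y), B (indicatorConstLp 2 hs hμ v) ∈ M := by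
    intro s hs hμ v hv
    have ht : Tendsto (fun n : ℕ => indicatorConstLp 2 (s := s ∩ Icc (-(n : ℝ)) n)
        (hs.inter measurableSet_Icc) (measure_ne_top_of_subset inter_subset_left hμ) v :
          ℕ → Lp Y 2 volPos) atTop (𝓝 (indicatorConstLp 2 hs hμ v)) := by
      refine tendsto_indicatorConstLp_set (s := s) (t := fun n : ℕ => s ∩ Icc (-(n : ℝ)) n)
        (by norm_num) ?_
      have hu : ⋂ n : ℕ, (s \ Icc (-(n : ℝ)) n) = ∅ := by
        ext t
        simp only [mem_iInter, Set.mem_sdiff, mem_empty_iff_false, iff_false, not_forall]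
        obtain ⟨n, hn⟩ := exists_nat_ge |t|
        exact ⟨n, fun h => h.2 (abs_le.1 hn)⟩
      have := tendsto_measure_iInter_atTop (μ := volPos) (s := fun n : ℕ => s \ Icc (-(n : ℝ)) n)
        (fun n => (hs.diff measurableSet_Icc).nullMeasurableSet)
        (fun m n hmn => sdiff_subset_sdiff_right (Icc_subset_Icc
          (by simpa using hmn) (by exact_mod_cast hmn)))
        ⟨0, measure_ne_top_of_subset sdiff_subset hμ⟩
      rw [hu, measure_empty] at this
      refine this.congr fun n => congrArg volPos (Set.ext fun t => ?_)
      simp only [Set.mem_sdiff, mem_symmDiff, mem_inter_iff]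
      tauto
    refine hM.mem_of_tendsto ((B.continuous.tendsto _).comp ht) (Eventually.of_forall fun n => ?_)
    exact h1 _ _ ((Metric.isBounded_Icc _ _).subset inter_subset_right) _ _ hv
  refine Lp.induction (p := 2) (by norm_num) (motive := fun f => B (P.compLp f) ∈ M) ?_ ?_ ?_ f
  · intro c s hs hμ
    have : P.compLp (indicatorConstLp 2 hs hμ.ne c) = indicatorConstLp 2 hs hμ.ne (P c) := by
      refine Lp.ext ?_
      filter_upwards [P.coeFn_compLp (indicatorConstLp 2 hs hμ.ne c),
        indicatorConstLp_coeFn (p := 2) (hs := hs) (hμs := hμ.ne) (c := c),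
        indicatorConstLp_coeFn (p := 2) (hs := hs) (hμs := hμ.ne) (c := P c)] with t a b e
      rw [a, b, e]
      by_cases ht : t ∈ s <;> simp [ht]
    rw [Lp.simpleFunc.coe_indicatorConst, this]
    exact h2 s hs hμ.ne _ (hG c)
  · intro f g hf hg _ h1 h2
    have : B (P.compLp (hf.toLp f + hg.toLp g)) =
        B (P.compLp (hf.toLp f)) + B (P.compLp (hg.toLp g)) := by
      rw [← map_add]; exact congrArg B (map_add (P.compLpL 2 volPos) _ _)
    rw [this]
    exact M.add_mem h1 h2
  · exact hM.preimage (B.comp (P.compLpL 2 volPos)).continuous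

/-- A closed subspace that contains the mollified simple tensors is the whole space. -/
lemma mem_of_mollified_tensors (hE : Continuous E) (hE₁ : Continuous E₁)
    (hEE₁ : ∀ f, E (embL2 U f) = (H1.toL2 U).compLp (E₁ f))
    (hE₁P : ∀ (P : H1 U →L[ℝ] H1 U) f, E₁ (P.compLp f) = P.compLp (E₁ f))
    (hrE₁ : ∀ f, restr (E₁ f) = f)
    (K : Set (ℝ → ℝ)) (hK : ∀ κ ∈ K, ContDiff ℝ 1 κ ∧ HasCompactSupport κ ∧ (∀ s, 0 ≤ κ s) ∧
      ∫ s, κ s = 1)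
    (hKr : ∀ r > 0, ∃ κ ∈ K, ∀ s, κ s ≠ 0 → ‖s‖ ≤ r)
    (hκE : ∀ κ ∈ K, ∀ f : Lp (L2 U) 2 volPos, E (restr (average κ (E f))) = average κ (E f))
    (G : Set (H1 U)) (hGV : (V : Set (H1 U)) ⊆ closure (Submodule.span ℝ G : Set (H1 U)))
    (hG : G ⊆ V)
    (M : Submodule ℝ (STSpace U E V)) (hM : IsClosed (M : Set (STSpace U E V)))
    (h : ∀ κ ∈ K, ∀ s (hs : MeasurableSet s) (_ : Bornology.IsBounded s) (hμ : volPos s ≠ ⊤),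
      ∀ v ∈ G, ∀ p : STSpace U E V,
        fn p = restr (average κ (E₁ (indicatorConstLp 2 hs hμ v))) → p ∈ M)
    (u : STSpace U E V) : u ∈ M := by
  have hPu : V.starProjection.compLp (fn u) = fn u := ae_mem_iff.1 (fn_mem u)
  -- A mollification of u lies in M by reduction to simple tensors, and its half density is no
  -- larger than that of u.
  have key : ∀ κ ∈ K, ∃ y ∈ M, fn y = restr (average κ (E₁ (fn u))) ∧ ‖dens y‖ ≤ ‖dens u‖ := by
    intro κ hκK
    obtain ⟨h1, h2, h3, h4⟩ := hK κ hκK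
    have hκ := h1.continuous.integrable_of_hasCompactSupport h2 (μ := volume)
    obtain ⟨B, hB⟩ := exists_mollifier (V := V) hE hE₁ hEE₁ hE₁P h1 h2 (hκE κ hκK)
    refine ⟨B (V.starProjection.compLp (fn u)), ?_, ?_, ?_⟩
    · refine apply_mem_of_indicator B V.starProjection M hM G
        (fun v => hGV (Submodule.starProjection_apply_mem _ _)) (fun s hs hb hμ v hv => ?_) (fn u)
      refine h κ hκK s hs hb hμ v hv _ ((hB _).1.trans ?_)
      congr 3
      refine ae_mem_iff.1 ?_
      filter_upwards [indicatorConstLp_coeFn (p := 2) (hs := hs) (hμs := hμ) (c := v)] with t a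
      rw [a]
      by_cases ht : t ∈ s
      · simpa [ht] using hG hv
      · simp [ht]
    · have := (hB (V.starProjection.compLp (fn u))).1
      rw [hPu] at this ⊢
      rw [this]
      congr 3
    · have h5 := isHalfDensity_dens (B (V.starProjection.compLp (fn u)))
      have h6 : V.starProjection.compLpL 2 volPos (fn u) = fn u := hPu
      rw [(hB _).2, hPu, h6] at h5
      refine norm_isHalfDensity_average_le hκ h3 h4 (isHalfDensity_dens u) ?_
      rwa [hPu]
  have hseq : ∀ n : ℕ, ∃ y ∈ M, ‖fn y - fn u‖ ≤ 1 / ((n : ℝ) + 1) ∧ ‖dens y‖ ≤ ‖dens u‖ := by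
    intro n
    have hn : (0 : ℝ) < 1 / ((n : ℝ) + 1) := by positivity
    obtain ⟨r, hr, H⟩ := norm_average_sub_le (E₁ (fn u)) hn
    obtain ⟨κ, hκK, hκr⟩ := hKr r hr
    obtain ⟨h1, h2, h3, h4⟩ := hK κ hκK
    obtain ⟨y, hy, hy1, hy2⟩ := key κ hκK
    refine ⟨y, hy, ?_, hy2⟩
    have h5 := H κ (h1.continuous.integrable_of_hasCompactSupport h2) h3 h4 hκr
    have h6 : fn y - fn u = restr (average κ (E₁ (fn u)) - E₁ (fn u)) := by
      rw [map_sub, hrE₁, hy1]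
    rw [h6]
    refine le_trans ?_ h5
    exact norm_Lp_toLp_restrict_le _ _
  choose y hyM hy1 hy2 using hseq
  have hlim : Tendsto (fun n => fn (y n)) atTop (𝓝 (fn u)) := by
    rw [tendsto_iff_norm_sub_tendsto_zero]
    exact squeeze_zero (fun n => norm_nonneg _) hy1 tendsto_one_div_add_atTop_nhds_zero_nat
  -- The mollifications converge in L²(ℝ⁺, H¹) with bounded half densities, which suffices for
  -- membership of the limit.
  refine STSpace.mem_of_bounded hE M (C := ‖fn u‖ + 1 + ‖dens u‖) hM hyM (fun n => ?_) hlim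
  have h1 := STSpace.norm_sq (y n)
  have h2 : ‖fn (y n)‖ ≤ ‖fn u‖ + 1 := by
    have := norm_le_norm_add_norm_sub (fn u) (fn (y n))
    have h3 := hy1 n
    have h4 : 1 / ((n : ℝ) + 1) ≤ 1 := by
      rw [div_le_one (by positivity)]; linarith [(Nat.cast_nonneg n : (0 : ℝ) ≤ n)]
    rw [norm_sub_rev] at this
    linarith
  have h3 := hy2 n
  refine abs_le_of_sq_le_sq' ?_ (by positivity) |>.2
  rw [h1]
  nlinarith [norm_nonneg (fn (y n)), norm_nonneg (dens (y n)), norm_nonneg (fn u)]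

end Density

/-! ### Density of smooth functions of time -/

section Kernels

variable {Y : Type*} [NormedAddCommGroup Y] [NormedSpace ℝ Y] [CompleteSpace Y]

/-- The mollification of the indicator function of `s`. -/
def mollIndicator (κ : ℝ → ℝ) (s : Set ℝ) (t : ℝ) : ℝ := ∫ σ, κ σ * s.indicator 1 (t - σ)

lemma contDiff_mollIndicator {κ : ℝ → ℝ} (h1 : ContDiff ℝ ∞ κ) (h2 : HasCompactSupport κ)
    {s : Set ℝ} (hs : MeasurableSet s) : ContDiff ℝ ∞ (mollIndicator κ s) := by
  have hl : LocallyIntegrable (s.indicator (1 : ℝ → ℝ)) volume :=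
    (locallyIntegrable_const (1 : ℝ)).indicator hs
  exact h2.contDiff_convolution_left (n := ⊤) (ContinuousLinearMap.mul ℝ ℝ) h1 hl

/-- A mollified simple tensor is again a tensor b(t) v with the same spatial factor; this reduces
density in time to scalar functions. -/
lemma average_indicator_ae {κ : ℝ → ℝ} (hκ : Integrable κ) {s : Set ℝ} {v : Y}
    {f : Lp Y 2 (volume : Measure ℝ)} (hf : f =ᵐ[volume] s.indicator fun _ => v) :
    average κ f =ᵐ[volume] fun t => mollIndicator κ s t • v := by
  filter_upwards [average_ae hκ f] with t ht
  rw [ht, mollIndicator, ← integral_smul_const]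
  refine integral_congr_ae ?_
  filter_upwards [(Measure.measurePreserving_sub_left (volume : Measure ℝ) t).quasiMeasurePreserving.ae hf]
    with σ hσ
  rw [hσ]
  by_cases h : t - σ ∈ s <;> simp [h]

lemma mollIndicator_neg {κ : ℝ → ℝ} (hκ : ∀ σ, κ (-σ) = κ σ) {s : Set ℝ}
    (hs : ∀ t, -t ∈ s ↔ t ∈ s) (t : ℝ) : mollIndicator κ s (-t) = mollIndicator κ s t := by
  unfold mollIndicator
  rw [← integral_neg_eq_self (fun σ => κ σ * s.indicator 1 (t - σ))]
  congr 1
  ext σ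
  rw [hκ]
  have : (-t - σ ∈ s) = (t - -σ ∈ s) := by
    rw [← hs]; ring_nf
  by_cases h : t - -σ ∈ s
  · rw [indicator_of_mem h, indicator_of_mem (this ▸ h)]; simp
  · rw [indicator_of_notMem h, indicator_of_notMem (this ▸ h)]

lemma mollIndicator_eq_zero {κ : ℝ → ℝ} {s : Set ℝ} {t : ℝ}
    (h : ∀ σ, κ σ ≠ 0 → t - σ ∉ s) : mollIndicator κ s t = 0 := by
  unfold mollIndicator
  refine integral_eq_zero_of_ae (Eventually.of_forall fun σ => ?_)
  by_cases h1 : κ σ = 0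
  · simp [h1]
  · simp [indicator_of_notMem (h σ h1)]

/-- A kernel supported in positive times only moves mass to later times, so the average still
vanishes for t ≤ 0. -/
lemma zeroExt_average_restr {κ : ℝ → ℝ} (hκ : Integrable κ) (h : ∀ σ ≤ 0, κ σ = 0)
    (f : Lp Y 2 volPos) :
    zeroExt (restr (average κ (zeroExt f))) = average κ (zeroExt f) := by
  refine zeroExt_restr ?_
  filter_upwards [average_ae hκ (zeroExt f)] with t ht h0
  rw [ht]
  refine integral_eq_zero_of_ae ?_
  filter_upwards [(Measure.measurePreserving_sub_left (volume : Measure ℝ) t).quasiMeasurePreserving.ae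
    (zeroExt_ae f)] with σ hσ
  rcases le_or_gt σ 0 with h1 | h1
  · simp [h σ h1]
  · rw [hσ, indicator_of_notMem (by simp; linarith)]; simp

/-- Averaging with an even kernel commutes with the reflection of time, so evenness survives. -/
lemma evenExt_average_restr {κ : ℝ → ℝ} (hκ : Integrable κ) (h : ∀ σ, κ (-σ) = κ σ)
    (f : Lp Y 2 volPos) :
    evenExt (restr (average κ (evenExt f))) = average κ (evenExt f) := by
  refine evenExt_restr ?_
  filter_upwards [average_ae hκ (evenExt f), ae_neg (average_ae hκ (evenExt f))] with t h1 h2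
  rw [h1, h2, ← integral_neg_eq_self (fun σ => κ σ • evenExt f (t - σ))]
  refine integral_congr_ae ?_
  have he : ∀ᵐ t : ℝ, evenExt f (-t) = evenExt f t := by
    filter_upwards [evenExt_ae' f, ae_neg (evenExt_ae' f)] with t a b
    rw [a, b, neg_neg, add_comm]
  filter_upwards [(Measure.measurePreserving_sub_left (volume : Measure ℝ) (-t)).quasiMeasurePreserving.ae he]
    with σ hσ
  rw [h, ← hσ]
  congr 2
  ring

/-- Symmetric and one-sided mollifiers. -/
lemma exists_bump_kernel (c r : ℝ) (hr : 0 < r) : ∃ κ : ℝ → ℝ, ContDiff ℝ ∞ κ ∧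
    HasCompactSupport κ ∧ (∀ s, 0 ≤ κ s) ∧ ∫ s, κ s = 1 ∧ (∀ s, κ s ≠ 0 → |s - c| < r) ∧
    (c = 0 → ∀ s, κ (-s) = κ s) := by
  let φ : ContDiffBump c := ⟨r / 2, r, by positivity, by linarith⟩
  refine ⟨φ.normed volume, φ.contDiff_normed, φ.hasCompactSupport_normed, φ.nonneg_normed,
    φ.integral_normed, fun s hs => ?_, ?_⟩
  · have : s ∈ Function.support (φ.normed volume) := hs
    rw [φ.support_normed_eq] at this
    simpa [Real.dist_eq] using this
  · rintro rfl s
    exact φ.normed_neg s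

end Kernels

/-! ### Smooth functions span dense subspaces of the trial and test spaces. -/

section Density

variable {U : Set (Sp d)} (hU : Bornology.IsBounded U) (hUo : IsOpen U)
  {V : Submodule ℝ (H1 U)} [V.HasOrthogonalProjection]
  (D : Set (ℝ → Sp d → ℝ)) (G : Set (Sp d → ℝ))
  (hD : ∀ g ∈ G, ∀ b : ℝ → ℝ, ContDiff ℝ ∞ b → ∀ a₀ b₀ : ℝ, 0 < a₀ →
    (∀ t, t ∉ Icc a₀ b₀ → b t = 0) → (fun t x => b t * g x) ∈ D)

lemma represents_of_tensor {E : Lp (L2 U) 2 volPos →ₗ[ℝ] Lp (L2 U) 2 (volume : Measure ℝ)}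
    {p : STSpace U E V} {v : H1 U} {g : Sp d → ℝ} (hv : H1.toL2 U v =ᵐ[volume.restrict U] g)
    {b : ℝ → ℝ} (h : ∀ᵐ t ∂volPos, fn p t = b t • v) : Represents p fun t x => b t * g x := by
  filter_upwards [h] with t ht
  rw [ht, map_smul]
  filter_upwards [Lp.coeFn_smul (b t) (H1.toL2 U v), hv] with x h1 h2
  rw [h1, Pi.smul_apply, h2, smul_eq_mul]

/-- The span of the elements of a space-time space that are given by functions in `D`. -/
def smoothSpan (E : Lp (L2 U) 2 volPos →ₗ[ℝ] Lp (L2 U) 2 (volume : Measure ℝ))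
    (V : Submodule ℝ (H1 U)) (D : Set (ℝ → Sp d → ℝ)) : Submodule ℝ (STSpace U E V) :=
  (Submodule.span ℝ {u | ∃ φ ∈ D, Represents u φ}).topologicalClosure

lemma mem_smoothSpan {E : Lp (L2 U) 2 volPos →ₗ[ℝ] Lp (L2 U) 2 (volume : Measure ℝ)}
    {u : STSpace U E V} {φ : ℝ → Sp d → ℝ} (hφ : φ ∈ D) (hu : Represents u φ) :
    u ∈ smoothSpan E V D :=
  Submodule.le_topologicalClosure _ (Submodule.subset_span ⟨φ, hφ, hu⟩)

include hD in
-- Kernels supported in (r, 3r) delay time by at least r. The mollified tensors then vanish for t <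
-- r and belong to the smooth class without any cutoff.
lemma mem_smoothSpan_trial
    (hV : (V : Set (H1 U)) ⊆ closure (Submodule.span ℝ
      {v | v ∈ V ∧ ∃ g ∈ G, H1.toL2 U v =ᵐ[volume.restrict U] g} : Set (H1 U)))
    (u : Trial U V) : u ∈ smoothSpan zeroExt V D := by
  refine mem_of_mollified_tensors (E₁ := zeroExt) continuous_zeroExt continuous_zeroExt
    (fun f => zeroExt_compLp _ _) (fun P f => zeroExt_compLp P f) restr_zeroExt
    {κ | ∃ r, 0 < r ∧ ContDiff ℝ ∞ κ ∧ HasCompactSupport κ ∧ (∀ s, 0 ≤ κ s) ∧ ∫ s, κ s = 1 ∧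
      ∀ s, κ s ≠ 0 → |s - 2 * r| < r} ?_ ?_ ?_ _ hV (fun v hv => hv.1) _
      (Submodule.isClosed_topologicalClosure _) ?_ u
  · rintro κ ⟨r, hr, h1, h2, h3, h4, -⟩
    exact ⟨h1.of_le (by simp), h2, h3, h4⟩
  · intro r hr
    -- Centre 2r/3 and radius r/3 put the support between r/3 and r.
    obtain ⟨κ, h1, h2, h3, h4, h5, -⟩ := exists_bump_kernel (2 * (r / 3)) (r / 3) (by positivity)
    refine ⟨κ, ⟨r / 3, by positivity, h1, h2, h3, h4, h5⟩, fun s hs => ?_⟩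
    have := abs_lt.1 (h5 s hs)
    rw [Real.norm_eq_abs, abs_le]
    constructor <;> linarith [this.1, this.2]
  · rintro κ ⟨r, hr, h1, h2, h3, h4, h5⟩ f
    refine zeroExt_average_restr (h1.continuous.integrable_of_hasCompactSupport h2)
      (fun σ hσ => ?_) f
    by_contra h
    have := abs_lt.1 (h5 σ h)
    linarith [this.1]
  · rintro κ ⟨r, hr, h1, h2, h3, h4, h5⟩ s hs hb hμ v ⟨hvV, g, hg, hvg⟩ p hp
    have hκ := h1.continuous.integrable_of_hasCompactSupport h2 (μ := volume)
    have e1 : zeroExt (indicatorConstLp 2 hs hμ v) =ᵐ[volume]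
        (s ∩ Ioi 0).indicator fun _ => v := by
      filter_upwards [zeroExt_ae (indicatorConstLp 2 hs hμ v), (ae_restrict_iff' measurableSet_Ioi).1
        (indicatorConstLp_coeFn (p := 2) (hs := hs) (hμs := hμ) (c := v))] with t a b
      rw [a]
      by_cases ht : t ∈ Ioi (0 : ℝ)
      · rw [indicator_of_mem ht, b ht]
        by_cases hts : t ∈ s
        · rw [indicator_of_mem hts, indicator_of_mem (show t ∈ s ∩ Ioi 0 from ⟨hts, ht⟩)]
        · rw [indicator_of_notMem hts, indicator_of_notMem fun h => hts h.1]
      · rw [indicator_of_notMem ht, indicator_of_notMem fun h => ht h.2]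
    have e2 := average_indicator_ae hκ e1
    obtain ⟨R, hR⟩ := hb.subset_closedBall (0 : ℝ)
    have hbs := contDiff_mollIndicator h1 h2 (hs.inter (measurableSet_Ioi (a := (0 : ℝ))))
    -- Shifts between r and 3r carry a subset of (0, R] into [r, R + 3r].
    refine mem_smoothSpan D (hD g hg (mollIndicator κ (s ∩ Ioi 0)) hbs r (R + 3 * r) hr ?_) ?_
    · intro t ht
      refine mollIndicator_eq_zero fun σ hσ h => ht ?_
      have h6 := abs_lt.1 (h5 σ hσ)
      have h7 : |t - σ| ≤ R := by simpa using hR h.1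
      have h8 : 0 < t - σ := h.2
      have h9 := abs_le.1 h7
      constructor <;> linarith [h6.1, h6.2, h9.2]
    · refine represents_of_tensor hvg ?_
      rw [hp]
      filter_upwards [restr_ae (average κ (zeroExt (indicatorConstLp 2 hs hμ v))),
        ae_restrict_of_ae e2] with t a b
      rw [a, b]

include hUo in
lemma H1.ofSmooth_eq {v : H1 U} {g : Sp d → ℝ} (hg : ContDiff ℝ 1 g)
    (hv : H1.toL2 U v =ᵐ[volume.restrict U] g) : H1.ofSmooth hU hUo.measurableSet g hg = v :=
  H1.toL2_injective hUo (Lp.ext ((H1.toL2_ofSmooth_ae hU hUo.measurableSet hg).trans hv.symm))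

include hU hUo in
-- Supplies the correction near t = 0 that is subtracted later. The bound is that of
-- `IsC1c.exists_isHalfDensity`, with c and c' estimated by their suprema on an interval of length
-- 2R.
lemma exists_even_tensor {v : H1 U} (hvV : v ∈ V) {g : Sp d → ℝ} (hg : ContDiff ℝ ∞ g)
    (hv : H1.toL2 U v =ᵐ[volume.restrict U] g) {c c' : ℝ → ℝ} (hc : ContDiff ℝ ∞ c)
    (hc' : ∀ t, HasDerivAt c (c' t) t) (hce : ∀ t, c (-t) = c t) {R : ℝ} (hR : 0 ≤ R)
    (hcR : ∀ t, t ∉ Icc (-R) R → c t = 0) {A A' : ℝ} (hA : ∀ t, |c t| ≤ A)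
    (hA' : ∀ t, |c' t| ≤ A') :
    ∃ q : Test U V, (∀ᵐ t ∂volPos, fn q t = c t • v) ∧ ∀ r : ℝ, 0 < r →
      ‖dens q‖ ^ 2 ≤ ((1 + r / 2) * (2 * R * A ^ 2) + 2 * R * A' ^ 2 / (2 * r)) *
        ‖H1.toL2 U v‖ ^ 2 := by
  have hUm := hUo.measurableSet
  have h : ContDiff ℝ ∞ fun p : ℝ × Sp d => c p.1 * g p.2 :=
    (hc.comp contDiff_fst).mul (hg.comp contDiff_snd)
  have hcs : ∃ a b : ℝ, ∀ t, t ∉ Icc a b → ∀ x, c t * g x = 0 :=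
    ⟨-R, R, fun t ht x => by rw [hcR t ht, zero_mul]⟩
  have hcR' : ∀ t, t ∉ Icc (-R) R → c' t = 0 := fun t ht => by
    have : (fun s => c s) =ᶠ[𝓝 t] fun _ => 0 := by
      filter_upwards [isClosed_Icc.isOpen_compl.mem_nhds ht] with s hs using hcR s hs
    exact (hc' t).unique ((hasDerivAt_const t (0 : ℝ)).congr_of_eventuallyEq this)
  have hsl : ∀ t, H1slice hU hUm (φ := fun t x => c t * g x) h t = c t • v := fun t => by
    refine H1.ofSmooth_eq hU hUo _ ?_
    rw [map_smul]
    filter_upwards [Lp.coeFn_smul (c t) (H1.toL2 U v), hv] with x h1 h2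
    rw [h1, Pi.smul_apply, h2, smul_eq_mul]
  have hsl2 : ∀ t, slice hU hUm (g := fun t x => c t * g x) h.continuous t = c t • H1.toL2 U v := fun t => by
    rw [← map_smul, ← hsl]; rfl
  have hsl3 : ∀ t, slice hU hUm (g := dt fun t x => c t * g x) (continuous_dt h) t = c' t • H1.toL2 U v := fun t => by
    have h1 := (isC1c_slice hU hUm h hcs).hasDerivAt t
    have h2 : HasDerivAt (slice hU hUm (g := fun t x => c t * g x) h.continuous) (c' t • H1.toL2 U v) t := by
      rw [show slice hU hUm (g := fun t x => c t * g x) h.continuous = fun t => c t • H1.toL2 U v from funext hsl2]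
      exact (hc' t).smul_const _
    exact h1.unique h2
  have bound : ∀ (f : Lp (L2 U) 2 (volume : Measure ℝ)) (k : ℝ → ℝ) (B : ℝ), (∀ t, |k t| ≤ B) →
      (∀ t, t ∉ Icc (-R) R → k t = 0) → (∀ᵐ t, f t = k t • H1.toL2 U v) →
      ‖f‖ ^ 2 ≤ 2 * R * B ^ 2 * ‖H1.toL2 U v‖ ^ 2 := by
    intro f k B hB hk hf
    rw [Lp_norm_sq]
    have e1 : ∫ t, ‖f t‖ ^ 2 = ∫ t in Icc (-R) R, ‖f t‖ ^ 2 := by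
      rw [← integral_indicator measurableSet_Icc]
      refine integral_congr_ae ?_
      filter_upwards [hf] with t ht
      by_cases h : t ∈ Icc (-R) R
      · rw [indicator_of_mem h]
      · rw [indicator_of_notMem h, ht, hk t h]; simp
    have e2 : ∫ t in Icc (-R) R, ‖f t‖ ^ 2 ≤ ∫ t in Icc (-R) R, B ^ 2 * ‖H1.toL2 U v‖ ^ 2 := by
      refine integral_mono_ae (Lp_integrable_sq f).restrict
        (integrable_const _) (ae_restrict_of_ae ?_)
      filter_upwards [hf] with t ht
      rw [ht, norm_smul, mul_pow]
      have := hB t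
      rw [Real.norm_eq_abs]
      gcongr
    rw [e1]
    refine e2.trans_eq ?_
    rw [setIntegral_const, smul_eq_mul, Measure.real, Real.volume_Icc, ENNReal.toReal_ofReal
      (by linarith)]
    ring
  obtain ⟨q, hq, -, hq'⟩ := exists_element hU hUm h hcs (E := evenExt) (V := V)
    (fun t => by rw [hsl]; exact V.smul_mem _ hvV)
    (evenExt_restr_slice hU hUm h hcs fun t x => by rw [hce])
  refine ⟨q, ?_, fun r hr => (hq' r hr).trans ?_⟩
  · filter_upwards [fn_restr_ae hU hUm h hcs hq] with t ht
    rw [ht, hsl]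
  · have b1 := bound (isC1c_slice hU hUm h hcs).toLp c A hA hcR (by
      filter_upwards [(isC1c_slice hU hUm h hcs).memLp.coeFn_toLp] with t ht
      rw [← hsl2, ← ht]; rfl)
    have b2 := bound (isC1c_slice hU hUm h hcs).derivLp c' A' hA' hcR' (by
      filter_upwards [(isC1c_slice hU hUm h hcs).memLp'.coeFn_toLp] with t ht
      rw [← hsl3, ← ht]; rfl)
    calc _ ≤ (1 + r / 2) * (2 * R * A ^ 2 * ‖H1.toL2 U v‖ ^ 2) +
          2 * R * A' ^ 2 * ‖H1.toL2 U v‖ ^ 2 / (2 * r) := by gcongr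
      _ = _ := by ring

/-- Smooth functions of time may be cut off near `t = 0` in the test space. -/
lemma exists_cutoff {b : ℝ → ℝ} (hb : ContDiff ℝ ∞ b) (hbe : ∀ t, b (-t) = b t)
    {R : ℝ} (hbR : ∀ t, t ∉ Icc (-R) R → b t = 0) :
    ∃ A, ∀ n : ℕ, ∃ c c' β : ℝ → ℝ, ContDiff ℝ ∞ c ∧ (∀ t, HasDerivAt c (c' t) t) ∧
      (∀ t, c (-t) = c t) ∧ (∀ t, t ∉ Icc (-(1 / ((n : ℝ) + 1))) (1 / ((n : ℝ) + 1)) → c t = 0) ∧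
      (∀ t, |c t| ≤ A) ∧ (∀ t, |c' t| ≤ A * ((n : ℝ) + 1)) ∧ ContDiff ℝ ∞ β ∧
      (∃ a₀ b₀, 0 < a₀ ∧ ∀ t, t ∉ Icc a₀ b₀ → β t = 0) ∧ ∀ t, 0 < t → β t = b t - c t := by
  let χ : ContDiffBump (0 : ℝ) := ⟨1 / 2, 1, by norm_num, by norm_num⟩
  have hχ : ContDiff ℝ ∞ χ := χ.contDiff
  have hbc : HasCompactSupport b := HasCompactSupport.intro isCompact_Icc hbR
  obtain ⟨B, hB⟩ := hb.continuous.bounded_above_of_compact_support hbc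
  obtain ⟨B', hB'⟩ := (hb.continuous_deriv (by simp)).bounded_above_of_compact_support hbc.deriv
  obtain ⟨X, hX⟩ := (hχ.continuous_deriv (by simp)).bounded_above_of_compact_support
    χ.hasCompactSupport.deriv
  simp only [Real.norm_eq_abs] at hB hB' hX
  have hB0 : 0 ≤ B := (abs_nonneg _).trans (hB 0)
  have hB0' : 0 ≤ B' := (abs_nonneg _).trans (hB' 0)
  have hX0 : 0 ≤ X := (abs_nonneg _).trans (hX 0)
  have hχ1 : ∀ t, |χ t| ≤ 1 := fun t => by rw [abs_of_nonneg χ.nonneg]; exact χ.le_one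
  refine ⟨B + B' + X * B, fun n => ?_⟩
  have hn : (0 : ℝ) < (n : ℝ) + 1 := by positivity
  have hn1 : (1 : ℝ) ≤ (n : ℝ) + 1 := by linarith [(Nat.cast_nonneg n : (0 : ℝ) ≤ n)]
  set N : ℝ := (n : ℝ) + 1
  have hχz : ∀ t, t ∉ Icc (-(1 / N)) (1 / N) → χ (N * t) = 0 := fun t ht => by
    refine χ.zero_of_le_dist ?_
    rw [Real.dist_eq, sub_zero, abs_mul, abs_of_pos hn]
    change 1 ≤ N * |t|
    by_contra! h
    exact ht (abs_le.1 ((le_div_iff₀ hn).2 (by linarith)))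
  have hχo : ∀ t, |t| ≤ 1 / (2 * N) → χ (N * t) = 1 := fun t ht => by
    refine χ.one_of_mem_closedBall ?_
    rw [mem_closedBall_zero_iff, Real.norm_eq_abs, abs_mul, abs_of_pos hn]
    change N * |t| ≤ 1 / 2
    rw [le_div_iff₀ (by positivity)] at ht
    linarith
  have hcχ : ContDiff ℝ ∞ fun t => χ (N * t) := hχ.comp (contDiff_const.mul contDiff_id)
  -- The correction c is b cut off at scale 1/N, so its derivative grows like N. In β the smooth
  -- transition deletes the mirror image at t < 0; it rises on 0 < t < 1/(2N), where b - c vanishes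
  -- already.
  refine ⟨fun t => χ (N * t) * b t, fun t => N * deriv χ (N * t) * b t + χ (N * t) * deriv b t,
    fun t => Real.smoothTransition (2 * N * t) * ((1 - χ (N * t)) * b t), hcχ.mul hb, fun t => ?_,
    fun t => ?_, fun t ht => ?_, fun t => ?_, fun t => ?_, ?_, ⟨1 / (2 * N), R, by positivity,
    fun t ht => ?_⟩, fun t ht => ?_⟩
  · have h1 : HasDerivAt (fun t => χ (N * t)) (N * deriv χ (N * t)) t := by
      have := ((hχ.differentiable (by simp) (N * t)).hasDerivAt).comp t
        ((hasDerivAt_id t).const_mul N)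
      rw [mul_one, mul_comm] at this
      exact this
    exact h1.mul ((hb.differentiable (by simp) t).hasDerivAt)
  · simp only
    rw [mul_neg, χ.neg, hbe]
  · simp only
    rw [hχz t ht, zero_mul]
  · rw [abs_mul]
    have := mul_le_mul (hχ1 (N * t)) (hB t) (abs_nonneg _) zero_le_one
    nlinarith [mul_nonneg hX0 hB0]
  · refine (abs_add_le _ _).trans ?_
    rw [abs_mul, abs_mul, abs_mul, abs_of_pos hn]
    have h1 := mul_le_mul (hχ1 (N * t)) (hB' t) (abs_nonneg _) zero_le_one
    have h2 := mul_le_mul (hX (N * t)) (hB t) (abs_nonneg _) hX0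
    nlinarith [mul_le_mul_of_nonneg_left hn1 hB0']
  · exact (Real.smoothTransition.contDiff.comp (contDiff_const.mul contDiff_id)).mul
      ((contDiff_const.sub hcχ).mul hb)
  · simp only
    rcases le_or_gt t 0 with h0 | h0
    · rw [Real.smoothTransition.zero_of_nonpos (by nlinarith), zero_mul]
    · rcases lt_or_ge t (1 / (2 * N)) with h1 | h1
      · rw [hχo t (by rw [abs_of_pos h0]; exact h1.le), sub_self, zero_mul, mul_zero]
      · rw [hbR t fun h => ht ⟨h1, h.2⟩, mul_zero, mul_zero]
  · simp only
    rcases lt_or_ge t (1 / (2 * N)) with h1 | h1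
    · rw [hχo t (by rw [abs_of_pos ht]; exact h1.le)]; ring
    · rw [Real.smoothTransition.one_of_one_le]
      · ring
      · rw [div_le_iff₀ (by positivity)] at h1
        linarith

include hU hUo hD in
-- An even b need not vanish at t = 0. Subtracting the corrections of width 1/(n+1) gives functions
-- supported in positive times. The corrections tend to zero in L² and stay bounded in H^{1/2}, the
-- exponent at which no trace at t = 0 exists, so p is in the closed span.
lemma mem_smoothSpan_test_of_even (hG : ∀ g ∈ G, ContDiff ℝ ∞ g) {v : H1 U} (hvV : v ∈ V)
    {g : Sp d → ℝ} (hg : g ∈ G)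
    (hv : H1.toL2 U v =ᵐ[volume.restrict U] g) {b : ℝ → ℝ} (hb : ContDiff ℝ ∞ b)
    (hbe : ∀ t, b (-t) = b t) {R : ℝ} (hbR : ∀ t, t ∉ Icc (-R) R → b t = 0) {p : Test U V}
    (hp : ∀ᵐ t ∂volPos, fn p t = b t • v) : p ∈ smoothSpan evenExt V D := by
  obtain ⟨A, hA⟩ := exists_cutoff hb hbe hbR
  choose c c' β h1 h2 h3 h4 h5 h6 h7 h8 h9 using hA
  have hn : ∀ n : ℕ, (0 : ℝ) < (n : ℝ) + 1 := fun n => by positivity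
  have hn1 : ∀ n : ℕ, (1 : ℝ) ≤ (n : ℝ) + 1 := fun n => by
    linarith [(Nat.cast_nonneg n : (0 : ℝ) ≤ n)]
  have hA0 : 0 ≤ A := (abs_nonneg _).trans (h5 0 0)
  choose q hq hq' using fun n => exists_even_tensor hU hUo hvV (hG g hg) hv (h1 n) (h2 n) (h3 n)
    (by have := hn n; positivity) (h4 n) (h5 n) (h6 n)
  -- The choice r = n + 1 lets the short support, of length 2/(n+1), compensate the derivative bound
  -- A(n+1). The total is at most 4A² times the squared L² norm of v.
  have hqd : ∀ n, ‖dens (q n)‖ ≤ 2 * A * ‖H1.toL2 U v‖ := fun n => by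
    refine abs_le_of_sq_le_sq' ((hq' n _ (hn n)).trans ?_) (by positivity) |>.2
    have e : (2 * A * ‖H1.toL2 U v‖) ^ 2 = (4 * A ^ 2) * ‖H1.toL2 U v‖ ^ 2 := by ring
    rw [e]
    refine mul_le_mul_of_nonneg_right ?_ (by positivity)
    have h10 := hn n
    have h11 := hn1 n
    set N : ℝ := (n : ℝ) + 1
    have e2 : (1 + N / 2) * (2 * (1 / N) * A ^ 2) + 2 * (1 / N) * (A * N) ^ 2 / (2 * N) =
        2 * A ^ 2 + 2 * A ^ 2 * (1 / N) := by field_simp; ring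
    rw [e2]
    have : 1 / N ≤ 1 := by rw [div_le_one h10]; exact h11
    nlinarith [sq_nonneg A]
  have hqf : ∀ n : ℕ, ‖fn (q n)‖ ^ 2 ≤ 1 / ((n : ℝ) + 1) * (A ^ 2 * ‖v‖ ^ 2) := fun n => by
    rw [Lp_norm_sq]
    have hle : (0 : ℝ) ≤ 1 / ((n : ℝ) + 1) := by have := hn n; positivity
    have e1 : ∫ t in Ioi (0 : ℝ), ‖fn (q n) t‖ ^ 2 ≤
        ∫ t in Ioi (0 : ℝ), (Ioc 0 (1 / ((n : ℝ) + 1))).indicator (fun _ => A ^ 2 * ‖v‖ ^ 2) t := by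
      refine integral_mono_ae (Lp_integrable_sq _) ?_ ?_
      · refine (IntegrableOn.integrable_indicator ?_ measurableSet_Ioc).restrict
        exact integrableOn_const (by simp)
      · filter_upwards [hq n, ae_restrict_mem measurableSet_Ioi] with t ht h0
        by_cases h : t ∈ Ioc (0 : ℝ) (1 / ((n : ℝ) + 1))
        · rw [indicator_of_mem h, ht, norm_smul, mul_pow, Real.norm_eq_abs]
          have := h5 n t
          gcongr
        · rw [indicator_of_notMem h, ht, h4 n t fun hh => h ⟨h0, hh.2⟩]
          simp
    refine e1.trans_eq ?_
    rw [setIntegral_indicator measurableSet_Ioc, setIntegral_const, smul_eq_mul,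
      inter_eq_self_of_subset_right Ioc_subset_Ioi_self, Measure.real, Real.volume_Ioc, sub_zero,
      ENNReal.toReal_ofReal hle]
  have hlim : Tendsto (fun n => fn (p - q n)) atTop (𝓝 (fn p)) := by
    have h10 : Tendsto (fun n => fn (q n)) atTop (𝓝 0) := by
      rw [tendsto_zero_iff_norm_tendsto_zero]
      have h11 : Tendsto (fun n => ‖fn (q n)‖ ^ 2) atTop (𝓝 0) := by
        refine squeeze_zero (fun n => by positivity) hqf ?_
        have := (tendsto_one_div_add_atTop_nhds_zero_nat (𝕜 := ℝ)).mul_const (A ^ 2 * ‖v‖ ^ 2)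
        rwa [zero_mul] at this
      have h12 := h11.sqrt
      simpa [Real.sqrt_sq] using h12
    have := (tendsto_const_nhds (x := fn p)).sub h10
    rw [sub_zero] at this
    exact this
  obtain ⟨C, hC⟩ := (Metric.isBounded_range_of_tendsto _ hlim).exists_norm_le
  refine STSpace.mem_of_bounded continuous_evenExt _ (y := fun n => p - q n)
    (C := C + (‖p‖ + 2 * A * ‖H1.toL2 U v‖))
    (Submodule.isClosed_topologicalClosure _) (fun n => ?_) (fun n => ?_) hlim
  · obtain ⟨a₀, b₀, ha₀, hab⟩ := h8 n
    refine mem_smoothSpan D (hD g hg (β n) (h7 n) a₀ b₀ ha₀ hab) (represents_of_tensor hv ?_)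
    filter_upwards [hp, hq n, Lp.coeFn_sub (fn p) (fn (q n)), ae_restrict_mem measurableSet_Ioi]
      with t a b c e
    have : fn (p - q n) = fn p - fn (q n) := rfl
    rw [this, c, Pi.sub_apply, a, b, h9 n t e, sub_smul]
  · have e1 := STSpace.norm_sq (p - q n)
    have e2 : ‖fn (p - q n)‖ ≤ C := hC _ ⟨n, rfl⟩
    have e3 : ‖dens (p - q n)‖ ≤ ‖p‖ + 2 * A * ‖H1.toL2 U v‖ := by
      have e4 : dens (p - q n) = dens p - dens (q n) := rfl
      have e5 : ‖dens p‖ ≤ ‖p‖ := by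
        refine abs_le_of_sq_le_sq' ?_ (norm_nonneg _) |>.2
        rw [STSpace.norm_sq]
        nlinarith [norm_nonneg (fn p)]
      rw [e4]
      exact (norm_sub_le _ _).trans (add_le_add e5 (hqd n))
    have e6 := norm_nonneg (fn (p - q n))
    have e7 := norm_nonneg (dens (p - q n))
    refine abs_le_of_sq_le_sq' ?_ (by linarith) |>.2
    rw [e1]
    nlinarith

include hU hUo hD in
-- Even mollification leaves tensors b(t) v with b smooth and even, to which the cutoff argument
-- applies.
lemma mem_smoothSpan_test (hG : ∀ g ∈ G, ContDiff ℝ ∞ g)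
    (hV : (V : Set (H1 U)) ⊆ closure (Submodule.span ℝ
      {v | v ∈ V ∧ ∃ g ∈ G, H1.toL2 U v =ᵐ[volume.restrict U] g} : Set (H1 U)))
    (u : Test U V) : u ∈ smoothSpan evenExt V D := by
  refine mem_of_mollified_tensors (E₁ := evenExt) continuous_evenExt continuous_evenExt
    (fun f => evenExt_compLp _ _) (fun P f => evenExt_compLp P f) restr_evenExt
    {κ | ∃ r, 0 < r ∧ ContDiff ℝ ∞ κ ∧ HasCompactSupport κ ∧ (∀ s, 0 ≤ κ s) ∧ ∫ s, κ s = 1 ∧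
      (∀ s, κ s ≠ 0 → |s - 0| < r) ∧ ∀ s, κ (-s) = κ s} ?_ ?_ ?_ _ hV (fun v hv => hv.1) _
      (Submodule.isClosed_topologicalClosure _) ?_ u
  · rintro κ ⟨r, hr, h1, h2, h3, h4, -⟩
    exact ⟨h1.of_le (by simp), h2, h3, h4⟩
  · intro r hr
    obtain ⟨κ, h1, h2, h3, h4, h5, h6⟩ := exists_bump_kernel 0 r hr
    refine ⟨κ, ⟨r, hr, h1, h2, h3, h4, h5, h6 rfl⟩, fun s hs => ?_⟩
    simpa using (h5 s hs).le
  · rintro κ ⟨r, hr, h1, h2, h3, h4, h5, h6⟩ f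
    exact evenExt_average_restr (h1.continuous.integrable_of_hasCompactSupport h2) h6 f
  · rintro κ ⟨r, hr, h1, h2, h3, h4, h5, h6⟩ s hs hb hμ v ⟨hvV, g, hg, hvg⟩ p hp
    have hκ := h1.continuous.integrable_of_hasCompactSupport h2 (μ := volume)
    set s' : Set ℝ := {t | t ∈ s ∧ 0 < t ∨ -t ∈ s ∧ 0 < -t} with hs'
    have hs'm : MeasurableSet s' := by
      have h7 := hs.inter (measurableSet_Ioi (a := (0 : ℝ)))
      exact h7.union (measurable_neg h7)
    have e1 : evenExt (indicatorConstLp 2 hs hμ v) =ᵐ[volume] s'.indicator fun _ => v := by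
      have hi := (ae_restrict_iff' measurableSet_Ioi).1
        (indicatorConstLp_coeFn (p := 2) (hs := hs) (hμs := hμ) (c := v))
      filter_upwards [evenExt_ae' (indicatorConstLp 2 hs hμ v), hi, ae_neg hi] with t a b b'
      rw [a]
      rcases lt_trichotomy t 0 with ht | ht | ht
      · have ht' : -t ∈ Ioi (0 : ℝ) := by simpa using ht
        have ht'' : t ∉ Ioi (0 : ℝ) := by simpa using ht.le
        rw [indicator_of_notMem ht'', indicator_of_mem ht', b' ht', zero_add]
        by_cases h : -t ∈ s
        · rw [indicator_of_mem h, indicator_of_mem (show t ∈ s' from Or.inr ⟨h, ht'⟩)]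
        · rw [indicator_of_notMem h, indicator_of_notMem (show t ∉ s' from fun hh =>
            hh.elim (fun h1 => ht'' h1.2) fun h1 => h h1.1)]
      · have h0 : t ∉ s' := fun hh => hh.elim (fun h1 => h1.2.ne' ht) fun h1 => by linarith [h1.2]
        rw [indicator_of_notMem h0]
        simp [ht]
      · have ht' : -t ∉ Ioi (0 : ℝ) := by simpa using ht.le
        rw [indicator_of_mem (mem_Ioi.2 ht), indicator_of_notMem ht', b ht, add_zero]
        by_cases h : t ∈ s
        · rw [indicator_of_mem h, indicator_of_mem (show t ∈ s' from Or.inl ⟨h, ht⟩)]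
        · rw [indicator_of_notMem h, indicator_of_notMem (show t ∉ s' from fun hh =>
            hh.elim (fun h1 => h h1.1) fun h1 => ht' h1.2)]
    have e2 := average_indicator_ae hκ e1
    obtain ⟨R, hR⟩ := hb.subset_closedBall (0 : ℝ)
    have hbs := contDiff_mollIndicator h1 h2 hs'm
    refine mem_smoothSpan_test_of_even hU hUo D G hD hG hvV hg hvg hbs
      (fun t => mollIndicator_neg h6 (fun t => ?_) t) (R := R + r) (fun t ht => ?_) ?_
    · simp only [hs', mem_ofPred_eq, neg_neg]
      exact or_comm
    · refine mollIndicator_eq_zero fun σ hσ h => ht ?_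
      have h7 := abs_lt.1 (h5 σ hσ)
      have h8 : |t - σ| ≤ R := by
        rcases h with h | h
        · simpa using hR h.1
        · rw [← abs_neg]; simpa using hR h.1
      have h9 := abs_le.1 h8
      constructor <;> linarith [h7.1, h7.2, h9.1, h9.2]
    · rw [hp]
      filter_upwards [restr_ae (average κ (evenExt (indicatorConstLp 2 hs hμ v))),
        ae_restrict_of_ae e2] with t a b
      rw [a, b]

end Density

/-! ### Density of smooth functions in `H¹` of a Lipschitz domain -/

section SpaceDensity

variable {U : Set (Sp d)}

/-- Extension by zero from `U` to the whole space. -/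
def spaceExt {Y : Type*} [NormedAddCommGroup Y] (hU : MeasurableSet U)
    (f : Lp Y 2 (volume.restrict U)) : Lp Y 2 (volume : Measure (Sp d)) :=
  ((memLp_indicator_iff_restrict hU).2 (Lp.memLp f)).toLp (U.indicator f)

lemma spaceExt_ae {Y : Type*} [NormedAddCommGroup Y] (hU : MeasurableSet U)
    (f : Lp Y 2 (volume.restrict U)) : spaceExt hU f =ᵐ[volume] U.indicator f :=
  MemLp.coeFn_toLp _

/-- Makes the reflected and shifted kernel admissible in the weak gradient identity, so that
derivatives of a convolution fall on the weak gradient. -/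
lemma isTest_kernel {κ : Sp d → ℝ} (h1 : ContDiff ℝ ∞ κ) {y a : Sp d} {ρ : ℝ}
    (h2 : tsupport κ ⊆ Metric.closedBall a ρ) (h3 : Metric.closedBall (y - a) ρ ⊆ U) :
    IsTest U fun z => κ (y - z) := by
  have hs : Function.support (fun z => κ (y - z)) ⊆ Metric.closedBall (y - a) ρ := fun z hz => by
    have := h2 (subset_tsupport _ (show y - z ∈ Function.support κ from hz))
    rw [mem_closedBall_iff_norm] at this ⊢
    rw [← norm_neg]
    have e1 : -(z - (y - a)) = y - z - a := by abel
    rwa [e1]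
  have hs' := closure_minimal hs Metric.isClosed_closedBall
  exact ⟨h1.comp (contDiff_const.sub contDiff_id),
    HasCompactSupport.of_support_subset_isCompact (isCompact_closedBall _ _) hs, hs'.trans h3⟩

lemma gradient_kernel {κ : Sp d → ℝ} (h1 : ContDiff ℝ ∞ κ) (y z : Sp d) :
    gradient (fun z => κ (y - z)) z = - gradient κ (y - z) := by
  rw [gradient_eq, gradient_eq, ← map_neg]
  congr 1
  have := (h1.differentiable (by simp) (y - z)).hasFDerivAt.comp z
    ((hasFDerivAt_id z).const_sub y)
  refine this.fderiv.trans ?_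
  ext e
  simp

/-- The convolution of a smooth kernel with an `L²` function. -/
lemma convolution_smooth {κ : Sp d → ℝ} (h1 : ContDiff ℝ ∞ κ) (h2 : HasCompactSupport κ)
    (f : Lp ℝ 2 (volume : Measure (Sp d))) :
    ContDiff ℝ ∞ (fun y => ∫ s, κ s • f (y - s)) ∧
      ∀ y, gradient (fun y => ∫ s, κ s • f (y - s)) y = ∫ z, f z • gradient κ (y - z) := by
  have hl : LocallyIntegrable f (volume : Measure (Sp d)) :=
    (Lp.memLp f).locallyIntegrable (by norm_num)
  have hF : (fun y => ∫ s, κ s • f (y - s)) =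
      convolution f κ (ContinuousLinearMap.lsmul ℝ ℝ) volume := by
    ext y
    rw [convolution_def, ← integral_sub_left_eq_self _ volume y]
    simp [mul_comm]
  rw [hF]
  refine ⟨h2.contDiff_convolution_right (n := ⊤) (ContinuousLinearMap.lsmul ℝ ℝ) hl h1,
    fun y => ?_⟩
  have hd := h2.hasFDerivAt_convolution_right (ContinuousLinearMap.lsmul ℝ ℝ) hl
    (h1.of_le (by simp)) y
  refine ext_inner_right ℝ fun e => ?_
  have hgc := continuous_gradient (h1.of_le (by simp) : ContDiff ℝ 1 κ)
  have hgs : HasCompactSupport (gradient κ) :=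
    (h2.fderiv (𝕜 := ℝ)).comp_left (g := (InnerProductSpace.toDual ℝ (Sp d)).symm) (map_zero _)
  have i1 : Integrable (fun z => f z • gradient κ (y - z)) :=
    hgs.convolutionExists_right (ContinuousLinearMap.lsmul ℝ ℝ) hl hgc y
  rw [inner_gradient, hd.fderiv, convolution_precompR_apply _ hl (h2.fderiv (𝕜 := ℝ))
    (h1.continuous_fderiv (by simp)), real_inner_comm, ← integral_inner i1, convolution_def]
  refine integral_congr_ae (Eventually.of_forall fun s => ?_)
  simp only [ContinuousLinearMap.lsmul_apply, smul_eq_mul, real_inner_smul_right]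
  rw [real_inner_comm, inner_gradient]

/-- Near `x`, the set `U` contains small balls around the translates of its points in a fixed
direction. -/
def IsGoodPoint (U : Set (Sp d)) (x : Sp d) : Prop :=
  ∃ (e : Sp d) (r c δ₀ : ℝ), 0 < r ∧ 0 < c ∧ 0 < δ₀ ∧ ∀ δ, 0 < δ → δ < δ₀ →
    ∀ y ∈ U ∩ Metric.ball x r, Metric.closedBall (y - δ • e) (c * δ) ⊆ U

lemma isGoodPoint_of_mem (hU : IsOpen U) {x : Sp d} (hx : x ∈ U) : IsGoodPoint U x := by
  obtain ⟨r, hr, h⟩ := Metric.isOpen_iff.1 hU x hx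
  refine ⟨0, r / 2, 1, r / 2, by positivity, one_pos, by positivity, fun δ h0 hδ y hy => ?_⟩
  refine subset_trans (fun z hz => ?_) h
  rw [smul_zero, sub_zero, one_mul] at hz
  have := Metric.mem_ball.1 hy.2
  have h2 := Metric.mem_closedBall.1 hz
  have := dist_triangle z y x
  rw [Metric.mem_ball]
  linarith

/-- Moving down by δ gains the height δ below the graph. A further displacement k loses at most ‖k‖
in height and 2K‖k‖ in the value of the Lipschitz function. -/
lemma isGoodPoint_of_frontier (hU : HasLipschitzBoundary U) {x : Sp d} (hx : x ∈ frontier U) :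
    IsGoodPoint U x := by
  obtain ⟨e, r, K, γ, he, hr, hγ, h⟩ := hU x hx
  -- For ‖k‖ ≤ cδ the loss (1 + 2K)‖k‖ is at most δ/2, less than the gain δ.
  set c : ℝ := 1 / (2 * (1 + 2 * K))
  have hc : 0 < c := by positivity
  have hcK : c * (1 + 2 * K) = 1 / 2 := by simp only [c]; field_simp
  have hc1 : c ≤ 1 / 2 := by nlinarith [K.2]
  refine ⟨e, r / 2, c, r / 4, by positivity, hc, by positivity, fun δ h0 hδ y hy z hz => ?_⟩
  have hyx := Metric.mem_ball.1 hy.2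
  have hz' := mem_closedBall_iff_norm.1 hz
  set k := z - (y - δ • e) with hk
  have hzk : z = y - δ • e + k := by rw [hk]; abel
  have hey := (h y (Metric.ball_subset_ball (by linarith) hy.2)).1 hy.1
  have hzx : z ∈ Metric.ball x r := by
    rw [mem_ball_iff_norm]
    rw [dist_eq_norm] at hyx
    have : z - x = (y - x) - δ • e + k := by rw [hzk]; abel
    rw [this]
    have h1 := norm_add_le ((y - x) - δ • e) k
    have h2 := norm_sub_le (y - x) (δ • e)
    rw [norm_smul, he, Real.norm_of_nonneg h0.le] at h2
    nlinarith
  rw [h z hzx]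
  have hee : ⟪e, e⟫ = 1 := by rw [real_inner_self_eq_norm_sq, he]; norm_num
  have e1 : ⟪e, z⟫ = ⟪e, y⟫ - δ + ⟪e, k⟫ := by
    rw [hzk, inner_add_right, inner_sub_right, inner_smul_right, hee]; ring
  have e2 : z - ⟪e, z⟫ • e = (y - ⟪e, y⟫ • e) + (k - ⟪e, k⟫ • e) := by
    rw [e1]
    conv_lhs => rw [hzk]
    module
  have h3 : |⟪e, k⟫| ≤ ‖k‖ := by
    have := abs_real_inner_le_norm e k
    rwa [he, one_mul] at this
  have h4 : ‖k - ⟪e, k⟫ • e‖ ≤ 2 * ‖k‖ := by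
    refine (norm_sub_le _ _).trans ?_
    rw [norm_smul, he, mul_one, Real.norm_eq_abs]
    linarith
  have h5 := hγ.dist_le_mul (z - ⟪e, z⟫ • e) (y - ⟪e, y⟫ • e)
  rw [Real.dist_eq, dist_eq_norm, e2, add_sub_cancel_left] at h5
  have h6 := (abs_le.1 h5).1
  have h7 := (abs_le.1 h3).2
  have h8 : (K : ℝ) * ‖k - ⟪e, k⟫ • e‖ ≤ K * (2 * (c * δ)) := by
    refine mul_le_mul_of_nonneg_left (h4.trans ?_) K.2
    linarith
  rw [e2, e1]
  nlinarith

/-- The subspace of `H¹(U)` spanned by smooth functions, closed. -/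
def H1smooth (U : Set (Sp d)) : Submodule ℝ (H1 U) :=
  (Submodule.span ℝ {v : H1 U | ∃ g, ContDiff ℝ ∞ g ∧
    H1.toL2 U v =ᵐ[volume.restrict U] g}).topologicalClosure

/-- Functions supported near a good point are limits of smooth functions. -/
lemma mem_H1smooth_of_support (hU : Bornology.IsBounded U) (hUo : IsOpen U) {x e : Sp d}
    {r r' c δ₀ : ℝ} (hr : r' < r) (hc : 0 < c) (hδ₀ : 0 < δ₀)
    (hgood : ∀ δ, 0 < δ → δ < δ₀ →
      ∀ y ∈ U ∩ Metric.ball x r, Metric.closedBall (y - δ • e) (c * δ) ⊆ U) (w : H1 U)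
    (hw : ∀ᵐ z ∂volume.restrict U, z ∉ Metric.closedBall x r' →
      H1.toL2 U w z = 0 ∧ H1.grad U w z = 0) : w ∈ H1smooth U := by
  have hUm := hUo.measurableSet
  refine Metric.mem_closure_iff.2 fun ε hε => ?_
  set f := spaceExt hUm (H1.toL2 U w) with hf
  set g := spaceExt hUm (H1.grad U w) with hg
  obtain ⟨r₁, hr₁, H₁⟩ := norm_average_sub_le f (half_pos hε)
  obtain ⟨r₂, hr₂, H₂⟩ := norm_average_sub_le g (by positivity : 0 < ε / 3)
  -- Shift plus kernel radius, (‖e‖ + c)δ, has to stay below both approximation radii and below the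
  -- gap r - r' between the support of w and the good region.
  set m : ℝ := min δ₀ (min (min r₁ r₂) (r - r') / (‖e‖ + c + 1)) with hm
  have hec : 0 < ‖e‖ + c + 1 := by positivity
  have hm0 : 0 < m := by
    refine lt_min hδ₀ (div_pos (lt_min (lt_min hr₁ hr₂) (by linarith)) hec)
  set δ := m / 2 with hδ
  have hδ0 : 0 < δ := by positivity
  have hδm : δ < m := by rw [hδ]; linarith
  have hδ1 : δ < δ₀ := hδm.trans_le (min_le_left _ _)
  have hδ2 : (‖e‖ + c) * δ < min (min r₁ r₂) (r - r') := by
    have := hδm.trans_le (min_le_right δ₀ _)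
    rw [lt_div_iff₀ hec] at this
    nlinarith
  have hδr : (‖e‖ + c) * δ < r - r' := hδ2.trans_le (min_le_right _ _)
  have hδr₁ : (‖e‖ + c) * δ < r₁ := hδ2.trans_le ((min_le_left _ _).trans (min_le_left _ _))
  have hδr₂ : (‖e‖ + c) * δ < r₂ := hδ2.trans_le ((min_le_left _ _).trans (min_le_right _ _))
  have hcδ : 0 < c * δ := mul_pos hc hδ0
  -- The kernel is centred at δe: averaging at y ∈ U near x uses only values in the ball around y -
  -- δe, which lies inside U.
  let ψ : ContDiffBump (δ • e) := ⟨c * δ / 2, c * δ, by positivity, by linarith⟩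
  set κ : Sp d → ℝ := ψ.normed volume with hκ
  have k1 : ContDiff ℝ ∞ κ := ψ.contDiff_normed
  have k2 : HasCompactSupport κ := ψ.hasCompactSupport_normed
  have k3 : tsupport κ ⊆ Metric.closedBall (δ • e) (c * δ) := ψ.tsupport_normed_eq.subset
  have k4 : ∀ s, κ s ≠ 0 → ‖s‖ ≤ (‖e‖ + c) * δ := fun s hs => by
    have := k3 (subset_tsupport _ hs)
    rw [mem_closedBall_iff_norm] at this
    have h2 := norm_le_norm_add_norm_sub (δ • e) s
    rw [norm_sub_rev, norm_smul, Real.norm_of_nonneg hδ0.le] at h2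
    linarith
  have ki := k1.continuous.integrable_of_hasCompactSupport k2 (μ := volume)
  have a1 := H₁ κ ki ψ.nonneg_normed ψ.integral_normed fun s hs => (k4 s hs).trans hδr₁.le
  have a2 := H₂ κ ki ψ.nonneg_normed ψ.integral_normed fun s hs => (k4 s hs).trans hδr₂.le
  obtain ⟨c1, c2⟩ := convolution_smooth k1 k2 f
  set F : Sp d → ℝ := fun y => ∫ s, κ s • f (y - s) with hF
  have hw' : ∀ᵐ z, (z ∉ U ∨ z ∉ Metric.closedBall x r') → f z = 0 ∧ g z = 0 := by
    filter_upwards [spaceExt_ae hUm (H1.toL2 U w), spaceExt_ae hUm (H1.grad U w),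
      (ae_restrict_iff' hUm).1 hw] with z h1 h2 h3 h4
    rw [hf, hg, h1, h2]
    by_cases hz : z ∈ U
    · rw [indicator_of_mem hz, indicator_of_mem hz]
      exact h3 hz (h4.resolve_left fun h => h hz)
    · exact ⟨indicator_of_notMem hz _, indicator_of_notMem hz _⟩
  -- Near x the kernel is a test function on U and the weak gradient identity applies. Away from x
  -- the kernel misses the support of w and both sides vanish.
  have hgrad : ∀ y ∈ U, gradient F y = ∫ s, κ s • g (y - s) := by
    intro y hy
    rw [c2 y]
    have e1 : ∫ s, κ s • g (y - s) = ∫ z, κ (y - z) • g z := by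
      rw [← integral_sub_left_eq_self _ volume y]
      simp
    rw [e1]
    by_cases hyb : y ∈ Metric.ball x r
    · have ht := isTest_kernel k1 k3 (hgood δ hδ0 hδ1 y ⟨hy, hyb⟩)
      have hwg := w.isWeakGradient _ ht
      simp only [gradient_kernel k1, smul_neg] at hwg
      rw [integral_neg, neg_inj] at hwg
      have e2 : ∫ z, f z • gradient κ (y - z) = ∫ z in U, H1.toL2 U w z • gradient κ (y - z) := by
        rw [← integral_indicator hUm]
        refine integral_congr_ae ?_
        filter_upwards [spaceExt_ae hUm (H1.toL2 U w)] with z hz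
        rw [hf, hz]
        by_cases h : z ∈ U
        · simp [h]
        · simp [h]
      have e3 : ∫ z, κ (y - z) • g z = ∫ z in U, κ (y - z) • H1.grad U w z := by
        rw [← integral_indicator hUm]
        refine integral_congr_ae ?_
        filter_upwards [spaceExt_ae hUm (H1.grad U w)] with z hz
        rw [hg, hz]
        by_cases h : z ∈ U
        · simp [h]
        · simp [h]
      rw [e2, e3, hwg]
    · have hz0 : ∀ z ∈ Metric.closedBall x r', κ (y - z) = 0 ∧ gradient κ (y - z) = 0 := by
        intro z hz
        have hn : y - z ∉ tsupport κ := fun h => by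
          have h1 := k3 h
          rw [mem_closedBall_iff_norm] at h1
          have h2 := norm_le_norm_add_norm_sub (δ • e) (y - z)
          rw [norm_sub_rev (δ • e), norm_smul, Real.norm_of_nonneg hδ0.le] at h2
          have h3 := mem_closedBall_iff_norm.1 hz
          have h4 : r ≤ ‖y - x‖ := by
            rw [← dist_eq_norm]; exact not_lt.1 hyb
          have h5 : ‖y - x‖ ≤ ‖y - z‖ + ‖z - x‖ := by
            have := norm_add_le (y - z) (z - x); simpa using this
          nlinarith
        refine ⟨image_eq_zero_of_notMem_tsupport hn, ?_⟩
        rw [gradient_eq]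
        have : fderiv ℝ κ (y - z) = 0 := by
          by_contra h
          exact hn (support_fderiv_subset ℝ h)
        rw [this, map_zero]
      rw [integral_eq_zero_of_ae, integral_eq_zero_of_ae]
      · filter_upwards [hw'] with z hz
        by_cases h : z ∈ Metric.closedBall x r'
        · simp [(hz0 z h).1]
        · simp [(hz (Or.inr h)).2]
      · filter_upwards [hw'] with z hz
        by_cases h : z ∈ Metric.closedBall x r'
        · simp [(hz0 z h).2]
        · simp [(hz (Or.inr h)).1]
  refine ⟨H1.ofSmooth hU hUm F (c1.of_le (by simp)), Submodule.subset_span ⟨F, c1,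
    H1.toL2_ofSmooth_ae hU hUm _⟩, ?_⟩
  rw [dist_eq_norm]
  have n1 : ‖H1.toL2 U (w - H1.ofSmooth hU hUm F (c1.of_le (by simp)))‖ ≤ ε / 2 := by
    refine le_trans ?_ a1
    rw [← norm_neg (average κ f - f), neg_sub]
    refine le_trans (le_of_eq ?_) (norm_Lp_toLp_restrict_le U (f - average κ f))
    congr 1
    refine Lp.ext ?_
    rw [map_sub]
    filter_upwards [Lp.coeFn_sub (H1.toL2 U w) (H1.toL2 U (H1.ofSmooth hU hUm F (c1.of_le (by simp)))),
      H1.toL2_ofSmooth_ae hU hUm (f := F) (c1.of_le (by simp)),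
      (((Lp.memLp (f - average κ f)).restrict U).coeFn_toLp),
      ae_restrict_of_ae (Lp.coeFn_sub f (average κ f)), ae_restrict_of_ae (average_ae ki f),
      ae_restrict_of_ae (spaceExt_ae hUm (H1.toL2 U w)), ae_restrict_mem hUm] with y b1 b2 b3 b4 b5 b6 b7
    rw [b1, Pi.sub_apply, b2, b3, b4, Pi.sub_apply, b5, hf, b6, indicator_of_mem b7]
  have n2 : ‖H1.grad U (w - H1.ofSmooth hU hUm F (c1.of_le (by simp)))‖ ≤ ε / 3 := by
    refine le_trans ?_ a2
    rw [← norm_neg (average κ g - g), neg_sub]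
    refine le_trans (le_of_eq ?_) (norm_Lp_toLp_restrict_le U (g - average κ g))
    congr 1
    refine Lp.ext ?_
    rw [map_sub]
    filter_upwards [Lp.coeFn_sub (H1.grad U w) (H1.grad U (H1.ofSmooth hU hUm F (c1.of_le (by simp)))),
      H1.grad_ofSmooth_ae hU hUm (f := F) (c1.of_le (by simp)),
      (((Lp.memLp (g - average κ g)).restrict U).coeFn_toLp),
      ae_restrict_of_ae (Lp.coeFn_sub g (average κ g)), ae_restrict_of_ae (average_ae ki g),
      ae_restrict_of_ae (spaceExt_ae hUm (H1.grad U w)), ae_restrict_mem hUm] with y b1 b2 b3 b4 b5 b6 b7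
    rw [b1, Pi.sub_apply, b2, b3, b4, Pi.sub_apply, b5, hg, b6, indicator_of_mem b7, hgrad y b7]
  -- The tolerances were chosen unequal because 1/4 + 1/9 < 1.
  refine abs_lt_of_sq_lt_sq' ?_ hε.le |>.2
  rw [H1.norm_sq]
  nlinarith [norm_nonneg (H1.toL2 U (w - H1.ofSmooth hU hUm F (c1.of_le (by simp)))),
    norm_nonneg (H1.grad U (w - H1.ofSmooth hU hUm F (c1.of_le (by simp))))]

/-- Multiplication of an `H¹` function by a test function. -/
lemma exists_mul_H1 {b : Sp d → ℝ} (hb : ContDiff ℝ ∞ b) (hbc : HasCompactSupport b) (v : H1 U) :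
    ∃ w : H1 U, H1.toL2 U w =ᵐ[volume.restrict U] (fun z => b z * H1.toL2 U v z) ∧
      H1.grad U w =ᵐ[volume.restrict U]
        fun z => b z • H1.grad U v z + H1.toL2 U v z • gradient b z := by
  have hgc := continuous_gradient (hb.of_le (by simp) : ContDiff ℝ 1 b)
  have hgs : HasCompactSupport (gradient b) :=
    (hbc.fderiv (𝕜 := ℝ)).comp_left (g := (InnerProductSpace.toDual ℝ (Sp d)).symm) (map_zero _)
  obtain ⟨C, hC⟩ := hb.continuous.bounded_above_of_compact_support hbc
  obtain ⟨C', hC'⟩ := hgc.bounded_above_of_compact_support hgs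
  have m1 : MemLp (fun z => b z * H1.toL2 U v z) 2 (volume.restrict U) := by
    refine (Lp.memLp (H1.toL2 U v)).of_le_mul (c := C)
      (hb.continuous.aestronglyMeasurable.mul (Lp.aestronglyMeasurable _))
      (Eventually.of_forall fun z => ?_)
    rw [norm_mul]
    exact mul_le_mul_of_nonneg_right (hC z) (norm_nonneg _)
  have m2 : MemLp (fun z => b z • H1.grad U v z) 2 (volume.restrict U) := by
    refine (Lp.memLp (H1.grad U v)).of_le_mul (c := C)
      (hb.continuous.aestronglyMeasurable.smul (Lp.aestronglyMeasurable _))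
      (Eventually.of_forall fun z => ?_)
    rw [norm_smul]
    exact mul_le_mul_of_nonneg_right (hC z) (norm_nonneg _)
  have m3 : MemLp (fun z => H1.toL2 U v z • gradient b z) 2 (volume.restrict U) := by
    refine (Lp.memLp (H1.toL2 U v)).of_le_mul (c := C')
      ((Lp.aestronglyMeasurable (H1.toL2 U v)).smul hgc.aestronglyMeasurable)
      (Eventually.of_forall fun z => ?_)
    rw [norm_smul, mul_comm]
    exact mul_le_mul_of_nonneg_right (hC' z) (norm_nonneg _)
  refine ⟨H1.mk _ _ m1 (m2.add m3) fun φ hφ => ?_, m1.coeFn_toLp, (m2.add m3).coeFn_toLp⟩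
  have hbφ : IsTest U fun z => b z * φ z := by
    refine ⟨hb.mul hφ.1, hφ.2.1.mul_left, (closure_mono ?_).trans hφ.2.2⟩
    exact Function.support_mul_subset_right _ _
  have hw := v.isWeakGradient _ hbφ
  have hgr : ∀ z, gradient (fun z => b z * φ z) z = b z • gradient φ z + φ z • gradient b z :=
    fun z => gradient_mul (hb.differentiable (by simp) z) (hφ.1.differentiable (by simp) z)
  have j1 : Integrable (fun z => (b z * H1.toL2 U v z) • gradient φ z) (volume.restrict U) :=
    memLp_one_iff_integrable.1 (hφ.memLp_gradient.smul m1)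
  have j2 : Integrable (fun z => φ z • (H1.toL2 U v z • gradient b z)) (volume.restrict U) :=
    memLp_one_iff_integrable.1 (m3.smul hφ.memLp)
  have j3 : Integrable (fun z => φ z • (b z • H1.grad U v z)) (volume.restrict U) :=
    memLp_one_iff_integrable.1 (m2.smul hφ.memLp)
  have e1 : ∫ z in U, H1.toL2 U v z • gradient (fun z => b z * φ z) z =
      (∫ z in U, (b z * H1.toL2 U v z) • gradient φ z) +
        ∫ z in U, φ z • (H1.toL2 U v z • gradient b z) := by
    rw [← integral_add j1 j2]
    refine integral_congr_ae (Eventually.of_forall fun z => ?_)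
    simp only [hgr]
    module
  have e2 : ∫ z in U, (b z * φ z) • H1.grad U v z = ∫ z in U, φ z • (b z • H1.grad U v z) := by
    refine integral_congr_ae (Eventually.of_forall fun z => ?_)
    simp only
    module
  have e3 : ∫ z in U, φ z • (b z • H1.grad U v z + H1.toL2 U v z • gradient b z) =
      (∫ z in U, φ z • (b z • H1.grad U v z)) + ∫ z in U, φ z • (H1.toL2 U v z • gradient b z) := by
    rw [← integral_add j3 j2]
    refine integral_congr_ae (Eventually.of_forall fun z => ?_)
    simp only [smul_add]
  rw [e1, e2] at hw
  change _ = - ∫ z in U, φ z • (b z • H1.grad U v z + H1.toL2 U v z • gradient b z)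
  rw [e3, neg_add, ← hw]
  abel

/-- Functions smooth up to the boundary are dense in `H¹(U)`, `U` a Lipschitz domain. -/
lemma H1smooth_eq_top (hU : IsLipschitzDomain U) : H1smooth U = ⊤ := by
  have hUb := hU.isBounded
  have hUo := hU.isOpen
  refine (Submodule.eq_top_iff').2 fun v => ?_
  have hgood : ∀ x ∈ closure U, IsGoodPoint U x := fun x hx => by
    by_cases h : x ∈ U
    · exact isGoodPoint_of_mem hUo h
    · exact isGoodPoint_of_frontier hU.lipschitz ⟨hx, by rwa [hUo.interior_eq]⟩
  choose! e r c δ₀ hr hc hδ hball using hgood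
  obtain ⟨t, ht, hcov⟩ := hUb.isCompact_closure.elim_nhds_subcover
    (fun x => Metric.ball x (r x / 4)) fun x hx => Metric.ball_mem_nhds x (by
      have := hr x hx; positivity)
  have hb : ∀ x ∈ t, ∃ b : Sp d → ℝ, ContDiff ℝ ∞ b ∧ HasCompactSupport b ∧
      (∀ z ∈ Metric.ball x (r x / 4), b z = 1) ∧ tsupport b ⊆ Metric.closedBall x (r x / 2) := by
    intro x hx
    have hrx := hr x (ht x hx)
    let b : ContDiffBump x := ⟨r x / 4, r x / 2, by positivity, by linarith⟩
    exact ⟨b, b.contDiff, b.hasCompactSupport, fun z hz =>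
      b.one_of_mem_closedBall (Metric.ball_subset_closedBall hz), b.tsupport_eq.subset⟩
  choose! b hb1 hb2 hb3 hb4 using hb
  -- Instead of a partition of unity, v is peeled: replacing w by w - b_x w subtracts a function
  -- supported near x and makes the remainder vanish on one more ball. After all balls of the cover
  -- nothing is left.
  have key : ∀ s : Finset (Sp d), s ⊆ t → ∃ w : H1 U, v - w ∈ H1smooth U ∧
      ∀ᵐ z ∂volume.restrict U, (∃ x ∈ s, z ∈ Metric.ball x (r x / 4)) → H1.toL2 U w z = 0 := by
    intro s
    induction s using Finset.induction_on with
    | empty => exact fun _ => ⟨v, by rw [sub_self]; exact Submodule.zero_mem _, by simp⟩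
    | insert x s hxs ih =>
      intro hs
      obtain ⟨w, hw1, hw2⟩ := ih ((Finset.subset_insert _ _).trans hs)
      have hxt : x ∈ t := hs (Finset.mem_insert_self _ _)
      obtain ⟨p, hp1, hp2⟩ := exists_mul_H1 (hb1 x hxt) (hb2 x hxt) w
      have hrx := hr x (ht x hxt)
      have hpm : p ∈ H1smooth U := by
        refine mem_H1smooth_of_support hUb hUo (r' := r x / 2) (by linarith) (hc x (ht x hxt))
          (hδ x (ht x hxt)) (hball x (ht x hxt)) p ?_
        filter_upwards [hp1, hp2] with z h1 h2 h3
        have h4 : z ∉ tsupport (b x) := fun h => h3 (hb4 x hxt h)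
        have h5 : gradient (b x) z = 0 := by
          have : fderiv ℝ (b x) z = 0 := by
            by_contra h
            exact h4 (support_fderiv_subset ℝ h)
          rw [gradient_eq, this, map_zero]
        rw [h1, h2, h5, image_eq_zero_of_notMem_tsupport h4]
        simp
      refine ⟨w - p, ?_, ?_⟩
      · have : v - (w - p) = (v - w) + p := by abel
        rw [this]
        exact Submodule.add_mem _ hw1 hpm
      · rw [map_sub]
        filter_upwards [Lp.coeFn_sub (H1.toL2 U w) (H1.toL2 U p), hw2, hp1] with z h1 h2 h3 h4
        rw [h1, Pi.sub_apply, h3]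
        obtain ⟨x', hx', hz⟩ := h4
        rcases Finset.mem_insert.1 hx' with rfl | hx'
        · rw [hb3 x' hxt z hz]; ring
        · rw [h2 ⟨x', hx', hz⟩]; ring
  obtain ⟨w, hw1, hw2⟩ := key t subset_rfl
  have hw0 : w = 0 := by
    refine H1.toL2_injective hUo (Lp.ext ?_)
    rw [map_zero]
    filter_upwards [hw2, ae_restrict_mem hUo.measurableSet, Lp.coeFn_zero ℝ 2 (volume.restrict U)]
      with z h1 h2 h3
    rw [h3, Pi.zero_apply]
    obtain ⟨x, hx, hz⟩ := mem_iUnion₂.1 (hcov (subset_closure h2))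
    exact h1 ⟨x, hx, hz⟩
  rwa [hw0, sub_zero] at hw1

end SpaceDensity

/-! ### Uniqueness of the parabolic operators -/

section Uniqueness

variable {U : Set (Sp d)} {α : Sp d → ℝ}

/-- A smooth function has at most one representative, since functions in H¹ are determined by their
L² class. Hence the operators agree on smooth pairs, and density is applied in one variable after
the other. -/
lemma ExtendsForm.unique (hUo : IsOpen U) {V : Submodule ℝ (H1 U)} {D : Set (ℝ → Sp d → ℝ)}
    (h1 : ∀ u : Trial U V, u ∈ smoothSpan zeroExt V D)
    (h2 : ∀ u : Test U V, u ∈ smoothSpan evenExt V D)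
    {A A' : Trial U V →L[ℝ] Test U V →L[ℝ] ℝ} (hA : ExtendsForm U V D α A)
    (hA' : ExtendsForm U V D α A') : A = A' := by
  have e1 : ∀ (u : Trial U V) (φ), φ ∈ D → Represents u φ → A u = A' u := by
    intro u φ hφ hu
    refine ContinuousLinearMap.ext_on (s := {v : Test U V | ∃ ψ ∈ D, Represents v ψ})
      (fun v => h2 v) ?_
    rintro v ⟨ψ, hψ, hv⟩
    obtain ⟨u1, v1, hu1, hv1, h3⟩ := hA φ hφ ψ hψ
    obtain ⟨u2, v2, hu2, hv2, h4⟩ := hA' φ hφ ψ hψ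
    rw [← hu.unique hUo hu1, ← hv.unique hUo hv1] at h3
    rw [← hu.unique hUo hu2, ← hv.unique hUo hv2] at h4
    rw [h3, h4]
  refine ContinuousLinearMap.ext_on (s := {u : Trial U V | ∃ φ ∈ D, Represents u φ})
      (fun u => h1 u) ?_
  rintro u ⟨φ, hφ, hu⟩
  exact e1 u φ hφ hu

lemma tensor_mem_smoothUpTo {g : Sp d → ℝ} (hg : ContDiff ℝ ∞ g) {b : ℝ → ℝ}
    (hb : ContDiff ℝ ∞ b) {a₀ b₀ : ℝ} (ha₀ : 0 < a₀) (h : ∀ t, t ∉ Icc a₀ b₀ → b t = 0) :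
    (fun t x => b t * g x) ∈ smoothUpTo d :=
  ⟨(hb.comp contDiff_fst).mul (hg.comp contDiff_snd), a₀, b₀, ha₀, fun t ht x => by
    simp only [h t ht, zero_mul]⟩

lemma tensor_mem_smoothCompact {g : Sp d → ℝ} (hg : IsTest U g) {b : ℝ → ℝ}
    (hb : ContDiff ℝ ∞ b) {a₀ b₀ : ℝ} (ha₀ : 0 < a₀) (h : ∀ t, t ∉ Icc a₀ b₀ → b t = 0) :
    (fun t x => b t * g x) ∈ smoothCompact U := by
  have hs : Function.support (fun p : ℝ × Sp d => b p.1 * g p.2) ⊆ Icc a₀ b₀ ×ˢ tsupport g := by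
    intro p hp
    constructor
    · by_contra h1
      exact hp (by simp [h _ h1])
    · by_contra h1
      exact hp (by simp [image_eq_zero_of_notMem_tsupport h1])
  have hK : IsCompact (Icc a₀ b₀ ×ˢ tsupport g) := isCompact_Icc.prod hg.2.1.isCompact
  refine ⟨(hb.comp contDiff_fst).mul (hg.1.comp contDiff_snd),
    HasCompactSupport.of_support_subset_isCompact hK hs, ?_⟩
  refine (closure_minimal hs hK.isClosed).trans (prod_mono (fun t ht => ?_) hg.2.2)
  exact ha₀.trans_le ht.1

instance (U : Set (Sp d)) : (H10 U).HasOrthogonalProjection :=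
  have : CompleteSpace (H10 U) := (Submodule.isClosed_topologicalClosure _).completeSpace_coe
  inferInstance

/-- The operator on `H₀¹`. -/
lemma existsUnique_extendsForm (hU : Bornology.IsBounded U) (hUo : IsOpen U)
    (hα : MemLp α ⊤ (volume.restrict U)) :
    ∃! A : Trial U (H10 U) →L[ℝ] Test U (H10 U) →L[ℝ] ℝ,
      ExtendsForm U (H10 U) (smoothCompact U) α A := by
  have hV : (H10 U : Set (H1 U)) ⊆ closure (Submodule.span ℝ
      {v | v ∈ H10 U ∧ ∃ g ∈ {g | IsTest U g}, H1.toL2 U v =ᵐ[volume.restrict U] g} :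
        Set (H1 U)) := by
    refine closure_mono (Submodule.span_mono fun v hv => ⟨?_, hv⟩)
    exact Submodule.le_topologicalClosure _ (Submodule.subset_span hv)
  have hD : ∀ g ∈ {g | IsTest U g}, ∀ b : ℝ → ℝ, ContDiff ℝ ∞ b → ∀ a₀ b₀ : ℝ, 0 < a₀ →
      (∀ t, t ∉ Icc a₀ b₀ → b t = 0) → (fun t x => b t * g x) ∈ smoothCompact U :=
    fun g hg b hb a₀ b₀ ha h => tensor_mem_smoothCompact hg hb ha h
  refine ⟨parabolicForm hα _, extendsForm_parabolicForm hα hU hUo.measurableSet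
    (smoothCompact_subset U) fun φ hφ h t => H1slice_mem_H10 hU hUo.measurableSet hφ h t,
    fun A hA => hA.unique hUo ?_ ?_ ?_⟩
  · exact mem_smoothSpan_trial _ {g | IsTest U g} hD hV
  · exact mem_smoothSpan_test hU hUo _ {g | IsTest U g} hD (fun g hg => hg.1) hV
  · exact extendsForm_parabolicForm hα hU hUo.measurableSet
      (smoothCompact_subset U) fun φ hφ h t => H1slice_mem_H10 hU hUo.measurableSet hφ h t

section Full

variable (hU : IsLipschitzDomain U)
include hU

lemma top_subset_closure_span : ((⊤ : Submodule ℝ (H1 U)) : Set (H1 U)) ⊆ closure (Submodule.span ℝ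
    {v | v ∈ (⊤ : Submodule ℝ (H1 U)) ∧ ∃ g ∈ {g | ContDiff ℝ ∞ g},
      H1.toL2 U v =ᵐ[volume.restrict U] g} : Set (H1 U)) := by
  intro v hv
  rw [← H1smooth_eq_top hU] at hv
  refine closure_mono (Submodule.span_mono fun v hv => ?_) hv
  exact ⟨trivial, hv⟩

lemma mem_smoothSpan_trial_top (u : Trial U ⊤) : u ∈ smoothSpan zeroExt ⊤ (smoothUpTo d) :=
  mem_smoothSpan_trial _ {g | ContDiff ℝ ∞ g}
    (fun _ hg _ hb _ _ ha h => tensor_mem_smoothUpTo hg hb ha h) (top_subset_closure_span hU) u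

lemma mem_smoothSpan_test_top (u : Test U ⊤) : u ∈ smoothSpan evenExt ⊤ (smoothUpTo d) :=
  mem_smoothSpan_test hU.isBounded hU.isOpen _ {g | ContDiff ℝ ∞ g}
    (fun _ hg _ hb _ _ ha h => tensor_mem_smoothUpTo hg hb ha h) (fun _ hg => hg)
    (top_subset_closure_span hU) u

lemma extendsForm_parabolicForm_top (hα : MemLp α ⊤ (volume.restrict U)) :
    ExtendsForm U ⊤ (smoothUpTo d) α (parabolicForm hα ⊤) :=
  extendsForm_parabolicForm hα hU.isBounded hU.isOpen.measurableSet subset_rfl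
    fun _ _ _ _ => trivial

lemma extendsForm_top_unique (hα : MemLp α ⊤ (volume.restrict U))
    {A : Trial U ⊤ →L[ℝ] Test U ⊤ →L[ℝ] ℝ} (hA : ExtendsForm U ⊤ (smoothUpTo d) α A) :
    A = parabolicForm hα ⊤ :=
  hA.unique hU.isOpen (mem_smoothSpan_trial_top hU) (mem_smoothSpan_test_top hU)
    (extendsForm_parabolicForm_top hU hα)

end Full

end Uniqueness

/-! ### The Gagliardo seminorm and even reflection -/

section Gagliardo

open scoped ENNReal

/-- The kernel `s⁻²`. -/
def gagKernel (s : ℝ) : ℝ≥0∞ := (‖s‖ₑ ^ 2)⁻¹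

lemma measurable_gagKernel : Measurable gagKernel := by
  unfold gagKernel; fun_prop

lemma gagKernel_ne_zero (s : ℝ) : gagKernel s ≠ 0 :=
  ENNReal.inv_ne_zero.2 (ENNReal.pow_ne_top enorm_ne_top)

lemma gagKernel_anti {s t : ℝ} (h : |s| ≤ |t|) : gagKernel t ≤ gagKernel s := by
  unfold gagKernel
  refine ENNReal.inv_le_inv.2 (pow_le_pow_left₀ (zero_le) ?_ 2)
  rw [Real.enorm_eq_ofReal_abs, Real.enorm_eq_ofReal_abs]
  exact ENNReal.ofReal_le_ofReal h

variable {Y : Type*} [NormedAddCommGroup Y]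

/-- The square of the Gagliardo seminorm of order `1/2`. -/
def gagliardo (f : ℝ → Y) : ℝ≥0∞ := ∫⁻ x, ∫⁻ y, ‖f x - f y‖ₑ ^ 2 * gagKernel (x - y)

lemma gagliardo_congr {f g : ℝ → Y} (h : f =ᵐ[volume] g) : gagliardo f = gagliardo g := by
  unfold gagliardo
  refine lintegral_congr_ae ?_
  filter_upwards [h] with x hx
  refine lintegral_congr_ae ?_
  filter_upwards [h] with y hy
  rw [hx, hy]

lemma lintegral_comp_abs_eq {h : ℝ → ℝ≥0∞} :
    ∫⁻ x, h |x| = 2 * ∫⁻ x in Ioi 0, h x := by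
  have h1 : ∫⁻ x in Ioi 0, h |x| = ∫⁻ x in Ioi (0 : ℝ), h x :=
    setLIntegral_congr_fun measurableSet_Ioi fun x hx => by rw [abs_of_pos hx]
  have h2 : ∫⁻ x in Iio 0, h |x| = ∫⁻ x in Ioi (0 : ℝ), h |x| := by
    rw [← lintegral_indicator measurableSet_Iio, ← lintegral_indicator measurableSet_Ioi,
      ← lintegral_neg_eq_self]
    refine lintegral_congr fun x => ?_
    simp only [indicator_apply, mem_Iio, mem_Ioi, abs_neg, Left.neg_neg_iff]
  rw [← lintegral_add_compl _ measurableSet_Ioi (μ := volume), compl_Ioi,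
    setLIntegral_congr Iio_ae_eq_Iic.symm, h2, h1, two_mul]

/-- Since ||x| - |y|| ≤ |x - y|, replacing the kernel argument by |x| - |y| only increases the
integral, which then splits into four equal quadrants. -/
lemma gagliardo_comp_abs_le (f : ℝ → Y) : gagliardo (fun t => f |t|) ≤ 4 * gagliardo f := by
  unfold gagliardo
  calc ∫⁻ x, ∫⁻ y, ‖f |x| - f |y|‖ₑ ^ 2 * gagKernel (x - y)
      ≤ ∫⁻ x : ℝ, ∫⁻ y : ℝ, ‖f |x| - f |y|‖ₑ ^ 2 * gagKernel (|x| - |y|) := by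
        refine lintegral_mono fun x => lintegral_mono fun y => ?_
        exact mul_le_mul_right (gagKernel_anti (abs_abs_sub_abs_le _ _)) _
    _ = 2 * ∫⁻ x in Ioi 0, 2 * ∫⁻ y in Ioi 0, ‖f x - f y‖ₑ ^ 2 * gagKernel (x - y) := by
        rw [lintegral_comp_abs_eq (h := fun x => ∫⁻ y : ℝ, ‖f x - f |y|‖ₑ ^ 2 * gagKernel (x - |y|))]
        congr 1
        refine lintegral_congr fun x => ?_
        rw [lintegral_comp_abs_eq (h := fun y => ‖f x - f y‖ₑ ^ 2 * gagKernel (x - y))]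
    _ ≤ 2 * ∫⁻ x, 2 * ∫⁻ y, ‖f x - f y‖ₑ ^ 2 * gagKernel (x - y) := by
        refine mul_le_mul_right ((setLIntegral_le_lintegral _ _).trans
          (lintegral_mono fun x => mul_le_mul_right (setLIntegral_le_lintegral _ _) _)) _
    _ = 4 * ∫⁻ x, ∫⁻ y, ‖f x - f y‖ₑ ^ 2 * gagKernel (x - y) := by
        rw [lintegral_const_mul' _ _ (by norm_num), ← mul_assoc]
        norm_num

lemma gagliardo_eq {f : ℝ → Y} (hf : StronglyMeasurable f) :
    gagliardo f = ∫⁻ s, (∫⁻ x, ‖f x - f (x - s)‖ₑ ^ 2) * gagKernel s := by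
  unfold gagliardo
  have h1 : ∀ x, ∫⁻ y, ‖f x - f y‖ₑ ^ 2 * gagKernel (x - y) =
      ∫⁻ s, ‖f x - f (x - s)‖ₑ ^ 2 * gagKernel s := fun x => by
    rw [← lintegral_sub_left_eq_self _ x]
    simp
  simp only [h1]
  have hm : Measurable fun p : ℝ × ℝ => ‖f p.1 - f (p.1 - p.2)‖ₑ ^ 2 := by
    have := (hf.comp_measurable (measurable_fst (β := ℝ))).sub
      (hf.comp_measurable (measurable_fst.sub (measurable_snd (α := ℝ))))
    exact this.enorm.pow_const 2
  rw [lintegral_lintegral_swap]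
  · refine lintegral_congr fun s => ?_
    rw [lintegral_mul_const]
    exact hm.comp (measurable_id.prodMk measurable_const)
  · exact (hm.mul (measurable_gagKernel.comp measurable_snd)).aemeasurable

lemma Lp_enorm_sq {X : Type*} [MeasurableSpace X] {μ : Measure X} (f : Lp Y 2 μ) :
    ‖f‖ₑ ^ 2 = ∫⁻ x, ‖f x‖ₑ ^ 2 ∂μ := by
  have := eLpNorm_nnreal_pow_eq_lintegral (f := f) (μ := μ) (p := 2) two_ne_zero
  rw [Lp.enorm_def]
  simpa using this

/-- The constant in the Fourier representation of the Gagliardo seminorm. -/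
def gagConst : ℝ≥0∞ := ∫⁻ s, ‖1 - mode s 1‖ₑ ^ 2 * gagKernel s

lemma mode_eq (s ξ : ℝ) : mode s ξ = Complex.exp (Complex.I * ((-(2 * Real.pi * (s * ξ)) : ℝ))) := by
  unfold mode
  rw [Real.fourierChar_apply]
  congr 1
  push_cast
  ring

/-- The oscillating factor is at most min(2, 2π|s|). Combining 4 for large s with 4π²s² for small s
gives the majorant 8π²/(1 + s²). -/
lemma gagConst_ne_top : gagConst ≠ ⊤ := by
  have hb : ∀ s, ‖1 - mode s 1‖ₑ ^ 2 * gagKernel s ≤ ENNReal.ofReal (8 * Real.pi ^ 2 * (1 + s ^ 2)⁻¹) := by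
    intro s
    by_cases hs : s = 0
    · subst hs
      simp [mode_eq]
    have h1 : ‖1 - mode s 1‖ ≤ 2 := (norm_sub_le _ _).trans (by rw [norm_mode]; norm_num)
    have h2 : ‖1 - mode s 1‖ ≤ 2 * Real.pi * |s| := by
      rw [norm_sub_rev, mode_eq]
      refine (Real.norm_exp_I_mul_ofReal_sub_one_le).trans_eq ?_
      rw [norm_neg, Real.norm_eq_abs, abs_mul, abs_of_pos (by positivity), mul_one]
    have h3 : gagKernel s = ENNReal.ofReal ((s ^ 2)⁻¹) := by
      unfold gagKernel
      rw [ENNReal.ofReal_inv_of_pos (by positivity), ← sq_abs, ENNReal.ofReal_pow (abs_nonneg s),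
        Real.enorm_eq_ofReal_abs]
    rw [h3, ← ofReal_norm, ← ENNReal.ofReal_pow (norm_nonneg _),
      ← ENNReal.ofReal_mul (by positivity)]
    refine ENNReal.ofReal_le_ofReal ?_
    rw [← div_eq_mul_inv, ← div_eq_mul_inv, div_le_div_iff₀ (by positivity) (by positivity)]
    have h4 : ‖1 - mode s 1‖ ^ 2 ≤ 4 * Real.pi ^ 2 * s ^ 2 := by
      have := pow_le_pow_left₀ (norm_nonneg _) h2 2
      rw [mul_pow, sq_abs] at this
      linarith
    have h5 : ‖1 - mode s 1‖ ^ 2 ≤ 4 := by nlinarith [norm_nonneg (1 - mode s 1)]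
    have h6 : 4 ≤ 4 * Real.pi ^ 2 := by nlinarith [Real.pi_gt_three]
    nlinarith [sq_nonneg s, mul_le_mul_of_nonneg_right h5 (sq_nonneg s),
      mul_le_mul_of_nonneg_right h6 (sq_nonneg s)]
  refine ((lintegral_mono hb).trans_lt ?_).ne
  exact (integrable_inv_one_add_sq.const_mul _).lintegral_lt_top

/-- The continuous function s ↦ 1 - `mode s 1` does not vanish identically: at s = 1/2 it equals 2.
This is needed to cancel the constant later. -/
lemma gagConst_ne_zero : gagConst ≠ 0 := by
  intro h
  unfold gagConst at h
  have hc : Continuous fun s => 1 - mode s 1 :=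
    continuous_const.sub (continuous_mode.comp (Continuous.prodMk_left 1))
  have hg : Measurable fun s => ‖1 - mode s 1‖ₑ ^ 2 * gagKernel s :=
    (hc.measurable.enorm.pow_const 2).mul measurable_gagKernel
  rw [lintegral_eq_zero_iff hg] at h
  have h1 : (fun s => 1 - mode s 1) =ᵐ[volume] fun _ => 0 := by
    filter_upwards [h] with s hs
    have := (mul_eq_zero.1 hs).resolve_right (gagKernel_ne_zero s)
    simpa using this
  have h2 := congrFun ((hc.ae_eq_iff_eq volume continuous_const).1 h1) (1 / 2)
  simp only [mode_eq] at h2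
  have h3 : Complex.I * ((-(2 * Real.pi * (1 / 2 * 1)) : ℝ) : ℂ) = -(Real.pi * Complex.I) := by
    push_cast; ring
  rw [h3, Complex.exp_neg, Complex.exp_pi_mul_I] at h2
  norm_num at h2

/-- Scaling s to sξ: the kernel contributes ξ² and the Jacobian 1/|ξ|. -/
lemma lintegral_mode (ξ : ℝ) :
    ∫⁻ s, ‖1 - mode s ξ‖ₑ ^ 2 * gagKernel s = ‖ξ‖ₑ * gagConst := by
  by_cases hξ : ξ = 0
  · subst hξ
    simp [mode_eq]
  have hc : Continuous fun s => 1 - mode s 1 :=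
    continuous_const.sub (continuous_mode.comp (Continuous.prodMk_left 1))
  have hg : Measurable fun s => ‖1 - mode s 1‖ₑ ^ 2 * gagKernel s :=
    (hc.measurable.enorm.pow_const 2).mul measurable_gagKernel
  have h1 := lintegral_map (μ := volume) hg (measurable_id.mul_const ξ)
  have h2 : Measure.map (fun s : ℝ => id s * ξ) volume = _ := Real.map_volume_mul_right hξ
  rw [h2, lintegral_smul_measure] at h1
  have h3 : ∀ s, ‖1 - mode s ξ‖ₑ ^ 2 * gagKernel s =
      ‖ξ‖ₑ ^ 2 * (‖1 - mode (id s * ξ) 1‖ₑ ^ 2 * gagKernel (id s * ξ)) := fun s => by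
    have e1 : mode (id s * ξ) 1 = mode s ξ := by rw [mode_eq, mode_eq, mul_one]; rfl
    have e2 : gagKernel s = ‖ξ‖ₑ ^ 2 * gagKernel (id s * ξ) := by
      unfold gagKernel
      rw [id, enorm_mul, mul_pow, ENNReal.mul_inv (Or.inr (by finiteness)) (Or.inl (by finiteness)),
        mul_comm _ (‖ξ‖ₑ ^ 2)⁻¹, ← mul_assoc, ENNReal.mul_inv_cancel (by simpa using hξ)
        (by finiteness), one_mul]
    rw [e1, e2]; ring
  simp only [h3]
  have h4 : Measurable fun s => ‖1 - mode (id s * ξ) 1‖ₑ ^ 2 * gagKernel (id s * ξ) :=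
    hg.comp (measurable_id.mul_const ξ)
  rw [lintegral_const_mul _ h4, ← h1]
  unfold gagConst
  rw [smul_eq_mul, ← mul_assoc]
  congr 1
  rw [abs_inv, ENNReal.ofReal_inv_of_pos (abs_pos.2 hξ), ← Real.enorm_eq_ofReal_abs, sq, mul_assoc,
    ENNReal.mul_inv_cancel (by simpa using hξ) enorm_ne_top, mul_one]

variable {Ω : Set (Sp d)}

lemma timeFourier_translate (s : ℝ) (w : Lp (L2 Ω) 2 (volume : Measure ℝ)) :
    timeFourier Ω (translate s w) =ᵐ[volume] fun ξ => mode s ξ • timeFourier Ω w ξ := by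
  have h1 : complexify Ω (translate s w) = translate s (complexify Ω w) :=
    translate_compLp (ofRealL2 Ω) s w
  rw [timeFourier_eq, timeFourier_eq, h1]
  exact fourier_translate s _

/-- For each shift s, Plancherel turns the L² norm of a difference into one with the factor |1 -
`mode s ξ`|². Tonelli then allows integrating over s at fixed ξ. -/
lemma gagliardo_eq_fourier (w : Lp (L2 Ω) 2 (volume : Measure ℝ)) :
    gagliardo w = gagConst * ∫⁻ ξ, ‖ξ‖ₑ * ‖timeFourier Ω w ξ‖ₑ ^ 2 := by
  rw [gagliardo_eq (Lp.stronglyMeasurable w)]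
  have h1 : ∀ s, ∫⁻ x, ‖w x - w (x - s)‖ₑ ^ 2 =
      ∫⁻ ξ, ‖1 - mode s ξ‖ₑ ^ 2 * ‖timeFourier Ω w ξ‖ₑ ^ 2 := fun s => by
    have e1 : ∫⁻ x, ‖w x - w (x - s)‖ₑ ^ 2 = ‖w - translate s w‖ₑ ^ 2 := by
      rw [Lp_enorm_sq]
      refine lintegral_congr_ae ?_
      filter_upwards [Lp.coeFn_sub w (translate s w), translate_ae s w] with x a b
      rw [a, Pi.sub_apply, b]
    have e2 : ‖w - translate s w‖ₑ = ‖timeFourier Ω w - timeFourier Ω (translate s w)‖ₑ := by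
      rw [← map_sub, ← ofReal_norm, ← ofReal_norm, norm_timeFourier]
    rw [e1, e2, Lp_enorm_sq]
    refine lintegral_congr_ae ?_
    filter_upwards [Lp.coeFn_sub (timeFourier Ω w) (timeFourier Ω (translate s w)),
      timeFourier_translate s w] with ξ a b
    rw [a, Pi.sub_apply, b, ← mul_pow, ← enorm_smul, sub_smul, one_smul]
  have hm : Measurable fun p : ℝ × ℝ => ‖1 - mode p.1 p.2‖ₑ ^ 2 :=
    ((continuous_const.sub continuous_mode).measurable.enorm).pow_const 2
  have hw : Measurable fun ξ => ‖timeFourier Ω w ξ‖ₑ ^ 2 :=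
    (Lp.stronglyMeasurable (timeFourier Ω w)).enorm.pow_const 2
  calc ∫⁻ s, (∫⁻ x, ‖w x - w (x - s)‖ₑ ^ 2) * gagKernel s
      = ∫⁻ s, ∫⁻ ξ, ‖1 - mode s ξ‖ₑ ^ 2 * ‖timeFourier Ω w ξ‖ₑ ^ 2 * gagKernel s := by
        refine lintegral_congr fun s => ?_
        rw [h1, lintegral_mul_const]
        exact (hm.comp (measurable_const.prodMk measurable_id)).mul hw
    _ = ∫⁻ ξ, ∫⁻ s, ‖1 - mode s ξ‖ₑ ^ 2 * ‖timeFourier Ω w ξ‖ₑ ^ 2 * gagKernel s := by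
        refine lintegral_lintegral_swap (Measurable.aemeasurable ?_)
        exact (hm.mul (hw.comp measurable_snd)).mul (measurable_gagKernel.comp measurable_fst)
    _ = ∫⁻ ξ, gagConst * (‖ξ‖ₑ * ‖timeFourier Ω w ξ‖ₑ ^ 2) := by
        refine lintegral_congr fun ξ => ?_
        have e : ∀ s, ‖1 - mode s ξ‖ₑ ^ 2 * ‖timeFourier Ω w ξ‖ₑ ^ 2 * gagKernel s =
          ‖1 - mode s ξ‖ₑ ^ 2 * gagKernel s * ‖timeFourier Ω w ξ‖ₑ ^ 2 := fun s => by ring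
        simp only [e]
        rw [lintegral_mul_const, lintegral_mode]
        · ring
        · exact (hm.comp (measurable_id.prodMk measurable_const)).mul measurable_gagKernel
    _ = _ := by
        rw [lintegral_const_mul]
        exact measurable_enorm.mul hw

/-- The even extension of the restriction of an `H^{1/2}` function. -/
lemma IsHalfDensity.evenExt_restr {w : Lp (L2 Ω) 2 (volume : Measure ℝ)}
    {h : Lp (L2C Ω) 2 (volume : Measure ℝ)} (hw : IsHalfDensity Ω w h) :
    ∃ k, IsHalfDensity Ω (evenExt (restr w)) k ∧ ‖k‖ ≤ 3 * ‖h‖ := by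
  set v := evenExt (restr w) with hv
  have hvw : v =ᵐ[volume] fun t => w |t| := by
    have hr := (ae_restrict_iff' measurableSet_Ioi).1 (restr_ae w)
    have h0 : ∀ᵐ t : ℝ, t ≠ 0 := by simp [ae_iff]
    filter_upwards [evenExt_ae' (restr w), hr, ae_neg hr, h0] with t a b c e
    rw [a]
    rcases lt_or_gt_of_ne e with ht | ht
    · have ht' : -t ∈ Ioi (0 : ℝ) := by simpa using ht
      rw [indicator_of_notMem (by simp [ht.le]), indicator_of_mem ht', c ht', zero_add,
        abs_of_neg ht]
    · rw [indicator_of_mem (mem_Ioi.2 ht), indicator_of_notMem (by simp [ht.le]), b ht, add_zero,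
        abs_of_pos ht]
  -- Reflection is controlled in the Gagliardo seminorm; in the Fourier representation the common
  -- constant cancels, being neither zero nor infinite.
  have g1 : gagliardo v ≤ 4 * gagliardo w := by
    rw [gagliardo_congr hvw]; exact gagliardo_comp_abs_le w
  rw [gagliardo_eq_fourier, gagliardo_eq_fourier, mul_left_comm,
    ENNReal.mul_le_mul_iff_right gagConst_ne_zero gagConst_ne_top] at g1
  have g2 : ∫⁻ ξ, ‖ξ‖ₑ * ‖timeFourier Ω w ξ‖ₑ ^ 2 ≤ ‖h‖ₑ ^ 2 := by
    rw [Lp_enorm_sq]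
    refine lintegral_mono_ae ?_
    filter_upwards [hw] with ξ hξ
    rw [hξ, enorm_smul, mul_pow]
    refine mul_le_mul_left ?_ _
    change _ ≤ ‖wt ξ‖ₑ ^ 2
    rw [Real.enorm_eq_ofReal_abs, Real.enorm_eq_ofReal (wt_pos ξ).le,
      ← ENNReal.ofReal_pow (wt_pos ξ).le]
    exact ENNReal.ofReal_le_ofReal (abs_le_wt_sq ξ)
  have g3 : ‖v‖ₑ ^ 2 ≤ 4 * ‖h‖ₑ ^ 2 := by
    have e1 : ‖v‖ ≤ 2 * ‖h‖ := by
      refine (norm_evenExt_le _).trans (mul_le_mul_of_nonneg_left ?_ zero_le_two)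
      refine (norm_Lp_toLp_restrict_le (Ioi (0 : ℝ)) w).trans ?_
      rw [← norm_timeFourier]
      refine Lp.norm_le_norm_of_ae_le ?_
      filter_upwards [hw] with ξ hξ
      rw [hξ, norm_smul]
      refine le_mul_of_one_le_left (norm_nonneg _) ?_
      exact (one_le_wt ξ).trans (le_abs_self _)
    have e2 : ‖v‖ₑ ≤ 2 * ‖h‖ₑ := by
      rw [← ofReal_norm, ← ofReal_norm]
      refine (ENNReal.ofReal_le_ofReal e1).trans_eq ?_
      rw [ENNReal.ofReal_mul zero_le_two]; simp
    calc ‖v‖ₑ ^ 2 ≤ (2 * ‖h‖ₑ) ^ 2 := pow_le_pow_left₀ (zero_le) e2 2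
      _ = _ := by ring
  -- The L² part and the seminorm contribute 4 each; the constant 3 of the statement comes from 8 ≤
  -- 9.
  have g4 : ∫⁻ ξ, ‖wt ξ • timeFourier Ω v ξ‖ₑ ^ 2 ≤ 8 * ‖h‖ₑ ^ 2 := by
    calc ∫⁻ ξ, ‖wt ξ • timeFourier Ω v ξ‖ₑ ^ 2
        ≤ ∫⁻ ξ, (‖timeFourier Ω v ξ‖ₑ ^ 2 + ‖ξ‖ₑ * ‖timeFourier Ω v ξ‖ₑ ^ 2) := by
          refine lintegral_mono fun ξ => ?_
          rw [enorm_smul, mul_pow]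
          refine le_trans (mul_le_mul_left (b := ‖wt ξ‖ₑ ^ 2) (c := 1 + ‖ξ‖ₑ) ?_ _) (by rw [add_mul, one_mul])
          rw [Real.enorm_eq_ofReal (wt_pos ξ).le, Real.enorm_eq_ofReal_abs ξ,
            ← ENNReal.ofReal_pow (wt_pos ξ).le, ← ENNReal.ofReal_one,
            ← ENNReal.ofReal_add zero_le_one (abs_nonneg _)]
          exact ENNReal.ofReal_le_ofReal (wt_sq_le ξ)
      _ = ‖v‖ₑ ^ 2 + ∫⁻ ξ, ‖ξ‖ₑ * ‖timeFourier Ω v ξ‖ₑ ^ 2 := by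
          rw [lintegral_add_left ((Lp.stronglyMeasurable (timeFourier Ω v)).enorm.pow_const 2),
            ← Lp_enorm_sq]
          congr 2
          rw [← ofReal_norm, ← ofReal_norm, norm_timeFourier]
      _ ≤ 4 * ‖h‖ₑ ^ 2 + 4 * ‖h‖ₑ ^ 2 := add_le_add g3 (g1.trans (mul_le_mul_right g2 _))
      _ = 8 * ‖h‖ₑ ^ 2 := by ring
  have hmeas : AEStronglyMeasurable (fun ξ => wt ξ • timeFourier Ω v ξ) volume :=
    continuous_wt.aestronglyMeasurable.smul (Lp.aestronglyMeasurable _)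
  have hm : MemLp (fun ξ => wt ξ • timeFourier Ω v ξ) 2 volume := by
    refine ⟨hmeas, ?_⟩
    have := eLpNorm_nnreal_pow_eq_lintegral (f := fun ξ => wt ξ • timeFourier Ω v ξ)
      (μ := volume) (p := 2) two_ne_zero
    simp only [NNReal.coe_ofNat, ENNReal.rpow_ofNat, ENNReal.coe_ofNat] at this
    rw [← this] at g4
    by_contra hcon
    rw [not_lt, top_le_iff] at hcon
    rw [hcon] at g4
    have h8 : 8 * ‖h‖ₑ ^ 2 < ⊤ := by finiteness
    exact absurd (g4.trans_lt h8) (by simp)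
  refine ⟨hm.toLp _, hm.coeFn_toLp, ?_⟩
  have e3 : ‖hm.toLp _‖ₑ ^ 2 ≤ 8 * ‖h‖ₑ ^ 2 := by
    rw [Lp_enorm_sq]
    refine le_trans (le_of_eq (lintegral_congr_ae ?_)) g4
    filter_upwards [hm.coeFn_toLp] with ξ hξ
    rw [hξ]
  rw [← ofReal_norm, ← ofReal_norm, ← ENNReal.ofReal_pow (norm_nonneg _),
    ← ENNReal.ofReal_pow (norm_nonneg _)] at e3
  have e4 : (8 : ℝ≥0∞) = ENNReal.ofReal 8 := by simp
  rw [e4, ← ENNReal.ofReal_mul (by norm_num), ENNReal.ofReal_le_ofReal_iff (by positivity)] at e3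
  refine abs_le_of_sq_le_sq' ?_ (by positivity) |>.2
  nlinarith [sq_nonneg ‖h‖]

end Gagliardo

/-! ### The Hilbert transform in time -/

section Hilbert

/-- The symbol of the Hilbert transform. -/
def hilbertSymbol (ξ : ℝ) : ℂ := -Complex.I * (SignType.sign ξ : ℂ)

lemma measurable_sign_complex : Measurable fun ξ : ℝ => ((SignType.sign ξ : ℂ)) := by
  have : (fun ξ : ℝ => ((SignType.sign ξ : ℂ))) =
      fun ξ => if 0 < ξ then 1 else if ξ < 0 then -1 else 0 := by
    ext ξ
    rcases lt_trichotomy ξ 0 with h | h | h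
    · simp [h, not_lt.2 h.le]
    · simp [h]
    · simp [h]
  rw [this]
  exact Measurable.ite measurableSet_Ioi measurable_const
    (Measurable.ite measurableSet_Iio measurable_const measurable_const)

lemma norm_sign_complex_le (ξ : ℝ) : ‖(SignType.sign ξ : ℂ)‖ ≤ 1 := by
  rcases lt_trichotomy ξ 0 with h | h | h <;> simp [h]

lemma norm_hilbertSymbol_le (ξ : ℝ) : ‖hilbertSymbol ξ‖ ≤ 1 := by
  unfold hilbertSymbol
  rw [norm_mul, norm_neg, Complex.norm_I, one_mul]
  exact norm_sign_complex_le ξ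

lemma memLp_hilbertSymbol : MemLp hilbertSymbol ⊤ (volume : Measure ℝ) :=
  memLp_top_of_bound (measurable_const.mul measurable_sign_complex).aestronglyMeasurable 1
    (Eventually.of_forall norm_hilbertSymbol_le)

lemma norm_mulL_hilbertSymbol_le {Z : Type*} [NormedAddCommGroup Z] [NormedSpace ℂ Z]
    (F : Lp Z 2 (volume : Measure ℝ)) : ‖mulL hilbertSymbol memLp_hilbertSymbol F‖ ≤ ‖F‖ := by
  refine Lp.norm_le_norm_of_ae_le ?_
  filter_upwards [mulL_ae hilbertSymbol memLp_hilbertSymbol F] with ξ h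
  rw [h, norm_smul]
  exact mul_le_of_le_one_left (norm_nonneg _) (norm_hilbertSymbol_le ξ)

variable {Ω : Set (Sp d)}

lemma isHilbertTransform_iff {v w : Lp (L2 Ω) 2 (volume : Measure ℝ)} :
    IsHilbertTransform Ω v w ↔
      timeFourier Ω w = mulL hilbertSymbol memLp_hilbertSymbol (timeFourier Ω v) := by
  constructor
  · intro h
    refine Lp.ext ?_
    filter_upwards [h, mulL_ae hilbertSymbol memLp_hilbertSymbol (timeFourier Ω v)] with ξ a b
    rw [a, b, hilbertSymbol]
  · intro h
    have := mulL_ae hilbertSymbol memLp_hilbertSymbol (timeFourier Ω v)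
    rw [← h] at this
    exact this

lemma IsHilbertTransform.add {v w v' w' : Lp (L2 Ω) 2 (volume : Measure ℝ)}
    (h : IsHilbertTransform Ω v w) (h' : IsHilbertTransform Ω v' w') :
    IsHilbertTransform Ω (v + v') (w + w') := by
  rw [isHilbertTransform_iff] at *
  rw [map_add, map_add, h, h', map_add]

lemma IsHilbertTransform.sub {v w v' w' : Lp (L2 Ω) 2 (volume : Measure ℝ)}
    (h : IsHilbertTransform Ω v w) (h' : IsHilbertTransform Ω v' w') :
    IsHilbertTransform Ω (v - v') (w - w') := by
  rw [isHilbertTransform_iff] at *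
  rw [map_sub, map_sub, h, h', map_sub]

lemma IsHilbertTransform.smul (c : ℝ) {v w : Lp (L2 Ω) 2 (volume : Measure ℝ)}
    (h : IsHilbertTransform Ω v w) : IsHilbertTransform Ω (c • v) (c • w) := by
  rw [isHilbertTransform_iff] at *
  rw [map_smul, map_smul, h]
  exact (((mulL hilbertSymbol memLp_hilbertSymbol).restrictScalars ℝ).map_smul c _).symm

lemma IsHilbertTransform.norm_le {v w : Lp (L2 Ω) 2 (volume : Measure ℝ)}
    (h : IsHilbertTransform Ω v w) : ‖w‖ ≤ ‖v‖ := by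
  rw [← norm_timeFourier w, ← norm_timeFourier v, isHilbertTransform_iff.1 h]
  exact norm_mulL_hilbertSymbol_le _

/-- The Hilbert transform of a real function is real. -/
lemma exists_scalar_hilbert (f : Lp ℝ 2 (volume : Measure ℝ)) :
    ∃ g : Lp ℝ 2 (volume : Measure ℝ), FT ℂ (Complex.ofRealCLM.compLp g) =
      mulL hilbertSymbol memLp_hilbertSymbol (FT ℂ (Complex.ofRealCLM.compLp f)) := by
  -- Real functions are the fixed points of conjugation, which on the Fourier side is conjugation
  -- combined with reflection. The symbol m satisfies m(-ξ) = conj m(ξ), so multiplication by m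
  -- keeps this symmetry.
  let C : ℂ →SL[starRingEnd ℂ] ℂ := (starL ℂ : ℂ ≃L⋆[ℂ] ℂ)
  have hC : ∀ z, C z = (starRingEnd ℂ) z := fun z => rfl
  set F := Complex.ofRealCLM.compLp f with hF
  set G := (FT ℂ).symm (mulL hilbertSymbol memLp_hilbertSymbol (FT ℂ F)) with hG
  have hG' : FT ℂ G = mulL hilbertSymbol memLp_hilbertSymbol (FT ℂ F) := by
    rw [hG, LinearIsometryEquiv.apply_symm_apply]
  have h1 : C.compLp F = F := by
    refine Lp.ext ?_
    filter_upwards [C.coeFn_compLp F, Complex.ofRealCLM.coeFn_compLp f] with t a b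
    rw [a, hF, b, hC]
    exact Complex.conj_ofReal _
  have h2 := fourier_compLp_conj C F
  rw [h1] at h2
  have h3 : C.compLp G = G := by
    refine (FT ℂ).injective ?_
    rw [fourier_compLp_conj C G, hG']
    refine Lp.ext ?_
    have a1 := C.coeFn_compLp (reflect (mulL hilbertSymbol memLp_hilbertSymbol (FT ℂ F)))
    have a2 := reflect_ae (mulL hilbertSymbol memLp_hilbertSymbol (FT ℂ F))
    have a3 := mulL_ae hilbertSymbol memLp_hilbertSymbol (FT ℂ F)
    have a4 : FT ℂ F =ᵐ[volume] fun ξ => C (FT ℂ F (-ξ)) := by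
      have b1 := C.coeFn_compLp (reflect (FT ℂ F))
      rw [← h2] at b1
      filter_upwards [b1, reflect_ae (FT ℂ F)] with ξ b c
      rw [b, c]
    filter_upwards [a1, a2, ae_neg a3, a3, a4] with ξ b1 b2 b3 b4 b5
    rw [b1, b2, b3, b4, b5, hC, smul_eq_mul, smul_eq_mul, map_mul, ← hC (FT ℂ F (-ξ)), ← b5]
    congr 1
    unfold hilbertSymbol
    rw [Left.sign_neg]
    rcases lt_trichotomy ξ 0 with h | h | h <;> simp [h]
  refine ⟨Complex.reCLM.compLp G, ?_⟩
  have h4 : Complex.ofRealCLM.compLp (Complex.reCLM.compLp G) = G := by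
    refine Lp.ext ?_
    have a1 := C.coeFn_compLp G
    rw [h3] at a1
    filter_upwards [Complex.ofRealCLM.coeFn_compLp (Complex.reCLM.compLp G),
      Complex.reCLM.coeFn_compLp G, a1] with t a b c
    rw [a, b]
    rw [hC] at c
    exact Complex.conj_eq_iff_re.1 c.symm
  rw [h4, hG']

lemma timeFourier_tensor (v : L2 Ω) (g : Lp ℝ 2 (volume : Measure ℝ)) :
    timeFourier Ω ((ContinuousLinearMap.toSpanSingleton ℝ v).compLp g) =
      (ContinuousLinearMap.toSpanSingleton ℂ (ofRealL2 Ω v)).compLp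
        (FT ℂ (Complex.ofRealCLM.compLp g)) := by
  rw [timeFourier_eq, ← fourier_compLp]
  congr 1
  refine Lp.ext ?_
  filter_upwards [(ofRealL2 Ω).coeFn_compLp ((ContinuousLinearMap.toSpanSingleton ℝ v).compLp g),
    (ContinuousLinearMap.toSpanSingleton ℝ v).coeFn_compLp g,
    (ContinuousLinearMap.toSpanSingleton ℂ (ofRealL2 Ω v)).coeFn_compLp
        (Complex.ofRealCLM.compLp g), Complex.ofRealCLM.coeFn_compLp g] with t a b c e
  refine a.trans ?_
  rw [b, c, e]
  simp only [ContinuousLinearMap.toSpanSingleton_apply, map_smul, Complex.ofRealCLM_apply]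
  exact (Complex.coe_smul _ _).symm

/-- A multiplier in time acts only on the scalar factor of a tensor f(t) v. -/
lemma isHilbertTransform_tensor (v : L2 Ω) {f g : Lp ℝ 2 (volume : Measure ℝ)}
    (h : FT ℂ (Complex.ofRealCLM.compLp g) =
      mulL hilbertSymbol memLp_hilbertSymbol (FT ℂ (Complex.ofRealCLM.compLp f))) :
    IsHilbertTransform Ω ((ContinuousLinearMap.toSpanSingleton ℝ v).compLp f)
      ((ContinuousLinearMap.toSpanSingleton ℝ v).compLp g) := by
  rw [isHilbertTransform_iff, timeFourier_tensor, timeFourier_tensor, h]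
  refine Lp.ext ?_
  set S := ContinuousLinearMap.toSpanSingleton ℂ (ofRealL2 Ω v)
  set F := FT ℂ (Complex.ofRealCLM.compLp f)
  filter_upwards [S.coeFn_compLp (mulL hilbertSymbol memLp_hilbertSymbol F),
    mulL_ae hilbertSymbol memLp_hilbertSymbol F, S.coeFn_compLp F,
    mulL_ae hilbertSymbol memLp_hilbertSymbol (S.compLp F)] with t a b c e
  rw [a, b, e, c, map_smul]

/-! ### The Hilbert transform with values in a space described by L² coordinates. -/

section Family

variable {Y : Type*} [NormedAddCommGroup Y] [InnerProductSpace ℝ Y] [CompleteSpace Y]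
  {ι : Type*} [Fintype ι] (L : ι → Y →L[ℝ] L2 Ω)

lemma norm_compLp_sq {X : Type*} [MeasurableSpace X] {μ : Measure X} {Z : Type*}
    [NormedAddCommGroup Z] [NormedSpace ℝ Z]
    (P : Y →L[ℝ] Z) (s : Finset ι) (hP : ∀ y, ‖P y‖ ^ 2 = ∑ i ∈ s, ‖L i y‖ ^ 2) (f : Lp Y 2 μ) :
    ‖P.compLp f‖ ^ 2 = ∑ i ∈ s, ‖(L i).compLp f‖ ^ 2 := by
  rw [Lp_norm_sq, Finset.sum_congr rfl fun i _ => Lp_norm_sq ((L i).compLp f),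
    ← integral_finsetSum _ fun i _ => Lp_integrable_sq _]
  refine integral_congr_ae ?_
  have h : ∀ᵐ x ∂μ, ∀ i ∈ s, (L i).compLp f x = L i (f x) := by
    rw [Finset.eventually_all]
    exact fun i _ => (L i).coeFn_compLp f
  filter_upwards [P.coeFn_compLp f, h] with x a b
  simp only [a, hP]
  exact Finset.sum_congr rfl fun i hi => by rw [b i hi]

/-- Each coordinate is contracted in L². Summing over a subset of the coordinates bounds a part of
the norm separately, such as the gradient. -/
lemma norm_compLp_le_of_hilbert {Z : Type*} [NormedAddCommGroup Z] [NormedSpace ℝ Z]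
    (P : Y →L[ℝ] Z) (s : Finset ι) (hP : ∀ y, ‖P y‖ ^ 2 = ∑ i ∈ s, ‖L i y‖ ^ 2)
    {f g : Lp Y 2 (volume : Measure ℝ)}
    (h : ∀ i, IsHilbertTransform Ω ((L i).compLp f) ((L i).compLp g)) :
    ‖P.compLp g‖ ≤ ‖P.compLp f‖ := by
  refine abs_le_of_sq_le_sq' ?_ (norm_nonneg _) |>.2
  rw [norm_compLp_sq L P s hP, norm_compLp_sq L P s hP]
  exact Finset.sum_le_sum fun i _ => pow_le_pow_left₀ (norm_nonneg _) (h i).norm_le 2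

variable (hL : ∀ y, ‖y‖ ^ 2 = ∑ i, ‖L i y‖ ^ 2)
include hL

lemma norm_le_of_hilbert {f g : Lp Y 2 (volume : Measure ℝ)}
    (h : ∀ i, IsHilbertTransform Ω ((L i).compLp f) ((L i).compLp g)) : ‖g‖ ≤ ‖f‖ := by
  have h1 := norm_compLp_le_of_hilbert L (ContinuousLinearMap.id ℝ Y) Finset.univ hL h
  have h2 : ∀ f : Lp Y 2 (volume : Measure ℝ), (ContinuousLinearMap.id ℝ Y).compLp f = f := by
    intro f
    refine Lp.ext ?_
    filter_upwards [(ContinuousLinearMap.id ℝ Y).coeFn_compLp f] with t a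
    rw [a]; rfl
  rwa [h2, h2] at h1

/-- On simple tensors the scalar transform is used, and sums are immediate. For limits, contraction
makes the transforms of an approximating sequence a Cauchy sequence. -/
lemma exists_hilbert (f : Lp Y 2 (volume : Measure ℝ)) :
    ∃ g, ∀ i, IsHilbertTransform Ω ((L i).compLp f) ((L i).compLp g) := by
  have hsub : ∀ i (a b : Lp Y 2 (volume : Measure ℝ)),
      (L i).compLp (a - b) = (L i).compLp a - (L i).compLp b := fun i a b =>
    map_sub ((L i).compLpL 2 volume) a b
  have hadd : ∀ i (a b : Lp Y 2 (volume : Measure ℝ)),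
      (L i).compLp (a + b) = (L i).compLp a + (L i).compLp b := fun i a b =>
    map_add ((L i).compLpL 2 volume) a b
  refine Lp.induction (p := 2) (by norm_num) (motive := fun f => ∃ g, ∀ i,
    IsHilbertTransform Ω ((L i).compLp f) ((L i).compLp g)) ?_ ?_ ?_ f
  · intro c s hs hμ
    obtain ⟨g, hg⟩ := exists_scalar_hilbert (indicatorConstLp 2 hs hμ.ne (1 : ℝ))
    refine ⟨(ContinuousLinearMap.toSpanSingleton ℝ c).compLp g, fun i => ?_⟩
    have h := isHilbertTransform_tensor (L i c) hg
    have e1 : ∀ k : Lp ℝ 2 (volume : Measure ℝ),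
        (L i).compLp ((ContinuousLinearMap.toSpanSingleton ℝ c).compLp k) =
          (ContinuousLinearMap.toSpanSingleton ℝ (L i c)).compLp k := fun k => by
      refine Lp.ext ?_
      filter_upwards [(L i).coeFn_compLp ((ContinuousLinearMap.toSpanSingleton ℝ c).compLp k),
        (ContinuousLinearMap.toSpanSingleton ℝ c).coeFn_compLp k,
        (ContinuousLinearMap.toSpanSingleton ℝ (L i c)).coeFn_compLp k] with t a b e
      rw [a, b, e]
      simp
    have e2 : (Lp.simpleFunc.indicatorConst 2 hs hμ.ne c : Lp Y 2 (volume : Measure ℝ)) =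
        (ContinuousLinearMap.toSpanSingleton ℝ c).compLp (indicatorConstLp 2 hs hμ.ne (1 : ℝ)) := by
      rw [Lp.simpleFunc.coe_indicatorConst]
      refine Lp.ext ?_
      filter_upwards [indicatorConstLp_coeFn (p := 2) (hs := hs) (hμs := hμ.ne) (c := c),
        indicatorConstLp_coeFn (p := 2) (hs := hs) (hμs := hμ.ne) (c := (1 : ℝ)),
        (ContinuousLinearMap.toSpanSingleton ℝ c).coeFn_compLp
          (indicatorConstLp 2 hs hμ.ne (1 : ℝ))] with t a b e
      rw [a, e, b]
      by_cases ht : t ∈ s <;> simp [ht]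
    rw [e2, e1, e1]
    exact h
  · rintro f g hf hg - ⟨f', hf'⟩ ⟨g', hg'⟩
    exact ⟨f' + g', fun i => by rw [hadd, hadd]; exact (hf' i).add (hg' i)⟩
  · refine isClosed_of_closure_subset fun f hf => ?_
    obtain ⟨a, ha, hlim⟩ := mem_closure_iff_seq_limit.1 hf
    choose b hb using ha
    have hdist : ∀ m n, dist (b m) (b n) ≤ dist (a m) (a n) := fun m n => by
      rw [dist_eq_norm, dist_eq_norm]
      refine norm_le_of_hilbert L hL fun i => ?_
      rw [hsub, hsub]
      exact (hb m i).sub (hb n i)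
    have hcauchy : CauchySeq b := by
      rw [Metric.cauchySeq_iff]
      intro ε hε
      obtain ⟨N, hN⟩ := Metric.cauchySeq_iff.1 hlim.cauchySeq ε hε
      exact ⟨N, fun m hm n hn => (hdist m n).trans_lt (hN m hm n hn)⟩
    obtain ⟨g, hg⟩ := cauchySeq_tendsto_of_complete hcauchy
    refine ⟨g, fun i => ?_⟩
    rw [isHilbertTransform_iff]
    have t1 : Tendsto (fun n => timeFourier Ω ((L i).compLp (b n))) atTop
        (𝓝 (timeFourier Ω ((L i).compLp g))) :=
      (continuous_timeFourier.tendsto _).comp ((((L i).compLpL 2 volume).continuous.tendsto _).comp hg)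
    have t2 : Tendsto (fun n => mulL hilbertSymbol memLp_hilbertSymbol
        (timeFourier Ω ((L i).compLp (a n)))) atTop
        (𝓝 (mulL hilbertSymbol memLp_hilbertSymbol (timeFourier Ω ((L i).compLp f)))) :=
      ((mulL hilbertSymbol memLp_hilbertSymbol).continuous.tendsto _).comp
        ((continuous_timeFourier.tendsto _).comp
          ((((L i).compLpL 2 volume).continuous.tendsto _).comp hlim))
    refine tendsto_nhds_unique (t1.congr fun n => ?_) t2
    exact isHilbertTransform_iff.1 (hb n i)

/-- The Hilbert transform in time of functions with values in a Hilbert space that is described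
by finitely many coordinates in `L²(Ω)`. -/
lemma exists_hilbertL : ∃ H : Lp Y 2 (volume : Measure ℝ) →L[ℝ] Lp Y 2 (volume : Measure ℝ),
    ∀ f i, IsHilbertTransform Ω ((L i).compLp f) ((L i).compLp (H f)) := by
  choose H hH using exists_hilbert L hL
  -- The difference of two transforms of f is a transform of f - f = 0, so contraction gives
  -- uniqueness and thereby linearity of the chosen transform.
  have huniq : ∀ f g, (∀ i, IsHilbertTransform Ω ((L i).compLp f) ((L i).compLp g)) → g = H f := by
    intro f g hg
    have : ‖g - H f‖ ≤ ‖f - f‖ := norm_le_of_hilbert L hL fun i => by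
      have h1 := map_sub ((L i).compLpL 2 (volume : Measure ℝ)) g (H f)
      have h2 := map_sub ((L i).compLpL 2 (volume : Measure ℝ)) f f
      have h3 := (hg i).sub (hH f i)
      exact (congrArg₂ (IsHilbertTransform Ω) h2 h1).mpr h3
    rw [sub_self, norm_zero] at this
    exact sub_eq_zero.1 (norm_le_zero_iff.1 this)
  let H₀ : Lp Y 2 (volume : Measure ℝ) →ₗ[ℝ] Lp Y 2 (volume : Measure ℝ) :=
    { toFun := H
      map_add' := fun f g => (huniq _ _ fun i => by
        have h1 := map_add ((L i).compLpL 2 (volume : Measure ℝ)) (H f) (H g)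
        have h2 := map_add ((L i).compLpL 2 (volume : Measure ℝ)) f g
        exact (congrArg₂ (IsHilbertTransform Ω) h2 h1).mpr ((hH f i).add (hH g i))).symm
      map_smul' := fun c f => (huniq _ _ fun i => by
        have h1 := map_smul ((L i).compLpL 2 (volume : Measure ℝ)) c (H f)
        have h2 := map_smul ((L i).compLpL 2 (volume : Measure ℝ)) c f
        exact (congrArg₂ (IsHilbertTransform Ω) h2 h1).mpr ((hH f i).smul c)).symm }
  exact ⟨H₀.mkContinuous 1 fun f => by
    rw [one_mul]; exact norm_le_of_hilbert L hL (hH f), hH⟩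

end Family

/-- The function and the components of its gradient. -/
def H1.coord (Ω : Set (Sp d)) : Option (Fin d) → H1 Ω →L[ℝ] L2 Ω
  | none => H1.toL2 Ω
  | some j => ((EuclideanSpace.proj j : Sp d →L[ℝ] ℝ).compLpL 2 (volume.restrict Ω)).comp (H1.grad Ω)

lemma H1.norm_grad_sq (v : H1 Ω) :
    ‖H1.grad Ω v‖ ^ 2 = ∑ i ∈ Finset.univ.erase none, ‖H1.coord Ω i v‖ ^ 2 := by
  have h1 : ∑ i ∈ Finset.univ.erase none, ‖H1.coord Ω i v‖ ^ 2 =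
      ∑ j : Fin d, ‖H1.coord Ω (some j) v‖ ^ 2 := by
    have := Finset.sum_erase_eq_sub (f := fun i => ‖H1.coord Ω i v‖ ^ 2) (Finset.mem_univ none)
    rw [this, Fintype.sum_option]
    ring
  rw [h1]
  simp only [Lp_norm_sq]
  rw [← integral_finsetSum _ fun i _ => Lp_integrable_sq _]
  refine integral_congr_ae ?_
  have h : ∀ᵐ x ∂volume.restrict Ω, ∀ j : Fin d, H1.coord Ω (some j) v x = H1.grad Ω v x j := by
    rw [ae_all_iff]
    exact fun j => (EuclideanSpace.proj j : Sp d →L[ℝ] ℝ).coeFn_compLpL (H1.grad Ω v)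
  filter_upwards [h] with x hx
  simp only [hx, EuclideanSpace.norm_sq_eq]

lemma H1.norm_sq_coord (v : H1 Ω) : ‖v‖ ^ 2 = ∑ i, ‖H1.coord Ω i v‖ ^ 2 := by
  rw [H1.norm_sq, H1.norm_grad_sq, Finset.sum_erase_eq_sub (Finset.mem_univ none)]
  simp only [H1.coord]
  ring

end Hilbert

/-! ### Rotated Hilbert transforms and coercivity -/

section Rotated

variable {U : Set (Sp d)} {V : Submodule ℝ (H1 U)}

/-- The time form as a functional of the half density of its first argument. -/
def timeFormL (l : Lp (L2C U) 2 (volume : Measure ℝ)) :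
    Lp (L2C U) 2 (volume : Measure ℝ) →L[ℝ] ℝ :=
  ((realInnerL (Lp (L2C U) 2 (volume : Measure ℝ))).flip l).comp
    ((mulL timeSymbol memLp_timeSymbol).restrictScalars ℝ)

lemma timeFormL_apply (k l : Lp (L2C U) 2 (volume : Measure ℝ)) :
    timeFormL l k = timeForm U k l := rfl

/-- The half density as a bounded operator. -/
def densL (V : Submodule ℝ (H1 U)) : Trial U V →L[ℝ] Lp (L2C U) 2 (volume : Measure ℝ) :=
  (WithLp.sndL 2 ℝ (Lp (H1 U) 2 volPos) (Lp (L2C U) 2 (volume : Measure ℝ))).comp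
    (Trial U V).subtypeL

lemma densL_apply (u : Trial U V) : densL V u = dens u := rfl

/-- The derivative of the smooth trial function lives on t > 0, where w vanishes. -/
lemma timeForm_eq_zero_of_represents (hU : Bornology.IsBounded U) (hUo : IsOpen U)
    {u : Trial U (⊤ : Submodule ℝ (H1 U))} {φ : ℝ → Sp d → ℝ} (hφ : φ ∈ smoothUpTo d)
    (hu : Represents u φ)
    {w : Lp (L2 U) 2 (volume : Measure ℝ)} {l : Lp (L2C U) 2 (volume : Measure ℝ)}
    (hl : IsHalfDensity U w l) (hw : restr w = 0) : timeForm U (dens u) l = 0 := by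
  obtain ⟨h, a, b, ha, hab⟩ := hφ
  have hc : ∃ a b : ℝ, ∀ t, t ∉ Icc a b → ∀ x, φ t x = 0 := ⟨a, b, hab⟩
  have h0 : ∀ t ≤ 0, ∀ x, φ t x = 0 := fun t ht => hab t fun h => by linarith [h.1]
  have hUm := hUo.measurableSet
  obtain ⟨u', hu', hu'', -⟩ := exists_element hU hUm h hc (E := zeroExt) (V := ⊤)
    (fun _ => trivial) (zeroExt_restr_slice hU hUm h hc h0)
  have e : u = u' := hu.unique hUo (represents_of_fn_eq hU hUm h hc hu')
  have hk := isHalfDensity_dens u'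
  rw [hu''] at hk
  rw [e, (isC1c_slice hU hUm h hc).timeForm_eq hk hl, L2.inner_def]
  refine integral_eq_zero_of_ae ?_
  have hw0 : ∀ᵐ t : ℝ, t ∈ Ioi (0 : ℝ) → w t = 0 := by
    rw [← ae_restrict_iff' measurableSet_Ioi]
    filter_upwards [restr_ae w, Lp.coeFn_zero (L2 U) 2 volPos] with t a b
    rw [← a, hw, b, Pi.zero_apply]
  filter_upwards [hw0, (isC1c_slice hU hUm h hc).memLp'.coeFn_toLp] with t a b
  rcases le_or_gt t 0 with ht | ht
  · have : (isC1c_slice hU hUm h hc).derivLp t = 0 :=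
      b.trans (slice_eq_zero hU hUm _ fun x => dt_eq_zero h h0 ht x)
    rw [this, inner_zero_left, Pi.zero_apply]
  · rw [a ht, inner_zero_right, Pi.zero_apply]

/-- The time form is continuous in the half density of the trial function, so vanishing on smooth
functions extends by density. -/
lemma timeFormL_comp_densL (hU : IsLipschitzDomain U)
    {w : Lp (L2 U) 2 (volume : Measure ℝ)} {l : Lp (L2C U) 2 (volume : Measure ℝ)}
    (hl : IsHalfDensity U w l) (hw : restr w = 0) :
    (timeFormL l).comp (densL (⊤ : Submodule ℝ (H1 U))) = 0 := by
  refine ContinuousLinearMap.ext_on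
    (s := {u : Trial U (⊤ : Submodule ℝ (H1 U)) | ∃ φ ∈ smoothUpTo d, Represents u φ})
    (fun u => mem_smoothSpan_trial_top hU u) ?_
  rintro u ⟨φ, hφ, hu⟩
  rw [ContinuousLinearMap.comp_apply, densL_apply, timeFormL_apply]
  exact timeForm_eq_zero_of_represents hU.isBounded hU.isOpen hφ hu hl hw

lemma coe_toFull (u : Trial U V) : ((toFull u : Trial U ⊤) : Ambient U) = u :=
  Submodule.coe_inclusion _ u

lemma dens_toFull (u : Trial U V) : dens (toFull u) = dens u := by
  unfold dens
  rw [coe_toFull]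

/-- The time form depends only on the values of the test function for positive times. -/
lemma timeForm_eq_zero (hU : IsLipschitzDomain U) (u : Trial U V)
    {w : Lp (L2 U) 2 (volume : Measure ℝ)} {l : Lp (L2C U) 2 (volume : Measure ℝ)}
    (hl : IsHalfDensity U w l) (hw : restr w = 0) : timeForm U (dens u) l = 0 := by
  have h := DFunLike.congr_fun (timeFormL_comp_densL hU hl hw) (toFull u)
  rwa [ContinuousLinearMap.comp_apply, densL_apply, timeFormL_apply,
    zero_apply, dens_toFull] at h

/-- The symbol of `cos θ - sin θ ℋ`. -/
def rotSymbol (θ ξ : ℝ) : ℂ := (Real.cos θ : ℂ) - (Real.sin θ : ℂ) * hilbertSymbol ξ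

lemma memLp_rotSymbol (θ : ℝ) : MemLp (rotSymbol θ) ⊤ (volume : Measure ℝ) := by
  refine memLp_top_of_bound (C := 2) ?_ (Eventually.of_forall fun ξ => ?_)
  · exact (measurable_const.sub (measurable_const.mul
      (measurable_const.mul measurable_sign_complex))).aestronglyMeasurable
  · refine (norm_sub_le _ _).trans ?_
    rw [norm_mul, Complex.norm_real, Complex.norm_real, Real.norm_eq_abs, Real.norm_eq_abs]
    nlinarith [Real.abs_cos_le_one θ, Real.abs_sin_le_one θ, norm_hilbertSymbol_le ξ,
      abs_nonneg (Real.sin θ), norm_nonneg (hilbertSymbol ξ)]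

lemma IsHalfDensity.rotated {θ : ℝ} {v w : Lp (L2 U) 2 (volume : Measure ℝ)}
    {h : Lp (L2C U) 2 (volume : Measure ℝ)} (hv : IsHalfDensity U v h)
    (hw : IsHilbertTransform U v w) :
    IsHalfDensity U (Real.cos θ • v - Real.sin θ • w)
      (mulL (rotSymbol θ) (memLp_rotSymbol θ) h) := by
  unfold IsHalfDensity
  rw [map_sub, map_smul, map_smul]
  filter_upwards [hv, hw, mulL_ae (rotSymbol θ) (memLp_rotSymbol θ) h,
    Lp.coeFn_sub (Real.cos θ • timeFourier U v) (Real.sin θ • timeFourier U w),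
    Lp.coeFn_smul (Real.cos θ) (timeFourier U v), Lp.coeFn_smul (Real.sin θ) (timeFourier U w)]
    with ξ a b c e f g
  rw [c, e, Pi.sub_apply, f, g, Pi.smul_apply, Pi.smul_apply, a, b, rotSymbol, hilbertSymbol]
  set z := timeFourier U v ξ
  have e1 : ∀ r : ℝ, r • z = (r : ℂ) • z := fun r => (Complex.coe_smul r z).symm
  have e2 : ∀ (r : ℝ) (y : L2C U), r • y = (r : ℂ) • y := fun r y => (Complex.coe_smul r y).symm
  change _ • (wt ξ • z) = wt ξ • (_ • z - _ • _)
  simp only [e2, smul_smul, ← sub_smul]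
  congr 1
  ring

/-- The weight `|ξ| / (1 + ξ²)^{1/2}`. -/
def absSymbol (ξ : ℝ) : ℝ := |ξ| / wt ξ ^ 2

lemma absSymbol_nonneg (ξ : ℝ) : 0 ≤ absSymbol ξ :=
  div_nonneg (abs_nonneg _) (sq_nonneg _)

lemma integrable_absSymbol (h : Lp (L2C U) 2 (volume : Measure ℝ)) :
    Integrable (fun ξ => absSymbol ξ * ‖h ξ‖ ^ 2) := by
  refine (Lp_integrable_sq h).bdd_mul (c := 1) ?_ (Eventually.of_forall fun ξ => ?_)
  · refine Continuous.aestronglyMeasurable ?_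
    exact continuous_abs.div (continuous_wt.pow 2) fun ξ => (pow_pos (wt_pos ξ) 2).ne'
  · rw [Real.norm_of_nonneg (absSymbol_nonneg ξ)]
    exact div_le_one_of_le₀ (abs_le_wt_sq ξ) (sq_nonneg _)

/-- The conjugate of the time symbol times cos θ + i sin θ sgn ξ has the real part 2π sin θ |ξ| /
`wt ξ`²; the cosine term is purely imaginary and drops out. -/
lemma timeForm_rotSymbol (θ : ℝ) (h : Lp (L2C U) 2 (volume : Measure ℝ)) :
    timeForm U h (mulL (rotSymbol θ) (memLp_rotSymbol θ) h) =
      2 * Real.pi * Real.sin θ * ∫ ξ, absSymbol ξ * ‖h ξ‖ ^ 2 := by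
  rw [timeForm, L2.inner_def, ← integral_const_mul]
  refine integral_congr_ae ?_
  filter_upwards [mulL_ae timeSymbol memLp_timeSymbol h,
    mulL_ae (rotSymbol θ) (memLp_rotSymbol θ) h] with ξ a b
  rw [a, b, real_inner_eq_re, inner_smul_left, inner_smul_right, inner_self_eq_norm_sq_to_K,
    rotSymbol, hilbertSymbol, timeSymbol, absSymbol]
  have hs : ξ * (SignType.sign ξ : ℝ) = |ξ| := self_mul_sign ξ
  have hs' : ((SignType.sign ξ : ℂ)) = ((SignType.sign ξ : ℝ) : ℂ) := by
    rcases lt_trichotomy ξ 0 with h | h | h <;> simp [h]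
  rw [hs', ← hs]
  simp only [map_mul, Complex.conj_ofReal, Complex.conj_I]
  have : (((2 * Real.pi * ξ / wt ξ ^ 2 : ℝ) : ℂ) * -Complex.I * (((Real.cos θ : ℂ) - (Real.sin θ : ℂ) *
      (-Complex.I * ((SignType.sign ξ : ℝ) : ℂ))) * ((‖h ξ‖ : ℝ) : ℂ) ^ 2)) =
      ((2 * Real.pi * Real.sin θ * (ξ * (SignType.sign ξ : ℝ) / wt ξ ^ 2 * ‖h ξ‖ ^ 2) : ℝ) : ℂ) +
      ((-(2 * Real.pi * ξ / wt ξ ^ 2) * Real.cos θ * ‖h ξ‖ ^ 2 : ℝ) : ℂ) * Complex.I := by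
    generalize (SignType.sign ξ : ℝ) = s
    simp only [Complex.ofReal_mul, Complex.ofReal_div, Complex.ofReal_pow, Complex.ofReal_neg,
      Complex.ofReal_ofNat]
    linear_combination (-(2 * (Real.pi : ℂ) * (ξ : ℂ) / (wt ξ : ℂ) ^ 2 * (Real.sin θ : ℂ) *
      (s : ℂ) * ((‖h ξ‖ : ℝ) : ℂ) ^ 2) : ℂ) * Complex.I_sq
  refine (congrArg Complex.re this).trans ?_
  rw [Complex.add_re, Complex.ofReal_re, Complex.re_ofReal_mul, Complex.I_re, mul_zero, add_zero]

/-- From `wt ξ`² ≤ 1 + |ξ|: the L² part of the H^{1/2} norm is dominated by the norm in L²(ℝ⁺, H¹),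
and only the seminorm has to come from the time form. -/
lemma norm_dens_sq_le (u : Trial U V) :
    ‖dens u‖ ^ 2 ≤ ‖fn u‖ ^ 2 + ∫ ξ, absSymbol ξ * ‖dens u ξ‖ ^ 2 := by
  have h1 : ‖timeFourier U (zeroExt (embL2 U (fn u)))‖ ≤ ‖fn u‖ := by
    rw [norm_timeFourier, norm_zeroExt]
    refine Lp.norm_le_norm_of_ae_le ?_
    filter_upwards [(H1.toL2 U).coeFn_compLpL (fn u)] with t a
    rw [embL2, a]
    refine abs_le_of_sq_le_sq' ?_ (norm_nonneg _) |>.2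
    rw [H1.norm_sq]
    linarith [sq_nonneg ‖H1.grad U (fn u t)‖]
  refine le_trans ?_ (add_le_add_left (pow_le_pow_left₀ (norm_nonneg _) h1 2) _)
  rw [Lp_norm_sq (dens u), Lp_norm_sq (timeFourier U (zeroExt (embL2 U (fn u)))),
    ← integral_add (Lp_integrable_sq _) (integrable_absSymbol _)]
  refine integral_mono_ae (Lp_integrable_sq _)
    ((Lp_integrable_sq _).add (integrable_absSymbol _)) ?_
  filter_upwards [isHalfDensity_dens u] with ξ a
  have hw := wt_pos ξ
  have e : ‖dens u ξ‖ = wt ξ * ‖timeFourier U (zeroExt (embL2 U (fn u))) ξ‖ := by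
    rw [a, norm_smul]
    exact congrArg (· * _) (Real.norm_of_nonneg hw.le)
  simp only [absSymbol]
  rw [e, mul_pow, ← mul_assoc, div_mul_cancel₀ _ (pow_pos hw 2).ne', ← one_add_mul]
  exact mul_le_mul_of_nonneg_right (wt_sq_le ξ) (sq_nonneg _)

/-- The even extension of v and the unrestricted rotated function agree on ℝ⁺. Their difference is
not seen by the time form, so the second may replace the first, and its half density is an explicit
multiple of that of u. -/
lemma timeForm_of_isRotatedHilbert (hU : IsLipschitzDomain U) {θ : ℝ} {u : Trial U V}
    {v : Test U V} (h : IsRotatedHilbert θ u v) :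
    timeForm U (dens u) (dens v) =
      2 * Real.pi * Real.sin θ * ∫ ξ, absSymbol ξ * ‖dens u ξ‖ ^ 2 := by
  obtain ⟨w, hw, h⟩ := h
  set z := zeroExt (embL2 U (fn u)) with hz
  have h1 := (isHalfDensity_dens u).rotated (θ := θ) hw
  have h2 := (isHalfDensity_dens v).add (h1.smul (-1))
  have h3 := timeForm_eq_zero hU u h2 ?_
  · rw [← timeForm_rotSymbol]
    have h4 : timeForm U (dens u) (dens v +
        (-1 : ℝ) • mulL (rotSymbol θ) (memLp_rotSymbol θ) (dens u)) =
        timeForm U (dens u) (dens v) + -1 * timeForm U (dens u)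
          (mulL (rotSymbol θ) (memLp_rotSymbol θ) (dens u)) :=
      (inner_add_right _ _ _).trans (congrArg _ (real_inner_smul_right _ _ _))
    rw [h4] at h3
    linarith
  · rw [map_add, restr_evenExt, map_smul, map_sub, map_smul, map_smul]
    have : embL2 U (fn v) = Real.cos θ • restr z - Real.sin θ • restr w := by
      refine Lp.ext ?_
      filter_upwards [h, restr_ae z, restr_ae w,
        Lp.coeFn_sub (Real.cos θ • restr z) (Real.sin θ • restr w),
        Lp.coeFn_smul (Real.cos θ) (restr z), Lp.coeFn_smul (Real.sin θ) (restr w)]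
        with t a b c e f g
      rw [a, e, Pi.sub_apply, f, g, Pi.smul_apply, Pi.smul_apply, b, c]
    rw [this, neg_one_smul, add_neg_cancel]

end Rotated

/-! ### The rotated operator on trial functions and coercivity. -/

section RotatedOperator

lemma compLp_comp {X : Type*} [MeasurableSpace X] {μ : Measure X} {Y Z Z' : Type*}
    [NormedAddCommGroup Y] [NormedSpace ℝ Y] [NormedAddCommGroup Z] [NormedSpace ℝ Z]
    [NormedAddCommGroup Z'] [NormedSpace ℝ Z'] (P : Z →L[ℝ] Z') (L : Y →L[ℝ] Z) (f : Lp Y 2 μ) :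
    (P.comp L).compLp f = P.compLp (L.compLp f) := by
  refine Lp.ext ?_
  filter_upwards [(P.comp L).coeFn_compLp f, P.coeFn_compLp (L.compLp f), L.coeFn_compLp f]
    with x a b c
  rw [a, b, c, ContinuousLinearMap.comp_apply]

lemma norm_restr_le {Y : Type*} [NormedAddCommGroup Y] [NormedSpace ℝ Y]
    (f : Lp Y 2 (volume : Measure ℝ)) : ‖restr f‖ ≤ ‖f‖ := by
  rw [Lp.norm_def, Lp.norm_def, eLpNorm_congr_ae (restr_ae f)]
  exact ENNReal.toReal_mono (Lp.eLpNorm_ne_top f) (eLpNorm_restrict_le _ _ _ _)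

variable {U : Set (Sp d)} (V : Submodule ℝ (H1 U)) [CompleteSpace V]

/-- Projection of `L²(ℝ⁺, H¹)` to `L²(ℝ⁺, V)`. -/
def projL : Lp (H1 U) 2 volPos →L[ℝ] Lp V 2 volPos :=
  V.orthogonalProjectionOnto.compLpL 2 volPos

lemma subtypeL_projL (u : Trial U V) : V.subtypeL.compLp (projL V (fn u)) = fn u := by
  refine Lp.ext ?_
  filter_upwards [V.subtypeL.coeFn_compLp (projL V (fn u)),
    V.orthogonalProjectionOnto.coeFn_compLpL (fn u), fn_mem u] with t a b c
  rw [a, projL, b]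
  exact Submodule.starProjection_eq_self_iff.2 c

/-- Extension by zero as a bounded operator. -/
def zeroExtL (Y : Type*) [NormedAddCommGroup Y] [NormedSpace ℝ Y] :
    Lp Y 2 volPos →L[ℝ] Lp Y 2 (volume : Measure ℝ) := ⟨zeroExt, continuous_zeroExt⟩

/-- The operator `R (cos θ - sin θ H) E` on `L²(ℝ⁺, Y)`. -/
def rotL {Y : Type*} [NormedAddCommGroup Y] [NormedSpace ℝ Y] (θ : ℝ)
    (H : Lp Y 2 (volume : Measure ℝ) →L[ℝ] Lp Y 2 (volume : Measure ℝ)) :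
    Lp Y 2 volPos →L[ℝ] Lp Y 2 volPos :=
  restr.comp ((Real.cos θ • ContinuousLinearMap.id ℝ _ - Real.sin θ • H).comp (zeroExtL Y))

lemma rotL_apply {Y : Type*} [NormedAddCommGroup Y] [NormedSpace ℝ Y] (θ : ℝ)
    (H : Lp Y 2 (volume : Measure ℝ) →L[ℝ] Lp Y 2 (volume : Measure ℝ)) (f : Lp Y 2 volPos) :
    rotL θ H f = restr (Real.cos θ • zeroExt f - Real.sin θ • H (zeroExt f)) := rfl

lemma compLp_rotL {Y W : Type*} [NormedAddCommGroup Y] [NormedSpace ℝ Y] [NormedAddCommGroup W]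
    [NormedSpace ℝ W] (θ : ℝ)
    (H : Lp Y 2 (volume : Measure ℝ) →L[ℝ] Lp Y 2 (volume : Measure ℝ)) (P : Y →L[ℝ] W)
    (f : Lp Y 2 volPos) : P.compLp (rotL θ H f) =
      restr (Real.cos θ • zeroExt (P.compLp f) - Real.sin θ • P.compLp (H (zeroExt f))) := by
  rw [rotL_apply, ← restr_compLp, zeroExt_compLp]
  congr 1
  have h2 := map_sub (P.compLpL 2 (volume : Measure ℝ))
    (Real.cos θ • zeroExt f) (Real.sin θ • H (zeroExt f))
  rw [map_smul, map_smul] at h2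
  exact h2

/-- The coordinates of the elements of a subspace of `H¹`. -/
def subCoord (V : Submodule ℝ (H1 U)) (i : Option (Fin d)) : V →L[ℝ] L2 U :=
  (H1.coord U i).comp V.subtypeL

lemma norm_sq_subCoord (v : V) : ‖v‖ ^ 2 = ∑ i, ‖subCoord V i v‖ ^ 2 :=
  H1.norm_sq_coord (v : H1 U)

lemma norm_grad_sq_subCoord (v : V) : ‖(H1.grad U).comp V.subtypeL v‖ ^ 2 =
    ∑ i ∈ Finset.univ.erase none, ‖subCoord V i v‖ ^ 2 :=
  H1.norm_grad_sq (v : H1 U)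

section

variable (θ : ℝ) (H : Lp V 2 (volume : Measure ℝ) →L[ℝ] Lp V 2 (volume : Measure ℝ))

/-- The rotated Hilbert transform `L²(ℝ⁺, V) → L²(ℝ⁺, V) ⊆ L²(ℝ⁺, H¹)`. -/
def rotTrial : Trial U V →L[ℝ] Lp (H1 U) 2 volPos :=
  (V.subtypeL.compLpL 2 volPos).comp ((rotL θ H).comp ((projL V).comp (fnL U zeroExt V)))

lemma rotTrial_apply (u : Trial U V) :
    rotTrial V θ H u = V.subtypeL.compLp (rotL θ H (projL V (fn u))) := rfl

lemma rotTrial_mem (u : Trial U V) : ∀ᵐ t ∂volPos, rotTrial V θ H u t ∈ V := by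
  rw [rotTrial_apply]
  filter_upwards [V.subtypeL.coeFn_compLp (rotL θ H (projL V (fn u)))] with t a
  rw [a]
  exact Subtype.property _

lemma compLp_rotTrial {W : Type*} [NormedAddCommGroup W] [NormedSpace ℝ W] (P : H1 U →L[ℝ] W)
    (u : Trial U V) : P.compLp (rotTrial V θ H u) =
      restr (Real.cos θ • zeroExt (P.compLp (fn u)) -
        Real.sin θ • (P.comp V.subtypeL).compLp (H (zeroExt (projL V (fn u))))) := by
  rw [rotTrial_apply, ← compLp_comp, compLp_rotL, compLp_comp P V.subtypeL (projL V (fn u)),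
    subtypeL_projL]

lemma compLp_rotTrial' {W : Type*} [NormedAddCommGroup W] [NormedSpace ℝ W] (P : H1 U →L[ℝ] W)
    (u : Trial U V) : P.compLp (rotTrial V θ H u) = Real.cos θ • P.compLp (fn u) -
        Real.sin θ • restr ((P.comp V.subtypeL).compLp (H (zeroExt (projL V (fn u))))) := by
  rw [compLp_rotTrial, map_sub, map_smul, map_smul, restr_zeroExt]

variable {H} (hH : ∀ f i, IsHilbertTransform U ((subCoord V i).compLp f)
  ((subCoord V i).compLp (H f)))
include hH

/-- The coordinate `none` is the embedding into L²(U), so the transform H of V-valued functions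
induces the Hilbert transform on L²(ℝ, L²(U)). -/
lemma isHilbertTransform_projL (u : Trial U V) :
    IsHilbertTransform U (zeroExt (embL2 U (fn u)))
      (((H1.toL2 U).comp V.subtypeL).compLp (H (zeroExt (projL V (fn u))))) := by
  have h1 := hH (zeroExt (projL V (fn u))) none
  have h2 : ((H1.toL2 U).comp V.subtypeL).compLp (zeroExt (projL V (fn u))) =
      zeroExt (embL2 U (fn u)) := by
    rw [← zeroExt_compLp, compLp_comp, subtypeL_projL]
    rfl
  rw [← h2]
  exact h1

/-- The transform acts on each gradient component separately; dropping the coordinate `none` gives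
contraction of the gradient alone. -/
lemma norm_grad_hilbert_le (u : Trial U V) :
    ‖restr (((H1.grad U).comp V.subtypeL).compLp (H (zeroExt (projL V (fn u)))))‖ ≤
      ‖(H1.grad U).compLp (fn u)‖ := by
  refine (norm_restr_le _).trans ?_
  refine (norm_compLp_le_of_hilbert (subCoord V) ((H1.grad U).comp V.subtypeL)
    (Finset.univ.erase none) (norm_grad_sq_subCoord V) (hH (zeroExt (projL V (fn u))))).trans ?_
  rw [← zeroExt_compLp, norm_zeroExt, compLp_comp, subtypeL_projL]

/-- Rotation multiplies the half density by a bounded symbol. Restriction to ℝ⁺ followed by even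
extension costs the factor 3. -/
lemma exists_halfDensity_rotTrial (u : Trial U V) :
    ∃ k, IsHalfDensity U (evenExt (embL2 U (rotTrial V θ H u))) k ∧
      ‖k‖ ≤ (3 * ‖mulL (Z := L2C U) (rotSymbol θ) (memLp_rotSymbol θ)‖) * ‖u‖ := by
  have h2 := (isHalfDensity_dens u).rotated (θ := θ) (isHilbertTransform_projL V hH u)
  obtain ⟨k, hk, hk'⟩ := h2.evenExt_restr
  refine ⟨k, ?_, hk'.trans ?_⟩
  · have h1 := compLp_rotTrial V θ H (H1.toL2 U) u
    have : embL2 U (rotTrial V θ H u) = (H1.toL2 U).compLp (rotTrial V θ H u) := rfl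
    rw [this, h1]
    exact hk
  · rw [mul_assoc]
    refine mul_le_mul_of_nonneg_left ?_ (by norm_num)
    refine (ContinuousLinearMap.le_opNorm _ _).trans ?_
    refine mul_le_mul_of_nonneg_left ?_ (norm_nonneg _)
    refine abs_le_of_sq_le_sq' ?_ (norm_nonneg _) |>.2
    rw [STSpace.norm_sq]
    linarith [sq_nonneg ‖fn u‖]

lemma isRotatedHilbert_rotTrial {u : Trial U V} {v : Test U V} (hv : fn v = rotTrial V θ H u) :
    IsRotatedHilbert θ u v := by
  refine ⟨_, isHilbertTransform_projL V hH u, ?_⟩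
  have h1 := compLp_rotTrial V θ H (H1.toL2 U) u
  rw [← hv] at h1
  set w := ((H1.toL2 U).comp V.subtypeL).compLp (H (zeroExt (projL V (fn u))))
  set z := zeroExt (embL2 U (fn u))
  have h1' : embL2 U (fn v) = restr (Real.cos θ • z - Real.sin θ • w) := h1
  rw [h1']
  filter_upwards [restr_ae (Real.cos θ • z - Real.sin θ • w),
    ae_restrict_of_ae (Lp.coeFn_sub (Real.cos θ • z) (Real.sin θ • w)),
    ae_restrict_of_ae (Lp.coeFn_smul (Real.cos θ) z),
    ae_restrict_of_ae (Lp.coeFn_smul (Real.sin θ) w)] with t a b c e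
  rw [a, b, Pi.sub_apply, c, e, Pi.smul_apply, Pi.smul_apply]

lemma exists_rotTrial_lift :
    ∃ B : Trial U V →L[ℝ] Test U V, ∀ u, fn (B u) = rotTrial V θ H u :=
  exists_lift (X := Trial U V) (E := evenExt) (V := V) (rotTrial V θ H)
    (3 * ‖mulL (Z := L2C U) (rotSymbol θ) (memLp_rotSymbol θ)‖) (rotTrial_mem V θ H)
    (exists_halfDensity_rotTrial V θ hH)

end

lemma exists_hilbertL_subCoord :
    ∃ H : Lp V 2 (volume : Measure ℝ) →L[ℝ] Lp V 2 (volume : Measure ℝ),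
      ∀ f i, IsHilbertTransform U ((subCoord V i).compLp f) ((subCoord V i).compLp (H f)) :=
  exists_hilbertL (Y := V) (subCoord V) (norm_sq_subCoord V)

lemma grad_of_fn_eq {θ : ℝ} {H : Lp V 2 (volume : Measure ℝ) →L[ℝ] Lp V 2 (volume : Measure ℝ)}
    {u : Trial U V} {v : Test U V} (hv : fn v = rotTrial V θ H u) :
    (H1.grad U).compLp (fn v) = Real.cos θ • (H1.grad U).compLp (fn u) -
      Real.sin θ • restr (((H1.grad U).comp V.subtypeL).compLp (H (zeroExt (projL V (fn u))))) := by
  rw [← compLp_rotTrial']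
  exact congrArg (H1.grad U).compLp hv

/-- Here k is the gradient of the restricted Hilbert transform; coercivity uses only its bound. -/
lemma exists_rotated (θ : ℝ) : ∃ B : Trial U V →L[ℝ] Test U V, ∀ u, IsRotatedHilbert θ u (B u) ∧
    ∃ k : Lp (Lp (Sp d) 2 (volume.restrict U)) 2 volPos,
      ‖k‖ ≤ ‖(H1.grad U).compLp (fn u)‖ ∧
      (H1.grad U).compLp (fn (B u)) =
        Real.cos θ • (H1.grad U).compLp (fn u) - Real.sin θ • k := by
  have h1 := exists_hilbertL_subCoord V
  cases h1 with | intro H hH =>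
  have h2 := exists_rotTrial_lift V θ (H := H) hH
  cases h2 with | intro B hB =>
  refine ⟨B, fun u => ?_⟩
  have h3 := isRotatedHilbert_rotTrial V θ (H := H) hH (u := u) (v := B u) (hB u)
  have h4 := grad_of_fn_eq V (θ := θ) (H := H) (u := u) (v := B u) (hB u)
  have h5 := norm_grad_hilbert_le V (H := H) hH u
  exact ⟨h3, _, h5, h4⟩

variable {V}

lemma fn_eq_of_isRotatedHilbert_zero (hUo : IsOpen U) {u : Trial U V} {v : Test U V}
    (h : IsRotatedHilbert 0 u v) : fn v = fn u := by
  obtain ⟨w, -, h⟩ := h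
  refine Lp.ext ?_
  filter_upwards [h, ae_restrict_of_ae (zeroExt_ae (embL2 U (fn u))),
    ae_restrict_mem measurableSet_Ioi, (H1.toL2 U).coeFn_compLpL (fn u),
    (H1.toL2 U).coeFn_compLpL (fn v)] with t a b c e f
  refine H1.toL2_injective hUo ?_
  rw [← f, ← e]
  refine a.trans ?_
  rw [Real.cos_zero, Real.sin_zero, one_smul, zero_smul, sub_zero, b, indicator_of_mem c]
  rfl

variable {α : Sp d → ℝ} (hα : MemLp α ⊤ (volume.restrict U))

lemma norm_flux_le (f : Lp (H1 U) 2 volPos) : ‖(flux hα).compLp f‖ ≤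
    ‖mulL (Z := Sp d) α hα‖ * ‖(H1.grad U).compLp f‖ := by
  refine Lp.norm_le_mul_norm_of_ae_le_mul ?_
  filter_upwards [(flux hα).coeFn_compLp f, (H1.grad U).coeFn_compLp f] with t a b
  rw [a, b]
  exact (mulL (Z := Sp d) α hα).le_opNorm _

lemma le_inner_flux_apply {c₀ : ℝ} (hc : ∀ᵐ x ∂(volume.restrict U), c₀ ≤ α x) (v : H1 U) :
    c₀ * ‖H1.grad U v‖ ^ 2 ≤ ⟪flux hα v, H1.grad U v⟫ := by
  rw [Lp_norm_sq (H1.grad U v), L2.inner_def, ← integral_const_mul]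
  refine integral_mono_ae ((Lp_integrable_sq _).const_mul _) (L2.integrable_inner (𝕜 := ℝ) _ _) ?_
  filter_upwards [mulL_ae α hα (H1.grad U v), hc] with x a b
  have : flux hα v x = α x • H1.grad U v x := a
  rw [this, real_inner_smul_left, real_inner_self_eq_norm_sq]
  exact mul_le_mul_of_nonneg_right b (sq_nonneg _)

lemma mul_norm_sq_le_inner_of_ae {X E : Type*} [MeasurableSpace X] {μ : Measure X}
    [NormedAddCommGroup E] [InnerProductSpace ℝ E] {c : ℝ} {f g : Lp E 2 μ}
    (h : ∀ᵐ x ∂μ, c * ‖g x‖ ^ 2 ≤ ⟪f x, g x⟫) : c * ‖g‖ ^ 2 ≤ ⟪f, g⟫ := by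
  rw [Lp_norm_sq g, L2.inner_def, ← integral_const_mul]
  exact integral_mono_ae ((Lp_integrable_sq _).const_mul _) (L2.integrable_inner (𝕜 := ℝ) _ _) h

lemma le_inner_flux {c₀ : ℝ} (hc : ∀ᵐ x ∂(volume.restrict U), c₀ ≤ α x)
    (f : Lp (H1 U) 2 volPos) : c₀ * ‖(H1.grad U).compLp f‖ ^ 2 ≤
      ⟪(flux hα).compLp f, (H1.grad U).compLp f⟫ := by
  refine mul_norm_sq_le_inner_of_ae ?_
  filter_upwards [(flux hα).coeFn_compLp f, (H1.grad U).coeFn_compLp f] with t a b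
  rw [a, b]
  exact le_inner_flux_apply hα hc _

/-- The unrotated part keeps the lower bound c₀; by Cauchy–Schwarz the rotated part costs at most M.
-/
lemma le_inner_rotated {E : Type*} [NormedAddCommGroup E] [InnerProductSpace ℝ E] {a g k : E}
    {c₀ M r s : ℝ} (hr : 0 ≤ r) (hs : 0 ≤ s) (h1 : c₀ * ‖g‖ ^ 2 ≤ ⟪a, g⟫) (h2 : ‖a‖ ≤ M * ‖g‖)
    (hk : ‖k‖ ≤ ‖g‖) : (r * c₀ - s * M) * ‖g‖ ^ 2 ≤ ⟪a, r • g - s • k⟫ := by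
  rw [inner_sub_right, real_inner_smul_right, real_inner_smul_right]
  have h3 : ⟪a, k⟫ ≤ M * ‖g‖ ^ 2 := by
    refine (real_inner_le_norm _ _).trans ?_
    refine (mul_le_mul h2 hk (norm_nonneg _) ((norm_nonneg _).trans h2)).trans ?_
    exact le_of_eq (by ring)
  have h4 := mul_le_mul_of_nonneg_left h1 hr
  have h5 := mul_le_mul_of_nonneg_left h3 hs
  linarith

lemma norm_fn_sq_le {P : ℝ} (hP : ∀ v ∈ V, ‖v‖ ^ 2 ≤ P * ‖H1.grad U v‖ ^ 2) (u : Trial U V) :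
    ‖fn u‖ ^ 2 ≤ P * ‖(H1.grad U).compLp (fn u)‖ ^ 2 := by
  rw [Lp_norm_sq (fn u), Lp_norm_sq ((H1.grad U).compLp (fn u)), ← integral_const_mul]
  refine integral_mono_ae (Lp_integrable_sq _) ((Lp_integrable_sq _).const_mul _) ?_
  filter_upwards [(H1.grad U).coeFn_compLp (fn u), fn_mem u] with t a b
  rw [a]
  exact hP _ b

lemma le_parabolicForm_rotated (hU : IsLipschitzDomain U) {c₀ θ : ℝ}
    (hc : ∀ᵐ x ∂(volume.restrict U), c₀ ≤ α x) (hcos : 0 ≤ Real.cos θ) (hsin : 0 ≤ Real.sin θ)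
    {u : Trial U V} {v : Test U V}
    (h : IsRotatedHilbert θ u v) {k : Lp (Lp (Sp d) 2 (volume.restrict U)) 2 volPos}
    (hk : ‖k‖ ≤ ‖(H1.grad U).compLp (fn u)‖)
    (hv : (H1.grad U).compLp (fn v) =
        Real.cos θ • (H1.grad U).compLp (fn u) - Real.sin θ • k) :
    2 * Real.pi * Real.sin θ * (∫ ξ, absSymbol ξ * ‖dens u ξ‖ ^ 2) +
      (Real.cos θ * c₀ - Real.sin θ * ‖mulL (Z := Sp d) α hα‖) *
        ‖(H1.grad U).compLp (fn u)‖ ^ 2 ≤ parabolicForm hα V u v := by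
  rw [parabolicForm_apply, timeForm_of_isRotatedHilbert hU h]
  refine add_le_add le_rfl ?_
  have h1 := le_inner_rotated hcos hsin (le_inner_flux hα hc (fn u)) (norm_flux_le hα (fn u)) hk
  rw [← hv] at h1
  exact h1

/-- The right-hand side tends to c₀ as θ → 0⁺, so half of c₀ survives for a small positive angle. -/
lemma exists_angle {c₀ : ℝ} (hc₀ : 0 < c₀) (M : ℝ) :
    ∃ θ ∈ Ioo 0 (Real.pi / 2), c₀ / 2 ≤ Real.cos θ * c₀ - Real.sin θ * M := by
  have h1 : Tendsto (fun θ => Real.cos θ * c₀ - Real.sin θ * M) (𝓝[>] 0) (𝓝 c₀) := by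
    have h : Continuous fun θ => Real.cos θ * c₀ - Real.sin θ * M := by fun_prop
    have := h.tendsto 0
    simp only [Real.cos_zero, Real.sin_zero, one_mul, zero_mul, sub_zero] at this
    exact this.mono_left nhdsWithin_le_nhds
  have h2 := h1.eventually (lt_mem_nhds (show c₀ / 2 < c₀ by linarith))
  have h3 : ∀ᶠ θ in 𝓝[>] (0 : ℝ), θ ∈ Ioo 0 (Real.pi / 2) :=
    Ioo_mem_nhdsGT (by positivity)
  obtain ⟨θ, h, h'⟩ := (h2.and h3).exists
  exact ⟨θ, h', h.le⟩

variable (V)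

/-- Coercivity of the parabolic form, for a closed spatial space with a Poincaré inequality. -/
lemma exists_coercive_inclusion (hU : IsLipschitzDomain U) {c₀ : ℝ} (hc₀ : 0 < c₀)
    (hc : ∀ᵐ x ∂(volume.restrict U), c₀ ≤ α x) {P : ℝ} (hP0 : 0 < P)
    (hP : ∀ v ∈ V, ‖v‖ ^ 2 ≤ P * ‖H1.grad U v‖ ^ 2) :
    ∃ J : Trial U V →L[ℝ] Test U V, (∀ u, fn (J u) = fn u) ∧
      ∃ c : ℝ, 0 < c ∧ ∀ u, c * ‖fn u‖ ^ 2 ≤ parabolicForm hα V u (J u) := by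
  -- The inclusion is the rotated operator with angle zero; its time form contributes 2π sin 0 = 0.
  obtain ⟨J, hJ⟩ := exists_rotated V 0
  refine ⟨J, fun u => fn_eq_of_isRotatedHilbert_zero hU.isOpen (hJ u).1, c₀ / P,
    by positivity, fun u => ?_⟩
  obtain ⟨h1, k, h2, h3⟩ := hJ u
  have h := le_parabolicForm_rotated hα hU hc (by simp) (by simp) h1 h2 h3
  rw [Real.cos_zero, Real.sin_zero] at h
  refine le_trans ?_ h
  have h4 := mul_le_mul_of_nonneg_left (norm_fn_sq_le hP u) (div_pos hc₀ hP0).le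
  rw [← mul_assoc, div_mul_cancel₀ _ hP0.ne'] at h4
  linarith

/-- F enters twice, once directly and once through the bound on D, so F + D is at most 2PN + Q. The
choice c ≤ c₀/(4P) lets c₀N/2 absorb the first term, and c ≤ S takes care of Q. -/
lemma coercivity_constant {S c₀ P F D Q N K : ℝ} (hS : 0 < S) (hc₀ : 0 < c₀) (hP0 : 0 < P)
    (hQ : 0 ≤ Q) (hN : 0 ≤ N) (hK : c₀ / 2 ≤ K) (h4 : F ≤ P * N) (h5 : D ≤ F + Q) :
    min S (c₀ / (4 * P)) * (F + D) ≤ S * Q + K * N := by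
  set c := min S (c₀ / (4 * P)) with hcdef
  have hcpos : 0 < c := by positivity
  have a1 : c * Q ≤ S * Q := mul_le_mul_of_nonneg_right (min_le_left _ _) hQ
  have a2 : c * (2 * (P * N)) ≤ c₀ / 2 * N := by
    refine (mul_le_mul_of_nonneg_right (min_le_right _ _) (by positivity)).trans (le_of_eq ?_)
    field_simp
    norm_num
  have a3 := mul_le_mul_of_nonneg_right hK hN
  have a4 : c * (F + D) ≤ c * (2 * (P * N) + Q) :=
    mul_le_mul_of_nonneg_left (by linarith) hcpos.le
  linarith

/-- Coercivity of the parabolic form after a rotated Hilbert transform. -/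
lemma exists_coercive_rotated (hU : IsLipschitzDomain U) {c₀ : ℝ} (hc₀ : 0 < c₀)
    (hc : ∀ᵐ x ∂(volume.restrict U), c₀ ≤ α x) {P : ℝ} (hP0 : 0 < P)
    (hP : ∀ v ∈ V, ‖v‖ ^ 2 ≤ P * ‖H1.grad U v‖ ^ 2) :
    ∃ θ ∈ Ioo 0 (Real.pi / 2), ∃ B : Trial U V →L[ℝ] Test U V,
      (∀ u, IsRotatedHilbert θ u (B u)) ∧
      ∃ c : ℝ, 0 < c ∧ ∀ u, c * ‖u‖ ^ 2 ≤ parabolicForm hα V u (B u) := by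
  obtain ⟨θ, hθ, hθ'⟩ := exists_angle hc₀ ‖mulL (Z := Sp d) α hα‖
  obtain ⟨B, hB⟩ := exists_rotated V θ
  have hs : 0 < Real.sin θ := Real.sin_pos_of_pos_of_lt_pi hθ.1 (by linarith [hθ.2, Real.pi_pos])
  have hcos : 0 ≤ Real.cos θ :=
    (Real.cos_pos_of_mem_Ioo ⟨by linarith [hθ.1, Real.pi_pos], hθ.2⟩).le
  have hS : 0 < 2 * Real.pi * Real.sin θ := by positivity
  refine ⟨θ, hθ, B, fun u => (hB u).1, min (2 * Real.pi * Real.sin θ) (c₀ / (4 * P)),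
    by positivity, fun u => ?_⟩
  obtain ⟨h1, k, h2, h3⟩ := hB u
  refine le_trans ?_ (le_parabolicForm_rotated hα hU hc hcos hs.le h1 h2 h3)
  rw [STSpace.norm_sq]
  exact coercivity_constant hS hc₀ hP0
    (integral_nonneg fun ξ => mul_nonneg (absSymbol_nonneg ξ) (sq_nonneg _)) (sq_nonneg _) hθ'
    (norm_fn_sq_le hP u) (norm_dens_sq_le u)

end RotatedOperator

/-! ### Boundary charts -/

section Charts

variable {n : ℕ}

/-- A vector of `ℝⁿ` in the hyperplane orthogonal to the first basis vector. -/
def hyper (b : OrthonormalBasis (Fin (n + 1)) ℝ (Sp (n + 1))) :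
    (Fin n → ℝ) →L[ℝ] Sp (n + 1) :=
  ∑ j, (ContinuousLinearMap.proj (R := ℝ) (φ := fun _ : Fin n => ℝ) j).smulRight (b j.succ)

lemma hyper_apply (b : OrthonormalBasis (Fin (n + 1)) ℝ (Sp (n + 1))) (z : Fin n → ℝ) :
    hyper b z = ∑ j, z j • b j.succ := by
  simp [hyper]

lemma repr_symm_cons (b : OrthonormalBasis (Fin (n + 1)) ℝ (Sp (n + 1))) (s : ℝ) (z : Fin n → ℝ) :
    b.repr.symm (WithLp.toLp 2 (Fin.cons s z : Fin (n + 1) → ℝ)) = hyper b z + s • b 0 := by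
  rw [← b.sum_repr_symm, Fin.sum_univ_succ, hyper_apply]
  refine Eq.trans ?_ (add_comm _ _)
  simp

lemma inner_zero_hyper (b : OrthonormalBasis (Fin (n + 1)) ℝ (Sp (n + 1))) (z : Fin n → ℝ) :
    ⟪b 0, hyper b z⟫ = 0 := by
  rw [hyper_apply, inner_sum]
  refine Finset.sum_eq_zero fun j _ => ?_
  rw [real_inner_smul_right, b.inner_eq_zero (Fin.succ_ne_zero j).symm, mul_zero]

lemma inner_succ_hyper (b : OrthonormalBasis (Fin (n + 1)) ℝ (Sp (n + 1))) (z : Fin n → ℝ)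
    (j : Fin n) : ⟪b j.succ, hyper b z⟫ = z j := by
  rw [hyper_apply, inner_sum, Finset.sum_eq_single j]
  · rw [real_inner_smul_right, real_inner_self_eq_norm_sq, b.norm_eq_one]; norm_num
  · intro i _ hi
    rw [real_inner_smul_right, b.inner_eq_zero fun h => hi (Fin.succ_injective _ h).symm, mul_zero]
  · intro h; exact absurd (Finset.mem_univ j) h

lemma hyper_inner (b : OrthonormalBasis (Fin (n + 1)) ℝ (Sp (n + 1))) (y : Sp (n + 1)) :
    hyper b (fun j => ⟪b j.succ, y⟫) = y - ⟪b 0, y⟫ • b 0 := by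
  rw [hyper_apply, eq_sub_iff_add_eq]
  have := b.sum_repr' y
  rw [Fin.sum_univ_succ] at this
  exact (add_comm _ _).trans this

/-- Orthonormal coordinates preserve Lebesgue measure. At fixed z the height is then replaced by the
depth σ = g z - s, which has Jacobian of modulus 1. -/
lemma lintegral_hyper (b : OrthonormalBasis (Fin (n + 1)) ℝ (Sp (n + 1))) {g : (Fin n → ℝ) → ℝ}
    {f : Sp (n + 1) → ENNReal} (hf : Measurable f) :
    ∫⁻ y, f y = ∫⁻ z, ∫⁻ σ, f (hyper b z + (g z - σ) • b 0) := by
  have h1 := b.measurePreserving_repr_symm.comp ((PiLp.volume_preserving_toLp (Fin (n + 1))).comp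
    (volume_preserving_piFinSuccAbove (fun _ : Fin (n + 1) => ℝ) 0).symm)
  have h2 : ∀ p : ℝ × (Fin n → ℝ), (b.repr.symm ∘ WithLp.toLp 2 ∘
      (MeasurableEquiv.piFinSuccAbove (fun _ : Fin (n + 1) => ℝ) 0).symm) p =
      hyper b p.2 + p.1 • b 0 := by
    intro p
    rw [← repr_symm_cons]
    simp [MeasurableEquiv.piFinSuccAbove, Fin.insertNthEquiv]
  rw [← h1.lintegral_comp hf]
  simp only [h2]
  have hm : Measurable fun p : ℝ × (Fin n → ℝ) => f (hyper b p.2 + p.1 • b 0) := by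
    refine hf.comp (Continuous.measurable ?_)
    fun_prop
  rw [Measure.volume_eq_prod, lintegral_prod_symm _ hm.aemeasurable]
  refine lintegral_congr fun z => ?_
  exact (lintegral_sub_left_eq_self (fun s => f (hyper b z + s • b 0)) (g z)).symm

/-- Local description of `U` near the boundary point `x` as the region below a Lipschitz graph
that is parametrized by `Γ`, with `e` the upward direction. -/
structure GraphChart (U : Set (Sp (n + 1))) (x : Sp (n + 1)) where
  (e : Sp (n + 1)) (Γ : (Fin n → ℝ) → Sp (n + 1)) (r : ℝ) (L : NNReal)
  norm_e : ‖e‖ = 1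
  r_pos : 0 < r
  lip : LipschitzWith L Γ
  anti : AntilipschitzWith 1 Γ
  lintegral_eq : ∀ f : Sp (n + 1) → ENNReal, Measurable f →
    ∫⁻ y, f y = ∫⁻ z, ∫⁻ σ : ℝ, f (Γ z - σ • e)
  surj : ∀ y, ∃ z, ∃ σ : ℝ, Γ z - σ • e = y
  mem_iff : ∀ z, ∀ σ : ℝ, Γ z - σ • e ∈ Metric.ball x r → (Γ z - σ • e ∈ U ↔ 0 < σ)
  frontier_eq : ∀ y ∈ frontier U, y ∈ Metric.ball x r → ∃ z, Γ z = y
  dist_le : ∀ z, ∀ σ : ℝ, dist (Γ z) x ≤ L * dist (Γ z - σ • e) x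

/-- Completing e to an orthonormal basis identifies points with pairs (z, σ) of horizontal position
and depth below the graph. Horizontal distances, in the supremum norm, never exceed distances of
points; this gives the bound on Γ from below and `dist_le`. Boundary points near x have depth zero
by continuity of the depth. -/
lemma exists_graphChart {U : Set (Sp (n + 1))} (hUo : IsOpen U) (hU : HasLipschitzBoundary U)
    {x : Sp (n + 1)} (hx : x ∈ frontier U) : Nonempty (GraphChart U x) := by
  obtain ⟨e, r, K, γ, he, hr, hγ, h⟩ := hU x hx
  obtain ⟨b, hb⟩ : ∃ b : OrthonormalBasis (Fin (n + 1)) ℝ (Sp (n + 1)), b 0 = e := by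
    have hv : Orthonormal ℝ (({0} : Set (Fin (n + 1))).domRestrict fun _ => e) := by
      constructor
      · intro i; exact he
      · intro i j hij
        exact absurd (Subsingleton.elim i j) hij
    obtain ⟨b, hb⟩ := hv.exists_orthonormalBasis_extension_of_card_eq (by simp)
    exact ⟨b, hb 0 rfl⟩
  subst hb
  let Γ : (Fin n → ℝ) → Sp (n + 1) := fun z => hyper b z + γ (hyper b z) • b 0
  have hΓ : ∀ z, ∀ σ : ℝ, Γ z - σ • b 0 = hyper b z + (γ (hyper b z) - σ) • b 0 := fun z σ => by
    simp only [Γ]; module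
  have hL : LipschitzWith (‖hyper b‖₊ + K * ‖hyper b‖₊) Γ := by
    refine (hyper b).lipschitz.add ?_
    refine LipschitzWith.of_dist_le_mul fun z z' => ?_
    rw [dist_eq_norm, ← sub_smul, norm_smul, he, mul_one, ← dist_eq_norm]
    exact (hγ.comp (hyper b).lipschitz).dist_le_mul z z'
  have hin0 : ∀ z, ∀ s : ℝ, ⟪b 0, hyper b z + s • b 0⟫ = s := fun z s => by
    rw [inner_add_right, inner_zero_hyper, real_inner_smul_right, real_inner_self_eq_norm_sq, he]
    ring
  have hin1 : ∀ z, ∀ s : ℝ, ∀ j : Fin n, ⟪b j.succ, hyper b z + s • b 0⟫ = z j := fun z s j => by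
    rw [inner_add_right, inner_succ_hyper, real_inner_smul_right,
      b.inner_eq_zero (Fin.succ_ne_zero j), mul_zero, add_zero]
  have hdist : ∀ z z', ∀ s s' : ℝ,
      dist z z' ≤ dist (hyper b z + s • b 0) (hyper b z' + s' • b 0) := by
    intro z z' s s'
    refine (dist_pi_le_iff dist_nonneg).2 fun j => ?_
    rw [← hin1 z s j, ← hin1 z' s' j, Real.dist_eq, ← inner_sub_right]
    refine (abs_real_inner_le_norm _ _).trans ?_
    rw [b.norm_eq_one, one_mul, dist_eq_norm]
  have hsurj : ∀ y, ∃ z, ∃ σ : ℝ, Γ z - σ • b 0 = y := by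
    intro y
    refine ⟨fun j => ⟪b j.succ, y⟫, γ (hyper b fun j => ⟪b j.succ, y⟫) - ⟪b 0, y⟫, ?_⟩
    rw [hΓ, sub_sub_cancel, hyper_inner, sub_add_cancel]
  have hmem : ∀ z, ∀ σ : ℝ, Γ z - σ • b 0 ∈ Metric.ball x r → (Γ z - σ • b 0 ∈ U ↔ 0 < σ) := by
    intro z σ hz
    rw [h _ hz, hΓ, hin0, add_sub_cancel_right]
    exact sub_lt_self_iff _
  have hfront : ∀ y ∈ frontier U, y ∈ Metric.ball x r → ∃ z, Γ z = y := by
    intro y hy hyr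
    let s : Sp (n + 1) → ℝ := fun y => γ (y - ⟪b 0, y⟫ • b 0) - ⟪b 0, y⟫
    have hs : Continuous s := (hγ.continuous.comp (by fun_prop)).sub (by fun_prop)
    have h1 : ∀ y ∈ Metric.ball x r, y ∈ U ↔ 0 < s y := fun y hy => by
      rw [h y hy]; exact sub_pos.symm
    have h2 : s y ≤ 0 := by
      by_contra hc
      exact hy.2 (by rw [hUo.interior_eq]; exact (h1 y hyr).2 (not_le.1 hc))
    have h3 : 0 ≤ s y := by
      by_contra hc
      obtain ⟨w, hw1, hw2⟩ := mem_closure_iff_nhds.1 hy.1 _ (inter_mem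
        (Metric.isOpen_ball.mem_nhds hyr) ((hs.tendsto y).eventually (gt_mem_nhds (not_le.1 hc))))
      have := (h1 w hw1.1).1 hw2
      exact absurd hw1.2 (not_lt.2 this.le)
    refine ⟨fun j => ⟪b j.succ, y⟫, ?_⟩
    have h4 : γ (y - ⟪b 0, y⟫ • b 0) = ⟪b 0, y⟫ := sub_eq_zero.1 (le_antisymm h2 h3)
    simp only [Γ]
    rw [hyper_inner, h4, sub_add_cancel]
  refine ⟨⟨b 0, Γ, r, _, he, hr, hL, ?_, ?_, hsurj, hmem, hfront, ?_⟩⟩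
  · exact AntilipschitzWith.of_le_mul_dist fun z z' => by
      rw [NNReal.coe_one, one_mul]
      exact hdist z z' _ _
  · intro f hf
    rw [lintegral_hyper b (g := fun z => γ (hyper b z)) hf]
    simp only [hΓ]
  · intro z σ
    obtain ⟨z₀, hz₀⟩ := hfront x hx (Metric.mem_ball_self hr)
    refine (hz₀ ▸ hL.dist_le_mul z z₀).trans (mul_le_mul_of_nonneg_left ?_ (by positivity))
    have := hdist z z₀ (γ (hyper b z) - σ) (γ (hyper b z₀))
    rwa [← hΓ, show hyper b z₀ + γ (hyper b z₀) • b 0 = x from hz₀] at this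

namespace GraphChart

variable {U : Set (Sp (n + 1))} {x : Sp (n + 1)} (c : GraphChart U x)

open scoped ENNReal

lemma measurable_Γ : Measurable c.Γ := c.lip.continuous.measurable

/-- Γ is Lipschitz and does not contract distances. So the Hausdorff measure on the graph and the
image of Lebesgue measure bound each other up to a constant, which replaces a surface area formula.
-/
lemma map_le_hausdorff : Measure.map c.Γ volume ≤ Measure.hausdorffMeasure (n : ℝ) := by
  refine Measure.le_iff.2 fun s hs => ?_
  rw [Measure.map_apply c.measurable_Γ hs]
  have := c.anti.hausdorffMeasure_preimage_le (Nat.cast_nonneg n : (0 : ℝ) ≤ n) s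
  rw [ENNReal.coe_one, ENNReal.one_rpow, one_mul] at this
  refine le_trans (le_of_eq ?_) this
  rw [← hausdorffMeasure_pi_real, Fintype.card_fin]

lemma hausdorff_restrict_le : (Measure.hausdorffMeasure (n : ℝ)).restrict (range c.Γ) ≤
    ((c.L : ℝ≥0∞) ^ n) • Measure.map c.Γ volume := by
  refine Measure.le_iff.2 fun s hs => ?_
  rw [Measure.restrict_apply hs, Measure.smul_apply, Measure.map_apply c.measurable_Γ hs,
    ← image_preimage_eq_inter_range]
  refine (c.lip.hausdorffMeasure_image_le (Nat.cast_nonneg n) _).trans (le_of_eq ?_)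
  have : (volume : Measure (Fin n → ℝ)) = Measure.hausdorffMeasure (n : ℝ) := by
    rw [← hausdorffMeasure_pi_real, Fintype.card_fin]
  rw [this, ENNReal.rpow_natCast, smul_eq_mul]

end GraphChart

end Charts

/-! ### Integration along lines -/

section Lines

open scoped ENNReal

/-- The fundamental theorem of calculus and Cauchy–Schwarz on (0, h]; the factors 2 come from (p +
q)² ≤ 2p² + 2q². -/
lemma enorm_sq_le_line {f f' : ℝ → ℝ} (hf : ∀ t, HasDerivAt f (f' t) t) (hf' : Continuous f')
    {h a b : ℝ} (ha : a ∈ Icc 0 h) (hb : b ∈ Icc 0 h) :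
    ‖f a‖ₑ ^ 2 ≤ 2 * ‖f b‖ₑ ^ 2 + 2 * ENNReal.ofReal h * ∫⁻ t in Ioc 0 h, ‖f' t‖ₑ ^ 2 := by
  have h1 : f a - f b = ∫ t in b..a, f' t :=
    (intervalIntegral.integral_eq_sub_of_hasDerivAt (fun t _ => hf t)
      (hf'.intervalIntegrable _ _)).symm
  have h2 : ‖f a - f b‖ₑ ≤ ∫⁻ t in Ioc 0 h, ‖f' t‖ₑ := by
    rw [h1, ← ofReal_norm, intervalIntegral.norm_integral_eq_norm_integral_uIoc, ofReal_norm]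
    refine (enorm_integral_le_lintegral_enorm _).trans (lintegral_mono_set ?_)
    intro t ht
    rw [mem_uIoc] at ht
    rcases ht with ht | ht
    · exact ⟨hb.1.trans_lt ht.1, ht.2.trans ha.2⟩
    · exact ⟨ha.1.trans_lt ht.1, ht.2.trans hb.2⟩
  have h3 : (∫⁻ t in Ioc 0 h, ‖f' t‖ₑ) ^ 2 ≤
      ENNReal.ofReal h * ∫⁻ t in Ioc 0 h, ‖f' t‖ₑ ^ 2 := by
    have hm : AEMeasurable (fun t => ‖f' t‖ₑ) (volume.restrict (Ioc 0 h)) :=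
      hf'.measurable.enorm.aemeasurable
    have := ENNReal.lintegral_mul_le_Lp_mul_Lq (volume.restrict (Ioc 0 h))
      (Real.HolderConjugate.two_two) (aemeasurable_const (b := (1 : ℝ≥0∞))) hm
    simp only [Pi.mul_apply, one_mul, ENNReal.one_rpow, lintegral_const, Measure.restrict_apply_univ,
      Real.volume_Ioc, sub_zero] at this
    refine (pow_le_pow_left₀ (zero_le) this 2).trans (le_of_eq ?_)
    rw [mul_pow, ← ENNReal.rpow_natCast, ← ENNReal.rpow_natCast, ← ENNReal.rpow_mul,
      ← ENNReal.rpow_mul]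
    norm_num
  have h4 : ‖f a‖ₑ ≤ ‖f b‖ₑ + ‖f a - f b‖ₑ := by
    refine le_trans (le_of_eq ?_) (enorm_add_le _ _)
    rw [add_sub_cancel]
  have h5 : ∀ p q : ℝ≥0∞, (p + q) ^ 2 ≤ 2 * p ^ 2 + 2 * q ^ 2 := by
    intro p q
    have := ENNReal.rpow_add_le_mul_rpow_add_rpow p q (p := 2) (by norm_num)
    norm_num at this
    rwa [mul_add] at this
  calc ‖f a‖ₑ ^ 2 ≤ (‖f b‖ₑ + ‖f a - f b‖ₑ) ^ 2 := pow_le_pow_left₀ (zero_le) h4 2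
    _ ≤ _ := h5 _ _
    _ ≤ _ := by
      rw [mul_assoc]
      gcongr
      exact (pow_le_pow_left₀ (zero_le) h2 2).trans h3

/-- A smooth function at two points of a segment. -/
lemma enorm_sq_le_segment {φ : Sp d → ℝ} (hφ : ContDiff ℝ 1 φ) (p w : Sp d) {h a b : ℝ}
    (ha : a ∈ Icc 0 h) (hb : b ∈ Icc 0 h) :
    ‖φ (p + a • w)‖ₑ ^ 2 ≤ 2 * ‖φ (p + b • w)‖ₑ ^ 2 +
      2 * ENNReal.ofReal h * (‖w‖ₑ ^ 2 * ∫⁻ t in Ioc 0 h, ‖gradient φ (p + t • w)‖ₑ ^ 2) := by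
  have hl : ∀ t : ℝ, HasDerivAt (fun t : ℝ => p + t • w) w t := fun t => by
    simpa using ((hasDerivAt_id t).smul_const w).const_add p
  have hd : ∀ t, HasDerivAt (fun t : ℝ => φ (p + t • w)) ⟪gradient φ (p + t • w), w⟫ t := by
    intro t
    have h1 : HasFDerivAt φ (fderiv ℝ φ (p + t • w)) (p + t • w) :=
      (hφ.differentiable (by simp) _).hasFDerivAt
    rw [inner_gradient]
    exact h1.comp_hasDerivAt t (hl t)
  have hc : Continuous fun t : ℝ => ⟪gradient φ (p + t • w), w⟫ :=
    ((continuous_gradient hφ).comp (show Continuous fun t : ℝ => p + t • w by fun_prop)).inner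
      continuous_const
  refine (enorm_sq_le_line hd hc ha hb).trans ?_
  have hm : Measurable fun t : ℝ => ‖gradient φ (p + t • w)‖ₑ ^ 2 :=
    (((continuous_gradient hφ).comp
      (show Continuous fun t : ℝ => p + t • w by fun_prop)).measurable.enorm).pow_const 2
  rw [← lintegral_const_mul _ hm]
  gcongr with t
  rw [← mul_pow]
  gcongr
  rw [← ofReal_norm, ← ofReal_norm w, ← ofReal_norm, ← ENNReal.ofReal_mul (norm_nonneg _), mul_comm]
  exact ENNReal.ofReal_le_ofReal (norm_inner_le_norm _ _)

/-- Comparison of a smooth function on a set and on its translate. -/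
lemma lintegral_enorm_sq_le_translate {U M : Set (Sp d)} (hM : MeasurableSet M)
    (hUm : MeasurableSet U) {φ : Sp d → ℝ} (hφ : ContDiff ℝ 1 φ) (w : Sp d)
    (h : ∀ m ∈ M, ∀ t ∈ Icc (0 : ℝ) 1, m + t • w ∈ U) :
    ∫⁻ y in M, ‖φ y‖ₑ ^ 2 ≤ 2 * (∫⁻ y in M, ‖φ (y + w)‖ₑ ^ 2) +
      2 * ‖w‖ₑ ^ 2 * ∫⁻ y in U, ‖gradient φ y‖ₑ ^ 2 := by
  have hg : Measurable fun y => ‖gradient φ y‖ₑ ^ 2 :=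
    ((continuous_gradient hφ).measurable.enorm).pow_const 2
  have hφm : Measurable fun y => ‖φ y‖ₑ ^ 2 := hφ.continuous.measurable.enorm.pow_const 2
  have hg2 : Measurable fun q : Sp d × ℝ => ‖gradient φ (q.1 + q.2 • w)‖ₑ ^ 2 :=
    hg.comp (Continuous.measurable (by fun_prop))
  have h1 : ∀ y, ‖φ y‖ₑ ^ 2 ≤ 2 * ‖φ (y + w)‖ₑ ^ 2 +
      2 * ‖w‖ₑ ^ 2 * ∫⁻ t in Ioc (0 : ℝ) 1, ‖gradient φ (y + t • w)‖ₑ ^ 2 := by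
    intro y
    have := enorm_sq_le_segment hφ y w (h := 1) (a := 0) (b := 1) (by simp) (by simp)
    simpa [mul_assoc] using this
  have hφw : Measurable fun y => ‖φ (y + w)‖ₑ ^ 2 := hφm.comp (measurable_add_const w)
  have h2 : ∀ t ∈ Ioc (0 : ℝ) 1, ∫⁻ y in M, ‖gradient φ (y + t • w)‖ₑ ^ 2 ≤
      ∫⁻ y in U, ‖gradient φ y‖ₑ ^ 2 := by
    intro t ht
    rw [← lintegral_indicator hM, ← lintegral_indicator hUm,
      ← lintegral_add_right_eq_self (U.indicator fun y => ‖gradient φ y‖ₑ ^ 2) (t • w)]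
    refine lintegral_mono fun y => ?_
    by_cases hy : y ∈ M
    · rw [indicator_of_mem hy, indicator_of_mem (h y hy t (Ioc_subset_Icc_self ht))]
    · rw [indicator_of_notMem hy]
      exact zero_le
  have h3 : ∫⁻ y in M, ∫⁻ t in Ioc (0 : ℝ) 1, ‖gradient φ (y + t • w)‖ₑ ^ 2 ≤
      ∫⁻ y in U, ‖gradient φ y‖ₑ ^ 2 := by
    rw [lintegral_lintegral_swap hg2.aemeasurable]
    refine (setLIntegral_mono' measurableSet_Ioc h2).trans ?_
    simp
  calc ∫⁻ y in M, ‖φ y‖ₑ ^ 2 ≤ ∫⁻ y in M, (2 * ‖φ (y + w)‖ₑ ^ 2 +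
      2 * ‖w‖ₑ ^ 2 * ∫⁻ t in Ioc (0 : ℝ) 1, ‖gradient φ (y + t • w)‖ₑ ^ 2) := lintegral_mono h1
    _ = 2 * (∫⁻ y in M, ‖φ (y + w)‖ₑ ^ 2) + 2 * ‖w‖ₑ ^ 2 *
        ∫⁻ y in M, ∫⁻ t in Ioc (0 : ℝ) 1, ‖gradient φ (y + t • w)‖ₑ ^ 2 := by
      rw [lintegral_add_left (hφw.const_mul 2), lintegral_const_mul _ hφw,
        lintegral_const_mul _ hg2.lintegral_prod_right]
    _ ≤ _ := by gcongr

end Lines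

/-! ### Estimates near the boundary -/

section Boundary

open scoped ENNReal

variable {n : ℕ}

namespace GraphChart

variable {U : Set (Sp (n + 1))} {x : Sp (n + 1)} (c : GraphChart U x)

lemma mem_of_pos {z : Fin n → ℝ} {σ : ℝ} (h : c.Γ z - σ • c.e ∈ Metric.ball x c.r) (hσ : 0 < σ) :
    c.Γ z - σ • c.e ∈ U := (c.mem_iff z σ h).2 hσ

lemma dist_sub_smul (y : Sp (n + 1)) (σ : ℝ) : dist y (y - σ • c.e) = |σ| := by
  rw [dist_eq_norm, sub_sub_cancel, norm_smul, c.norm_e, mul_one, Real.norm_eq_abs]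

lemma mem_ball_of_dist {z : Fin n → ℝ} {σ R : ℝ} (h : dist (c.Γ z) x + |σ| < R) :
    c.Γ z - σ • c.e ∈ Metric.ball x R := by
  rw [Metric.mem_ball]
  have := dist_triangle_left (c.Γ z - σ • c.e) x (c.Γ z)
  rw [c.dist_sub_smul] at this
  linarith

lemma mem_frontier {z : Fin n → ℝ} (hz : c.Γ z ∈ Metric.ball x c.r) : c.Γ z ∈ frontier U := by
  have hcont : Continuous fun σ : ℝ => c.Γ z - σ • c.e := by fun_prop
  have h0 : c.Γ z - (0 : ℝ) • c.e = c.Γ z := by rw [zero_smul, sub_zero]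
  have h1 : c.Γ z ∉ U := fun h => by
    rw [← h0] at h hz
    exact lt_irrefl _ ((c.mem_iff z 0 hz).1 h)
  refine ⟨?_, fun h => h1 (interior_subset h)⟩
  have ht : Tendsto (fun σ : ℝ => c.Γ z - σ • c.e) (𝓝[>] 0) (𝓝 (c.Γ z)) := by
    have := hcont.tendsto 0
    rw [h0] at this
    exact this.mono_left nhdsWithin_le_nhds
  refine mem_closure_of_tendsto ht ?_
  filter_upwards [ht.eventually (Metric.isOpen_ball.mem_nhds hz), self_mem_nhdsWithin] with σ h2 h3
  exact c.mem_of_pos h2 h3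

lemma lintegral_le {A : Set (Fin n → ℝ)} (hA : MeasurableSet A) {h : ℝ} (hU : MeasurableSet U)
    (hAU : ∀ z ∈ A, ∀ σ ∈ Ioc 0 h, c.Γ z - σ • c.e ∈ U) {F : Sp (n + 1) → ℝ≥0∞}
    (hF : Measurable F) :
    ∫⁻ z in A, ∫⁻ σ in Ioc 0 h, F (c.Γ z - σ • c.e) ≤ ∫⁻ y in U, F y := by
  rw [← lintegral_indicator hU, c.lintegral_eq _ (hF.indicator hU), ← lintegral_indicator hA]
  refine lintegral_mono fun z => ?_
  by_cases hz : z ∈ A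
  · rw [indicator_of_mem hz, ← lintegral_indicator measurableSet_Ioc]
    refine lintegral_mono fun σ => ?_
    by_cases hσ : σ ∈ Ioc 0 h
    · rw [indicator_of_mem hσ, indicator_of_mem (hAU z hz σ hσ)]
    · rw [indicator_of_notMem hσ]
      exact zero_le
  · rw [indicator_of_notMem hz]
    exact zero_le

lemma lintegral_hausdorff_le {M : Set (Sp (n + 1))} {R : ℝ} (hM : M ⊆ range c.Γ)
    (hMR : M ⊆ Metric.ball x R) {F : Sp (n + 1) → ℝ≥0∞} (hF : Measurable F) :
    ∫⁻ y in M, F y ∂(Measure.hausdorffMeasure (n : ℝ)) ≤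
      (c.L : ℝ≥0∞) ^ n * ∫⁻ z in c.Γ ⁻¹' Metric.ball x R, F (c.Γ z) := by
  have h1 : (Measure.hausdorffMeasure (n : ℝ)).restrict M ≤
      (((c.L : ℝ≥0∞) ^ n) • Measure.map c.Γ volume).restrict (Metric.ball x R) := by
    refine le_trans (Measure.restrict_mono (subset_inter hMR hM) le_rfl) ?_
    rw [← Measure.restrict_restrict measurableSet_ball]
    exact Measure.restrict_mono subset_rfl c.hausdorff_restrict_le
  refine (lintegral_mono' h1 le_rfl).trans (le_of_eq ?_)
  rw [Measure.restrict_smul, lintegral_smul_measure, smul_eq_mul,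
    setLIntegral_map measurableSet_ball hF c.measurable_Γ]

lemma le_lintegral_hausdorff {A : Set (Fin n → ℝ)} {P : Set (Sp (n + 1))} (hP : MeasurableSet P)
    (hA : ∀ z ∈ A, c.Γ z ∈ P) {F : Sp (n + 1) → ℝ≥0∞} (hF : Measurable F) :
    ∫⁻ z in A, F (c.Γ z) ≤ ∫⁻ y in P, F y ∂(Measure.hausdorffMeasure (n : ℝ)) := by
  refine (lintegral_mono_set (t := c.Γ ⁻¹' P) hA).trans ?_
  rw [← setLIntegral_map hP hF c.measurable_Γ]
  exact lintegral_mono' (Measure.restrict_mono subset_rfl c.map_le_hausdorff) le_rfl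

lemma measurable_comp {F : Sp (n + 1) → ℝ≥0∞} (hF : Measurable F) :
    Measurable fun p : (Fin n → ℝ) × ℝ => F (c.Γ p.1 - p.2 • c.e) :=
  hF.comp ((c.measurable_Γ.comp measurable_fst).sub (measurable_snd.smul_const _))

lemma measurable_comp_right {F : Sp (n + 1) → ℝ≥0∞} (hF : Measurable F) (z : Fin n → ℝ) :
    Measurable fun σ : ℝ => F (c.Γ z - σ • c.e) :=
  hF.comp (measurable_const.sub (measurable_id.smul_const _))

lemma measurable_lintegral_comp {F : Sp (n + 1) → ℝ≥0∞} (hF : Measurable F) (h : ℝ) :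
    Measurable fun z => ∫⁻ σ in Ioc 0 h, F (c.Γ z - σ • c.e) :=
  (c.measurable_comp hF).lintegral_prod_right

section Smooth

variable {φ : Sp (n + 1) → ℝ} (hφ : ContDiff ℝ 1 φ)
include hφ

lemma enorm_sq_le (z : Fin n → ℝ) {h a b : ℝ} (ha : a ∈ Icc 0 h) (hb : b ∈ Icc 0 h) :
    ‖φ (c.Γ z - a • c.e)‖ₑ ^ 2 ≤ 2 * ‖φ (c.Γ z - b • c.e)‖ₑ ^ 2 +
      2 * ENNReal.ofReal h * ∫⁻ t in Ioc 0 h, ‖gradient φ (c.Γ z - t • c.e)‖ₑ ^ 2 := by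
  have := enorm_sq_le_segment hφ (c.Γ z) (-c.e) ha hb
  have he : ‖-c.e‖ₑ = 1 := by rw [enorm_neg, ← ofReal_norm, c.norm_e, ENNReal.ofReal_one]
  simpa only [smul_neg, ← sub_eq_add_neg, he, one_pow, one_mul] using this

/-- A local trace inequality. -/
lemma lintegral_trace_le (hUm : MeasurableSet U) {h : ℝ} (hh : 0 < h) (hr : 2 * h ≤ c.r) :
    ENNReal.ofReal h *
      ∫⁻ y in frontier U ∩ Metric.ball x h, ‖φ y‖ₑ ^ 2 ∂(Measure.hausdorffMeasure (n : ℝ)) ≤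
    (c.L : ℝ≥0∞) ^ n * (2 * (∫⁻ y in U, ‖φ y‖ₑ ^ 2) +
      2 * ENNReal.ofReal h ^ 2 * ∫⁻ y in U, ‖gradient φ y‖ₑ ^ 2) := by
  have hφm : Measurable fun y => ‖φ y‖ₑ ^ 2 := hφ.continuous.measurable.enorm.pow_const 2
  have hgm : Measurable fun y => ‖gradient φ y‖ₑ ^ 2 :=
    ((continuous_gradient hφ).measurable.enorm).pow_const 2
  set D := c.Γ ⁻¹' Metric.ball x h
  have hD : MeasurableSet D := c.measurable_Γ measurableSet_ball
  have hDU : ∀ z ∈ D, ∀ σ ∈ Ioc 0 h, c.Γ z - σ • c.e ∈ U := by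
    intro z hz σ hσ
    refine c.mem_of_pos (c.mem_ball_of_dist ?_) hσ.1
    rw [abs_of_pos hσ.1]
    have := Metric.mem_ball.1 (show c.Γ z ∈ Metric.ball x h from hz)
    linarith [hσ.2]
  -- The value at depth 0 is compared with the value at depth σ, and the comparison is integrated
  -- over σ in (0, h].
  have h1 : ∀ z, ENNReal.ofReal h * ‖φ (c.Γ z)‖ₑ ^ 2 ≤
      2 * (∫⁻ σ in Ioc 0 h, ‖φ (c.Γ z - σ • c.e)‖ₑ ^ 2) + 2 * ENNReal.ofReal h ^ 2 *
        ∫⁻ t in Ioc 0 h, ‖gradient φ (c.Γ z - t • c.e)‖ₑ ^ 2 := by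
    intro z
    have h2 : ∫⁻ σ in Ioc 0 h, ‖φ (c.Γ z)‖ₑ ^ 2 ≤ ∫⁻ σ in Ioc 0 h,
        (2 * ‖φ (c.Γ z - σ • c.e)‖ₑ ^ 2 + 2 * ENNReal.ofReal h *
          ∫⁻ t in Ioc 0 h, ‖gradient φ (c.Γ z - t • c.e)‖ₑ ^ 2) := by
      refine setLIntegral_mono' measurableSet_Ioc fun σ hσ => ?_
      have := c.enorm_sq_le hφ z (h := h) (a := 0) (b := σ) ⟨le_rfl, hh.le⟩ ⟨hσ.1.le, hσ.2⟩
      rwa [zero_smul, sub_zero] at this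
    have hmz : Measurable fun σ : ℝ => ‖φ (c.Γ z - σ • c.e)‖ₑ ^ 2 :=
      c.measurable_comp_right (F := fun y => ‖φ y‖ₑ ^ 2) hφm z
    rw [lintegral_add_left (hmz.const_mul 2), lintegral_const_mul _ hmz] at h2
    simp only [lintegral_const, Measure.restrict_apply_univ, Real.volume_Ioc, sub_zero] at h2
    rw [mul_comm]
    refine h2.trans (le_of_eq ?_)
    ring
  have hMr : frontier U ∩ Metric.ball x h ⊆ range c.Γ := fun y hy =>
    c.frontier_eq y hy.1 (Metric.ball_subset_ball (by linarith) hy.2)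
  have h3 := c.lintegral_hausdorff_le hMr inter_subset_right hφm
  have h4 : ENNReal.ofReal h * ∫⁻ z in D, ‖φ (c.Γ z)‖ₑ ^ 2 ≤
      2 * (∫⁻ y in U, ‖φ y‖ₑ ^ 2) +
        2 * ENNReal.ofReal h ^ 2 * ∫⁻ y in U, ‖gradient φ y‖ₑ ^ 2 := by
    have m0 : Measurable fun z => ‖φ (c.Γ z)‖ₑ ^ 2 := hφm.comp c.measurable_Γ
    rw [← lintegral_const_mul _ m0]
    refine (lintegral_mono h1).trans ?_
    have m1 : Measurable fun z => ∫⁻ σ in Ioc 0 h, ‖φ (c.Γ z - σ • c.e)‖ₑ ^ 2 :=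
      c.measurable_lintegral_comp (F := fun y => ‖φ y‖ₑ ^ 2) hφm h
    have m2 : Measurable fun z => ∫⁻ σ in Ioc 0 h, ‖gradient φ (c.Γ z - σ • c.e)‖ₑ ^ 2 :=
      c.measurable_lintegral_comp (F := fun y => ‖gradient φ y‖ₑ ^ 2) hgm h
    rw [lintegral_add_left (m1.const_mul 2), lintegral_const_mul _ m1, lintegral_const_mul _ m2]
    have a1 := c.lintegral_le hD hUm hDU hφm
    have a2 := c.lintegral_le hD hUm hDU hgm
    gcongr
  refine (mul_le_mul_right h3 _).trans ?_
  rw [mul_left_comm]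
  exact mul_le_mul_right h4 _

/-- A local Friedrichs inequality. -/
lemma lintegral_friedrichs_le (hUm : MeasurableSet U) {δ ρ : ℝ} (hδ : 0 < δ)
    (hr : (2 * c.L + 1) * δ < c.r) (hρ : (2 * c.L + 1) * δ < ρ) :
    ∫⁻ y in U ∩ Metric.ball x δ, ‖φ y‖ₑ ^ 2 ≤
      2 * ENNReal.ofReal ((c.L + 1) * δ) * (∫⁻ y in frontier U ∩ Metric.ball x ρ,
        ‖φ y‖ₑ ^ 2 ∂(Measure.hausdorffMeasure (n : ℝ))) +
      2 * ENNReal.ofReal ((c.L + 1) * δ) ^ 2 * ∫⁻ y in U, ‖gradient φ y‖ₑ ^ 2 := by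
  -- A point of the ball of radius δ lies below a graph point within Lδ of x, hence at depth at most
  -- (L + 1)δ. Together these give the radius (2L + 1)δ of the hypotheses.
  set h : ℝ := (c.L + 1) * δ with hh
  have hL : (0 : ℝ) ≤ c.L := c.L.2
  have hh0 : 0 ≤ h := by positivity
  have hφm : Measurable fun y => ‖φ y‖ₑ ^ 2 := hφ.continuous.measurable.enorm.pow_const 2
  have hgm : Measurable fun y => ‖gradient φ y‖ₑ ^ 2 :=
    ((continuous_gradient hφ).measurable.enorm).pow_const 2
  set D := c.Γ ⁻¹' Metric.closedBall x (c.L * δ)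
  have hD : MeasurableSet D := c.measurable_Γ measurableSet_closedBall
  have hDd : ∀ z ∈ D, dist (c.Γ z) x ≤ c.L * δ := fun z hz => hz
  have hDU : ∀ z ∈ D, ∀ σ ∈ Ioc 0 h, c.Γ z - σ • c.e ∈ U := by
    intro z hz σ hσ
    refine c.mem_of_pos (c.mem_ball_of_dist ?_) hσ.1
    rw [abs_of_pos hσ.1]
    have := hDd z hz
    have := hσ.2
    nlinarith
  have hDP : ∀ z ∈ D, c.Γ z ∈ frontier U ∩ Metric.ball x ρ := by
    intro z hz
    have := hDd z hz
    refine ⟨c.mem_frontier ?_, ?_⟩ <;> rw [Metric.mem_ball] <;> nlinarith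
  have hB : MeasurableSet (U ∩ Metric.ball x δ) := hUm.inter measurableSet_ball
  have h1 : ∫⁻ y in U ∩ Metric.ball x δ, ‖φ y‖ₑ ^ 2 ≤
      ∫⁻ z in D, ∫⁻ σ in Ioc 0 h, ‖φ (c.Γ z - σ • c.e)‖ₑ ^ 2 := by
    rw [← lintegral_indicator hB, c.lintegral_eq _ (hφm.indicator hB), ← lintegral_indicator hD]
    refine lintegral_mono fun z => ?_
    have key : ∀ σ, c.Γ z - σ • c.e ∈ U ∩ Metric.ball x δ → z ∈ D ∧ σ ∈ Ioc 0 h := by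
      rintro σ ⟨h1, h2⟩
      have h3 : dist (c.Γ z) x ≤ c.L * δ := (c.dist_le z σ).trans
        (mul_le_mul_of_nonneg_left (Metric.mem_ball.1 h2).le hL)
      have h5 : δ ≤ c.r := by nlinarith
      have h4 := (c.mem_iff z σ (Metric.ball_subset_ball h5 h2)).1 h1
      refine ⟨h3, h4, ?_⟩
      have h6 := dist_triangle_right (c.Γ z) (c.Γ z - σ • c.e) x
      rw [c.dist_sub_smul, abs_of_pos h4] at h6
      have := (Metric.mem_ball.1 h2)
      rw [hh]
      linarith
    by_cases hz : z ∈ D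
    · rw [indicator_of_mem hz, ← lintegral_indicator measurableSet_Ioc]
      refine lintegral_mono fun σ => ?_
      by_cases hσ : c.Γ z - σ • c.e ∈ U ∩ Metric.ball x δ
      · rw [indicator_of_mem hσ, indicator_of_mem (key σ hσ).2]
      · rw [indicator_of_notMem hσ]
        exact zero_le
    · refine le_trans (le_of_eq ?_) zero_le
      rw [lintegral_eq_zero_iff' ?_]
      · refine Eventually.of_forall fun σ => ?_
        exact indicator_of_notMem (fun hσ => hz (key σ hσ).1) _
      · exact (c.measurable_comp_right (hφm.indicator hB) z).aemeasurable
  have h2 : ∀ z, ∫⁻ σ in Ioc 0 h, ‖φ (c.Γ z - σ • c.e)‖ₑ ^ 2 ≤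
      2 * ENNReal.ofReal h * ‖φ (c.Γ z)‖ₑ ^ 2 + 2 * ENNReal.ofReal h ^ 2 *
        ∫⁻ t in Ioc 0 h, ‖gradient φ (c.Γ z - t • c.e)‖ₑ ^ 2 := by
    intro z
    have h2 : ∫⁻ σ in Ioc 0 h, ‖φ (c.Γ z - σ • c.e)‖ₑ ^ 2 ≤ ∫⁻ σ in Ioc 0 h,
        (2 * ‖φ (c.Γ z)‖ₑ ^ 2 + 2 * ENNReal.ofReal h *
          ∫⁻ t in Ioc 0 h, ‖gradient φ (c.Γ z - t • c.e)‖ₑ ^ 2) := by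
      refine setLIntegral_mono' measurableSet_Ioc fun σ hσ => ?_
      have := c.enorm_sq_le hφ z (h := h) (a := σ) (b := 0) ⟨hσ.1.le, hσ.2⟩ ⟨le_rfl, hh0⟩
      rwa [zero_smul, sub_zero] at this
    simp only [lintegral_const, Measure.restrict_apply_univ, Real.volume_Ioc, sub_zero] at h2
    refine h2.trans (le_of_eq ?_)
    ring
  refine h1.trans ((lintegral_mono h2).trans ?_)
  have m0 : Measurable fun z => ‖φ (c.Γ z)‖ₑ ^ 2 := hφm.comp c.measurable_Γ
  have m2 : Measurable fun z => ∫⁻ σ in Ioc 0 h, ‖gradient φ (c.Γ z - σ • c.e)‖ₑ ^ 2 :=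
    c.measurable_lintegral_comp (F := fun y => ‖gradient φ y‖ₑ ^ 2) hgm h
  rw [lintegral_add_left (m0.const_mul _), lintegral_const_mul _ m0, lintegral_const_mul _ m2]
  have a1 := c.le_lintegral_hausdorff (isClosed_frontier.measurableSet.inter measurableSet_ball)
    hDP hφm
  have a2 := c.lintegral_le hD hUm hDU hgm
  gcongr

end Smooth

end GraphChart

end Boundary

/-! ### The trace inequality and the Friedrichs inequality for smooth functions -/

section SmoothInequalities

open scoped ENNReal

variable {n : ℕ} {U : Set (Sp (n + 1))}

/-- The local trace inequality holds near every boundary point, and the boundary is compact. -/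
lemma exists_trace_bound (hU : IsLipschitzDomain U) : ∃ C : ℝ≥0∞, C ≠ ⊤ ∧
    ∀ φ : Sp (n + 1) → ℝ, ContDiff ℝ 1 φ →
      ∫⁻ y in frontier U, ‖φ y‖ₑ ^ 2 ∂(Measure.hausdorffMeasure (n : ℝ)) ≤
        C * ((∫⁻ y in U, ‖φ y‖ₑ ^ 2) + ∫⁻ y in U, ‖gradient φ y‖ₑ ^ 2) := by
  have hK : IsCompact (frontier U) := Metric.isCompact_of_isClosed_isBounded isClosed_frontier
    (hU.isBounded.closure.subset frontier_subset_closure)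
  have := hK.induction_on (p := fun A => ∃ C : ℝ≥0∞, C ≠ ⊤ ∧
    ∀ φ : Sp (n + 1) → ℝ, ContDiff ℝ 1 φ →
      ∫⁻ y in frontier U ∩ A, ‖φ y‖ₑ ^ 2 ∂(Measure.hausdorffMeasure (n : ℝ)) ≤
        C * ((∫⁻ y in U, ‖φ y‖ₑ ^ 2) + ∫⁻ y in U, ‖gradient φ y‖ₑ ^ 2)) ?_ ?_ ?_ ?_
  · simpa using this
  · exact ⟨0, by simp, fun φ _ => by simp⟩
  · rintro s t hst ⟨C, hC, h⟩
    exact ⟨C, hC, fun φ hφ => (lintegral_mono_set (inter_subset_inter_right _ hst)).trans (h φ hφ)⟩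
  · rintro s t ⟨C, hC, h⟩ ⟨C', hC', h'⟩
    refine ⟨C + C', ENNReal.add_ne_top.2 ⟨hC, hC'⟩, fun φ hφ => ?_⟩
    rw [inter_union_distrib_left, add_mul]
    exact (lintegral_union_le _ _ _).trans (add_le_add (h φ hφ) (h' φ hφ))
  · intro x hx
    obtain ⟨c⟩ := exists_graphChart hU.isOpen hU.lipschitz hx
    have hr := c.r_pos
    set h := c.r / 2 with hh
    have hh0 : 0 < h := by positivity
    refine ⟨Metric.ball x h, mem_nhdsWithin_of_mem_nhds (Metric.ball_mem_nhds _ hh0),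
      (ENNReal.ofReal h)⁻¹ * ((c.L : ℝ≥0∞) ^ n * (2 + 2 * ENNReal.ofReal h ^ 2)), ?_,
      fun φ hφ => ?_⟩
    · have : ENNReal.ofReal h ≠ 0 := by simpa using hh0
      finiteness
    · have h1 := c.lintegral_trace_le hφ hU.isOpen.measurableSet hh0 (by linarith)
      have h0 : ENNReal.ofReal h ≠ 0 := by simpa using hh0
      set A := ∫⁻ y in U, ‖φ y‖ₑ ^ 2
      set B := ∫⁻ y in U, ‖gradient φ y‖ₑ ^ 2
      rw [mul_assoc, ← ENNReal.mul_le_iff_le_inv h0 ENNReal.ofReal_ne_top]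
      refine h1.trans ?_
      rw [mul_assoc ((c.L : ℝ≥0∞) ^ n)]
      refine mul_le_mul' le_rfl ?_
      calc 2 * A + 2 * ENNReal.ofReal h ^ 2 * B
          ≤ 2 * A + 2 * ENNReal.ofReal h ^ 2 * B + (2 * B + 2 * ENNReal.ofReal h ^ 2 * A) :=
            le_self_add
        _ = _ := by ring

/-- On the set `A`, smooth functions are bounded by their gradients on `U` and by their values on
the part of the boundary of `U` in the ball around `x` of radius `ρ`. -/
def FriedrichsOn (U : Set (Sp (n + 1))) (x : Sp (n + 1)) (ρ : ℝ) (A : Set (Sp (n + 1))) : Prop :=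
  ∃ C : ℝ≥0∞, C ≠ ⊤ ∧ ∀ φ : Sp (n + 1) → ℝ, ContDiff ℝ 1 φ →
    ∫⁻ y in A, ‖φ y‖ₑ ^ 2 ≤ C * ((∫⁻ y in U, ‖gradient φ y‖ₑ ^ 2) +
      ∫⁻ y in frontier U ∩ Metric.ball x ρ, ‖φ y‖ₑ ^ 2 ∂(Measure.hausdorffMeasure (n : ℝ)))

namespace FriedrichsOn

variable {x : Sp (n + 1)} {ρ : ℝ} {A B : Set (Sp (n + 1))}

lemma empty : FriedrichsOn U x ρ ∅ := ⟨0, by simp, fun φ _ => by simp⟩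

lemma mono (h : FriedrichsOn U x ρ B) (hAB : A ⊆ B) : FriedrichsOn U x ρ A := by
  obtain ⟨C, hC, h⟩ := h
  exact ⟨C, hC, fun φ hφ => (lintegral_mono_set hAB).trans (h φ hφ)⟩

lemma union (hA : FriedrichsOn U x ρ A) (hB : FriedrichsOn U x ρ B) :
    FriedrichsOn U x ρ (A ∪ B) := by
  obtain ⟨C, hC, h⟩ := hA
  obtain ⟨C', hC', h'⟩ := hB
  refine ⟨C + C', ENNReal.add_ne_top.2 ⟨hC, hC'⟩, fun φ hφ => ?_⟩
  rw [add_mul]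
  exact (lintegral_union_le _ _ _).trans (add_le_add (h φ hφ) (h' φ hφ))

lemma of_isCompact {K : Set (Sp (n + 1))} (hK : IsCompact K)
    (h : ∀ y ∈ K, ∃ t ∈ 𝓝 y, FriedrichsOn U x ρ (U ∩ t)) : FriedrichsOn U x ρ (U ∩ K) := by
  refine hK.induction_on (p := fun A => FriedrichsOn U x ρ (U ∩ A)) ?_ ?_ ?_ ?_
  · rw [inter_empty]
    exact empty
  · exact fun s t hst h => h.mono (inter_subset_inter_right _ hst)
  · intro s t hs ht
    rw [inter_union_distrib_left]
    exact hs.union ht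
  · intro y hy
    obtain ⟨t, ht, h⟩ := h y hy
    exact ⟨t, mem_nhdsWithin_of_mem_nhds ht, h⟩

/-- Values at a and a + w differ by an integral of the gradient along the segment, which stays in U.
This moves the inequality from one set to another. -/
lemma of_translate (hU : IsOpen U) (hA : MeasurableSet A) (hBm : MeasurableSet B)
    (hB : FriedrichsOn U x ρ B) (w : Sp (n + 1)) (hAB : ∀ a ∈ A, a + w ∈ B)
    (h : ∀ a ∈ A, ∀ t ∈ Icc (0 : ℝ) 1, a + t • w ∈ U) : FriedrichsOn U x ρ A := by
  obtain ⟨C, hC, hφC⟩ := hB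
  refine ⟨2 * C + 2 * ‖w‖ₑ ^ 2, by finiteness, fun φ hφ => ?_⟩
  refine (lintegral_enorm_sq_le_translate hA hU.measurableSet hφ w h).trans ?_
  have h1 : ∫⁻ y in A, ‖φ (y + w)‖ₑ ^ 2 ≤ ∫⁻ y in B, ‖φ y‖ₑ ^ 2 := by
    rw [← lintegral_indicator hA, ← lintegral_indicator hBm,
      ← lintegral_add_right_eq_self (B.indicator fun y => ‖φ y‖ₑ ^ 2) w]
    refine lintegral_mono fun y => ?_
    by_cases hy : y ∈ A
    · rw [indicator_of_mem hy, indicator_of_mem (hAB y hy)]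
    · rw [indicator_of_notMem hy]
      exact zero_le
  have h2 := h1.trans (hφC φ hφ)
  set G := ∫⁻ y in U, ‖gradient φ y‖ₑ ^ 2
  set P := ∫⁻ y in frontier U ∩ Metric.ball x ρ, ‖φ y‖ₑ ^ 2 ∂(Measure.hausdorffMeasure (n : ℝ))
  calc 2 * (∫⁻ y in A, ‖φ (y + w)‖ₑ ^ 2) + 2 * ‖w‖ₑ ^ 2 * G
      ≤ 2 * (C * (G + P)) + 2 * ‖w‖ₑ ^ 2 * G := by gcongr
    _ ≤ 2 * (C * (G + P)) + 2 * ‖w‖ₑ ^ 2 * G + 2 * ‖w‖ₑ ^ 2 * P := le_self_add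
    _ = _ := by ring

lemma of_frontier (hU : IsLipschitzDomain U) (hx : x ∈ frontier U) (hρ : 0 < ρ) :
    ∃ δ, 0 < δ ∧ FriedrichsOn U x ρ (U ∩ Metric.ball x δ) := by
  obtain ⟨c⟩ := exists_graphChart hU.isOpen hU.lipschitz hx
  have hL : (0 : ℝ) ≤ c.L := c.L.2
  have hm : 0 < min c.r ρ := lt_min c.r_pos hρ
  set δ := min c.r ρ / (2 * (2 * c.L + 1)) with hδ
  have hδ0 : 0 < δ := by positivity
  have h1 : (2 * c.L + 1) * δ = min c.r ρ / 2 := by rw [hδ]; field_simp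
  have h2 := min_le_left c.r ρ
  have h3 := min_le_right c.r ρ
  set h := ENNReal.ofReal ((c.L + 1) * δ)
  refine ⟨δ, hδ0, 2 * h + 2 * h ^ 2, by finiteness, fun φ hφ => ?_⟩
  refine (c.lintegral_friedrichs_le hφ hU.isOpen.measurableSet hδ0 (ρ := ρ) (by linarith)
    (by linarith)).trans ?_
  set G := ∫⁻ y in U, ‖gradient φ y‖ₑ ^ 2
  set P := ∫⁻ y in frontier U ∩ Metric.ball x ρ, ‖φ y‖ₑ ^ 2 ∂(Measure.hausdorffMeasure (n : ℝ))
  calc 2 * h * P + 2 * h ^ 2 * G ≤ 2 * h * P + 2 * h ^ 2 * G + (2 * h * G + 2 * h ^ 2 * P) :=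
        le_self_add
    _ = _ := by ring

/-- The inequality spreads from one boundary point to all interior points. -/
lemma of_mem (hU : IsLipschitzDomain U) (hx : x ∈ frontier U) (hρ : 0 < ρ) {y : Sp (n + 1)}
    (hy : y ∈ U) : ∃ t ∈ 𝓝 y, FriedrichsOn U x ρ (U ∩ t) := by
  -- The points near which the inequality holds form an open set. It meets U near x, by the local
  -- inequality there, and it is closed relative to U, by short translations. Connectedness of U
  -- finishes the argument.
  have key : U ⊆ {y | ∃ t ∈ 𝓝 y, FriedrichsOn U x ρ (U ∩ t)} := by
    refine hU.isConnected.isPreconnected.subset_of_closure_inter_subset ?_ ?_ ?_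
    · rw [isOpen_iff_mem_nhds]
      rintro y ⟨t, ht, h⟩
      filter_upwards [eventually_mem_nhds_iff.2 ht] with z hz
      exact ⟨t, hz, h⟩
    · obtain ⟨δ, hδ, h⟩ := of_frontier hU hx hρ
      obtain ⟨y, hy1, hy2⟩ := mem_closure_iff_nhds.1 hx.1 _ (Metric.ball_mem_nhds x hδ)
      exact ⟨y, hy2, _, Metric.isOpen_ball.mem_nhds hy1, h⟩
    · rintro y ⟨hy1, hy2⟩
      obtain ⟨ε, hε, hball⟩ := Metric.isOpen_iff.1 hU.isOpen y hy2
      obtain ⟨z, hz, t, ht, h⟩ := mem_closure_iff_nhds.1 hy1 _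
        (Metric.ball_mem_nhds y (show 0 < ε / 2 by positivity))
      obtain ⟨s, hs, hst⟩ := Metric.mem_nhds_iff.1 ht
      have hm : 0 < min s (ε / 2) := by positivity
      have hzy : ‖z - y‖ < ε / 2 := by rwa [← dist_eq_norm]
      refine ⟨Metric.ball y (min s (ε / 2)), Metric.ball_mem_nhds _ hm, mono ?_ inter_subset_right⟩
      have hseg : ∀ a ∈ Metric.ball y (min s (ε / 2)), ∀ t ∈ Icc (0 : ℝ) 1,
          a + t • (z - y) ∈ U := by
        intro a ha t ht
        refine hball ?_
        rw [mem_ball_iff_norm] at ha ⊢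
        have h1 : a + t • (z - y) - y = (a - y) + t • (z - y) := by abel
        have h2 : ‖t • (z - y)‖ ≤ ‖z - y‖ := by
          rw [norm_smul, Real.norm_of_nonneg ht.1]
          exact mul_le_of_le_one_left (norm_nonneg _) ht.2
        rw [h1]
        have := norm_add_le (a - y) (t • (z - y))
        have := min_le_right s (ε / 2)
        linarith
      refine of_translate hU.isOpen measurableSet_ball
        (hU.isOpen.measurableSet.inter (measurableSet_ball (x := z) (ε := s))) (h.mono
          (inter_subset_inter_right _ hst)) (z - y) ?_ hseg
      intro a ha
      have h3 := hseg a ha 1 ⟨zero_le_one, le_rfl⟩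
      rw [one_smul] at h3
      refine ⟨h3, ?_⟩
      rw [mem_ball_iff_norm] at ha ⊢
      have h1 : a + (z - y) - z = a - y := by abel
      rw [h1]
      exact ha.trans_le (min_le_left _ _)
  exact key hy

/-- Pushing U near y down by δ lands in a compact subset K of U, where the inequality is known from
interior points; a translation brings it back. -/
lemma of_mem_frontier (hU : IsLipschitzDomain U) (hx : x ∈ frontier U) (hρ : 0 < ρ)
    {y : Sp (n + 1)} (hy : y ∈ frontier U) : ∃ t ∈ 𝓝 y, FriedrichsOn U x ρ (U ∩ t) := by
  obtain ⟨c⟩ := exists_graphChart hU.isOpen hU.lipschitz hy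
  have hL : (0 : ℝ) ≤ c.L := c.L.2
  have hr := c.r_pos
  -- Graph points belonging to K are within L²δ of y and depths are at most (L + 2)δ; this δ keeps
  -- the sum below the chart radius.
  obtain ⟨δ, hδ, h1⟩ : ∃ δ : ℝ, 0 < δ ∧ (c.L ^ 2 + 2 * c.L + 3) * δ = c.r := by
    refine ⟨c.r / (c.L ^ 2 + 2 * c.L + 3), by positivity, ?_⟩
    field_simp
  obtain ⟨z₀, hz₀⟩ := c.frontier_eq y hy (Metric.mem_ball_self hr)
  set K := (fun p : (Fin n → ℝ) × ℝ => c.Γ p.1 - p.2 • c.e) ''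
    (Metric.closedBall z₀ (c.L * δ) ×ˢ Icc δ ((c.L + 2) * δ)) with hKdef
  have hcont : Continuous fun p : (Fin n → ℝ) × ℝ => c.Γ p.1 - p.2 • c.e := by
    have := c.lip.continuous
    fun_prop
  have hK : IsCompact K := ((isCompact_closedBall _ _).prod isCompact_Icc).image hcont
  have hKU : K ⊆ U := by
    rintro _ ⟨⟨z, σ⟩, ⟨hz, hσ⟩, rfl⟩
    have h2 : dist (c.Γ z) y ≤ c.L * (c.L * δ) := by
      have := (c.lip.dist_le_mul z z₀).trans (mul_le_mul_of_nonneg_left hz hL)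
      rwa [hz₀] at this
    refine c.mem_of_pos (c.mem_ball_of_dist ?_) (hδ.trans_le hσ.1)
    rw [abs_of_pos (hδ.trans_le hσ.1)]
    have := hσ.2
    nlinarith
  have hgood : FriedrichsOn U x ρ (U ∩ K) := of_isCompact hK fun p hp => of_mem hU hx hρ (hKU hp)
  have hkey : ∀ a ∈ U ∩ Metric.ball y δ, ∃ z, ∃ σ : ℝ, a = c.Γ z - σ • c.e ∧ 0 < σ ∧
      σ ≤ (c.L + 1) * δ ∧ dist (c.Γ z) y ≤ c.L * δ := by
    rintro a ⟨ha1, ha2⟩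
    obtain ⟨z, σ, rfl⟩ := c.surj a
    have h3 : dist (c.Γ z) y ≤ c.L * δ := (c.dist_le z σ).trans
      (mul_le_mul_of_nonneg_left (Metric.mem_ball.1 ha2).le hL)
    have h5 : δ ≤ c.r := by nlinarith
    have h4 := (c.mem_iff z σ (Metric.ball_subset_ball h5 ha2)).1 ha1
    refine ⟨z, σ, rfl, h4, ?_, h3⟩
    have h6 := dist_triangle_right (c.Γ z) (c.Γ z - σ • c.e) y
    rw [c.dist_sub_smul, abs_of_pos h4] at h6
    have := (Metric.mem_ball.1 ha2)
    linarith
  refine ⟨Metric.ball y δ, Metric.ball_mem_nhds _ hδ, of_translate hU.isOpen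
    (hU.isOpen.measurableSet.inter measurableSet_ball)
    (hU.isOpen.measurableSet.inter hK.measurableSet) hgood (-(δ • c.e)) ?_ ?_⟩
  · intro a ha
    obtain ⟨z, σ, rfl, h2, h3, h4⟩ := hkey a ha
    have h5 : c.Γ z - σ • c.e + -(δ • c.e) ∈ K := by
      refine ⟨(z, σ + δ), ⟨?_, by linarith, by linarith⟩, by simp only; module⟩
      have := c.anti.le_mul_dist z z₀
      rw [NNReal.coe_one, one_mul, hz₀] at this
      exact this.trans h4
    exact ⟨hKU h5, h5⟩
  · intro a ha t ht
    obtain ⟨z, σ, rfl, h2, h3, h4⟩ := hkey a ha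
    have h5 : c.Γ z - σ • c.e + t • -(δ • c.e) = c.Γ z - (σ + t * δ) • c.e := by module
    rw [h5]
    have h6 : 0 ≤ t * δ := mul_nonneg ht.1 hδ.le
    have h7 : t * δ ≤ δ := mul_le_of_le_one_left hδ.le ht.2
    refine c.mem_of_pos (c.mem_ball_of_dist ?_) (by linarith)
    rw [abs_of_pos (by linarith)]
    nlinarith

lemma self (hU : IsLipschitzDomain U) (hx : x ∈ frontier U) (hρ : 0 < ρ) :
    FriedrichsOn U x ρ U := by
  have h := of_isCompact (U := U) (x := x) (ρ := ρ) hU.isBounded.isCompact_closure fun y hy => ?_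
  · rwa [inter_eq_left.2 subset_closure] at h
  · by_cases hyU : y ∈ U
    · exact of_mem hU hx hρ hyU
    · exact of_mem_frontier hU hx hρ ⟨hy, by rwa [hU.isOpen.interior_eq]⟩

end FriedrichsOn

end SmoothInequalities

/-! ### Traces -/

section Traces

open scoped ENNReal

/-- Pairs given by smooth functions already form a subspace, so the span adds nothing and closed
conditions need only be checked on them. -/
lemma traceGraph_subset {U : Set (Sp d)} {K : Set (H1 U × Lp ℝ 2 (surfaceMeasure U))}
    (hK : IsClosed K) (h : ∀ (p : H1 U × Lp ℝ 2 (surfaceMeasure U)) (φ : Sp d → ℝ),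
      ContDiff ℝ ∞ φ → H1.toL2 U p.1 =ᵐ[volume.restrict U] φ → p.2 =ᵐ[surfaceMeasure U] φ → p ∈ K) :
    (traceGraph U : Set (H1 U × Lp ℝ 2 (surfaceMeasure U))) ⊆ K := by
  refine closure_minimal (fun p hp => ?_) hK
  have key : ∃ φ : Sp d → ℝ, ContDiff ℝ ∞ φ ∧ H1.toL2 U p.1 =ᵐ[volume.restrict U] φ ∧
      p.2 =ᵐ[surfaceMeasure U] φ := by
    refine Submodule.span_induction (p := fun p _ => ∃ φ : Sp d → ℝ, ContDiff ℝ ∞ φ ∧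
      H1.toL2 U p.1 =ᵐ[volume.restrict U] φ ∧ p.2 =ᵐ[surfaceMeasure U] φ)
      (fun p hp => hp) ?_ ?_ ?_ hp
    · refine ⟨fun _ => 0, contDiff_const, ?_, ?_⟩
      · rw [Prod.fst_zero, map_zero]
        exact Lp.coeFn_zero _ _ _
      · exact Lp.coeFn_zero _ _ _
    · rintro p q - - ⟨φ, h1, h2, h3⟩ ⟨ψ, h4, h5, h6⟩
      refine ⟨fun x => φ x + ψ x, h1.add h4, ?_, ?_⟩
      · rw [Prod.fst_add, map_add]
        filter_upwards [Lp.coeFn_add (H1.toL2 U p.1) (H1.toL2 U q.1), h2, h5] with x a b c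
        rw [a, Pi.add_apply, b, c]
      · rw [Prod.snd_add]
        filter_upwards [Lp.coeFn_add p.2 q.2, h3, h6] with x a b c
        rw [a, Pi.add_apply, b, c]
    · rintro r p - ⟨φ, h1, h2, h3⟩
      refine ⟨fun x => r * φ x, contDiff_const.mul h1, ?_, ?_⟩
      · rw [Prod.smul_fst, map_smul]
        filter_upwards [Lp.coeFn_smul r (H1.toL2 U p.1), h2] with x a b
        rw [a, Pi.smul_apply, b, smul_eq_mul]
      · rw [Prod.smul_snd]
        filter_upwards [Lp.coeFn_smul r p.2, h3] with x a b
        rw [a, Pi.smul_apply, b, smul_eq_mul]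
  obtain ⟨φ, h1, h2, h3⟩ := key
  exact h p φ h1 h2 h3

lemma norm_sq_le_of_enorm {E F G : Type*} [NormedAddCommGroup E] [NormedAddCommGroup F]
    [NormedAddCommGroup G] {a : E} {b : F} {c : G} {C : ℝ≥0∞} (hC : C ≠ ⊤)
    (h : ‖a‖ₑ ^ 2 ≤ C * (‖b‖ₑ ^ 2 + ‖c‖ₑ ^ 2)) : ‖a‖ ^ 2 ≤ C.toReal * (‖b‖ ^ 2 + ‖c‖ ^ 2) := by
  have hb : ‖b‖ₑ ^ 2 ≠ ⊤ := by finiteness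
  have hc : ‖c‖ₑ ^ 2 ≠ ⊤ := by finiteness
  have h1 := ENNReal.toReal_mono (ENNReal.mul_ne_top hC (ENNReal.add_ne_top.2 ⟨hb, hc⟩)) h
  rw [ENNReal.toReal_mul, ENNReal.toReal_add hb hc] at h1
  simpa using h1

variable {n : ℕ} {U : Set (Sp (n + 1))}

lemma surfaceMeasure_eq : surfaceMeasure U =
    (Measure.hausdorffMeasure (n : ℝ)).restrict (frontier U) := by
  unfold surfaceMeasure
  congr 2
  push_cast
  ring

lemma Lp_enorm_sq_congr {X : Type*} [MeasurableSpace X] {μ : Measure X} {E : Type*}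
    [NormedAddCommGroup E] (g : Lp E 2 μ) {φ : X → E} (h : g =ᵐ[μ] φ) :
    ‖g‖ₑ ^ 2 = ∫⁻ x, ‖φ x‖ₑ ^ 2 ∂μ := by
  rw [Lp_enorm_sq]
  exact lintegral_congr_ae (h.mono fun x hx => by simp only [hx])

section Bounds

variable (hU : IsLipschitzDomain U)
include hU

lemma grad_ae_of_smooth {v : H1 U} {φ : Sp (n + 1) → ℝ} (hφ : ContDiff ℝ 1 φ)
    (hv : H1.toL2 U v =ᵐ[volume.restrict U] φ) :
    H1.grad U v =ᵐ[volume.restrict U] gradient φ := by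
  rw [← H1.ofSmooth_eq hU.isBounded hU.isOpen hφ hv]
  exact H1.grad_ofSmooth_ae hU.isBounded hU.isOpen.measurableSet hφ

/-- The trace operator is bounded. -/
lemma exists_norm_trace_le : ∃ C : ℝ, 0 ≤ C ∧ ∀ p ∈ traceGraph U, ‖p.2‖ ^ 2 ≤ C * ‖p.1‖ ^ 2 := by
  obtain ⟨C, hC, h⟩ := exists_trace_bound hU
  refine ⟨C.toReal, ENNReal.toReal_nonneg, fun p hp => ?_⟩
  have hK : IsClosed {p : H1 U × Lp ℝ 2 (surfaceMeasure U) |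
      ‖p.2‖ ^ 2 ≤ C.toReal * ‖p.1‖ ^ 2} :=
    isClosed_le (by fun_prop) (by fun_prop)
  refine traceGraph_subset hK (fun p φ h1 h2 h3 => ?_) hp
  have h1' : ContDiff ℝ 1 φ := h1.of_le (by simp)
  have h4 := h φ h1'
  rw [← surfaceMeasure_eq, ← Lp_enorm_sq_congr p.2 h3, ← Lp_enorm_sq_congr _ h2,
    ← Lp_enorm_sq_congr _ (grad_ae_of_smooth hU h1' h2)] at h4
  rw [mem_ofPred_eq, H1.norm_sq]
  exact norm_sq_le_of_enorm hC h4

/-- The Friedrichs inequality with a boundary term near the boundary point `x`. -/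
lemma exists_norm_toL2_le {x : Sp (n + 1)} (hx : x ∈ frontier U) {ρ : ℝ} (hρ : 0 < ρ) :
    ∃ C : ℝ, 0 ≤ C ∧ ∀ p ∈ traceGraph U, ‖H1.toL2 U p.1‖ ^ 2 ≤ C * (‖H1.grad U p.1‖ ^ 2 +
      ‖LpToLpRestrictCLM (Sp (n + 1)) ℝ ℝ (surfaceMeasure U) 2 (Metric.ball x ρ) p.2‖ ^ 2) := by
  obtain ⟨C, hC, h⟩ := FriedrichsOn.self hU hx hρ
  refine ⟨C.toReal, ENNReal.toReal_nonneg, fun p hp => ?_⟩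
  have hK : IsClosed {p : H1 U × Lp ℝ 2 (surfaceMeasure U) |
      ‖H1.toL2 U p.1‖ ^ 2 ≤ C.toReal * (‖H1.grad U p.1‖ ^ 2 +
      ‖LpToLpRestrictCLM (Sp (n + 1)) ℝ ℝ (surfaceMeasure U) 2 (Metric.ball x ρ) p.2‖ ^ 2)} :=
    isClosed_le (by fun_prop) (by fun_prop)
  refine traceGraph_subset hK (fun p φ h1 h2 h3 => ?_) hp
  have h1' : ContDiff ℝ 1 φ := h1.of_le (by simp)
  have h4 := h φ h1'
  have h5 : LpToLpRestrictCLM (Sp (n + 1)) ℝ ℝ (surfaceMeasure U) 2 (Metric.ball x ρ) p.2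
      =ᵐ[(surfaceMeasure U).restrict (Metric.ball x ρ)] φ :=
    (LpToLpRestrictCLM_coeFn ℝ _ p.2).trans (ae_restrict_of_ae h3)
  rw [inter_comm, ← Measure.restrict_restrict measurableSet_ball, ← surfaceMeasure_eq,
    ← Lp_enorm_sq_congr _ h5, ← Lp_enorm_sq_congr _ h2,
    ← Lp_enorm_sq_congr _ (grad_ae_of_smooth hU h1' h2)] at h4
  rw [mem_ofPred_eq]
  exact norm_sq_le_of_enorm hC h4

/-- The pairs (v, trace of v) with vanishing trace outside Γ form a closed subspace of a product of
complete spaces. By the trace inequality its projection to v is bounded below, so the range is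
complete. -/
lemma isComplete_H1van {Γ : Set (Sp (n + 1))} (hΓ : MeasurableSet Γ) :
    IsComplete (H1van U Γ : Set (H1 U)) := by
  set A := frontier U \ Γ
  have hA : MeasurableSet A := isClosed_frontier.measurableSet.diff hΓ
  let R := LpToLpRestrictCLM (Sp (n + 1)) ℝ ℝ (surfaceMeasure U) 2 A
  have hR : ∀ g, (∀ᵐ x ∂(surfaceMeasure U), x ∈ A → g x = 0) ↔ R g = 0 := by
    intro g
    rw [← ae_restrict_iff' hA]
    have h1 := LpToLpRestrictCLM_coeFn ℝ A g
    constructor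
    · intro h
      refine Lp.ext ?_
      filter_upwards [h1, h, Lp.coeFn_zero ℝ 2 ((surfaceMeasure U).restrict A)] with x a b c
      exact (a.trans b).trans c.symm
    · intro h
      filter_upwards [h1, Lp.coeFn_zero ℝ 2 ((surfaceMeasure U).restrict A)] with x a c
      rw [← a]
      exact (congrArg (fun f : Lp ℝ 2 ((surfaceMeasure U).restrict A) => f x) h).trans c
  let K : Submodule ℝ (H1 U × Lp ℝ 2 (surfaceMeasure U)) :=
    traceGraph U ⊓ (LinearMap.ker R.toLinearMap).comap
      (LinearMap.snd ℝ _ _)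
  have hKc : IsClosed (K : Set (H1 U × Lp ℝ 2 (surfaceMeasure U))) := by
    have h1 : IsClosed (traceGraph U : Set (H1 U × Lp ℝ 2 (surfaceMeasure U))) :=
      Submodule.isClosed_topologicalClosure _
    have h2 : IsClosed {p : H1 U × Lp ℝ 2 (surfaceMeasure U) | R p.2 = 0} :=
      isClosed_eq (R.continuous.comp continuous_snd) continuous_const
    exact h1.inter h2
  have : CompleteSpace K := hKc.completeSpace_coe
  obtain ⟨C, hC, hb⟩ := exists_norm_trace_le hU
  let f : K → H1 U := fun p => p.1.1
  have hf : AntilipschitzWith (max 1 (Real.toNNReal √C)) f := by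
    refine AntilipschitzWith.of_le_mul_dist fun p q => ?_
    have h1 := hb _ ((traceGraph U).sub_mem p.2.1 q.2.1)
    have h2 : ‖p.1.2 - q.1.2‖ ≤ √C * ‖p.1.1 - q.1.1‖ := by
      refine abs_le_of_sq_le_sq' ?_ (by positivity) |>.2
      rw [mul_pow, Real.sq_sqrt hC]
      exact h1
    rw [Subtype.dist_eq, Prod.dist_eq, NNReal.coe_max, NNReal.coe_one,
      Real.coe_toNNReal _ (Real.sqrt_nonneg _), dist_eq_norm, dist_eq_norm]
    refine max_le ?_ (h2.trans ?_)
    · exact le_mul_of_one_le_left (norm_nonneg _) (le_max_left _ _)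
    · exact mul_le_mul_of_nonneg_right (le_max_right _ _) (norm_nonneg _)
  have hu : UniformContinuous f := uniformContinuous_fst.comp uniformContinuous_subtype_val
  have h := hf.isComplete_range hu
  have e : (H1van U Γ : Set (H1 U)) = range f := by
    ext v
    refine ⟨?_, ?_⟩
    · rintro ⟨g, h1, h2⟩
      exact ⟨⟨(v, g), h1, (hR g).1 h2⟩, rfl⟩
    · rintro ⟨⟨p, h1, h2⟩, rfl⟩
      exact ⟨p.2, h1, (hR p.2).2 h2⟩
  rw [e]
  exact h

/-- The Friedrichs inequality on `H1van`, when the trace vanishes near a boundary point. -/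
lemma exists_norm_H1van_le {Γ : Set (Sp (n + 1))} {x : Sp (n + 1)} (hx : x ∈ frontier U) {ρ : ℝ}
    (hρ : 0 < ρ) (hΓ : ∀ y ∈ Γ, y ∉ Metric.ball x ρ) :
    ∃ P : ℝ, 0 < P ∧ ∀ v ∈ H1van U Γ, ‖v‖ ^ 2 ≤ P * ‖H1.grad U v‖ ^ 2 := by
  obtain ⟨C, hC, h⟩ := exists_norm_toL2_le hU hx hρ
  refine ⟨C + 1, by positivity, ?_⟩
  rintro v ⟨g, h1, h2⟩
  have h3 := h (v, g) h1
  have h4 : LpToLpRestrictCLM (Sp (n + 1)) ℝ ℝ (surfaceMeasure U) 2 (Metric.ball x ρ) g = 0 := by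
    refine Lp.ext ?_
    have h5 : ∀ᵐ y ∂(surfaceMeasure U), y ∈ frontier U :=
      ae_restrict_mem isClosed_frontier.measurableSet
    filter_upwards [LpToLpRestrictCLM_coeFn ℝ (Metric.ball x ρ) g, ae_restrict_of_ae h2,
      ae_restrict_of_ae h5, ae_restrict_mem measurableSet_ball,
      Lp.coeFn_zero ℝ 2 ((surfaceMeasure U).restrict (Metric.ball x ρ))] with y a b c e f
    rw [a, f, Pi.zero_apply]
    exact b ⟨c, fun hy => hΓ y hy e⟩
  simp only [h4, norm_zero] at h3
  rw [H1.norm_sq]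
  linarith

end Bounds

end Traces

/-! ### Decompositions -/

section Decomposition

/-- Just above the graph, points are separated from U. An open set containing a boundary point would
contain such points and could not lie in the closure of U. -/
lemma IsLipschitzDomain.disjoint_frontier {U S : Set (Sp d)} (hU : IsLipschitzDomain U)
    (hS : IsOpen S) (hSU : S ⊆ closure U) : Disjoint S (frontier U) := by
  rw [Set.disjoint_left]
  intro x hxS hx
  obtain ⟨e, r, K, γ, he, hr, hγ, h⟩ := hU.lipschitz x hx
  have hee : ⟪e, e⟫ = 1 := by rw [real_inner_self_eq_norm_sq, he]; norm_num
  let s : Sp d → ℝ := fun y => γ (y - ⟪e, y⟫ • e) - ⟪e, y⟫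
  have hs : Continuous s := (hγ.continuous.comp (by fun_prop)).sub (by fun_prop)
  have hsx : s x ≤ 0 := by
    by_contra hc
    exact hx.2 (by
      rw [hU.isOpen.interior_eq]
      exact (h x (Metric.mem_ball_self hr)).2 (sub_pos.1 (not_le.1 hc)))
  obtain ⟨ε, hε, hball⟩ := Metric.isOpen_iff.1 (hS.inter (Metric.isOpen_ball (x := x) (ε := r))) x
    ⟨hxS, Metric.mem_ball_self hr⟩
  have hy : x + (ε / 2) • e ∈ Metric.ball x ε := by
    rw [mem_ball_iff_norm, add_sub_cancel_left, norm_smul, he, mul_one,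
      Real.norm_of_nonneg (by positivity)]
    linarith
  set y := x + (ε / 2) • e with hydef
  have hsy : s y < 0 := by
    have e1 : ⟪e, y⟫ = ⟪e, x⟫ + ε / 2 := by
      rw [hydef, inner_add_right, real_inner_smul_right, hee, mul_one]
    have e2 : y - ⟪e, y⟫ • e = x - ⟪e, x⟫ • e := by rw [e1, hydef]; module
    have e3 : s y = γ (y - ⟪e, y⟫ • e) - ⟪e, y⟫ := rfl
    rw [e3, e2, e1]
    have : s x = γ (x - ⟪e, x⟫ • e) - ⟪e, x⟫ := rfl
    linarith
  obtain ⟨hyS, hyr⟩ := hball hy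
  obtain ⟨w, hw1, hw2⟩ := mem_closure_iff_nhds.1 (hSU hyS) _ (inter_mem
    (Metric.isOpen_ball.mem_nhds hyr) ((hs.tendsto y).eventually (gt_mem_nhds hsy)))
  have h3 : 0 < s w := sub_pos.2 ((h w hw1.1).1 hw2)
  exact absurd hw1.2 (not_lt.2 h3.le)

variable {Ω : Set (Sp d)} {S : Fin 2 → Set (Sp d)} (hΩ : IsDecomposition Ω S)
include hΩ

lemma IsDecomposition.closure_subset (i : Fin 2) : closure (S i) ⊆ closure Ω := by
  rw [hΩ.closure_eq]
  fin_cases i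
  · exact subset_union_left
  · exact subset_union_right

lemma IsDecomposition.disjoint_frontier (i : Fin 2) : Disjoint (S i) (frontier Ω) :=
  hΩ.domain.disjoint_frontier (hΩ.subdomain i).isOpen
    (subset_closure.trans (hΩ.closure_subset i))

lemma IsDecomposition.subset (i : Fin 2) : S i ⊆ Ω := by
  intro x hx
  by_contra h
  refine Set.disjoint_left.1 (hΩ.disjoint_frontier i) hx ⟨hΩ.closure_subset i (subset_closure hx), ?_⟩
  rwa [hΩ.domain.isOpen.interior_eq]

lemma measurableSet_interface : MeasurableSet (interface Ω S) :=
  (isClosed_frontier.measurableSet.inter isClosed_frontier.measurableSet).diff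
    isClosed_frontier.measurableSet

/-- Away from the other subdomain, the boundary of a subdomain contains no interface. -/
lemma IsDecomposition.exists_exterior_point (i : Fin 2) : ∃ x ∈ frontier (S i), ∃ ρ, 0 < ρ ∧
    ∀ y ∈ interface Ω S, y ∉ Metric.ball x ρ := by
  -- The indices swap here: a point of ∂Ω outside ∂(S j), with j the other index, is outside the
  -- closure of S j. It hence lies on ∂(S i) and keeps a distance from the interface, which is
  -- contained in ∂(S j).
  obtain ⟨j, hij⟩ : ∃ j : Fin 2, ∀ k, k = i ∨ k = j := ⟨1 - i, by decide +revert⟩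
  obtain ⟨x, hx1, hx2⟩ := hΩ.exterior_nonempty j
  have hxn : ∀ k, x ∉ S k := fun k hk => Set.disjoint_left.1 (hΩ.disjoint_frontier k) hk hx1
  have hxj : x ∉ closure (S j) := fun h => hx2 ⟨h, fun h' => hxn j (interior_subset h')⟩
  have hxi : x ∈ closure (S i) := by
    have h1 : x ∈ closure (S 0) ∪ closure (S 1) := hΩ.closure_eq ▸ hx1.1
    rcases h1 with h1 | h1
    · rcases hij 0 with h | h
      · rwa [← h]
      · exact absurd (h ▸ h1) hxj
    · rcases hij 1 with h | h
      · rwa [← h]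
      · exact absurd (h ▸ h1) hxj
  refine ⟨x, ⟨hxi, fun h => hxn i (interior_subset h)⟩, ?_⟩
  obtain ⟨ρ, hρ, hball⟩ := Metric.isOpen_iff.1 isClosed_closure.isOpen_compl x hxj
  refine ⟨ρ, hρ, fun y hy hyb => hball hyb ?_⟩
  have h2 : y ∈ frontier (S j) := by
    fin_cases j
    · exact hy.1.1
    · exact hy.1.2
  exact h2.1

end Decomposition

/-! ### The operators on the subdomains -/

lemma parabolicForm_toFull {U : Set (Sp d)} {α : Sp d → ℝ} (hα : MemLp α ⊤ (volume.restrict U))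
    {V : Submodule ℝ (H1 U)} (u : Trial U V) (v : Test U V) :
    parabolicForm hα V u v = parabolicForm hα ⊤ (toFull u) (toFull v) := by
  have hu : ((toFull u : Trial U ⊤) : Ambient U) = u := Submodule.coe_inclusion _ u
  have hv : ((toFull v : Test U ⊤) : Ambient U) = v := Submodule.coe_inclusion _ v
  change ambientForm hα (u : Ambient U) (v : Ambient U) =
    ambientForm hα ((toFull u : Trial U ⊤) : Ambient U) ((toFull v : Test U ⊤) : Ambient U)
  rw [hu, hv]

/-- The conclusion on a single subdomain, for a closed spatial space with a Poincaré inequality. -/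
lemma exists_subdomain_operator {U : Set (Sp d)} (hU : IsLipschitzDomain U) {α : Sp d → ℝ}
    (hα : MemLp α ⊤ (volume.restrict U)) (V : Submodule ℝ (H1 U)) [CompleteSpace V] {c₀ : ℝ}
    (hc₀ : 0 < c₀) (hc : ∀ᵐ x ∂(volume.restrict U), c₀ ≤ α x)
    (hP : ∃ P : ℝ, 0 < P ∧ ∀ v ∈ V, ‖v‖ ^ 2 ≤ P * ‖H1.grad U v‖ ^ 2) :
    ∃ Afull : Trial U ⊤ →L[ℝ] Test U ⊤ →L[ℝ] ℝ,
      ExtendsForm U ⊤ (smoothUpTo d) α Afull ∧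
      (∀ A', ExtendsForm U ⊤ (smoothUpTo d) α A' → A' = Afull) ∧
      ∃ A : Trial U V →L[ℝ] Test U V →L[ℝ] ℝ,
        (∀ u v, A u v = Afull (toFull u) (toFull v)) ∧
        (∃ J : Trial U V →L[ℝ] Test U V, (∀ u, fn (J u) = fn u) ∧
          ∃ c : ℝ, 0 < c ∧ ∀ u, c * ‖fn u‖ ^ 2 ≤ A u (J u)) ∧
        ∃ θ ∈ Ioo 0 (Real.pi / 2), ∃ B : Trial U V →L[ℝ] Test U V,
          (∀ u, IsRotatedHilbert θ u (B u)) ∧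
          ∃ c : ℝ, 0 < c ∧ ∀ u, c * ‖u‖ ^ 2 ≤ A u (B u) := by
  obtain ⟨P, hP0, hP⟩ := hP
  refine ⟨parabolicForm hα ⊤, extendsForm_parabolicForm_top hU hα,
    fun A' hA' => extendsForm_top_unique hU hα hA', parabolicForm hα V, ?_, ?_, ?_⟩
  · exact parabolicForm_toFull hα
  · exact exists_coercive_inclusion V hα hU hc₀ hc hP0 hP
  · exact exists_coercive_rotated V hα hU hc₀ hc hP0 hP

lemma IsDecomposition.exists_norm_H1van_le {n : ℕ} {Ω : Set (Sp (n + 1))}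
    {S : Fin 2 → Set (Sp (n + 1))} (hΩ : IsDecomposition Ω S) (i : Fin 2) :
    ∃ P : ℝ, 0 < P ∧ ∀ v ∈ H1van (S i) (interface Ω S), ‖v‖ ^ 2 ≤ P * ‖H1.grad (S i) v‖ ^ 2 := by
  obtain ⟨x, hx, ρ, hρ, hΓ⟩ := hΩ.exists_exterior_point i
  exact RobinRobin.exists_norm_H1van_le (hΩ.subdomain i) hx hρ hΓ

end RobinRobin

end

open RobinRobin
theorem mainTheorem3 (d : ℕ) (hd : d = 2 ∨ d = 3)
    (Ω : Set (Sp d)) (S : Fin 2 → Set (Sp d)) (hΩ : IsDecomposition Ω S)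
    (α : Sp d → ℝ) (hα : MemLp α ⊤ (volume.restrict Ω))
    (c₀ : ℝ) (hc₀ : 0 < c₀) (hαc : ∀ᵐ x ∂(volume.restrict Ω), c₀ ≤ α x) :
    -- the operator `A : W → W̃*`
    (∃! A : Trial Ω (H10 Ω) →L[ℝ] Test Ω (H10 Ω) →L[ℝ] ℝ,
      ExtendsForm Ω (H10 Ω) (smoothCompact Ω) α A) ∧
    -- the operators `A i : W i → W̃ i*`
    ∀ i : Fin 2,
      ∃ Afull : Trial (S i) ⊤ →L[ℝ] Test (S i) ⊤ →L[ℝ] ℝ,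
        ExtendsForm (S i) ⊤ (smoothUpTo d) α Afull ∧
        (∀ A', ExtendsForm (S i) ⊤ (smoothUpTo d) α A' → A' = Afull) ∧
        ∃ A : Trial (S i) (H1van (S i) (interface Ω S)) →L[ℝ]
            Test (S i) (H1van (S i) (interface Ω S)) →L[ℝ] ℝ,
          (∀ u v, A u v = Afull (toFull u) (toFull v)) ∧
          -- coercivity in `L²(ℝ⁺, V i)`, with `J` the inclusion of `W i` in `W̃ i`
          (∃ J : Trial (S i) (H1van (S i) (interface Ω S)) →L[ℝ]
              Test (S i) (H1van (S i) (interface Ω S)),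
            (∀ u, fn (J u) = fn u) ∧
            ∃ c : ℝ, 0 < c ∧ ∀ u, c * ‖fn u‖ ^ 2 ≤ A u (J u)) ∧
          -- coercivity in `W i` after a rotated Hilbert transform
          ∃ θ ∈ Ioo 0 (Real.pi / 2),
            ∃ B : Trial (S i) (H1van (S i) (interface Ω S)) →L[ℝ]
                Test (S i) (H1van (S i) (interface Ω S)),
              (∀ u, IsRotatedHilbert θ u (B u)) ∧
              ∃ c : ℝ, 0 < c ∧ ∀ u, c * ‖u‖ ^ 2 ≤ A u (B u) := by
  -- The boundary charts are parametrized by n = d - 1 variables.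
  obtain ⟨n, rfl⟩ : ∃ n, d = n + 1 := Nat.exists_eq_add_one.2 (by omega)
  refine ⟨existsUnique_extendsForm hΩ.domain.isBounded hΩ.domain.isOpen hα, fun i => ?_⟩
  have hU := hΩ.subdomain i
  have hμ : volume.restrict (S i) ≤ volume.restrict Ω :=
    Measure.restrict_mono (hΩ.subset i) le_rfl
  have hα' : MemLp α ⊤ (volume.restrict (S i)) := hα.mono_measure hμ
  have hαc' : ∀ᵐ x ∂(volume.restrict (S i)), c₀ ≤ α x :=
    ae_restrict_of_ae_restrict_of_subset (hΩ.subset i) hαc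
  -- Completeness provides the orthogonal projection onto the spatial space and the Hilbert
  -- transform of functions with values in it.
  have hc : CompleteSpace (H1van (S i) (interface Ω S)) :=
    completeSpace_coe_iff_isComplete.2 (isComplete_H1van hU (measurableSet_interface hΩ))
  exact exists_subdomain_operator hU hα' _ hc₀ hαc' (hΩ.exists_norm_H1van_le i)
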